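/- **Conventions.** Let $K$ be a field of characteristic $0$, $A$ a $\mathbb Z$-graded, associative, unital, graded commutative $K$-algebra, and $L,P,Q$ graded $A$-modules. A bar (or the letter itself in an exponent of $(-)$) denotes the degree of a homogeneous element, all identities below are for homogeneous arguments, and $\alpha(\sigma,\boldsymbol v)$ is the Koszul sign of an unshuffle $\sigma\in S_{i,j}$ on $\boldsymbol v=(v_1,\dots,v_{i+j})$. $[\Phi,\Psi]=\Phi\Psi-(-)^{\Phi\Psi}\Psi\Phi$ is the graded commutator of endomorphisms. An *$L_\infty[1]$ algebra* is a graded vector space $V$ with graded symmetric, $k$-linear maps $\lambda_k$ of degree $1$ ($k\ge1$, and $\lambda_0=0$) such that $\sum_{i+j=n}\sum_{\sigma\in S_{i,j}}\alpha(\sigma,\boldsymbol v)\,\lambda_{j+1}(\lambda_i(v_{\sigma(1)},\dots,v_{\sigma(i)}),v_{\sigma(i+1)},\dots,v_{\sigma(n)})=0$ for all $n$. A *left* (resp. *right*) *$L_\infty[1]$ module* over $V$ is a graded vector space $W$ with multilinear maps $\mu(v_1,\dots,v_n|w)$ ($n\ge 0$) of degree $1$, graded symmetric in the $v$'s, such that,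 with the sign $+$ (resp. $-$) in front of the second sum, $$\sum_{i+j=n}\sum_{\sigma\in S_{i,j}}\alpha(\sigma,\boldsymbol v)\,\mu(\lambda_i(v_{\sigma(1)},\dots,v_{\sigma(i)}),v_{\sigma(i+1)},\dots,v_{\sigma(n)}|w)\pm\sum_{i+j=n}\sum_{\sigma\in S_{i,j}}(-)^{\bar v_{\sigma(1)}+\cdots+\bar v_{\sigma(i)}}\alpha(\sigma,\boldsymbol v)\,\mu(v_{\sigma(1)},\dots,v_{\sigma(i)}|\mu(v_{\sigma(i+1)},\dots,v_{\sigma(n)}|w))=0.$$ An *$LR_\infty[1]$ algebra* structure on $(A,L)$ consists of brackets $X(\xi_1,\dots,\xi_k)\in L$ ($k\geq 1$) and anchors $\sigma(\xi_1,\dots,\xi_n|a)\in A$ ($n\ge0$), $K$-multilinear, of degree $1$ and graded symmetric in the $\xi$'s, such that $\sigma$ is graded $A$-multilinear in the $\xi$'s and a derivation of $A$ in $a$; $X(\xi_1,\dots,\xi_n,a\eta)=\sigma(\xi_1,\dots,\xi_n|a)\eta+(-)^{a(1+\xi_1+\cdots+\xi_n)}aX(\xi_1,\dots,\xi_n,\eta)$;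 $(L,X)$ is an $L_\infty[1]$ algebra; and $(A,\sigma)$ is a left $L_\infty[1]$ module over it. A *left $(A,L)$-connection* $\nabla$ in $P$ consists of $K$-multilinear maps $\nabla(\xi_1,\dots,\xi_n|p)\in P$ ($n\ge0$) of degree $1$, graded symmetric and graded $A$-multilinear in the $\xi$'s, with $\nabla(\xi_1,\dots,\xi_n|ap)=(-)^{a(1+\xi_1+\cdots+\xi_n)}a\nabla(\xi_1,\dots,\xi_n|p)+\sigma(\xi_1,\dots,\xi_n|a)p$. A *right $(A,L)$-connection* $\Delta$ in $Q$ consists of $K$-multilinear maps $\Delta(\xi_1,\dots,\xi_n|q)\in Q$ of degree $1$, graded symmetric in the $\xi$'s, with $\Delta(\xi_1,\dots,\xi_n|aq)=(-)^{a(1+\xi_1+\cdots+\xi_n)}a\Delta(\xi_1,\dots,\xi_n|q)-\sigma(\xi_1,\dots,\xi_n|a)q$ and graded $A$-multilinear in the $\xi$'s for the $A$-module structure $(a\cdot Y)(q)=(-)^{aY}Y(aq)$ on operators $Y$ on $Q$. The *curvature* $J(\nabla)(\xi_1,\dots,\xi_n|p)$ (resp. $J(\Delta)(\xi_1,\dots,\xi_n|q)$)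 is the left-hand side of the left (resp. right) module identity above, with $\lambda=X$ and $\mu=\nabla$ (resp. $\mu=\Delta$). The connection is *flat* if its curvature vanishes identically. $S_A^\bullet L$ is the graded symmetric algebra of $L$ over $A$ (so $S^0_AL=A$), and $\mathrm{Sym}_A(L,P)=\bigoplus_{\ell\ge0}\mathrm{Sym}^\ell_A(L,P)$, where $\mathrm{Sym}_A^\ell(L,P)$ is the span of the homogeneous, graded symmetric, graded $A$-multilinear maps $L^{\times \ell}\to P$. $S_A^\bullet L$ acts on $\mathrm{Sym}_A(L,P)$ by $i_u$: for $u=\zeta_1\cdots\zeta_k$ and $\Omega$ an $\ell$-form, $(i_u\Omega)(\xi_1,\dots,\xi_{\ell-k})=(-)^{u\Omega}\Omega(\zeta_1,\dots,\zeta_k,\xi_1,\dots,\xi_{\ell-k})$ (and $0$ if $k>\ell$), while $i_a$ is multiplication by $a\in A$. It acts on $S_A^\bullet L\otimes_AQ$ by multiplication, $\mu_u$. For $k\ge1$ let $$(D_k^\nabla\Omega)(\xi_1,\dots,\xi_{\ell+k-1})=\sum_{\sigma\in S_{k-1,\ell}}(-)^{\bar\Omega(\bar\xi_{\sigma(1)}+\cdots+\bar\xi_{\sigma(k-1)})}\alpha(\sigma,\boldsymbol\xi)\nabla(\xi_{\sigma(1)},\dots,\xi_{\sigma(k-1)}|\Omega(\xi_{\sigma(k)},\dots,\xi_{\sigma(\ell+k-1)}))-\sum_{\tau\in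 S_{k,\ell-1}}(-)^{\Omega}\alpha(\tau,\boldsymbol\xi)\Omega(X(\xi_{\tau(1)},\dots,\xi_{\tau(k)}),\xi_{\tau(k+1)},\dots,\xi_{\tau(\ell+k-1)})$$ for an $\ell$-form $\Omega$, $$D_k^\Delta(\xi_1\cdots\xi_\ell\otimes q)=\sum_{\tau\in S_{k,\ell-k}}\alpha(\tau,\boldsymbol\xi)X(\xi_{\tau(1)},\dots,\xi_{\tau(k)})\xi_{\tau(k+1)}\cdots\xi_{\tau(\ell)}\otimes q-\sum_{\sigma\in S_{\ell-k+1,k-1}}(-)^{\bar\xi_{\sigma(1)}+\cdots+\bar\xi_{\sigma(\ell-k+1)}}\alpha(\sigma,\boldsymbol\xi)\xi_{\sigma(1)}\cdots\xi_{\sigma(\ell-k+1)}\otimes\Delta(\xi_{\sigma(\ell-k+2)},\dots,\xi_{\sigma(\ell)}|q),$$ and, for $u_1,\dots,u_{k-1}\in S_A^\bullet L$, $$L^\nabla(u_1,\dots,u_{k-1}|\Omega)=-(-)^k[\cdots[[D_k^\nabla,i_{u_1}],i_{u_2}]\cdots,i_{u_{k-1}}]\Omega,\qquad R^\Delta(u_1,\dots,u_{k-1}|U)=-[\cdots[[D_k^\Delta,\mu_{u_1}],\mu_{u_2}]\cdots,\mu_{u_{k-1}}]U.$$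 **Statement.** Let $(A,L)$ be an $LR_\infty[1]$ algebra. 0. There is exactly one family of graded symmetric $K$-multilinear brackets $\{u_1,\dots,u_k\}$ ($k\ge1$) of degree $1$ on $S_A^\bullet L$ that are graded derivations in each argument, with $\{\xi_1,\dots,\xi_k\}=X(\xi_1,\dots,\xi_k)$ and $\{\xi_1,\dots,\xi_n,a\}=\sigma(\xi_1,\dots,\xi_n|a)$ for $\xi_i\in L$, $a\in A$, and vanishing whenever two arguments are in $A$. With these brackets $S_A^\bullet L$ is an $L_\infty[1]$ algebra. 1. Let $\nabla$ be a left $(A,L)$-connection in $P$. The operators $D_k^\nabla$ are well defined on $\mathrm{Sym}_A(L,P)$. If $\nabla$ is flat, then $L^\nabla$ equips $\mathrm{Sym}_A(L,P)$ with the structure of a left $L_\infty[1]$ module over the $L_\infty[1]$ algebra $S_A^\bullet L$. If, in addition, $L$ is projective and finitely generated over $A$, the converse is also true: if $L^\nabla$ is such a structure then $\nabla$ is flat. 2. Let $\Delta$ be a right $(A,L)$-connection in $Q$. The operators $D_k^\Delta$ are well defined on $S_A^\bullet L\otimes_AQ$, and $\Delta$ is flat if and only if $R^\Delta$ equips $S_A^\bullet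 L\otimes_AQ$ with the structure of a right $L_\infty[1]$ module over the $L_\infty[1]$ algebra $S_A^\bullet L$. -/

import Mathlib

set_option linter.unusedSectionVars false

namespace SHLR

open scoped DirectSum TensorProduct

/-! ### Signs, unshuffles, graded symmetric and graded linear operations -/

section Signs

/-- An `(i, n - i)`-unshuffle of `n` letters is the same thing as the set `I` of its first `i`
values. `koszulSign I e` is the Koszul sign `α` of that unshuffle on letters of degrees `e`: the
letters labelled by `I` (in increasing order) are moved in front of the letters labelled by the
complement of `I` (in increasing order). -/
def koszulSign {n : ℕ} (I : Finset (Fin n)) (e : Fin n → ℤ) : ℤˣ :=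
  ∏ x ∈ (Iᶜ ×ˢ I).filter (fun x => x.1 < x.2), (e x.1 * e x.2).negOnePow

/-- The letters of `v` labelled by `I`, in increasing order. -/
def pick {M : Type*} {n : ℕ} (v : Fin n → M) (I : Finset (Fin n)) : Fin I.card → M :=
  fun t => v (I.orderEmbOfFin rfl t)

variable {K : Type*} [Field K]

/-- `v` consists of homogeneous elements of degrees `e`. -/
def Homog {M : Type*} [AddCommGroup M] [Module K M] (ℳ : ℤ → Submodule K M) {n : ℕ}
    (e : Fin n → ℤ) (v : Fin n → M) : Prop :=
  ∀ i, v i ∈ ℳ (e i)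

/-- Graded symmetry: exchanging two neighbouring homogeneous arguments produces the Koszul sign. -/
def GradedSymm {M N : Type*} [AddCommGroup M] [Module K M] [AddCommGroup N]
    (ℳ : ℤ → Submodule K M) {n : ℕ} (f : (Fin n → M) → N) : Prop :=
  ∀ (e : Fin n → ℤ) (v : Fin n → M), Homog ℳ e v → ∀ i j : Fin n, (i : ℕ) + 1 = j →
    f (v ∘ Equiv.swap i j) = (e i * e j).negOnePow • f v

/-- `f` has degree `d`. -/
def HasDegree {M N : Type*} [AddCommGroup M] [Module K M] [AddCommGroup N] [Module K N]
    (ℳ : ℤ → Submodule K M) (𝒩 : ℤ → Submodule K N) {n : ℕ} (d : ℤ) (f : (Fin n → M) → N) : Prop :=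
  ∀ (e : Fin n → ℤ) (v : Fin n → M), Homog ℳ e v → f v ∈ 𝒩 (d + ∑ i, e i)

/-- Graded `A`-multilinearity of an operation `f` of degree `d`: a scalar that is pulled out of the
`i`-th slot passes `f` and the first `i - 1` arguments. -/
def GradedMultilin {A M N : Type*} [Ring A] [Algebra K A] [AddCommGroup M] [Module K M]
    [Module A M] [AddCommGroup N] [Module A N] (𝒜 : ℤ → Submodule K A) (ℳ : ℤ → Submodule K M)
    {n : ℕ} (d : ℤ) (f : (Fin n → M) → N) : Prop :=
  ∀ (r : ℤ) (a : A), a ∈ 𝒜 r → ∀ (e : Fin n → ℤ) (v : Fin n → M), Homog ℳ e v → ∀ i : Fin n,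
    f (Function.update v i (a • v i)) =
      (r * (d + ∑ j ∈ Finset.Iio i, e j)).negOnePow • a • f v

/-- Graded commutativity of a graded algebra. -/
class IsGradedComm {A : Type*} [Ring A] [Algebra K A] (𝒜 : ℤ → Submodule K A) : Prop where
  comm : ∀ (i j : ℤ) (a b : A), a ∈ 𝒜 i → b ∈ 𝒜 j → a * b = (i * j).negOnePow • (b * a)

end Signs

/-! ### `L_∞[1]` algebras and their left and right modules -/

section LInfinity

variable {K : Type*} [Field K]
  {V : Type*} [AddCommGroup V] [Module K V] (𝒱 : ℤ → Submodule K V) [DirectSum.Decomposition 𝒱]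
  {W : Type*} [AddCommGroup W] [Module K W] (𝒲 : ℤ → Submodule K W) [DirectSum.Decomposition 𝒲]

/-- `lam k` (`k ≥ 1`) are the brackets of an `L_∞[1]` algebra; there is no `0`-ary bracket. -/
structure IsLInfinityAlgebra (lam : ∀ k : ℕ, MultilinearMap K (fun _ : Fin k => V) V) : Prop where
  zero : lam 0 = 0
  degree : ∀ k, HasDegree 𝒱 𝒱 1 (lam k)
  symm : ∀ k, GradedSymm 𝒱 (lam k)
  jacobi : ∀ (n : ℕ) (e : Fin n → ℤ) (v : Fin n → V), Homog 𝒱 e v →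
    ∑ I : Finset (Fin n), koszulSign I e •
      lam (Iᶜ.card + 1) (Fin.cons (lam I.card (pick v I)) (pick v Iᶜ)) = 0

/-- The structure maps of a left or right module: `mu n v w` is the `(n + 1)`-ary operation
`μ_{n+1}(v_1, …, v_n | w)`. -/
structure IsModuleOps (mu : ∀ n : ℕ, MultilinearMap K (fun _ : Fin n => V) (Module.End K W)) :
    Prop where
  degree : ∀ (n : ℕ) (e : Fin n → ℤ) (v : Fin n → V), Homog 𝒱 e v → ∀ (f : ℤ) (w : W),
    w ∈ 𝒲 f → mu n v w ∈ 𝒲 (1 + ∑ i, e i + f)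
  symm : ∀ n, GradedSymm 𝒱 (mu n)

/-- `mu` is the structure of a (left) `L_∞[1]` module over `(V, lam)` on `W`. -/
structure IsLeftLInfinityModule (lam : ∀ k : ℕ, MultilinearMap K (fun _ : Fin k => V) V)
    (mu : ∀ n : ℕ, MultilinearMap K (fun _ : Fin n => V) (Module.End K W)) : Prop
    extends IsModuleOps 𝒱 𝒲 mu where
  jacobi : ∀ (n : ℕ) (e : Fin n → ℤ) (v : Fin n → V), Homog 𝒱 e v → ∀ w : W,
    (∑ I : Finset (Fin n), koszulSign I e •
        mu (Iᶜ.card + 1) (Fin.cons (lam I.card (pick v I)) (pick v Iᶜ)) w)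
      + ∑ I : Finset (Fin n), (∑ i ∈ I, e i).negOnePow • koszulSign I e •
        mu I.card (pick v I) (mu Iᶜ.card (pick v Iᶜ) w) = 0

/-- `rho` is the structure of a right `L_∞[1]` module over `(V, lam)` on `W`. -/
structure IsRightLInfinityModule (lam : ∀ k : ℕ, MultilinearMap K (fun _ : Fin k => V) V)
    (rho : ∀ n : ℕ, MultilinearMap K (fun _ : Fin n => V) (Module.End K W)) : Prop
    extends IsModuleOps 𝒱 𝒲 rho where
  jacobi : ∀ (n : ℕ) (e : Fin n → ℤ) (v : Fin n → V), Homog 𝒱 e v → ∀ w : W,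
    (∑ I : Finset (Fin n), koszulSign I e •
        rho (Iᶜ.card + 1) (Fin.cons (lam I.card (pick v I)) (pick v Iᶜ)) w)
      - ∑ I : Finset (Fin n), (∑ i ∈ I, e i).negOnePow • koszulSign I e •
        rho I.card (pick v I) (rho Iᶜ.card (pick v Iᶜ) w) = 0

end LInfinity

/-! ### Graded commutators of endomorphisms of a graded vector space -/

section Commutator

variable {K : Type*} [Field K]
  {W : Type*} [AddCommGroup W] [Module K W] (𝒲 : ℤ → Submodule K W) [DirectSum.Decomposition 𝒲]

/-- The grading involution, `w ↦ (-1)^d w` on elements of degree `d`. -/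
def parity : Module.End K W :=
  DirectSum.toModule K ℤ W (fun d => ((d.negOnePow : ℤˣ) : ℤ) • (𝒲 d).subtype) ∘ₗ
    (DirectSum.decomposeLinearEquiv 𝒲).toLinearMap

theorem parity_apply {d : ℤ} {w : W} (hw : w ∈ 𝒲 d) : parity 𝒲 w = d.negOnePow • w := by
  have h : DirectSum.decompose 𝒲 w = DirectSum.of (fun i => 𝒲 i) d ⟨w, hw⟩ :=
    DirectSum.decompose_of_mem 𝒲 hw
  simp only [parity, LinearMap.comp_apply, LinearEquiv.coe_coe,
    DirectSum.decomposeLinearEquiv_apply, h, ← DirectSum.lof_eq_of K, DirectSum.toModule_lof,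
    LinearMap.smul_apply, Submodule.subtype_apply, Units.smul_def]

/-- The graded commutator `[Φ, Ψ] = ΦΨ - (-1)^{ΦΨ} ΨΦ`, bilinear in `Φ` and `Ψ`. With `ε` the grading
involution, `½(Ψ + εΨε)` and `½(Ψ - εΨε)` are the even and the odd part of `Ψ`, and
`εΦε = (-1)^Φ Φ`. -/
def gradedCommutator : Module.End K W →ₗ[K] Module.End K W →ₗ[K] Module.End K W :=
  LinearMap.mk₂ K (fun Φ Ψ => Φ * Ψ
      - ((2 : K)⁻¹ • (Ψ + parity 𝒲 * Ψ * parity 𝒲)) * Φ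
      - ((2 : K)⁻¹ • (Ψ - parity 𝒲 * Ψ * parity 𝒲)) * (parity 𝒲 * Φ * parity 𝒲))
    (fun a b c => by simp only [add_mul, mul_add]; abel)
    (fun c a b => by
      simp only [smul_mul_assoc, mul_smul_comm, smul_sub])
    (fun a b c => by
      simp only [add_mul, mul_add, smul_add, smul_sub, sub_mul]; abel)
    (fun c a b => by
      simp only [smul_mul_assoc, mul_smul_comm, smul_sub, smul_add, add_mul, sub_mul,
        smul_comm c (2 : K)⁻¹])

/-- `Φ` is homogeneous of degree `a`. -/
def EndDegree (a : ℤ) (Φ : Module.End K W) : Prop :=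
  ∀ (d : ℤ) (w : W), w ∈ 𝒲 d → Φ w ∈ 𝒲 (a + d)

theorem parity_conj {a : ℤ} {Φ : Module.End K W} (h : EndDegree 𝒲 a Φ) :
    parity 𝒲 * Φ * parity 𝒲 = a.negOnePow • Φ := by
  ext w
  induction w using DirectSum.Decomposition.inductionOn 𝒲 with
  | zero => simp
  | @homogeneous i m =>
    have h1 := parity_apply 𝒲 m.2
    have h2 := parity_apply 𝒲 (h i m m.2)
    simp only [Module.End.mul_apply, h1, Units.smul_def, map_zsmul, h2, LinearMap.smul_apply,
      smul_smul, Int.negOnePow_add]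
    congr 1
    rcases Int.even_or_odd i with hi | hi
    · simp [Int.negOnePow_even i hi]
    · simp [Int.negOnePow_odd i hi]
  | add m m' h1 h2 => simp only [map_add, h1, h2]

/-- On homogeneous endomorphisms `gradedCommutator` is the usual graded commutator. -/
theorem gradedCommutator_apply [CharZero K] {a b : ℤ} {Φ Ψ : Module.End K W}
    (hΦ : EndDegree 𝒲 a Φ) (hΨ : EndDegree 𝒲 b Ψ) :
    gradedCommutator 𝒲 Φ Ψ = Φ * Ψ - (a * b).negOnePow • (Ψ * Φ) := by
  have h2 : (2 : K)⁻¹ • (Ψ + Ψ) = Ψ := by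
    rw [← two_smul K Ψ, smul_smul, inv_mul_cancel₀ two_ne_zero, one_smul]
  simp only [gradedCommutator, LinearMap.mk₂_apply, parity_conj 𝒲 hΦ, parity_conj 𝒲 hΨ]
  rcases Int.even_or_odd b with hb | hb
  · simp [Int.negOnePow_even b hb, Int.negOnePow_even _ (hb.mul_left a), h2]
  · rcases Int.even_or_odd a with ha | ha
    · simp [Int.negOnePow_odd b hb, Int.negOnePow_even a ha,
        Int.negOnePow_even _ (ha.mul_right b), h2]
    · simp [Int.negOnePow_odd b hb, Int.negOnePow_odd a ha, Int.negOnePow_odd _ (ha.mul hb), h2]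

/-- The iterated commutators `[⋯[[Φ, ρ(u_1)], ρ(u_2)]⋯, ρ(u_n)]`, linear in `Φ` and multilinear in
`u_1, …, u_n`. -/
def iteratedCommutator {S : Type*} [AddCommGroup S] [Module K S] (ρ : S →ₗ[K] Module.End K W) :
    ∀ n : ℕ, Module.End K W →ₗ[K] MultilinearMap K (fun _ : Fin n => S) (Module.End K W)
  | 0 => LinearMap.mk
      ⟨fun Φ => MultilinearMap.constOfIsEmpty K (fun _ : Fin 0 => S) Φ, fun _ _ => rfl⟩
      (fun _ _ => rfl)
  | n + 1 =>
      (multilinearCurryLeftEquiv K (fun _ : Fin (n + 1) => S) (Module.End K W)).symm.toLinearMap ∘ₗ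
        LinearMap.llcomp K S (Module.End K W)
          (MultilinearMap K (fun _ : Fin n => S) (Module.End K W)) (iteratedCommutator ρ n) ∘ₗ
        (gradedCommutator 𝒲).compl₂ ρ

theorem iteratedCommutator_zero {S : Type*} [AddCommGroup S] [Module K S]
    (ρ : S →ₗ[K] Module.End K W) (Φ : Module.End K W) (u : Fin 0 → S) :
    iteratedCommutator 𝒲 ρ 0 Φ u = Φ := rfl

theorem iteratedCommutator_succ {S : Type*} [AddCommGroup S] [Module K S]
    (ρ : S →ₗ[K] Module.End K W) (n : ℕ) (Φ : Module.End K W) (u : Fin (n + 1) → S) :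
    iteratedCommutator 𝒲 ρ (n + 1) Φ u =
      iteratedCommutator 𝒲 ρ n (gradedCommutator 𝒲 Φ (ρ (u 0))) (Fin.tail u) := rfl

end Commutator

/-! ### The graded symmetric algebra of a graded module -/

section SymmetricAlgebra

variable {K : Type*} [Field K]
  {A : Type*} [Ring A] [Algebra K A] (𝒜 : ℤ → Submodule K A) [GradedAlgebra 𝒜]
  {L : Type*} [AddCommGroup L] [Module K L] [Module A L] [IsScalarTower K A L]
  (ℒ : ℤ → Submodule K L) [DirectSum.Decomposition ℒ] [SetLike.GradedSMul 𝒜 ℒ]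

/-- The relations of the graded symmetric algebra `S_A^• L` on the generators `a ∈ A` and `ξ ∈ L`;
they are (bi)linear, so that it is enough to impose them for homogeneous `a`, `b`, `ξ`, `ζ`. -/
inductive SymRel : TensorAlgebra K (A × L) → TensorAlgebra K (A × L) → Prop
  | one : SymRel (TensorAlgebra.ι K (1, 0)) 1
  | mul {i j : ℤ} {a b : A} (ha : a ∈ 𝒜 i) (hb : b ∈ 𝒜 j) :
      SymRel (TensorAlgebra.ι K (a, 0) * TensorAlgebra.ι K (b, 0)) (TensorAlgebra.ι K (a * b, 0))
  | smul {i j : ℤ} {a : A} {ξ : L} (ha : a ∈ 𝒜 i) (hξ : ξ ∈ ℒ j) :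
      SymRel (TensorAlgebra.ι K (a, 0) * TensorAlgebra.ι K (0, ξ)) (TensorAlgebra.ι K (0, a • ξ))
  | comm_smul {i j : ℤ} {a : A} {ξ : L} (ha : a ∈ 𝒜 i) (hξ : ξ ∈ ℒ j) :
      SymRel (TensorAlgebra.ι K (a, 0) * TensorAlgebra.ι K (0, ξ))
        ((i * j).negOnePow • (TensorAlgebra.ι K (0, ξ) * TensorAlgebra.ι K (a, 0)))
  | comm {i j : ℤ} {ξ ζ : L} (hξ : ξ ∈ ℒ i) (hζ : ζ ∈ ℒ j) :
      SymRel (TensorAlgebra.ι K (0, ξ) * TensorAlgebra.ι K (0, ζ))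
        ((i * j).negOnePow • (TensorAlgebra.ι K (0, ζ) * TensorAlgebra.ι K (0, ξ)))

/-- The graded symmetric algebra `S_A^• L` of the graded `A`-module `L`. -/
def SymAlg : Type _ := RingQuot (SymRel 𝒜 ℒ)

instance : Ring (SymAlg 𝒜 ℒ) := inferInstanceAs (Ring (RingQuot (SymRel 𝒜 ℒ)))
instance : Algebra K (SymAlg 𝒜 ℒ) := inferInstanceAs (Algebra K (RingQuot (SymRel 𝒜 ℒ)))

namespace SymAlg

def mk : TensorAlgebra K (A × L) →ₐ[K] SymAlg 𝒜 ℒ := RingQuot.mkAlgHom K (SymRel 𝒜 ℒ)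

/-- The canonical map `A → S_A^• L`. -/
def ιA : A →ₗ[K] SymAlg 𝒜 ℒ :=
  (mk 𝒜 ℒ).toLinearMap ∘ₗ TensorAlgebra.ι K ∘ₗ LinearMap.inl K A L

/-- The canonical map `L → S_A^• L`. -/
def ιL : L →ₗ[K] SymAlg 𝒜 ℒ :=
  (mk 𝒜 ℒ).toLinearMap ∘ₗ TensorAlgebra.ι K ∘ₗ LinearMap.inr K A L

variable {𝒜 ℒ}

theorem mk_rel {x y : TensorAlgebra K (A × L)} (h : SymRel 𝒜 ℒ x y) : mk 𝒜 ℒ x = mk 𝒜 ℒ y :=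
  RingQuot.mkAlgHom_rel K h

/-- The data from which an algebra map out of `S_A^• L` is built. -/
structure LiftData (B : Type*) [Ring B] [Algebra K B] (𝒜 : ℤ → Submodule K A)
    (ℒ : ℤ → Submodule K L) where
  f : A →ₗ[K] B
  g : L →ₗ[K] B
  one : f 1 = 1
  mul : ∀ {i j : ℤ} {a b : A}, a ∈ 𝒜 i → b ∈ 𝒜 j → f a * f b = f (a * b)
  smul : ∀ {i j : ℤ} {a : A} {ξ : L}, a ∈ 𝒜 i → ξ ∈ ℒ j → f a * g ξ = g (a • ξ)
  comm_smul : ∀ {i j : ℤ} {a : A} {ξ : L}, a ∈ 𝒜 i → ξ ∈ ℒ j →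
    f a * g ξ = (i * j).negOnePow • (g ξ * f a)
  comm : ∀ {i j : ℤ} {ξ ζ : L}, ξ ∈ ℒ i → ζ ∈ ℒ j → g ξ * g ζ = (i * j).negOnePow • (g ζ * g ξ)

/-- The universal property of `S_A^• L`. -/
def lift {B : Type*} [Ring B] [Algebra K B] (F : LiftData B 𝒜 ℒ) : SymAlg 𝒜 ℒ →ₐ[K] B :=
  RingQuot.liftAlgHom K ⟨TensorAlgebra.lift K (F.f.coprod F.g), by
    intro x y h
    induction h with
    | one => simp [F.one]
    | mul ha hb => simp [F.mul ha hb]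
    | smul ha hb => simp [F.smul ha hb]
    | comm_smul ha hb => simp [F.comm_smul ha hb, Units.smul_def]
    | comm ha hb => simp [F.comm ha hb, Units.smul_def]⟩

theorem lift_mk {B : Type*} [Ring B] [Algebra K B] (F : LiftData B 𝒜 ℒ)
    (x : TensorAlgebra K (A × L)) :
    lift F (mk 𝒜 ℒ x) = TensorAlgebra.lift K (F.f.coprod F.g) x :=
  RingQuot.liftAlgHom_mkAlgHom_apply K _ _ x

theorem lift_ιA {B : Type*} [Ring B] [Algebra K B] (F : LiftData B 𝒜 ℒ) (a : A) :
    lift F (ιA 𝒜 ℒ a) = F.f a := by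
  simp [ιA, lift_mk]

theorem lift_ιL {B : Type*} [Ring B] [Algebra K B] (F : LiftData B 𝒜 ℒ) (ξ : L) :
    lift F (ιL 𝒜 ℒ ξ) = F.g ξ := by
  simp [ιL, lift_mk]

theorem algHom_ext {B : Type*} [Ring B] [Algebra K B] {f g : SymAlg 𝒜 ℒ →ₐ[K] B}
    (hA : ∀ a, f (ιA 𝒜 ℒ a) = g (ιA 𝒜 ℒ a)) (hL : ∀ ξ, f (ιL 𝒜 ℒ ξ) = g (ιL 𝒜 ℒ ξ)) : f = g := by
  refine RingQuot.ringQuot_ext' K f g (TensorAlgebra.hom_ext (LinearMap.ext ?_))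
  rintro ⟨a, ξ⟩
  have h : ((a, ξ) : A × L) = (a, 0) + (0, ξ) := by simp
  have h1 := hA a
  have h2 := hL ξ
  simp only [ιA, ιL, mk, LinearMap.comp_apply, LinearMap.inl_apply, LinearMap.inr_apply]
    at h1 h2
  rw [h, map_add, map_add]
  exact congrArg₂ (· + ·) h1 h2

theorem ιA_one : ιA 𝒜 ℒ 1 = 1 := by
  simpa [ιA] using mk_rel (𝒜 := 𝒜) (ℒ := ℒ) SymRel.one

theorem ιA_mul {i j : ℤ} {a b : A} (ha : a ∈ 𝒜 i) (hb : b ∈ 𝒜 j) :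
    ιA 𝒜 ℒ a * ιA 𝒜 ℒ b = ιA 𝒜 ℒ (a * b) := by
  simpa [ιA] using mk_rel (ℒ := ℒ) (SymRel.mul ha hb)

theorem ιA_mul_ιL {i j : ℤ} {a : A} {ξ : L} (ha : a ∈ 𝒜 i) (hξ : ξ ∈ ℒ j) :
    ιA 𝒜 ℒ a * ιL 𝒜 ℒ ξ = ιL 𝒜 ℒ (a • ξ) := by
  simpa [ιA, ιL] using mk_rel (SymRel.smul ha hξ)

theorem ιA_comm_ιL {i j : ℤ} {a : A} {ξ : L} (ha : a ∈ 𝒜 i) (hξ : ξ ∈ ℒ j) :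
    ιA 𝒜 ℒ a * ιL 𝒜 ℒ ξ = (i * j).negOnePow • (ιL 𝒜 ℒ ξ * ιA 𝒜 ℒ a) := by
  simpa [ιA, ιL, Units.smul_def] using mk_rel (SymRel.comm_smul ha hξ)

theorem ιL_comm {i j : ℤ} {ξ ζ : L} (hξ : ξ ∈ ℒ i) (hζ : ζ ∈ ℒ j) :
    ιL 𝒜 ℒ ξ * ιL 𝒜 ℒ ζ = (i * j).negOnePow • (ιL 𝒜 ℒ ζ * ιL 𝒜 ℒ ξ) := by
  simpa [ιL, Units.smul_def] using mk_rel (𝒜 := 𝒜) (SymRel.comm hξ hζ)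

variable (𝒜 ℒ)

/-- Products of homogeneous generators, with their total degree. -/
inductive IsMonomial : ℤ → SymAlg 𝒜 ℒ → Prop
  | one : IsMonomial 0 1
  | mulA {i d : ℤ} {a : A} {x : SymAlg 𝒜 ℒ} (ha : a ∈ 𝒜 i) (hx : IsMonomial d x) :
      IsMonomial (i + d) (ιA 𝒜 ℒ a * x)
  | mulL {i d : ℤ} {ξ : L} {x : SymAlg 𝒜 ℒ} (hξ : ξ ∈ ℒ i) (hx : IsMonomial d x) :
      IsMonomial (i + d) (ιL 𝒜 ℒ ξ * x)

/-- The grading of `S_A^• L` by the total degree. -/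
def grade (d : ℤ) : Submodule K (SymAlg 𝒜 ℒ) := Submodule.span K {x | IsMonomial 𝒜 ℒ d x}

variable {𝒜 ℒ}

theorem IsMonomial.mul {i j : ℤ} {x y : SymAlg 𝒜 ℒ} (hx : IsMonomial 𝒜 ℒ i x)
    (hy : IsMonomial 𝒜 ℒ j y) : IsMonomial 𝒜 ℒ (i + j) (x * y) := by
  induction hx with
  | one => simpa using hy
  | mulA ha _ ih => rw [add_assoc, mul_assoc]; exact .mulA ha ih
  | mulL ha _ ih => rw [add_assoc, mul_assoc]; exact .mulL ha ih

theorem ιA_mem {i : ℤ} {a : A} (ha : a ∈ 𝒜 i) : ιA 𝒜 ℒ a ∈ grade 𝒜 ℒ i := by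
  have h := IsMonomial.mulA (ℒ := ℒ) ha .one
  rw [add_zero, mul_one] at h
  exact Submodule.subset_span h

theorem ιL_mem {i : ℤ} {ξ : L} (hξ : ξ ∈ ℒ i) : ιL 𝒜 ℒ ξ ∈ grade 𝒜 ℒ i := by
  have h := IsMonomial.mulL (𝒜 := 𝒜) hξ .one
  rw [add_zero, mul_one] at h
  exact Submodule.subset_span h

instance : SetLike.GradedMonoid (grade 𝒜 ℒ) where
  one_mem := Submodule.subset_span .one
  mul_mem {i j x y} hx hy := by
    have h : grade 𝒜 ℒ i * grade 𝒜 ℒ j ≤ grade 𝒜 ℒ (i + j) := by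
      rw [grade, grade, Submodule.span_mul_span]
      refine Submodule.span_mono ?_
      rintro _ ⟨x, hx, y, hy, rfl⟩
      exact hx.mul hy
    exact h (Submodule.mul_mem_mul hx hy)

/-- `A → ⨁ (S_A^• L)_d` -/
def gradeA : A →ₗ[K] ⨁ d, grade 𝒜 ℒ d :=
  DirectSum.lmap (fun i => ((ιA 𝒜 ℒ).domRestrict (𝒜 i)).codRestrict (grade 𝒜 ℒ i)
    (fun x => ιA_mem x.2)) ∘ₗ (DirectSum.decomposeLinearEquiv 𝒜).toLinearMap

/-- `L → ⨁ (S_A^• L)_d` -/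
def gradeL : L →ₗ[K] ⨁ d, grade 𝒜 ℒ d :=
  DirectSum.lmap (fun i => ((ιL 𝒜 ℒ).domRestrict (ℒ i)).codRestrict (grade 𝒜 ℒ i)
    (fun x => ιL_mem x.2)) ∘ₗ (DirectSum.decomposeLinearEquiv ℒ).toLinearMap

theorem gradeA_apply {i : ℤ} {a : A} (ha : a ∈ 𝒜 i) :
    (gradeA a : ⨁ d, grade 𝒜 ℒ d) = DirectSum.of (fun d => grade 𝒜 ℒ d) i ⟨_, ιA_mem ha⟩ := by
  simp only [gradeA, LinearMap.comp_apply, LinearEquiv.coe_coe,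
    DirectSum.decomposeLinearEquiv_apply, DirectSum.decompose_of_mem 𝒜 ha,
    ← DirectSum.lof_eq_of K, DirectSum.lmap_lof]
  rfl

theorem gradeL_apply {i : ℤ} {ξ : L} (hξ : ξ ∈ ℒ i) :
    (gradeL ξ : ⨁ d, grade 𝒜 ℒ d) = DirectSum.of (fun d => grade 𝒜 ℒ d) i ⟨_, ιL_mem hξ⟩ := by
  simp only [gradeL, LinearMap.comp_apply, LinearEquiv.coe_coe,
    DirectSum.decomposeLinearEquiv_apply, DirectSum.decompose_of_mem ℒ hξ,
    ← DirectSum.lof_eq_of K, DirectSum.lmap_lof]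
  rfl

theorem of_eq {i j : ℤ} (h : i = j) {x y : SymAlg 𝒜 ℒ} (hx : x ∈ grade 𝒜 ℒ i)
    (hy : y ∈ grade 𝒜 ℒ j) (hxy : x = y) :
    DirectSum.of (fun d => grade 𝒜 ℒ d) i ⟨x, hx⟩ =
      DirectSum.of (fun d => grade 𝒜 ℒ d) j ⟨y, hy⟩ := by
  subst h; subst hxy; rfl

theorem smul_of_eq {i j : ℤ} (h : i = j) (c : ℤˣ) {x y : SymAlg 𝒜 ℒ} (hx : x ∈ grade 𝒜 ℒ i)
    (hy : y ∈ grade 𝒜 ℒ j) (hxy : x = c • y) :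
    DirectSum.of (fun d => grade 𝒜 ℒ d) i ⟨x, hx⟩ =
      c • DirectSum.of (fun d => grade 𝒜 ℒ d) j ⟨y, hy⟩ := by
  subst h; subst hxy
  have h1 : (⟨c • y, hx⟩ : grade 𝒜 ℒ i) = (c : ℤ) • ⟨y, hy⟩ := rfl
  rw [h1, map_zsmul, Units.smul_def]

def gradeData : LiftData (⨁ d, grade 𝒜 ℒ d) 𝒜 ℒ :=
  { f := gradeA
    g := gradeL
    one := by
      rw [gradeA_apply SetLike.GradedOne.one_mem]
      exact of_eq rfl _ _ ιA_one
    mul := fun ha hb => by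
      rw [gradeA_apply ha, gradeA_apply hb, gradeA_apply (SetLike.GradedMul.mul_mem ha hb),
        DirectSum.of_mul_of]
      exact of_eq rfl _ _ (ιA_mul ha hb)
    smul := fun ha hb => by
      rw [gradeA_apply ha, gradeL_apply hb, gradeL_apply (SetLike.GradedSMul.smul_mem ha hb),
        DirectSum.of_mul_of]
      exact of_eq rfl _ _ (ιA_mul_ιL ha hb)
    comm_smul := fun ha hb => by
      rw [gradeA_apply ha, gradeL_apply hb, DirectSum.of_mul_of, DirectSum.of_mul_of]
      exact smul_of_eq (add_comm _ _) _ _ _ (ιA_comm_ιL ha hb)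
    comm := fun ha hb => by
      rw [gradeL_apply ha, gradeL_apply hb, DirectSum.of_mul_of, DirectSum.of_mul_of]
      exact smul_of_eq (add_comm _ _) _ _ _ (ιL_comm ha hb) }

def gradeLift : SymAlg 𝒜 ℒ →ₐ[K] ⨁ d, grade 𝒜 ℒ d := lift gradeData

theorem gradeLift_ιA {i : ℤ} {a : A} (ha : a ∈ 𝒜 i) : gradeLift (ιA 𝒜 ℒ a) =
    DirectSum.of (fun d => grade 𝒜 ℒ d) i ⟨_, ιA_mem ha⟩ :=
  (lift_ιA gradeData a).trans (gradeA_apply ha)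

theorem gradeLift_ιL {i : ℤ} {ξ : L} (hξ : ξ ∈ ℒ i) : gradeLift (ιL 𝒜 ℒ ξ) =
    DirectSum.of (fun d => grade 𝒜 ℒ d) i ⟨_, ιL_mem hξ⟩ :=
  (lift_ιL gradeData ξ).trans (gradeL_apply hξ)

theorem gradeLift_of {i : ℤ} {x : SymAlg 𝒜 ℒ} (hx : IsMonomial 𝒜 ℒ i x) :
    gradeLift x = DirectSum.of (fun d => grade 𝒜 ℒ d) i ⟨x, Submodule.subset_span hx⟩ := by
  induction hx with
  | one => rw [map_one]; rfl
  | mulA ha _ ih =>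
    rw [map_mul, ih, gradeLift_ιA ha, DirectSum.of_mul_of]
    exact of_eq rfl _ _ rfl
  | mulL ha _ ih =>
    rw [map_mul, ih, gradeLift_ιL ha, DirectSum.of_mul_of]
    exact of_eq rfl _ _ rfl

instance : GradedAlgebra (grade 𝒜 ℒ) :=
  GradedAlgebra.ofAlgHom (grade 𝒜 ℒ) gradeLift
    (by
      refine algHom_ext (fun a => ?_) (fun ξ => ?_)
      · induction a using DirectSum.Decomposition.inductionOn 𝒜 with
        | zero => simp
        | homogeneous a =>
          rw [AlgHom.comp_apply, gradeLift_ιA a.2, AlgHom.id_apply, DirectSum.coeAlgHom_of]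
        | add a b h1 h2 => rw [map_add, map_add, map_add, h1, h2]
      · induction ξ using DirectSum.Decomposition.inductionOn ℒ with
        | zero => simp
        | homogeneous a =>
          rw [AlgHom.comp_apply, gradeLift_ιL a.2, AlgHom.id_apply, DirectSum.coeAlgHom_of]
        | add a b h1 h2 => rw [map_add, map_add, map_add, h1, h2])
    (by
      rintro i ⟨x, hx⟩
      induction hx using Submodule.span_induction with
      | mem x hx => exact gradeLift_of hx
      | zero => exact (map_zero _).trans (map_zero (DirectSum.of _ i)).symm
      | add x y hx hy h1 h2 =>
        simp only at h1 h2 ⊢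
        rw [map_add, h1, h2, ← map_add]
        rfl
      | smul c x hx h =>
        simp only at h ⊢
        rw [map_smul, h, ← DirectSum.lof_eq_of K, ← map_smul]
        rfl)

/-- The product `ξ_1 ⋯ ξ_m` in `S_A^• L`. -/
def prodL (𝒜 : ℤ → Submodule K A) (ℒ : ℤ → Submodule K L) {m : ℕ} (ξ : Fin m → L) :
    SymAlg 𝒜 ℒ :=
  (List.ofFn (fun i => ιL 𝒜 ℒ (ξ i))).prod

end SymAlg

end SymmetricAlgebra

/-! ### `LR_∞[1]` algebras, left and right connections, curvature -/

section LieRinehart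

variable {K : Type*} [Field K]
  {A : Type*} [Ring A] [Algebra K A] {L : Type*} [AddCommGroup L] [Module K L] [Module A L]

/-- An `LR_∞[1]` algebra structure on `(A, L)`: a degree `1` multiderivation of `L` without `0`-entry
component and with vanishing higher Jacobiator. `X k` is the `k`-th bracket, and the anchor `σ n` is
the symbol of `X (n + 1)`, so that `σ n ξ a` is `σ(ξ_1, …, ξ_n | a)`. -/
structure LRInfinity (𝒜 : ℤ → Submodule K A) (ℒ : ℤ → Submodule K L) where
  X : ∀ k : ℕ, MultilinearMap K (fun _ : Fin k => L) L
  σ : ∀ n : ℕ, MultilinearMap K (fun _ : Fin n => L) (Module.End K A)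
  X_zero : X 0 = 0
  X_degree : ∀ k, HasDegree ℒ ℒ 1 (X k)
  X_symm : ∀ k, GradedSymm ℒ (X k)
  σ_degree : ∀ (n : ℕ) (e : Fin n → ℤ) (ξ : Fin n → L), Homog ℒ e ξ → ∀ (r : ℤ) (a : A), a ∈ 𝒜 r →
    σ n ξ a ∈ 𝒜 (1 + ∑ i, e i + r)
  σ_symm : ∀ n, GradedSymm ℒ (σ n)
  σ_linear : ∀ (n : ℕ) (b : A), GradedMultilin 𝒜 ℒ 1 (fun ξ => σ n ξ b)
  σ_leibniz : ∀ (n : ℕ) (e : Fin n → ℤ) (ξ : Fin n → L), Homog ℒ e ξ → ∀ (r : ℤ) (a : A), a ∈ 𝒜 r →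
    ∀ b : A, σ n ξ (a * b) = σ n ξ a * b + ((1 + ∑ i, e i) * r).negOnePow • (a * σ n ξ b)
  X_leibniz : ∀ (n : ℕ) (e : Fin n → ℤ) (ξ : Fin n → L), Homog ℒ e ξ → ∀ (r : ℤ) (a : A), a ∈ 𝒜 r →
    ∀ η : L, X (n + 1) (Fin.snoc (α := fun _ => L) ξ (a • η)) = σ n ξ a • η
      + ((1 + ∑ i, e i) * r).negOnePow • a • X (n + 1) (Fin.snoc (α := fun _ => L) ξ η)
  jacobi : ∀ (n : ℕ) (e : Fin n → ℤ) (ξ : Fin n → L), Homog ℒ e ξ →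
    ∑ I : Finset (Fin n), koszulSign I e •
      X (Iᶜ.card + 1) (Fin.cons (X I.card (pick ξ I)) (pick ξ Iᶜ)) = 0
  jacobi_symbol : ∀ (n : ℕ) (e : Fin n → ℤ) (ξ : Fin n → L), Homog ℒ e ξ → ∀ a : A,
    (∑ I : Finset (Fin n), (∑ i ∈ I, e i).negOnePow • koszulSign I e •
        σ I.card (pick ξ I) (σ Iᶜ.card (pick ξ Iᶜ) a))
      + ∑ I : Finset (Fin n), koszulSign I e •
        σ (Iᶜ.card + 1) (Fin.cons (X I.card (pick ξ I)) (pick ξ Iᶜ)) a = 0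

variable {𝒜 : ℤ → Submodule K A} {ℒ : ℤ → Submodule K L}

/-- A left `(A, L)`-connection in `P`; `nabla n ξ p` is `∇(ξ_1, …, ξ_n | p)`. -/
structure LeftConnection (𝕏 : LRInfinity 𝒜 ℒ) {P : Type*} [AddCommGroup P] [Module K P] [Module A P]
    (𝓟 : ℤ → Submodule K P) where
  nabla : ∀ n : ℕ, MultilinearMap K (fun _ : Fin n => L) (Module.End K P)
  degree : ∀ (n : ℕ) (e : Fin n → ℤ) (ξ : Fin n → L), Homog ℒ e ξ → ∀ (s : ℤ) (p : P), p ∈ 𝓟 s →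
    nabla n ξ p ∈ 𝓟 (1 + ∑ i, e i + s)
  symm : ∀ n, GradedSymm ℒ (nabla n)
  linear : ∀ (n : ℕ) (p : P), GradedMultilin 𝒜 ℒ 1 (fun ξ => nabla n ξ p)
  leibniz : ∀ (n : ℕ) (e : Fin n → ℤ) (ξ : Fin n → L), Homog ℒ e ξ → ∀ (r : ℤ) (a : A), a ∈ 𝒜 r →
    ∀ p : P, nabla n ξ (a • p) =
      ((1 + ∑ i, e i) * r).negOnePow • a • nabla n ξ p + 𝕏.σ n ξ a • p

/-- The curvature `J(∇)(ξ_1, …, ξ_n | p)` on homogeneous `ξ_i` of degrees `e i`. -/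
def LeftConnection.curvature {𝕏 : LRInfinity 𝒜 ℒ} {P : Type*} [AddCommGroup P] [Module K P]
    [Module A P] {𝓟 : ℤ → Submodule K P} (D : LeftConnection 𝕏 𝓟) {n : ℕ} (e : Fin n → ℤ)
    (ξ : Fin n → L) (p : P) : P :=
  (∑ I : Finset (Fin n), koszulSign I e •
      D.nabla (Iᶜ.card + 1) (Fin.cons (𝕏.X I.card (pick ξ I)) (pick ξ Iᶜ)) p)
    + ∑ I : Finset (Fin n), (∑ i ∈ I, e i).negOnePow • koszulSign I e •
      D.nabla I.card (pick ξ I) (D.nabla Iᶜ.card (pick ξ Iᶜ) p)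

/-- The curvature vanishes identically. -/
def LeftConnection.Flat {𝕏 : LRInfinity 𝒜 ℒ} {P : Type*} [AddCommGroup P] [Module K P]
    [Module A P] {𝓟 : ℤ → Submodule K P} (D : LeftConnection 𝕏 𝓟) : Prop :=
  ∀ (n : ℕ) (e : Fin n → ℤ) (ξ : Fin n → L), Homog ℒ e ξ → ∀ p : P, D.curvature e ξ p = 0

/-- A right `(A, L)`-connection in `Q`; `delta n ξ q` is `Δ(ξ_1, …, ξ_n | q)`. The field `linear` is
graded `A`-multilinearity with respect to the `A`-module structure `(a, Y) ↦ (-1)^{aY} Y ∘ a`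
on derivations `Y` of `Q`. -/
structure RightConnection (𝕏 : LRInfinity 𝒜 ℒ) {Q : Type*} [AddCommGroup Q] [Module K Q]
    [Module A Q] (𝒬 : ℤ → Submodule K Q) where
  delta : ∀ n : ℕ, MultilinearMap K (fun _ : Fin n => L) (Module.End K Q)
  degree : ∀ (n : ℕ) (e : Fin n → ℤ) (ξ : Fin n → L), Homog ℒ e ξ → ∀ (s : ℤ) (q : Q), q ∈ 𝒬 s →
    delta n ξ q ∈ 𝒬 (1 + ∑ i, e i + s)
  symm : ∀ n, GradedSymm ℒ (delta n)
  linear : ∀ (n : ℕ) (r : ℤ) (a : A), a ∈ 𝒜 r → ∀ (e : Fin n → ℤ) (ξ : Fin n → L), Homog ℒ e ξ →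
    ∀ (i : Fin n) (q : Q), delta n (Function.update ξ i (a • ξ i)) q =
      (r * (1 + ∑ j ∈ Finset.Iio i, e j)).negOnePow •
        (r * (1 + ∑ j, e j)).negOnePow • delta n ξ (a • q)
  leibniz : ∀ (n : ℕ) (e : Fin n → ℤ) (ξ : Fin n → L), Homog ℒ e ξ → ∀ (r : ℤ) (a : A), a ∈ 𝒜 r →
    ∀ q : Q, delta n ξ (a • q) =
      ((1 + ∑ i, e i) * r).negOnePow • a • delta n ξ q - 𝕏.σ n ξ a • q

/-- The curvature `J(Δ)(ξ_1, …, ξ_n | q)` on homogeneous `ξ_i` of degrees `e i`. -/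
def RightConnection.curvature {𝕏 : LRInfinity 𝒜 ℒ} {Q : Type*} [AddCommGroup Q] [Module K Q]
    [Module A Q] {𝒬 : ℤ → Submodule K Q} (D : RightConnection 𝕏 𝒬) {n : ℕ} (e : Fin n → ℤ)
    (ξ : Fin n → L) (q : Q) : Q :=
  (∑ I : Finset (Fin n), koszulSign I e •
      D.delta (Iᶜ.card + 1) (Fin.cons (𝕏.X I.card (pick ξ I)) (pick ξ Iᶜ)) q)
    - ∑ I : Finset (Fin n), (∑ i ∈ I, e i).negOnePow • koszulSign I e •
      D.delta I.card (pick ξ I) (D.delta Iᶜ.card (pick ξ Iᶜ) q)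

/-- The curvature vanishes identically. -/
def RightConnection.Flat {𝕏 : LRInfinity 𝒜 ℒ} {Q : Type*} [AddCommGroup Q] [Module K Q]
    [Module A Q] {𝒬 : ℤ → Submodule K Q} (D : RightConnection 𝕏 𝒬) : Prop :=
  ∀ (n : ℕ) (e : Fin n → ℤ) (ξ : Fin n → L), Homog ℒ e ξ → ∀ q : Q, D.curvature e ξ q = 0

end LieRinehart

/-! ### The `P_∞[1]` algebra structure on `S_A^• L` -/

section Extension

variable {K : Type*} [Field K]
  {A : Type*} [Ring A] [Algebra K A] {𝒜 : ℤ → Submodule K A}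
  {L : Type*} [AddCommGroup L] [Module K L] [Module A L] {ℒ : ℤ → Submodule K L}

/-- `lam` is the extension of the structure multiderivation of `(A, L)` to a degree `1`
multiderivation of the algebra `S_A^• L`: on generators it is given by the brackets and anchors, and it
vanishes when two arguments are from `A`. -/
structure IsMultiderivationExtension (𝕏 : LRInfinity 𝒜 ℒ)
    (lam : ∀ k : ℕ, MultilinearMap K (fun _ : Fin k => SymAlg 𝒜 ℒ) (SymAlg 𝒜 ℒ)) : Prop where
  zero : lam 0 = 0
  degree : ∀ k, HasDegree (SymAlg.grade 𝒜 ℒ) (SymAlg.grade 𝒜 ℒ) 1 (lam k)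
  symm : ∀ k, GradedSymm (SymAlg.grade 𝒜 ℒ) (lam k)
  leibniz : ∀ (n : ℕ) (e : Fin n → ℤ) (u : Fin n → SymAlg 𝒜 ℒ), Homog (SymAlg.grade 𝒜 ℒ) e u →
    ∀ (r : ℤ) (x : SymAlg 𝒜 ℒ), x ∈ SymAlg.grade 𝒜 ℒ r → ∀ y : SymAlg 𝒜 ℒ,
      lam (n + 1) (Fin.snoc (α := fun _ => SymAlg 𝒜 ℒ) u (x * y)) =
        ((1 + ∑ i, e i) * r).negOnePow •
            (x * lam (n + 1) (Fin.snoc (α := fun _ => SymAlg 𝒜 ℒ) u y))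
          + lam (n + 1) (Fin.snoc (α := fun _ => SymAlg 𝒜 ℒ) u x) * y
  bracket : ∀ (k : ℕ) (ξ : Fin k → L),
    lam k (fun i => SymAlg.ιL 𝒜 ℒ (ξ i)) = SymAlg.ιL 𝒜 ℒ (𝕏.X k ξ)
  anchor : ∀ (n : ℕ) (ξ : Fin n → L) (a : A),
    lam (n + 1) (Fin.snoc (α := fun _ => SymAlg 𝒜 ℒ) (fun i => SymAlg.ιL 𝒜 ℒ (ξ i))
      (SymAlg.ιA 𝒜 ℒ a)) = SymAlg.ιA 𝒜 ℒ (𝕏.σ n ξ a)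
  vanish : ∀ (n : ℕ) (u : Fin n → SymAlg 𝒜 ℒ) (a b : A),
    lam (n + 2) (Fin.snoc (α := fun _ => SymAlg 𝒜 ℒ)
      (Fin.snoc (α := fun _ => SymAlg 𝒜 ℒ) u (SymAlg.ιA 𝒜 ℒ a)) (SymAlg.ιA 𝒜 ℒ b)) = 0

end Extension

/-! ### Right calculus: `S_A^• L ⊗_A Q` -/

section Tensor

variable {K : Type*} [Field K]
  {A : Type*} [Ring A] [Algebra K A] (𝒜 : ℤ → Submodule K A) [GradedAlgebra 𝒜]
  {L : Type*} [AddCommGroup L] [Module K L] [Module A L] [IsScalarTower K A L]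
  (ℒ : ℤ → Submodule K L) [DirectSum.Decomposition ℒ] [SetLike.GradedSMul 𝒜 ℒ]
  {Q : Type*} [AddCommGroup Q] [Module K Q] [Module A Q] [IsScalarTower K A Q]
  (𝒬 : ℤ → Submodule K Q) [DirectSum.Decomposition 𝒬] [SetLike.GradedSMul 𝒜 𝒬]

/-- The relations `u a ⊗ q = u ⊗ a q` that cut `S_A^• L ⊗_A Q` out of `S_A^• L ⊗_K Q`. -/
def balanced (Q : Type*) [AddCommGroup Q] [Module K Q] [Module A Q] :
    Submodule (SymAlg 𝒜 ℒ) (SymAlg 𝒜 ℒ ⊗[K] Q) :=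
  Submodule.span (SymAlg 𝒜 ℒ)
    {x | ∃ (u : SymAlg 𝒜 ℒ) (a : A) (q : Q), x = (u * SymAlg.ιA 𝒜 ℒ a) ⊗ₜ[K] q - u ⊗ₜ[K] (a • q)}

/-- `S_A^• L ⊗_A Q`, as a left `S_A^• L`-module. -/
def SymTensor (Q : Type*) [AddCommGroup Q] [Module K Q] [Module A Q] : Type _ :=
  (SymAlg 𝒜 ℒ ⊗[K] Q) ⧸ balanced 𝒜 ℒ Q

namespace SymTensor

instance : AddCommGroup (SymTensor 𝒜 ℒ Q) :=
  inferInstanceAs (AddCommGroup ((SymAlg 𝒜 ℒ ⊗[K] Q) ⧸ balanced 𝒜 ℒ Q))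
instance : Module (SymAlg 𝒜 ℒ) (SymTensor 𝒜 ℒ Q) :=
  inferInstanceAs (Module (SymAlg 𝒜 ℒ) ((SymAlg 𝒜 ℒ ⊗[K] Q) ⧸ balanced 𝒜 ℒ Q))
instance : Module K (SymTensor 𝒜 ℒ Q) :=
  inferInstanceAs (Module K ((SymAlg 𝒜 ℒ ⊗[K] Q) ⧸ balanced 𝒜 ℒ Q))
instance : IsScalarTower K (SymAlg 𝒜 ℒ) (SymTensor 𝒜 ℒ Q) :=
  inferInstanceAs (IsScalarTower K (SymAlg 𝒜 ℒ) ((SymAlg 𝒜 ℒ ⊗[K] Q) ⧸ balanced 𝒜 ℒ Q))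

/-- The quotient map. -/
def mkQ : SymAlg 𝒜 ℒ ⊗[K] Q →ₗ[SymAlg 𝒜 ℒ] SymTensor 𝒜 ℒ Q := (balanced 𝒜 ℒ Q).mkQ

/-- The element `u ⊗ q`. -/
def tmul (u : SymAlg 𝒜 ℒ) (q : Q) : SymTensor 𝒜 ℒ Q := mkQ 𝒜 ℒ (u ⊗ₜ[K] q)

/-- The grading of `S_A^• L ⊗_A Q` by the total degree. -/
def grade (d : ℤ) : Submodule K (SymTensor 𝒜 ℒ Q) :=
  Submodule.span K {x | ∃ (i j : ℤ) (u : SymAlg 𝒜 ℒ) (q : Q), u ∈ SymAlg.grade 𝒜 ℒ i ∧ q ∈ 𝒬 j ∧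
    i + j = d ∧ x = tmul 𝒜 ℒ u q}

variable {𝒜 ℒ 𝒬}

theorem tmul_mem {i j : ℤ} {u : SymAlg 𝒜 ℒ} {q : Q} (hu : u ∈ SymAlg.grade 𝒜 ℒ i) (hq : q ∈ 𝒬 j) :
    tmul 𝒜 ℒ u q ∈ grade 𝒜 ℒ 𝒬 (i + j) :=
  Submodule.subset_span ⟨i, j, u, q, hu, hq, rfl, rfl⟩

theorem tmul_add_left (u v : SymAlg 𝒜 ℒ) (q : Q) :
    tmul 𝒜 ℒ (u + v) q = tmul 𝒜 ℒ u q + tmul 𝒜 ℒ v q := by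
  simp only [tmul, TensorProduct.add_tmul, map_add]

theorem tmul_add_right (u : SymAlg 𝒜 ℒ) (p q : Q) :
    tmul 𝒜 ℒ u (p + q) = tmul 𝒜 ℒ u p + tmul 𝒜 ℒ u q := by
  simp only [tmul, TensorProduct.tmul_add, map_add]

theorem tmul_smul_left (c : K) (u : SymAlg 𝒜 ℒ) (q : Q) :
    tmul 𝒜 ℒ (c • u) q = c • tmul 𝒜 ℒ u q := rfl

theorem tmul_smul_right (c : K) (u : SymAlg 𝒜 ℒ) (q : Q) :
    tmul 𝒜 ℒ u (c • q) = c • tmul 𝒜 ℒ u q := by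
  rw [← tmul_smul_left, tmul, tmul, TensorProduct.smul_tmul]

theorem tmul_balanced (u : SymAlg 𝒜 ℒ) (a : A) (q : Q) :
    tmul 𝒜 ℒ (u * SymAlg.ιA 𝒜 ℒ a) q = tmul 𝒜 ℒ u (a • q) :=
  (Submodule.Quotient.eq _).2 (Submodule.subset_span ⟨u, a, q, rfl⟩)

/-- `u ⊗ q` in its graded component. -/
def homTmul (i j : ℤ) : SymAlg.grade 𝒜 ℒ i →ₗ[K] 𝒬 j →ₗ[K] ⨁ d, grade 𝒜 ℒ 𝒬 d :=
  LinearMap.mk₂ K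
    (fun u q => DirectSum.lof K ℤ (fun d => grade 𝒜 ℒ 𝒬 d) (i + j)
      ⟨tmul 𝒜 ℒ (u : SymAlg 𝒜 ℒ) (q : Q), tmul_mem u.2 q.2⟩)
    (fun u v q => by
      rw [← map_add]; exact congrArg _ (Subtype.ext (tmul_add_left _ _ _)))
    (fun c u q => by
      rw [← map_smul]; exact congrArg _ (Subtype.ext (tmul_smul_left _ _ _)))
    (fun u p q => by
      rw [← map_add]; exact congrArg _ (Subtype.ext (tmul_add_right _ _ _)))
    (fun c u q => by
      rw [← map_smul]; exact congrArg _ (Subtype.ext (tmul_smul_right _ _ _)))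

/-- `u ⊗ q` split into its graded components. -/
def splitTmul : SymAlg 𝒜 ℒ →ₗ[K] Q →ₗ[K] ⨁ d, grade 𝒜 ℒ 𝒬 d :=
  (DirectSum.toModule K ℤ _ (fun i => LinearMap.flip (DirectSum.toModule K ℤ _
    (fun j => (homTmul (𝒬 := 𝒬) i j).flip)))).compl₁₂
    (DirectSum.decomposeLinearEquiv (SymAlg.grade 𝒜 ℒ)).toLinearMap
    (DirectSum.decomposeLinearEquiv 𝒬).toLinearMap

theorem splitTmul_apply {i j : ℤ} {u : SymAlg 𝒜 ℒ} {q : Q} (hu : u ∈ SymAlg.grade 𝒜 ℒ i)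
    (hq : q ∈ 𝒬 j) : splitTmul (𝒬 := 𝒬) u q =
      DirectSum.lof K ℤ (fun d => grade 𝒜 ℒ 𝒬 d) (i + j) ⟨_, tmul_mem hu hq⟩ := by
  simp only [splitTmul, LinearMap.compl₁₂_apply, LinearEquiv.coe_coe,
    DirectSum.decomposeLinearEquiv_apply, DirectSum.decompose_of_mem _ hu,
    DirectSum.decompose_of_mem _ hq, ← DirectSum.lof_eq_of K, DirectSum.toModule_lof,
    LinearMap.flip_apply]
  rfl

theorem lof_eq {i j : ℤ} (h : i = j) {x y : SymTensor 𝒜 ℒ Q} (hx : x ∈ grade 𝒜 ℒ 𝒬 i)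
    (hy : y ∈ grade 𝒜 ℒ 𝒬 j) (hxy : x = y) :
    DirectSum.lof K ℤ (fun d => grade 𝒜 ℒ 𝒬 d) i ⟨x, hx⟩ =
      DirectSum.lof K ℤ (fun d => grade 𝒜 ℒ 𝒬 d) j ⟨y, hy⟩ := by
  subst h; subst hxy; rfl

theorem splitTmul_balanced (u : SymAlg 𝒜 ℒ) (a : A) (q : Q) :
    splitTmul (𝒬 := 𝒬) (u * SymAlg.ιA 𝒜 ℒ a) q = splitTmul (𝒬 := 𝒬) u (a • q) := by
  induction u using DirectSum.Decomposition.inductionOn (SymAlg.grade 𝒜 ℒ) with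
  | zero => simp
  | add u v h1 h2 => rw [add_mul, map_add, map_add, LinearMap.add_apply, LinearMap.add_apply, h1, h2]
  | homogeneous u =>
    induction a using DirectSum.Decomposition.inductionOn 𝒜 with
    | zero => simp
    | add a b h1 h2 => rw [map_add, mul_add, map_add, LinearMap.add_apply, add_smul, map_add, h1, h2]
    | homogeneous a =>
      induction q using DirectSum.Decomposition.inductionOn 𝒬 with
      | zero => simp
      | add p q h1 h2 => rw [map_add, smul_add, map_add, h1, h2]
      | homogeneous q =>
        rw [splitTmul_apply (SetLike.GradedMul.mul_mem u.2 (SymAlg.ιA_mem a.2)) q.2,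
          splitTmul_apply u.2 (SetLike.GradedSMul.smul_mem a.2 q.2)]
        exact lof_eq (add_assoc _ _ _) _ _ (tmul_balanced _ _ _)

theorem balanced_le : (balanced 𝒜 ℒ Q).restrictScalars K ≤
    LinearMap.ker (TensorProduct.lift (splitTmul (𝒜 := 𝒜) (ℒ := ℒ) (𝒬 := 𝒬))) := by
  intro x hx
  rw [Submodule.restrictScalars_mem] at hx
  rw [LinearMap.mem_ker]
  suffices h : ∀ s : SymAlg 𝒜 ℒ, TensorProduct.lift (splitTmul (𝒬 := 𝒬)) (s • x) = 0 by
    simpa using h 1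
  induction hx using Submodule.span_induction with
  | zero => simp
  | add x y _ _ h1 h2 => intro s; rw [smul_add, map_add, h1, h2, add_zero]
  | smul c x _ h => intro s; rw [smul_smul]; exact h _
  | mem x hx =>
    obtain ⟨u, a, q, rfl⟩ := hx
    intro s
    rw [smul_sub, TensorProduct.smul_tmul', TensorProduct.smul_tmul', map_sub,
      TensorProduct.lift.tmul, TensorProduct.lift.tmul, smul_eq_mul, smul_eq_mul, ← mul_assoc,
      splitTmul_balanced, sub_self]

def split : SymTensor 𝒜 ℒ Q →ₗ[K] ⨁ d, grade 𝒜 ℒ 𝒬 d where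
  toFun := Quotient.lift (s := (balanced 𝒜 ℒ Q).quotientRel)
    (fun x => TensorProduct.lift (splitTmul (𝒜 := 𝒜) (ℒ := ℒ) (𝒬 := 𝒬)) x)
    (fun x y h => by
      have h1 : x - y ∈ balanced 𝒜 ℒ Q := (Submodule.quotientRel_def _).1 h
      have h2 := balanced_le (𝒬 := 𝒬) h1
      rw [LinearMap.mem_ker, map_sub] at h2
      exact sub_eq_zero.1 h2)
  map_add' := by
    rintro ⟨x⟩ ⟨y⟩
    exact map_add (TensorProduct.lift (splitTmul (𝒜 := 𝒜) (ℒ := ℒ) (𝒬 := 𝒬))) x y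
  map_smul' := by
    rintro c ⟨x⟩
    exact map_smul (TensorProduct.lift (splitTmul (𝒜 := 𝒜) (ℒ := ℒ) (𝒬 := 𝒬))) c x

theorem split_tmul (u : SymAlg 𝒜 ℒ) (q : Q) :
    split (𝒬 := 𝒬) (tmul 𝒜 ℒ u q) = splitTmul (𝒬 := 𝒬) u q := rfl

theorem tmul_induction {p : SymTensor 𝒜 ℒ Q → Prop} (h0 : p 0)
    (hadd : ∀ x y, p x → p y → p (x + y))
    (h : ∀ (u : SymAlg 𝒜 ℒ) (q : Q), p (tmul 𝒜 ℒ u q)) (x : SymTensor 𝒜 ℒ Q) : p x := by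
  obtain ⟨x, rfl⟩ := Submodule.Quotient.mk_surjective _ x
  induction x with
  | zero => exact h0
  | tmul u q => exact h u q
  | add x y hx hy => exact hadd _ _ hx hy

instance : DirectSum.Decomposition (grade 𝒜 ℒ 𝒬) :=
  DirectSum.Decomposition.ofLinearMap (grade 𝒜 ℒ 𝒬) (split (𝒬 := 𝒬))
    (by
      refine LinearMap.ext fun x => ?_
      rw [LinearMap.comp_apply, LinearMap.id_apply]
      induction x using tmul_induction with
      | h0 => simp
      | hadd x y hx hy => rw [map_add, map_add, hx, hy]
      | h u q =>
        rw [split_tmul]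
        induction u using DirectSum.Decomposition.inductionOn (SymAlg.grade 𝒜 ℒ) with
        | zero => rw [map_zero, LinearMap.zero_apply, map_zero]; simp [tmul]
        | add u v h1 h2 =>
          rw [map_add, LinearMap.add_apply, map_add, h1, h2, tmul_add_left]
        | homogeneous u =>
          induction q using DirectSum.Decomposition.inductionOn 𝒬 with
          | zero => rw [map_zero, map_zero]; simp [tmul]
          | add p q h1 h2 => rw [map_add, map_add, h1, h2, tmul_add_right]
          | homogeneous q => rw [splitTmul_apply u.2 q.2, DirectSum.coeLinearMap_lof])
    (by
      refine DirectSum.linearMap_ext _ fun d => LinearMap.ext ?_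
      rintro ⟨x, hx⟩
      rw [LinearMap.comp_apply, LinearMap.comp_apply, DirectSum.coeLinearMap_lof,
        LinearMap.comp_apply, LinearMap.id_apply]
      induction hx using Submodule.span_induction with
      | mem x hx =>
        obtain ⟨i, j, u, q, hu, hq, rfl, rfl⟩ := hx
        exact (split_tmul u q).trans (splitTmul_apply hu hq)
      | zero => exact (map_zero _).trans (map_zero (DirectSum.lof K ℤ _ d)).symm
      | add x y hx hy h1 h2 =>
        simp only at h1 h2 ⊢
        rw [map_add, h1, h2, ← map_add]
        rfl
      | smul c x hx h =>
        simp only at h ⊢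
        rw [map_smul, h, ← map_smul]
        rfl)

end SymTensor

/-- Multiplication of `S_A^• L ⊗_A Q` by `u ∈ S_A^• L`. -/
def mulOp (𝒜 : ℤ → Submodule K A) (ℒ : ℤ → Submodule K L) (Q : Type*) [AddCommGroup Q] [Module K Q]
    [Module A Q] : SymAlg 𝒜 ℒ →ₗ[K] Module.End K (SymTensor 𝒜 ℒ Q) :=
  (Algebra.lsmul K K (SymTensor 𝒜 ℒ Q)).toLinearMap

variable {𝒜 ℒ 𝒬}

/-- `D n` (`n ≥ 0`) is the component `D_{n+1}^Δ` of the derivation of `S_A^• L ⊗_A Q` associated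
with the right connection `Δ`. -/
def IsRinehart {𝕏 : LRInfinity 𝒜 ℒ} (Δ : RightConnection 𝕏 𝒬)
    (D : ℕ → Module.End K (SymTensor 𝒜 ℒ Q)) : Prop :=
  ∀ (n m : ℕ) (e : Fin m → ℤ) (ξ : Fin m → L), Homog ℒ e ξ → ∀ q : Q,
    D n (SymTensor.tmul 𝒜 ℒ (SymAlg.prodL 𝒜 ℒ ξ) q) =
      (∑ I : Finset (Fin m) with I.card = n + 1, koszulSign I e • SymTensor.tmul 𝒜 ℒ
          (SymAlg.ιL 𝒜 ℒ (𝕏.X I.card (pick ξ I)) * SymAlg.prodL 𝒜 ℒ (pick ξ Iᶜ)) q)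
        - ∑ J : Finset (Fin m) with Jᶜ.card = n, (∑ j ∈ J, e j).negOnePow • koszulSign J e •
          SymTensor.tmul 𝒜 ℒ (SymAlg.prodL 𝒜 ℒ (pick ξ J)) (Δ.delta Jᶜ.card (pick ξ Jᶜ) q)

/-- The operations `R^Δ(u_1, …, u_n | U) = -[⋯[[D_{n+1}^Δ, μ_{u_1}], μ_{u_2}]⋯, μ_{u_n}] U`. -/
def rightLie (𝒬 : ℤ → Submodule K Q) [DirectSum.Decomposition 𝒬] [SetLike.GradedSMul 𝒜 𝒬]
    (D : ℕ → Module.End K (SymTensor 𝒜 ℒ Q)) (n : ℕ) :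
    MultilinearMap K (fun _ : Fin n => SymAlg 𝒜 ℒ) (Module.End K (SymTensor 𝒜 ℒ Q)) :=
  -iteratedCommutator (SymTensor.grade 𝒜 ℒ 𝒬) (mulOp 𝒜 ℒ Q) n (D n)

end Tensor

/-! ### Left calculus: `Sym_A(L, P)` -/

section Forms

variable {K : Type*} [Field K]
  {A : Type*} [Ring A] [Algebra K A] (𝒜 : ℤ → Submodule K A) [GradedAlgebra 𝒜]
  {L : Type*} [AddCommGroup L] [Module K L] [Module A L] [IsScalarTower K A L]
  (ℒ : ℤ → Submodule K L) [DirectSum.Decomposition ℒ] [SetLike.GradedSMul 𝒜 ℒ]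
  {P : Type*} [AddCommGroup P] [Module K P] [Module A P] [IsScalarTower K A P]
  (𝓟 : ℤ → Submodule K P) [DirectSum.Decomposition 𝓟] [SetLike.GradedSMul 𝒜 𝓟]

/-- `P`-valued symmetric `m`-forms of degree `d` on `L`: graded symmetric, graded `A`-multilinear maps
`L × ⋯ × L → P` of degree `d`. -/
def symForm (m : ℕ) (d : ℤ) : Submodule K (MultilinearMap K (fun _ : Fin m => L) P) where
  carrier := {Ω | HasDegree ℒ 𝓟 d Ω ∧ GradedSymm ℒ Ω ∧ GradedMultilin 𝒜 ℒ d Ω}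
  zero_mem' := ⟨fun e v h => Submodule.zero_mem _, fun e v h i j hij => by simp,
    fun r a ha e v h i => by simp⟩
  add_mem' := by
    rintro Ω Θ ⟨h1, h2, h3⟩ ⟨g1, g2, g3⟩
    refine ⟨fun e v h => Submodule.add_mem _ (h1 e v h) (g1 e v h), fun e v h i j hij => ?_,
      fun r a ha e v h i => ?_⟩
    · simp only [add_apply, h2 e v h i j hij, g2 e v h i j hij, smul_add]
    · simp only [add_apply, h3 r a ha e v h i, g3 r a ha e v h i, smul_add]
  smul_mem' := by
    rintro c Ω ⟨h1, h2, h3⟩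
    refine ⟨fun e v h => Submodule.smul_mem _ _ (h1 e v h), fun e v h i j hij => ?_,
      fun r a ha e v h i => ?_⟩
    · simp only [smul_apply, h2 e v h i j hij, Units.smul_def]
      rw [smul_comm]
    · simp only [smul_apply, h3 r a ha e v h i, Units.smul_def]
      rw [smul_comm c, smul_comm c]

/-- The forms of degree `d`, with any number `m` of entries. -/
def FormsDeg (d : ℤ) : Type _ := ⨁ m : ℕ, symForm 𝒜 ℒ 𝓟 m d

instance (d : ℤ) : AddCommGroup (FormsDeg 𝒜 ℒ 𝓟 d) :=
  inferInstanceAs (AddCommGroup (⨁ m : ℕ, symForm 𝒜 ℒ 𝓟 m d))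
instance (d : ℤ) : Module K (FormsDeg 𝒜 ℒ 𝓟 d) :=
  inferInstanceAs (Module K (⨁ m : ℕ, symForm 𝒜 ℒ 𝓟 m d))

/-- `Sym_A(L, P)`, the direct sum over the degree `d` and the number `m` of entries. -/
def SymForms : Type _ := ⨁ d : ℤ, FormsDeg 𝒜 ℒ 𝓟 d

instance : AddCommGroup (SymForms 𝒜 ℒ 𝓟) :=
  inferInstanceAs (AddCommGroup (⨁ d : ℤ, FormsDeg 𝒜 ℒ 𝓟 d))
instance : Module K (SymForms 𝒜 ℒ 𝓟) :=
  inferInstanceAs (Module K (⨁ d : ℤ, FormsDeg 𝒜 ℒ 𝓟 d))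

namespace SymForms

/-- Inclusion of the forms of degree `d`. -/
def inclDeg (d : ℤ) : FormsDeg 𝒜 ℒ 𝓟 d →ₗ[K] SymForms 𝒜 ℒ 𝓟 :=
  DirectSum.lof K ℤ (fun d => FormsDeg 𝒜 ℒ 𝓟 d) d

/-- Inclusion of the `m`-forms of degree `d`. -/
def inclNum (m : ℕ) (d : ℤ) : symForm 𝒜 ℒ 𝓟 m d →ₗ[K] FormsDeg 𝒜 ℒ 𝓟 d :=
  DirectSum.lof K ℕ (fun m => symForm 𝒜 ℒ 𝓟 m d) m

/-- Inclusion of the `m`-forms of degree `d`. -/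
def incl (m : ℕ) (d : ℤ) : symForm 𝒜 ℒ 𝓟 m d →ₗ[K] SymForms 𝒜 ℒ 𝓟 :=
  inclDeg 𝒜 ℒ 𝓟 d ∘ₗ inclNum 𝒜 ℒ 𝓟 m d

/-- Linear maps out of `Sym_A(L, P)`. -/
def lift {M : Type*} [AddCommGroup M] [Module K M]
    (g : ∀ (m : ℕ) (d : ℤ), symForm 𝒜 ℒ 𝓟 m d →ₗ[K] M) : SymForms 𝒜 ℒ 𝓟 →ₗ[K] M :=
  DirectSum.toModule K ℤ M (fun d => DirectSum.toModule K ℕ M (fun m => g m d))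

/-- The grading of `Sym_A(L, P)` by the degree `d`. -/
def grade (d : ℤ) : Submodule K (SymForms 𝒜 ℒ 𝓟) := LinearMap.range (inclDeg 𝒜 ℒ 𝓟 d)

variable {𝒜 ℒ 𝓟}

theorem lift_incl {M : Type*} [AddCommGroup M] [Module K M]
    (g : ∀ (m : ℕ) (d : ℤ), symForm 𝒜 ℒ 𝓟 m d →ₗ[K] M) (m : ℕ) (d : ℤ) (Ω : symForm 𝒜 ℒ 𝓟 m d) :
    lift 𝒜 ℒ 𝓟 g (incl 𝒜 ℒ 𝓟 m d Ω) = g m d Ω := by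
  refine (DirectSum.toModule_lof K d _).trans ?_
  exact DirectSum.toModule_lof K m _

theorem hom_ext {M : Type*} [AddCommGroup M] [Module K M] {f g : SymForms 𝒜 ℒ 𝓟 →ₗ[K] M}
    (h : ∀ (m : ℕ) (d : ℤ) (Ω : symForm 𝒜 ℒ 𝓟 m d),
      f (incl 𝒜 ℒ 𝓟 m d Ω) = g (incl 𝒜 ℒ 𝓟 m d Ω)) : f = g :=
  DirectSum.linearMap_ext _ fun d => DirectSum.linearMap_ext _ fun m => LinearMap.ext fun Ω => h m d Ω

theorem incl_eq {m : ℕ} {d d' : ℤ} (hd : d = d') {Ω : symForm 𝒜 ℒ 𝓟 m d}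
    {Ω' : symForm 𝒜 ℒ 𝓟 m d'} (h : Ω.1 = Ω'.1) : incl 𝒜 ℒ 𝓟 m d Ω = incl 𝒜 ℒ 𝓟 m d' Ω' := by
  subst hd
  exact congrArg _ (Subtype.ext h)

theorem incl_eq_smul {m : ℕ} {d d' : ℤ} (hd : d = d') (c : ℤˣ) {Ω : symForm 𝒜 ℒ 𝓟 m d}
    {Ω' : symForm 𝒜 ℒ 𝓟 m d'} (h : Ω.1 = c • Ω'.1) :
    incl 𝒜 ℒ 𝓟 m d Ω = c • incl 𝒜 ℒ 𝓟 m d' Ω' := by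
  subst hd
  have h1 : Ω = (c : ℤ) • Ω' := Subtype.ext h
  rw [h1, map_zsmul, Units.smul_def]

def split : SymForms 𝒜 ℒ 𝓟 →ₗ[K] ⨁ d, grade 𝒜 ℒ 𝓟 d :=
  DirectSum.lmap (fun d => (inclDeg 𝒜 ℒ 𝓟 d).rangeRestrict)

theorem split_inclDeg (d : ℤ) (x : FormsDeg 𝒜 ℒ 𝓟 d) :
    split (inclDeg 𝒜 ℒ 𝓟 d x) =
      DirectSum.lof K ℤ (fun d => grade 𝒜 ℒ 𝓟 d) d ⟨_, LinearMap.mem_range_self _ x⟩ :=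
  DirectSum.lmap_lof _ d x

instance : DirectSum.Decomposition (grade 𝒜 ℒ 𝓟) :=
  DirectSum.Decomposition.ofLinearMap (grade 𝒜 ℒ 𝓟) split
    (by
      refine DirectSum.linearMap_ext _ fun d => LinearMap.ext fun x => ?_
      exact (congrArg (DirectSum.coeLinearMap (grade 𝒜 ℒ 𝓟)) (split_inclDeg d x)).trans
        (DirectSum.coeLinearMap_lof _ _ _))
    (by
      refine DirectSum.linearMap_ext _ fun d => LinearMap.ext ?_
      rintro ⟨_, x, rfl⟩
      rw [LinearMap.comp_apply, LinearMap.comp_apply, DirectSum.coeLinearMap_lof]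
      exact split_inclDeg d x)

/-- A bilinear operation `M × Sym_A(L, P) → Sym_A(L, P)` from its values on homogeneous arguments. -/
def assemble {M : Type*} [AddCommGroup M] [Module K M] (ℳ : ℤ → Submodule K M)
    [DirectSum.Decomposition ℳ]
    (g : ∀ (r : ℤ) (m : ℕ) (d : ℤ), symForm 𝒜 ℒ 𝓟 m d →ₗ[K] ℳ r →ₗ[K] SymForms 𝒜 ℒ 𝓟) :
    M →ₗ[K] Module.End K (SymForms 𝒜 ℒ 𝓟) :=
  DirectSum.toModule K ℤ (Module.End K (SymForms 𝒜 ℒ 𝓟)) (fun r => (lift 𝒜 ℒ 𝓟 (g r)).flip) ∘ₗ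
    (DirectSum.decomposeLinearEquiv ℳ).toLinearMap

theorem assemble_apply {M : Type*} [AddCommGroup M] [Module K M] (ℳ : ℤ → Submodule K M)
    [DirectSum.Decomposition ℳ]
    (g : ∀ (r : ℤ) (m : ℕ) (d : ℤ), symForm 𝒜 ℒ 𝓟 m d →ₗ[K] ℳ r →ₗ[K] SymForms 𝒜 ℒ 𝓟)
    {r : ℤ} {x : M} (hx : x ∈ ℳ r) (m : ℕ) (d : ℤ) (Ω : symForm 𝒜 ℒ 𝓟 m d) :
    assemble ℳ g x (incl 𝒜 ℒ 𝓟 m d Ω) = g r m d Ω ⟨x, hx⟩ := by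
  rw [assemble, LinearMap.comp_apply, LinearEquiv.coe_coe, DirectSum.decomposeLinearEquiv_apply,
    DirectSum.decompose_of_mem ℳ hx, ← DirectSum.lof_eq_of K, DirectSum.toModule_lof,
    LinearMap.flip_apply, lift_incl]

theorem homog_cons {n : ℕ} {e : Fin n → ℤ} {v : Fin n → L} {i : ℤ} {ξ : L} (hξ : ξ ∈ ℒ i)
    (h : Homog ℒ e v) :
    Homog ℒ (Fin.cons i e : Fin (n + 1) → ℤ) (Fin.cons ξ v : Fin (n + 1) → L) := by
  intro k
  induction k using Fin.cases with
  | zero => exact hξ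
  | succ k => exact h k

theorem cons_swap {n : ℕ} (ξ : L) (v : Fin n → L) (i j : Fin n) :
    (Fin.cons ξ (v ∘ Equiv.swap i j) : Fin (n + 1) → L) =
      (Fin.cons ξ v : Fin (n + 1) → L) ∘ Equiv.swap i.succ j.succ := by
  funext k
  induction k using Fin.cases with
  | zero =>
    rw [Function.comp_apply, Equiv.swap_apply_of_ne_of_ne (Fin.succ_ne_zero i).symm
      (Fin.succ_ne_zero j).symm]
    rfl
  | succ k =>
    rw [Function.comp_apply, Fin.cons_succ, Function.comp_apply, ← (Fin.succ_injective n).map_swap,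
      Fin.cons_succ]

theorem sum_Iio_succ {n : ℕ} (i : ℤ) (e : Fin n → ℤ) (k : Fin n) :
    ∑ j ∈ Finset.Iio k.succ, (Fin.cons i e : Fin (n + 1) → ℤ) j = i + ∑ j ∈ Finset.Iio k, e j := by
  rw [← Finset.filter_gt_eq_Iio, ← Finset.filter_gt_eq_Iio, Finset.sum_filter, Finset.sum_filter,
    Fin.sum_univ_succ]
  simp

/-- Insertion of `ξ` (of degree `i`) as the first argument of `Ω`, with the sign `(-1)^{ξΩ}`. -/
def insertForm {i d : ℤ} {m : ℕ} (Ω : symForm 𝒜 ℒ 𝓟 (m + 1) d) (ξ : ℒ i) :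
    symForm 𝒜 ℒ 𝓟 m (d + i) :=
  ⟨(i * d).negOnePow • Ω.1.curryLeft ξ, by
    obtain ⟨h1, h2, h3⟩ := Ω.2
    refine ⟨fun e v h => ?_, fun e v h j k hjk => ?_, fun r a ha e v h j => ?_⟩
    · have := h1 _ _ (homog_cons ξ.2 h)
      rw [Fin.sum_univ_succ] at this
      simp only [Fin.cons_zero, Fin.cons_succ, ← add_assoc] at this
      exact Submodule.smul_of_tower_mem _ ((i * d).negOnePow : ℤ) this
    · have := h2 _ _ (homog_cons ξ.2 h) j.succ k.succ (by simpa using hjk)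
      rw [← cons_swap] at this
      simp only [Fin.cons_succ] at this
      simp only [smul_apply, MultilinearMap.curryLeft_apply, this]
      rw [smul_comm]
    · have := h3 r a ha _ _ (homog_cons ξ.2 h) j.succ
      rw [sum_Iio_succ, Fin.cons_succ, ← Fin.cons_update] at this
      simp only [smul_apply, MultilinearMap.curryLeft_apply, this, add_assoc]
      rw [smul_comm, smul_comm a]⟩

/-- The product `a Ω`, for `a` of degree `i`. -/
def smulForm [IsGradedComm 𝒜] {i d : ℤ} {m : ℕ} (Ω : symForm 𝒜 ℒ 𝓟 m d) (a : 𝒜 i) :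
    symForm 𝒜 ℒ 𝓟 m (d + i) :=
  ⟨(a : A) • Ω.1, by
    obtain ⟨h1, h2, h3⟩ := Ω.2
    refine ⟨fun e v h => ?_, fun e v h j k hjk => ?_, fun r b hb e v h j => ?_⟩
    · have := SetLike.GradedSMul.smul_mem a.2 (h1 e v h)
      rw [vadd_eq_add, ← add_assoc, add_comm i d] at this
      exact this
    · simp only [smul_apply, h2 e v h j k hjk]
      rw [smul_comm]
    · simp only [smul_apply, h3 r b hb e v h j]
      rw [smul_comm (a : A), smul_smul (a : A), IsGradedComm.comm (𝒜 := 𝒜) i r a b a.2 hb,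
        Units.smul_def (i * r).negOnePow, smul_assoc, ← Units.smul_def, smul_smul, ← Int.negOnePow_add, mul_smul]
      congr 2
      ring⟩

/-- A multilinear map is determined by its values on homogeneous arguments. -/
theorem ext_homog {M N : Type*} [AddCommGroup M] [Module K M] [AddCommGroup N] [Module K N]
    (ℳ : ℤ → Submodule K M) [DirectSum.Decomposition ℳ] : ∀ {n : ℕ}
    {f g : MultilinearMap K (fun _ : Fin n => M) N}
    (_ : ∀ (e : Fin n → ℤ) (v : Fin n → M), Homog ℳ e v → f v = g v), f = g
  | 0, f, g, h => MultilinearMap.ext fun v => h (fun _ => 0) v (fun i => i.elim0)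
  | n + 1, f, g, h => by
    have key : f.curryLeft = g.curryLeft := by
      refine LinearMap.ext fun x => ?_
      induction x using DirectSum.Decomposition.inductionOn ℳ with
      | zero => rw [map_zero, map_zero]
      | add x y hx hy => rw [map_add, map_add, hx, hy]
      | @homogeneous i x =>
        refine ext_homog ℳ fun e v hv => h (Fin.cons i e) (Fin.cons (x : M) v) fun k => ?_
        induction k using Fin.cases with
        | zero => exact x.2
        | succ k => exact hv k
    rw [← MultilinearMap.uncurry_curryLeft f, key, MultilinearMap.uncurry_curryLeft]

/-- The operators `i_a`, `a ∈ A`: multiplication by `a`. -/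
def opA (𝒜 : ℤ → Submodule K A) [GradedAlgebra 𝒜] [IsGradedComm 𝒜] (ℒ : ℤ → Submodule K L)
    [DirectSum.Decomposition ℒ] [SetLike.GradedSMul 𝒜 ℒ] (𝓟 : ℤ → Submodule K P)
    [DirectSum.Decomposition 𝓟] [SetLike.GradedSMul 𝒜 𝓟] :
    A →ₗ[K] Module.End K (SymForms 𝒜 ℒ 𝓟) :=
  assemble 𝒜 (fun r m d => LinearMap.mk₂ K (fun Ω a => incl 𝒜 ℒ 𝓟 m (d + r) (smulForm Ω a))
    (fun Ω Θ a => by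
      rw [← map_add]; exact incl_eq rfl (smul_add (a : A) Ω.1 Θ.1))
    (fun c Ω a => by
      rw [← map_smul]; exact incl_eq rfl (MultilinearMap.ext fun v => smul_comm (a : A) c (Ω.1 v)))
    (fun Ω a b => by
      rw [← map_add]; exact incl_eq rfl (add_smul (a : A) (b : A) Ω.1))
    (fun c Ω a => by
      rw [← map_smul]; exact incl_eq rfl (MultilinearMap.ext fun v => smul_assoc c (a : A) (Ω.1 v))))

/-- The operators `i_ξ`, `ξ ∈ L`: insertion of `ξ`. -/
def opL (𝒜 : ℤ → Submodule K A) [GradedAlgebra 𝒜] (ℒ : ℤ → Submodule K L)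
    [DirectSum.Decomposition ℒ] [SetLike.GradedSMul 𝒜 ℒ] (𝓟 : ℤ → Submodule K P)
    [DirectSum.Decomposition 𝓟] [SetLike.GradedSMul 𝒜 𝓟] :
    L →ₗ[K] Module.End K (SymForms 𝒜 ℒ 𝓟) :=
  assemble ℒ (fun r m d => match m with
    | 0 => 0
    | m + 1 => LinearMap.mk₂ K (fun Ω ξ => incl 𝒜 ℒ 𝓟 m (d + r) (insertForm Ω ξ))
      (fun Ω Θ ξ => by
        rw [← map_add]
        exact incl_eq rfl (MultilinearMap.ext fun v => by
          simp [insertForm, smul_add]))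
      (fun c Ω ξ => by
        rw [← map_smul]
        exact incl_eq rfl (MultilinearMap.ext fun v => by
          simp [insertForm, smul_comm c]))
      (fun Ω ξ ζ => by
        rw [← map_add]
        exact incl_eq rfl (by simp [insertForm, smul_add]))
      (fun c Ω ξ => by
        rw [← map_smul]
        exact incl_eq rfl (by simp [insertForm, smul_comm c])))

theorem opA_incl [IsGradedComm 𝒜] {r : ℤ} {a : A} (ha : a ∈ 𝒜 r) (m : ℕ) (d : ℤ)
    (Ω : symForm 𝒜 ℒ 𝓟 m d) : opA 𝒜 ℒ 𝓟 a (incl 𝒜 ℒ 𝓟 m d Ω) =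
      incl 𝒜 ℒ 𝓟 m (d + r) (smulForm Ω ⟨a, ha⟩) :=
  assemble_apply 𝒜 _ ha m d Ω

theorem opL_incl_zero {r : ℤ} {ξ : L} (hξ : ξ ∈ ℒ r) (d : ℤ)
    (Ω : symForm 𝒜 ℒ 𝓟 0 d) : opL 𝒜 ℒ 𝓟 ξ (incl 𝒜 ℒ 𝓟 0 d Ω) = 0 :=
  assemble_apply ℒ _ hξ 0 d Ω

theorem opL_incl {r : ℤ} {ξ : L} (hξ : ξ ∈ ℒ r) (m : ℕ) (d : ℤ)
    (Ω : symForm 𝒜 ℒ 𝓟 (m + 1) d) : opL 𝒜 ℒ 𝓟 ξ (incl 𝒜 ℒ 𝓟 (m + 1) d Ω) =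
      incl 𝒜 ℒ 𝓟 m (d + r) (insertForm Ω ⟨ξ, hξ⟩) :=
  assemble_apply ℒ _ hξ (m + 1) d Ω

/-- The relations of `S_A^• L` hold for multiplications and insertions. -/
def insertData (𝒜 : ℤ → Submodule K A) [GradedAlgebra 𝒜] [IsGradedComm 𝒜] (ℒ : ℤ → Submodule K L)
    [DirectSum.Decomposition ℒ] [SetLike.GradedSMul 𝒜 ℒ] (𝓟 : ℤ → Submodule K P)
    [DirectSum.Decomposition 𝓟] [SetLike.GradedSMul 𝒜 𝓟] :
    SymAlg.LiftData (Module.End K (SymForms 𝒜 ℒ 𝓟)) 𝒜 ℒ where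
  f := opA 𝒜 ℒ 𝓟
  g := opL 𝒜 ℒ 𝓟
  one := by
    refine hom_ext fun m d Ω => ?_
    rw [opA_incl SetLike.GradedOne.one_mem]
    exact incl_eq (add_zero d) (one_smul A Ω.1)
  mul := fun {i j a b} ha hb => by
    refine hom_ext fun m d Ω => ?_
    rw [Module.End.mul_apply, opA_incl hb, opA_incl ha, opA_incl (SetLike.GradedMul.mul_mem ha hb)]
    exact incl_eq (by ring) (mul_smul a b Ω.1).symm
  smul := fun {i j a ξ} ha hξ => by
    refine hom_ext fun m d Ω => ?_
    rw [Module.End.mul_apply]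
    cases m with
    | zero =>
      rw [opL_incl_zero hξ, map_zero, opL_incl_zero (SetLike.GradedSMul.smul_mem ha hξ)]
    | succ m =>
      rw [opL_incl hξ, opA_incl ha, opL_incl (SetLike.GradedSMul.smul_mem ha hξ)]
      refine incl_eq (by rw [vadd_eq_add]; ring) (ext_homog ℒ fun e v hv => ?_)
      have h := Ω.2.2.2 i a ha _ _ (homog_cons hξ hv) 0
      rw [Fin.update_cons_zero] at h
      simp only [smulForm, insertForm, smul_apply, MultilinearMap.curryLeft_apply, Fin.cons_zero] at h ⊢
      rw [h, smul_comm a, smul_smul, ← Int.negOnePow_add]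
      congr 1
      have h0 : Finset.Iio (0 : Fin (m + 1)) = ∅ := by ext x; simp
      rw [h0, Finset.sum_empty, add_zero, vadd_eq_add, add_mul, add_comm (i * d), add_assoc,
        Int.negOnePow_add, Int.negOnePow_even (i * d + i * d) ⟨_, rfl⟩, mul_one]
  comm_smul := fun {i j a ξ} ha hξ => by
    refine hom_ext fun m d Ω => ?_
    rw [LinearMap.smul_apply, Module.End.mul_apply, Module.End.mul_apply]
    cases m with
    | zero => rw [opL_incl_zero hξ, map_zero, opA_incl ha, opL_incl_zero hξ, smul_zero]
    | succ m =>
      rw [opL_incl hξ, opA_incl ha, opA_incl ha, opL_incl hξ]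
      refine incl_eq_smul (by ring) _ (MultilinearMap.ext fun v => ?_)
      simp only [smulForm, insertForm, smul_apply, MultilinearMap.curryLeft_apply]
      rw [smul_comm a, smul_smul, ← Int.negOnePow_add]
      congr 1
      have h0 : i * j + j * (d + i) = j * d + (i * j + i * j) := by ring
      rw [h0, Int.negOnePow_add, Int.negOnePow_even (i * j + i * j) ⟨_, rfl⟩, mul_one]
  comm := fun {i j ξ ζ} hξ hζ => by
    refine hom_ext fun m d Ω => ?_
    rw [LinearMap.smul_apply, Module.End.mul_apply, Module.End.mul_apply]
    match m, Ω with
    | 0, Ω => rw [opL_incl_zero hξ, opL_incl_zero hζ, map_zero, map_zero, smul_zero]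
    | 1, Ω =>
      rw [opL_incl hξ, opL_incl hζ, opL_incl_zero hξ, opL_incl_zero hζ, smul_zero]
    | m + 2, Ω =>
      rw [opL_incl hξ, opL_incl hζ, opL_incl hξ, opL_incl hζ]
      refine incl_eq_smul (by ring) _ (ext_homog ℒ fun e v hv => ?_)
      have h := Ω.2.2.1 _ _ (homog_cons hξ (homog_cons hζ hv)) 0 1 rfl
      have hs : (Fin.cons ξ (Fin.cons ζ v : Fin (m + 1) → L) : Fin (m + 2) → L) ∘
          Equiv.swap 0 1 = Fin.cons ζ (Fin.cons ξ v : Fin (m + 1) → L) := by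
        funext k
        induction k using Fin.cases with
        | zero => simp
        | succ k =>
          induction k using Fin.cases with
          | zero => simp
          | succ k =>
            rw [Function.comp_apply, Equiv.swap_apply_of_ne_of_ne (Fin.succ_ne_zero _)
              (by simp [Fin.ext_iff])]
            rfl
      rw [hs] at h
      simp only [insertForm, smul_apply, MultilinearMap.curryLeft_apply, Fin.cons_zero,
        Fin.cons_one] at h ⊢
      rw [h, smul_smul, smul_smul, smul_smul, smul_smul, ← Int.negOnePow_add, ← Int.negOnePow_add,
        ← Int.negOnePow_add, ← Int.negOnePow_add]
      congr 1
      have h0 : i * (d + j) + j * d + i * j = i * d + j * d + 2 * (i * j) := by ring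
      have h1 : i * j + j * (d + i) + i * d = i * d + j * d + 2 * (i * j) := by ring
      rw [h0, h1]

/-- The `S_A^• L`-module structure `u ↦ i_u` of `Sym_A(L, P)`. -/
def insertion (𝒜 : ℤ → Submodule K A) [GradedAlgebra 𝒜] [IsGradedComm 𝒜] (ℒ : ℤ → Submodule K L)
    [DirectSum.Decomposition ℒ] [SetLike.GradedSMul 𝒜 ℒ] (𝓟 : ℤ → Submodule K P)
    [DirectSum.Decomposition 𝓟] [SetLike.GradedSMul 𝒜 𝓟] :
    SymAlg 𝒜 ℒ →ₐ[K] Module.End K (SymForms 𝒜 ℒ 𝓟) :=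
  SymAlg.lift (insertData 𝒜 ℒ 𝓟)

end SymForms

variable {𝒜 ℒ 𝓟}

/-- The value of an `m`-form `Ω` on `k` arguments, in the case `k = m`. -/
def formEval {m : ℕ} {d : ℤ} (Ω : symForm 𝒜 ℒ 𝓟 m d) {k : ℕ} (v : Fin k → L) : P :=
  if h : k = m then Ω.1 (v ∘ Fin.cast h.symm) else 0

/-- `D n` (`n ≥ 0`) is the component `D_{n+1}^∇` of the derivation of `Sym_A(L, P)` associated with the
left connection `∇`: it maps an `m`-form `Ω` of degree `d` to an `(m + n)`-form of degree `d + 1`. -/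
def IsChevalleyEilenberg {𝕏 : LRInfinity 𝒜 ℒ} (C : LeftConnection 𝕏 𝓟)
    (D : ℕ → Module.End K (SymForms 𝒜 ℒ 𝓟)) : Prop :=
  ∀ (n m : ℕ) (d : ℤ) (Ω : symForm 𝒜 ℒ 𝓟 m d), ∃ Ω' : symForm 𝒜 ℒ 𝓟 (m + n) (d + 1),
    D n (SymForms.incl 𝒜 ℒ 𝓟 m d Ω) = SymForms.incl 𝒜 ℒ 𝓟 (m + n) (d + 1) Ω' ∧
    ∀ (e : Fin (m + n) → ℤ) (ξ : Fin (m + n) → L), Homog ℒ e ξ →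
      Ω'.1 ξ = (∑ I : Finset (Fin (m + n)) with I.card = n,
          (d * ∑ i ∈ I, e i).negOnePow • koszulSign I e •
            C.nabla I.card (pick ξ I) (formEval Ω (pick ξ Iᶜ)))
        - ∑ I : Finset (Fin (m + n)) with I.card = n + 1, d.negOnePow • koszulSign I e •
            formEval Ω (Fin.cons (𝕏.X I.card (pick ξ I)) (pick ξ Iᶜ) : Fin (Iᶜ.card + 1) → L)

/-- The operations `L^∇(u_1, …, u_n | Ω) = -(-1)^{n+1} [⋯[[D_{n+1}^∇, i_{u_1}], i_{u_2}]⋯, i_{u_n}] Ω`. -/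
def leftLie [IsGradedComm 𝒜] (𝓟 : ℤ → Submodule K P) [DirectSum.Decomposition 𝓟]
    [SetLike.GradedSMul 𝒜 𝓟] (D : ℕ → Module.End K (SymForms 𝒜 ℒ 𝓟)) (n : ℕ) :
    MultilinearMap K (fun _ : Fin n => SymAlg 𝒜 ℒ) (Module.End K (SymForms 𝒜 ℒ 𝓟)) :=
  (-(-1 : K) ^ (n + 1)) • iteratedCommutator (SymForms.grade 𝒜 ℒ 𝓟)
    (SymForms.insertion 𝒜 ℒ 𝓟).toLinearMap n (D n)

end Forms

end SHLR

set_option linter.unusedSectionVars false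

namespace SHLR

open scoped DirectSum TensorProduct

/-! ### Signs -/

section SignLemmas

/-! Sums over unshuffles with Koszul signs are first turned into a recursion on lists of homogeneous
elements: each letter goes into the first or into the second sublist, and in the second case it
collects the sign for passing the first one (`spl`, `sum_pick_eq_spl`). Sign identities then become
parity checks, mostly made letter by letter.

The brackets on the symmetric algebra. A graded symmetric operation that is a derivation in each
slot is determined by its values on the generators from A and L (`MDer.unique`). Conversely, values
on generators compatible with the relations of the algebra extend. For one slot, the universal
property is applied to right multiplications on pairs (x, dx), a form of the dual number trick
(`exists_der`); for several slots the extension is made one slot at a time (`extSpec_step`,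
`Good.extSpec`). Compatibility of the brackets and anchors with the relations is the content of the
Leibniz and linearity axioms (`genBracket_good`). The Jacobiator of such brackets is again a
multiderivation, since its cross terms cancel in pairs (`jacobiator_mder`). It therefore vanishes as
soon as it does on generators, where it is the Jacobi identity of X, the identity of the anchors, or
trivially zero, according to the number of entries from A (`symBracket_jacobi`).

The modules. Both calculi are instances of derived brackets. Let S act on W by operators ρ(u), and
let D n denote the component with index n + 1. The iterated commutator of D n with n + 1 operators
is, up to the sign s ^ n, the operator of the bracket of the n + 1 elements; this need only be
checked on generators (`comm_eq_of_generators`). Let `sqComp D n` be the sum of the products D p D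
(n - p). By the Leibniz rule for commutators, commuting it with n operators yields the left-hand
side of the module identity up to sign (`comm_sqComp_eq`), and commuting it with more operators
yields Jacobiators, hence zero (`comm_sqComp_eq_zero`). So the module identities say that the n-fold
commutators of `sqComp D n` vanish (`isLeftModule_iff`, `isRightModule_iff`).

Flatness. An operator on the tensor product is determined by its commutators with letters from L,
evaluated on the elements 1 ⊗ q (`comm_eq_of_one`). An operator on forms is determined likewise by
the 0-form components of the results (`comm_eq_of_val_nil`). For `sqComp D n` these data vanish when
there are fewer than n letters, by a count of entries. They are the curvature up to sign when there
are n letters (`comm_sqComp_one`, `val_nil_comm_sqComp`), and vanish for more than n letters by the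
Jacobi identity. Hence flatness forces every `sqComp D n` to vanish, and the module identities
follow. Conversely the module identities give back the curvature: q ↦ 1 ⊗ q is injective
(`tens_one_injective`), and every homogeneous p is the value of a 0-form (`exists_val_nil_eq`).

The operators D themselves are well defined over A because the anchor term produced by the Leibniz
rule of the bracket cancels the one produced by the connection (`rinehartTerm_smul`, `ceTerm_smul`).
-/

theorem sgn_mul {R : Type*} [Ring R] (s : ℤˣ) (x y : R) : (s • x) * y = s • (x * y) := by
  simp only [Units.smul_def, smul_mul_assoc]

theorem mul_sgn {R : Type*} [Ring R] (s : ℤˣ) (x y : R) : x * (s • y) = s • (x * y) := by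
  simp only [Units.smul_def, mul_smul_comm]

theorem map_sgn {M N F : Type*} [AddCommGroup M] [AddCommGroup N] [FunLike F M N]
    [AddMonoidHomClass F M N] (f : F) (s : ℤˣ) (x : M) : f (s • x) = s • f x := by
  simp [Units.smul_def]

theorem smul_sgn {R M : Type*} [Ring R] [AddCommGroup M] [Module R M] (r : R) (s : ℤˣ) (x : M) :
    r • (s • x) = s • (r • x) := by
  simp only [Units.smul_def]; rw [smul_comm]

theorem sgn_smul {R M : Type*} [Ring R] [AddCommGroup M] [Module R M] (r : R) (s : ℤˣ) (x : M) :
    (s • r) • x = s • (r • x) := by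
  simp only [Units.smul_def, smul_assoc]

theorem sgn_mem {K M : Type*} [Ring K] [AddCommGroup M] [Module K M] {p : Submodule K M} (s : ℤˣ)
    {x : M} (h : x ∈ p) : s • x ∈ p :=
  Submodule.smul_of_tower_mem _ (s : ℤ) h

theorem sgn_smul_sgn {M : Type*} [AddCommGroup M] (a b : ℤ) (x : M) :
    a.negOnePow • b.negOnePow • x = (a + b).negOnePow • x := by
  rw [smul_smul, Int.negOnePow_add]

/-- Signs are compared through the parity of the difference of their exponents. Almost every sign
verification below ends here, with an `Even` goal in integer degrees. -/
theorem sgn_congr {M : Type*} [AddCommGroup M] {a b : ℤ} {x y : M} (h : Even (a - b))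
    (hx : x = y) : a.negOnePow • x = b.negOnePow • y := by
  rw [hx, (Int.negOnePow_eq_iff a b).2 h]

theorem sgn_eq_self {M : Type*} [AddCommGroup M] {a : ℤ} {x : M} (h : Even a) :
    a.negOnePow • x = x := by
  rw [Int.negOnePow_even _ h, one_smul]

theorem neg_sgn {M : Type*} [AddCommGroup M] (a : ℤ) (x : M) :
    -(a.negOnePow • x) = (a + 1).negOnePow • x := by
  rw [Int.negOnePow_succ, Units.neg_smul]

end SignLemmas

/-! ### Lists of letters with degrees and signed sums over unshuffles -/

/-- Letters that have a degree. -/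
class HasDeg (α : Type*) where
  deg : α → ℤ

open HasDeg (deg)

section Lists

variable {α : Type*} [HasDeg α] {N : Type*} [AddCommGroup N]

/-- The total degree of a list of letters. -/
def ldeg (l : List α) : ℤ := (l.map deg).sum

@[simp] theorem ldeg_nil : ldeg ([] : List α) = 0 := rfl

@[simp] theorem ldeg_cons (x : α) (l : List α) : ldeg (x :: l) = deg x + ldeg l := by simp [ldeg]

@[simp] theorem ldeg_append (l m : List α) : ldeg (l ++ m) = ldeg l + ldeg m := by simp [ldeg]

theorem ldeg_perm {l m : List α} (h : l.Perm m) : ldeg l = ldeg m := (h.map _).sum_eq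

/-- The sum of `α(I, J) F(I, J)` over all unshuffles of a list into two sublists `I` and `J`. -/
def spl : (List α → List α → N) → List α → N
  | F, [] => F [] []
  | F, x :: l => spl (fun I J => F (x :: I) J) l +
      spl (fun I J => (deg x * ldeg I).negOnePow • F I (x :: J)) l

@[simp] theorem spl_nil (F : List α → List α → N) : spl F [] = F [] [] := rfl

theorem spl_cons (F : List α → List α → N) (x : α) (l : List α) :
    spl F (x :: l) = spl (fun I J => F (x :: I) J) l +
      spl (fun I J => (deg x * ldeg I).negOnePow • F I (x :: J)) l := rfl

/-- The permutation hypothesis makes the total length and the total degree of the two parts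
available when the summands are compared. -/
theorem spl_congr {F G : List α → List α → N} {l : List α}
    (h : ∀ I J, (I ++ J).Perm l → F I J = G I J) : spl F l = spl G l := by
  induction l generalizing F G with
  | nil => exact h [] [] (by simp)
  | cons x l ih =>
    refine congrArg₂ (· + ·) (ih fun I J hp => h (x :: I) J (by simpa using hp))
      (ih fun I J hp => ?_)
    rw [h I (x :: J) (List.perm_middle.trans (by simpa using hp))]

theorem spl_add (F G : List α → List α → N) (l : List α) :
    spl (fun I J => F I J + G I J) l = spl F l + spl G l := by
  induction l generalizing F G with
  | nil => rfl
  | cons x l ih => simp only [spl_cons, smul_add, ih]; abel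

theorem spl_map {M F : Type*} [AddCommGroup M] [FunLike F N M] [AddMonoidHomClass F N M] (f : F)
    (G : List α → List α → N) (l : List α) : f (spl G l) = spl (fun I J => f (G I J)) l := by
  induction l generalizing G with
  | nil => rfl
  | cons x l ih => simp only [spl_cons, map_add, ih, map_sgn]

theorem spl_smul (s : ℤˣ) (F : List α → List α → N) (l : List α) :
    spl (fun I J => s • F I J) l = s • spl F l :=
  (spl_map (DistribSMul.toAddMonoidHom N s) F l).symm

theorem spl_neg (F : List α → List α → N) (l : List α) :
    spl (fun I J => -F I J) l = -spl F l := by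
  simpa using spl_smul (-1) F l

theorem spl_sub (F G : List α → List α → N) (l : List α) :
    spl (fun I J => F I J - G I J) l = spl F l - spl G l := by
  simp only [sub_eq_add_neg, spl_add, spl_neg]

theorem spl_zero (l : List α) : spl (fun _ _ => (0 : N)) l = 0 := by
  have h := spl_add (fun _ _ => (0 : N)) (fun _ _ => (0 : N)) l
  simpa only [add_zero, left_eq_add] using h

theorem spl_eq_zero {F : List α → List α → N} {l : List α}
    (h : ∀ I J, (I ++ J).Perm l → F I J = 0) : spl F l = 0 :=
  (spl_congr h).trans (spl_zero l)

theorem spl_sum {ι : Type*} (s : Finset ι) (F : ι → List α → List α → N) (l : List α) :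
    spl (fun I J => ∑ i ∈ s, F i I J) l = ∑ i ∈ s, spl (F i) l := by
  classical
  induction s using Finset.induction_on with
  | empty => simp only [Finset.sum_empty, spl_zero]
  | insert i s hi ih => simp only [Finset.sum_insert hi, spl_add, ih]

/-- The only splitting with empty second part puts every letter into the first one, and its sign is
trivial. -/
theorem spl_right {F : List α → List α → N} {l : List α}
    (h : ∀ I J, (I ++ J).Perm l → J ≠ [] → F I J = 0) : spl F l = F l [] := by
  induction l generalizing F with
  | nil => rfl
  | cons x l ih =>
    rw [spl_cons, ih, spl_eq_zero, add_zero]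
    · intro I J hp
      rw [h I _ (List.perm_middle.trans (by simpa using hp)) (by simp), smul_zero]
    · exact fun I J hp hJ => h _ _ (by simpa using hp) hJ

/-- Complementation matches the splittings with each other; the two Koszul signs differ by the sign
for moving the whole of one part past the other. -/
theorem spl_swap (F : List α → List α → N) (l : List α) :
    spl F l = spl (fun I J => (ldeg I * ldeg J).negOnePow • F J I) l := by
  induction l generalizing F with
  | nil => simp
  | cons x l ih =>
    rw [spl_cons, spl_cons, add_comm, ih, ih (fun I J => F (x :: I) J)]
    congr 1
    · refine spl_congr fun I J _ => ?_
      rw [smul_smul, ← Int.negOnePow_add]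
      refine sgn_congr ?_ rfl
      rw [ldeg_cons]; grind
    · refine spl_congr fun I J _ => ?_
      rw [smul_smul, ← Int.negOnePow_add]
      refine sgn_congr ?_ rfl
      rw [ldeg_cons]; grind

/-- Graded symmetry of an operation on lists. -/
def LSym (F : List α → N) : Prop :=
  ∀ p x y q, F (p ++ x :: y :: q) = (deg x * deg y).negOnePow • F (p ++ y :: x :: q)

theorem LSym.cons {F : List α → N} (h : LSym F) (z : α) : LSym (fun l => F (z :: l)) :=
  fun p => h (z :: p)

theorem LSym.append {F : List α → N} (h : LSym F) (m : List α) : LSym (fun l => F (m ++ l)) :=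
  fun p x y q => by simpa using h (m ++ p) x y q

theorem LSym.smul {F : List α → N} (h : LSym F) (s : ℤˣ) : LSym (fun l => s • F l) :=
  fun p x y q => by simp only [h p x y q]; rw [smul_comm]

theorem LSym.map {M H : Type*} [AddCommGroup M] [FunLike H N M] [AddMonoidHomClass H N M]
    {F : List α → N} (h : LSym F) (f : H) : LSym (fun l => f (F l)) :=
  fun p x y q => by simp only [h p x y q, map_sgn]

/-- Signs that depend on the total degree do not affect graded symmetry. -/
theorem LSym.smul_ldeg {F : List α → N} (h : LSym F) (s : ℤ → ℤˣ) :
    LSym (fun l => s (ldeg l) • F l) := fun p x y q => by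
  simp only [h p x y q]
  rw [smul_comm, ldeg_perm ((List.Perm.swap y x q).append_left p)]

/-- Moving a letter to the front. -/
theorem LSym.front {F : List α → N} (h : LSym F) (p : List α) (x : α) (q : List α) :
    F (p ++ x :: q) = (deg x * ldeg p).negOnePow • F (x :: (p ++ q)) := by
  induction p generalizing F with
  | nil => simp
  | cons y p ih =>
    have h1 := ih (h.cons y)
    have h2 := h [] y x (p ++ q)
    simp only [List.nil_append] at h2
    rw [List.cons_append, h1, h2, smul_smul, ← Int.negOnePow_add]
    refine sgn_congr ?_ rfl
    rw [ldeg_cons]; grind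

/-- Iterated commutators grow at the end of a list and the Leibniz axioms act on the last slot,
whereas derivations are normalised in the first slot. This lemma passes between the two conventions.
-/
theorem LSym.back {F : List α → N} (h : LSym F) (x : α) (q : List α) :
    F (x :: q) = (deg x * ldeg q).negOnePow • F (q ++ [x]) := by
  rw [h.front q x [], smul_smul, ← Int.negOnePow_add, List.append_nil, sgn_eq_self ⟨_, rfl⟩]

/-- Splittings are graded symmetric. -/
theorem LSym.spl {F : List α → List α → N} (h1 : ∀ J, LSym (fun I => F I J))
    (h2 : ∀ I, LSym (F I)) : LSym (spl F) := by
  intro p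
  induction p generalizing F with
  | nil =>
    intro x y q
    simp only [List.nil_append, spl_cons, ldeg_cons, smul_add]
    have e1 := fun I J => h1 J [] x y I
    have e2 := fun I J => h2 I [] x y J
    simp only [List.nil_append] at e1 e2
    simp only [e1, e2, ← spl_smul]
    rw [add_assoc, add_assoc]
    refine congrArg₂ (· + ·) rfl ?_
    -- The two sums that put x and y into different parts trade places under the exchange, so they
    -- are permuted before the comparison term by term.
    rw [← add_assoc, ← add_assoc, add_comm (SHLR.spl (fun I J => _ • F (x :: I) (y :: J)) q)]
    refine congrArg₂ (· + ·) (congrArg₂ (· + ·) ?_ ?_) ?_ <;>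
    · refine spl_congr fun I J _ => ?_
      simp only [sgn_smul_sgn]
      refine sgn_congr ?_ rfl
      grind
  | cons z p ih =>
    intro x y q
    simp only [List.cons_append, spl_cons, smul_add]
    rw [ih (fun J => (h1 J).cons z) (fun I => h2 (z :: I)) x y q,
      ih (F := fun I J => (deg z * ldeg I).negOnePow • F I (z :: J))
        (fun J => (h1 (z :: J)).smul_ldeg fun d => (deg z * d).negOnePow)
        (fun I => ((h2 I).cons z).smul _) x y q]

end Lists

end SHLR

namespace SHLR

open scoped DirectSum TensorProduct
open HasDeg (deg)

/-! ### Sums over subsets as signed sums over unshuffles of lists -/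

section Subsets

/-- Both sides come from increasing lists of indices with the same entries, and a duplicate-free set
of entries has only one increasing enumeration. -/
theorem ofFn_pick {α : Type*} {n : ℕ} (h : Fin n → α) (I : Finset (Fin n)) :
    List.ofFn (pick h I) = ((List.finRange n).filter (· ∈ I)).map h := by
  have h1 : List.ofFn (pick h I) = (List.ofFn fun t => I.orderEmbOfFin rfl t).map h := by
    rw [List.map_ofFn]; rfl
  rw [h1]
  congr 1
  refine List.Perm.eq_of_pairwise (le := (· ≤ ·)) (fun a b _ _ => le_antisymm) ?_ ?_ ?_
  · rw [List.pairwise_ofFn]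
    intro i j hij
    exact (I.orderEmbOfFin rfl).monotone hij.le
  · exact ((List.pairwise_le_finRange n).filter _)
  · rw [List.perm_ext_iff_of_nodup]
    · intro a
      simp only [List.mem_ofFn, List.mem_filter, List.mem_finRange, true_and, decide_eq_true_eq]
      have := Finset.range_orderEmbOfFin I rfl
      rw [← Finset.mem_coe, ← this, Set.mem_range]
    · exact List.nodup_ofFn.2 (I.orderEmbOfFin rfl).injective
    · exact (List.nodup_finRange n).filter _

/-- As a product over all pairs of indices the sign can be split at the index 0, which the induction
on the number of letters needs. -/
theorem koszulSign_eq {n : ℕ} (I : Finset (Fin n)) (e : Fin n → ℤ) :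
    koszulSign I e = ∏ x : Fin n, ∏ y : Fin n,
      if x ∉ I ∧ y ∈ I ∧ x < y then (e x * e y).negOnePow else 1 := by
  rw [koszulSign, ← Finset.prod_product', Finset.prod_filter]
  have h : Iᶜ ×ˢ I ⊆ Finset.univ ×ˢ Finset.univ := fun x _ => by simp
  rw [← Finset.prod_subset h]
  · refine Finset.prod_congr rfl fun x hx => ?_
    simp only [Finset.mem_product, Finset.mem_compl] at hx
    simp [hx.1, hx.2]
  · intro x _ hx
    simp only [Finset.mem_product, Finset.mem_compl, not_and] at hx
    rw [if_neg]
    tauto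

/-- The letter 0 lies in the first part and nothing stands before it, so no letter has to be passed.
-/
theorem koszulSign_insert_zero {n : ℕ} (I : Finset (Fin n)) (e : Fin (n + 1) → ℤ) :
    koszulSign (insert 0 (I.map (Fin.succEmb n))) e = koszulSign I (fun i => e i.succ) := by
  rw [koszulSign_eq, koszulSign_eq, Fin.prod_univ_succ]
  simp only [Fin.prod_univ_succ]
  simp [Fin.succ_ne_zero, Fin.succ_lt_succ_iff]

/-- Here the letter 0 lies in the second part, and each letter of I has to pass it. -/
theorem koszulSign_map_succ {n : ℕ} (I : Finset (Fin n)) (e : Fin (n + 1) → ℤ) :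
    koszulSign (I.map (Fin.succEmb n)) e =
      (e 0 * ∑ i ∈ I, e i.succ).negOnePow * koszulSign I (fun i => e i.succ) := by
  rw [koszulSign_eq, koszulSign_eq, Fin.prod_univ_succ]
  simp only [Fin.prod_univ_succ]
  have h : (e 0 * ∑ i ∈ I, e i.succ).negOnePow =
      ∏ i : Fin n, if i ∈ I then (e 0 * e i.succ).negOnePow else 1 := by
    rw [Finset.mul_sum, ← Finset.prod_filter, Finset.filter_mem_eq_inter, Finset.univ_inter]
    induction I using Finset.induction_on with
    | empty => simp
    | insert a s ha ih => rw [Finset.sum_insert ha, Finset.prod_insert ha, Int.negOnePow_add, ih]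
  rw [h]
  simp [Fin.succ_ne_zero, Fin.succ_lt_succ_iff]

theorem sum_subsets_succ {N : Type*} [AddCommMonoid N] {n : ℕ} (f : Finset (Fin (n + 1)) → N) :
    ∑ I : Finset (Fin (n + 1)), f I = ∑ I : Finset (Fin n), f (insert 0 (I.map (Fin.succEmb n))) +
      ∑ I : Finset (Fin n), f (I.map (Fin.succEmb n)) := by
  have h0 : (0 : Fin (n + 1)) ∉ (Finset.univ : Finset (Fin n)).map (Fin.succEmb n) := by
    simp [Fin.succ_ne_zero]
  have h1 : (Finset.univ : Finset (Finset (Fin (n + 1)))) =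
      (insert 0 ((Finset.univ : Finset (Fin n)).map (Fin.succEmb n))).powerset := by
    rw [← Finset.powerset_univ, Fin.univ_succ, Finset.cons_eq_insert]
    rfl
  have h2 : ((Finset.univ : Finset (Fin n)).map (Fin.succEmb n)).powerset =
      (Finset.univ : Finset (Finset (Fin n))).map ⟨Finset.map (Fin.succEmb n), Finset.map_injective _⟩ := by
    ext s
    simp only [Finset.mem_powerset, Finset.mem_map, Finset.mem_univ, true_and,
      Function.Embedding.coeFn_mk]
    rw [Finset.subset_map_iff]
    constructor
    · rintro ⟨t, _, rfl⟩; exact ⟨t, rfl⟩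
    · rintro ⟨t, rfl⟩; exact ⟨t, Finset.subset_univ _, rfl⟩
  rw [h1, Finset.sum_powerset_insert h0, h2, Finset.sum_map, Finset.sum_map, add_comm]
  rfl

theorem ldeg_ofFn_pick {α : Type*} [HasDeg α] {n : ℕ} (h : Fin n → α) (I : Finset (Fin n)) :
    ldeg (List.ofFn (pick h I)) = ∑ i ∈ I, deg (h i) := by
  rw [ofFn_pick, ldeg, List.map_map, ← Finset.sum_map_toList]
  refine List.Perm.sum_eq (List.Perm.map _ ?_)
  rw [List.perm_ext_iff_of_nodup ((List.nodup_finRange n).filter _) I.nodup_toList]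
  simp

/-- This is the bridge from subsets of `Fin n` to lists. The two summands in the recursion of `spl`
are the cases 0 ∈ I and 0 ∉ I, and the extra sign in the second one is that of
`koszulSign_map_succ`. -/
theorem sum_pick_eq_spl {α : Type*} [HasDeg α] {N : Type*} [AddCommGroup N] {n : ℕ}
    (h : Fin n → α) (F : List α → List α → N) :
    ∑ I : Finset (Fin n), koszulSign I (fun i => deg (h i)) •
      F (List.ofFn (pick h I)) (List.ofFn (pick h Iᶜ)) = spl F (List.ofFn h) := by
  simp only [ofFn_pick]
  induction n generalizing F with
  | zero =>
    rw [Fintype.sum_unique]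
    simp [koszulSign_eq]
  | succ n ih =>
    rw [sum_subsets_succ, List.ofFn_succ, spl_cons, ← ih, ← ih]
    have e1 : ∀ I : Finset (Fin n), (List.finRange (n + 1)).filter
        (· ∈ insert 0 (I.map (Fin.succEmb n))) =
          0 :: ((List.finRange n).filter (· ∈ I)).map Fin.succ := fun I => by
      rw [List.finRange_succ, List.filter_cons_of_pos (by simp), List.filter_map]
      congr 3
      ext i
      simp [Fin.succ_ne_zero]
    have e2 : ∀ I : Finset (Fin n), (List.finRange (n + 1)).filter
        (· ∈ (I.map (Fin.succEmb n))) = ((List.finRange n).filter (· ∈ I)).map Fin.succ :=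
      fun I => by
      rw [List.finRange_succ, List.filter_cons_of_neg (by simp [Fin.succ_ne_zero]), List.filter_map]
      congr 2
      ext i
      simp
    have c1 : ∀ I : Finset (Fin n), (insert 0 (I.map (Fin.succEmb n)))ᶜ =
        Iᶜ.map (Fin.succEmb n) := fun I => by
      ext i
      induction i using Fin.cases <;> simp [Fin.succ_ne_zero]
    have c2 : ∀ I : Finset (Fin n), (I.map (Fin.succEmb n))ᶜ =
        insert 0 (Iᶜ.map (Fin.succEmb n)) := fun I => by
      ext i
      induction i using Fin.cases <;> simp [Fin.succ_ne_zero]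
    have d : ∀ I : Finset (Fin n), ∑ i ∈ I, deg (h i.succ) =
        ldeg (((List.finRange n).filter (· ∈ I)).map fun i => h i.succ) := fun I => by
      rw [← ofFn_pick (fun i => h i.succ), ldeg_ofFn_pick]
    congr 1
    · refine Finset.sum_congr rfl fun I _ => ?_
      rw [c1, e1, e2, koszulSign_insert_zero]
      simp only [List.map_cons, List.map_map]
      rfl
    · refine Finset.sum_congr rfl fun I _ => ?_
      rw [c2, e1, e2, koszulSign_map_succ, d]
      simp only [List.map_cons, List.map_map]
      rw [mul_comm, mul_smul]
      rfl

end Subsets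

/-! ### Homogeneous elements and multilinear operations on lists -/

/-- A homogeneous element together with its degree. -/
structure Hgs {K M : Type*} [Ring K] [AddCommGroup M] [Module K M] (ℳ : ℤ → Submodule K M) where
  d : ℤ
  val : M
  mem : val ∈ ℳ d

instance {K M : Type*} [Ring K] [AddCommGroup M] [Module K M] (ℳ : ℤ → Submodule K M) :
    HasDeg (Hgs ℳ) := ⟨Hgs.d⟩

section Operations

variable {K : Type*} [Field K] {M : Type*} [AddCommGroup M] [Module K M] {ℳ : ℤ → Submodule K M}
  {N : Type*} [AddCommGroup N] [Module K N]

@[simp] theorem deg_mk {d : ℤ} {x : M} (h : x ∈ ℳ d) : deg (⟨d, x, h⟩ : Hgs ℳ) = d := rfl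

/-- `K`-linearity in each slot of an operation on lists of homogeneous elements. -/
def LLin (F : List (Hgs ℳ) → N) : Prop :=
  ∀ (p q : List (Hgs ℳ)) (i : ℤ) (c : K) (x y : M) (hx : x ∈ ℳ i) (hy : y ∈ ℳ i)
    (h : c • x + y ∈ ℳ i),
    F (p ++ ⟨i, c • x + y, h⟩ :: q) = c • F (p ++ ⟨i, x, hx⟩ :: q) + F (p ++ ⟨i, y, hy⟩ :: q)

theorem LLin.cons {F : List (Hgs ℳ) → N} (h : LLin F) (z : Hgs ℳ) : LLin (fun l => F (z :: l)) :=
  fun p => h (z :: p)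

theorem LLin.smul_ldeg {F : List (Hgs ℳ) → N} (h : LLin F) (s : ℤ → ℤˣ) :
    LLin (fun l => s (ldeg l) • F l) := fun p q i c x y hx hy hh => by
  simp only [h p q i c x y hx hy hh, ldeg_append, ldeg_cons, deg_mk, smul_add, smul_sgn]

theorem LLin.map {N' : Type*} [AddCommGroup N'] [Module K N'] {F : List (Hgs ℳ) → N} (h : LLin F)
    (f : N →ₗ[K] N') : LLin (fun l => f (F l)) := fun p q i c x y hx hy hh => by
  simp only [h p q i c x y hx hy hh, map_add, map_smul]

theorem LLin.ite {F : List (Hgs ℳ) → N} (h : LLin F) (n : ℕ) :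
    LLin (fun l => if l.length = n then F l else 0) := fun p q i c x y hx hy hh => by
  simp only [h p q i c x y hx hy hh, List.length_append, List.length_cons]
  split_ifs <;> simp

theorem LLin.spl {F : List (Hgs ℳ) → List (Hgs ℳ) → N} (h1 : ∀ J, LLin (fun I => F I J))
    (h2 : ∀ I, LLin (F I)) : LLin (spl F) := by
  intro p
  induction p generalizing F with
  | nil =>
    intro q i c x y hx hy hh
    simp only [List.nil_append, spl_cons, deg_mk]
    have e1 := fun I J => h1 J [] I i c x y hx hy hh
    have e2 := fun I J => h2 I [] J i c x y hx hy hh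
    simp only [List.nil_append] at e1 e2
    have key : ∀ G : List (Hgs ℳ) → List (Hgs ℳ) → N,
        SHLR.spl (fun I J => c • G I J) q = c • SHLR.spl G q := fun G =>
      (spl_map (DistribSMul.toAddMonoidHom N c) G q).symm
    simp only [e1, e2, smul_add, spl_add]
    rw [key]
    simp only [← smul_sgn]
    rw [key]
    exact add_add_add_comm _ _ _ _
  | cons z p ih =>
    intro q i c x y hx hy hh
    simp only [List.cons_append, spl_cons, smul_add]
    rw [ih (F := fun I J => F (z :: I) J) (fun J => (h1 J).cons z) (fun I => h2 (z :: I)),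
      ih (F := fun I J => (deg z * ldeg I).negOnePow • F I (z :: J))
        (fun J => (h1 (z :: J)).smul_ldeg fun d => (deg z * d).negOnePow)
        (fun I => ((h2 I).cons z).smul_ldeg fun _ => _)]
    exact add_add_add_comm _ _ _ _

theorem LLin.zero_head {F : List (Hgs ℳ) → N} (h : LLin F) (i : ℤ) (p q : List (Hgs ℳ)) :
    F (p ++ ⟨i, 0, (ℳ i).zero_mem⟩ :: q) = 0 := by
  have h1 := h p q i (1 : K) 0 0 (ℳ i).zero_mem (ℳ i).zero_mem (by simp)
  simpa using h1

/-- The value of the member of the family `f` with the right number of slots. -/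
def ev (f : ∀ k : ℕ, MultilinearMap K (fun _ : Fin k => M) N) (l : List (Hgs ℳ)) : N :=
  f l.length (fun i => (l.get i).val)

theorem ev_eq (f : ∀ k : ℕ, MultilinearMap K (fun _ : Fin k => M) N) {l : List (Hgs ℳ)} {k : ℕ}
    (h : l.length = k) : ev f l = f k (fun i => (l.get (i.cast h.symm)).val) := by
  subst h; rfl

theorem ev_ofFn (f : ∀ k : ℕ, MultilinearMap K (fun _ : Fin k => M) N) {k : ℕ} (h : Fin k → Hgs ℳ) :
    ev f (List.ofFn h) = f k (fun i => (h i).val) := by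
  rw [ev_eq f (List.length_ofFn)]
  congr 1
  funext i
  simp

theorem ev_cons (f : ∀ k : ℕ, MultilinearMap K (fun _ : Fin k => M) N) (x : Hgs ℳ)
    (l : List (Hgs ℳ)) : ev f (x :: l) =
      f (l.length + 1) (Fin.cons x.val (fun i => (l.get i).val) : Fin (l.length + 1) → M) := by
  rw [ev]
  congr 1
  funext i
  induction i using Fin.cases <;> rfl

theorem ev_cons_ofFn (f : ∀ k : ℕ, MultilinearMap K (fun _ : Fin k => M) N) (x : Hgs ℳ) {k : ℕ}
    (h : Fin k → Hgs ℳ) : ev f (x :: List.ofFn h) =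
      f (k + 1) (Fin.cons x.val (fun i => (h i).val) : Fin (k + 1) → M) := by
  have : x :: List.ofFn h = List.ofFn (Fin.cons x h : Fin (k + 1) → Hgs ℳ) := by
    rw [List.ofFn_succ]; rfl
  rw [this, ev_ofFn]
  congr 1
  funext i
  induction i using Fin.cases <;> rfl

theorem ofFn_snoc {α : Type*} {k : ℕ} (h : Fin k → α) (x : α) :
    List.ofFn (Fin.snoc (α := fun _ => α) h x) = List.ofFn h ++ [x] := by
  rw [List.ofFn_succ', List.concat_eq_append]
  simp

theorem ev_ofFn_snoc (f : ∀ k : ℕ, MultilinearMap K (fun _ : Fin k => M) N) (x : Hgs ℳ) {k : ℕ}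
    (h : Fin k → Hgs ℳ) : ev f (List.ofFn h ++ [x]) =
      f (k + 1) (Fin.snoc (α := fun _ => M) (fun i => (h i).val) x.val) := by
  rw [← ofFn_snoc, ev_ofFn]
  congr 1
  funext i
  induction i using Fin.lastCases <;> simp

theorem ev_snoc (f : ∀ k : ℕ, MultilinearMap K (fun _ : Fin k => M) N) (x : Hgs ℳ)
    (l : List (Hgs ℳ)) : ev f (l ++ [x]) =
      f (l.length + 1) (Fin.snoc (α := fun _ => M) (fun i => (l.get i).val) x.val) := by
  have h := ev_ofFn_snoc f x l.get
  rwa [List.ofFn_get] at h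

theorem ev_llin (f : ∀ k : ℕ, MultilinearMap K (fun _ : Fin k => M) N) :
    LLin (ℳ := ℳ) (ev f) := by
  intro p q i c x y hx hy hh
  -- The list with z at the place `p.length` is an update of a function that does not mention z, so
  -- multilinearity of `f` applies. What that function takes at this place, possibly the default 0,
  -- is overwritten.
  have key : ∀ (z : M) (hz : z ∈ ℳ i), ev f (p ++ ⟨i, z, hz⟩ :: q) =
      f (p.length + q.length + 1) (Function.update
        (fun j : Fin (p.length + q.length + 1) =>
          if h : (j : ℕ) < p.length then (p.get ⟨j, h⟩).val else
            if h : (j : ℕ) - p.length - 1 < q.length then (q.get ⟨_, h⟩).val else 0)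
        ⟨p.length, by omega⟩ z) := by
    intro z hz
    rw [ev_eq f (k := p.length + q.length + 1) (by simp; omega)]
    congr 1
    funext j
    rcases lt_trichotomy (j : ℕ) p.length with h | h | h
    · rw [Function.update_of_ne (fun h' => by rw [h'] at h; simp at h)]
      simp [h, List.getElem_append_left]
    · have h' : j = ⟨p.length, by omega⟩ := Fin.ext h
      rw [h', Function.update_self]
      simp
    · rw [Function.update_of_ne (fun h' => by rw [h'] at h; simp at h)]
      have h2 : (j : ℕ) - p.length - 1 < q.length := by omega
      simp only [h.not_gt, dite_false, h2, dite_true, List.get_eq_getElem, Fin.val_cast]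
      rw [List.getElem_append_right h.le, List.getElem_cons]
      rw [dif_neg (by omega)]
  simp only [key, MultilinearMap.map_update_add, MultilinearMap.map_update_smul]

/-- An exchange of neighbouring slots of `Fin k` is an exchange of neighbouring letters in p ++ x ::
y :: q. From here on graded symmetry is used only in its list form. -/
theorem gradedSymm_iff_lsym (f : ∀ k : ℕ, MultilinearMap K (fun _ : Fin k => M) N) :
    (∀ k, GradedSymm ℳ (f k)) ↔ LSym (α := Hgs ℳ) (ev f) := by
  -- The list of values is cut around the two neighbouring slots; the swap leaves the pieces before
  -- and after them untouched.
  have key : ∀ {k : ℕ} (h : Fin k → Hgs ℳ) (i j : Fin k), (i : ℕ) + 1 = j →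
      ∃ p q, p.length = (i : ℕ) ∧ List.ofFn h = p ++ h i :: h j :: q ∧
        List.ofFn (h ∘ Equiv.swap i j) = p ++ h j :: h i :: q := by
    intro k h i j hij
    have hl : ∀ g : Fin k → Hgs ℳ, List.ofFn g =
        (List.ofFn g).take i ++ g i :: g j :: (List.ofFn g).drop (i + 2) := by
      intro g
      refine List.ext_getElem (by simp; omega) fun t h1 h2 => ?_
      simp only [List.length_ofFn] at h1
      rcases lt_trichotomy t i with h | h | h
      · rw [List.getElem_append_left (by simp; omega)]; simp
      · subst h; simp
      · rw [List.getElem_append_right (by simp; omega)]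
        simp only [List.getElem_cons, List.length_take, List.length_ofFn]
        rw [dif_neg (by omega)]
        split_ifs with h3
        · have : t = j := by omega
          simp [this]
        · simp only [List.getElem_drop, List.getElem_ofFn]
          congr 2
          omega
    refine ⟨_, _, by simp, hl h, (hl _).trans ?_⟩
    simp only [Function.comp_apply, Equiv.swap_apply_left, Equiv.swap_apply_right]
    congr 1
    · refine List.ext_getElem (by simp) fun t h1 h2 => ?_
      simp only [List.length_take, List.length_ofFn, lt_inf_iff] at h1
      simp only [List.getElem_take, List.getElem_ofFn, Function.comp_apply]
      rw [Equiv.swap_apply_of_ne_of_ne] <;> simp [Fin.ext_iff] <;> omega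
    · congr 2
      refine List.ext_getElem (by simp) fun t h1 h2 => ?_
      simp only [List.getElem_drop, List.getElem_ofFn, Function.comp_apply]
      rw [Equiv.swap_apply_of_ne_of_ne] <;> simp [Fin.ext_iff] <;> omega
  constructor
  · intro h p x y q
    let l := p ++ y :: x :: q
    have hl : l.length = p.length + q.length + 2 := by simp [l]; omega
    have h1 := h l.length (fun i => (l.get i).d) (fun i => (l.get i).val) (fun i => (l.get i).mem)
      ⟨p.length, by omega⟩ ⟨p.length + 1, by omega⟩ rfl
    obtain ⟨p', q', hp, e1, e2⟩ := key l.get ⟨p.length, by omega⟩ ⟨p.length + 1, by omega⟩ rfl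
    have h2 : ev f (List.ofFn (l.get ∘ Equiv.swap ⟨p.length, by omega⟩ ⟨p.length + 1, by omega⟩)) = _ :=
      (ev_ofFn f _).trans h1
    have g1 : l.get ⟨p.length, by omega⟩ = y := by simp [l]
    have g2 : l.get ⟨p.length + 1, by omega⟩ = x := by simp [l]
    rw [List.ofFn_get, g1, g2] at e1
    rw [g1, g2] at e2 h2
    have h3 : p = p' ∧ q = q' := by
      have := List.append_inj e1 hp.symm
      simpa using this
    obtain ⟨rfl, rfl⟩ := h3
    rw [e2] at h2
    exact h2.trans (by rw [mul_comm]; rfl)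
  · intro h k e v hv i j hij
    obtain ⟨p, q, -, e1, e2⟩ := key (fun i => (⟨e i, v i, hv i⟩ : Hgs ℳ)) i j hij
    have h1 := ev_ofFn f (fun i => (⟨e i, v i, hv i⟩ : Hgs ℳ))
    have h2 := ev_ofFn f ((fun i => (⟨e i, v i, hv i⟩ : Hgs ℳ)) ∘ Equiv.swap i j)
    rw [e1] at h1
    rw [e2, h] at h2
    refine h2.symm.trans ?_
    rw [h1, mul_comm]
    rfl

end Operations

end SHLR

namespace SHLR

open scoped DirectSum TensorProduct
open HasDeg (deg)

/-! ### Maps given on homogeneous elements -/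

section HomogLift

variable {K : Type*} [Field K] {M : Type*} [AddCommGroup M] [Module K M] (ℳ : ℤ → Submodule K M)
  [DirectSum.Decomposition ℳ] {N : Type*} [AddCommGroup N] [Module K N]

/-- The linear map with given restrictions to the homogeneous components. -/
def homogLift (g : ∀ i, ℳ i →ₗ[K] N) : M →ₗ[K] N :=
  DirectSum.toModule K ℤ N g ∘ₗ (DirectSum.decomposeLinearEquiv ℳ).toLinearMap

theorem homogLift_apply (g : ∀ i, ℳ i →ₗ[K] N) {i : ℤ} {x : M} (hx : x ∈ ℳ i) :
    homogLift ℳ g x = g i ⟨x, hx⟩ := by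
  rw [homogLift, LinearMap.comp_apply, LinearEquiv.coe_coe, DirectSum.decomposeLinearEquiv_apply,
    DirectSum.decompose_of_mem ℳ hx, ← DirectSum.lof_eq_of K, DirectSum.toModule_lof]

theorem linear_ext_homog {f g : M →ₗ[K] N} (h : ∀ i, ∀ x ∈ ℳ i, f x = g x) : f = g := by
  refine LinearMap.ext fun x => ?_
  induction x using DirectSum.Decomposition.inductionOn ℳ with
  | zero => rw [map_zero, map_zero]
  | add x y hx hy => rw [map_add, map_add, hx, hy]
  | @homogeneous i x => exact h i x x.2

variable {ℳ}

/-- Induction by currying: the operation with a fixed homogeneous first argument is multilinear by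
induction, and its dependence on that argument extends linearly from the homogeneous components. -/
theorem exists_multilinear (n : ℕ) {F : List (Hgs ℳ) → N} (hF : LLin F) :
    ∃ f : MultilinearMap K (fun _ : Fin n => M) N, ∀ h : Fin n → Hgs ℳ,
      f (fun i => (h i).val) = F (List.ofFn h) := by
  induction n generalizing F with
  | zero => exact ⟨MultilinearMap.constOfIsEmpty K _ (F []), fun h => by simp⟩
  | succ n ih =>
    choose g hg using fun z : Hgs ℳ => ih (hF.cons z)
    -- The maps `g z` are arbitrary choices, yet they depend linearly on z, because a multilinear
    -- map is determined by its values on homogeneous arguments.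
    let φ : ∀ i, ℳ i →ₗ[K] MultilinearMap K (fun _ : Fin n => M) N := fun i =>
      { toFun := fun x => g ⟨i, x, x.2⟩
        map_add' := fun x y => SymForms.ext_homog ℳ fun e v hv => by
          have h := fun z => hg z (fun j => ⟨e j, v j, hv j⟩)
          have h1 := hF [] (List.ofFn fun j => (⟨e j, v j, hv j⟩ : Hgs ℳ)) i 1 x y x.2 y.2
            (by rw [one_smul]; exact (x + y).2)
          simp only [one_smul, List.nil_append] at h1
          rw [add_apply, h, h, h, ← h1]
          rfl
        map_smul' := fun c x => SymForms.ext_homog ℳ fun e v hv => by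
          have h := fun z => hg z (fun j => ⟨e j, v j, hv j⟩)
          have h1 := hF [] (List.ofFn fun j => (⟨e j, v j, hv j⟩ : Hgs ℳ)) i c x 0 x.2
            (ℳ i).zero_mem (by rw [add_zero]; exact (c • x).2)
          have h0 := hF.zero_head i [] (List.ofFn fun j => (⟨e j, v j, hv j⟩ : Hgs ℳ))
          simp only [add_zero, List.nil_append] at h1 h0
          rw [smul_apply, h, h, RingHom.id_apply]
          exact h1.trans (by rw [h0, add_zero]) }
    refine ⟨LinearMap.uncurryLeft (homogLift ℳ φ), fun h => ?_⟩
    rw [LinearMap.uncurryLeft_apply, homogLift_apply ℳ φ (h 0).mem]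
    exact (hg (h 0) (fun i => h i.succ)).trans (by rw [List.ofFn_succ])

/-- The multilinear maps with given values on lists of homogeneous elements. -/
noncomputable def multOf {F : List (Hgs ℳ) → N} (hF : LLin F) (n : ℕ) :
    MultilinearMap K (fun _ : Fin n => M) N := (exists_multilinear n hF).choose

theorem multOf_apply {F : List (Hgs ℳ) → N} (hF : LLin F) {n : ℕ} (h : Fin n → Hgs ℳ) :
    multOf hF n (fun i => (h i).val) = F (List.ofFn h) := (exists_multilinear n hF).choose_spec h

theorem ev_multOf {F : List (Hgs ℳ) → N} (hF : LLin F) (l : List (Hgs ℳ)) :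
    ev (multOf hF) l = F l := by
  rw [ev, multOf_apply hF (fun i => l.get i), List.ofFn_get]

end HomogLift

/-! ### Iterated graded commutators -/

section Comm

variable {K : Type*} [Field K] [CharZero K]
  {W : Type*} [AddCommGroup W] [Module K W] {𝒲 : ℤ → Submodule K W} [DirectSum.Decomposition 𝒲]
  {S : Type*} [Ring S] [Algebra K S] {𝒮 : ℤ → Submodule K S} [GradedAlgebra 𝒮]
  {ρ : S →ₐ[K] Module.End K W}

/-- The action `ρ` respects the degrees. -/
def IsGradedAction (𝒲 : ℤ → Submodule K W) (𝒮 : ℤ → Submodule K S)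
    (ρ : S →ₐ[K] Module.End K W) : Prop :=
  ∀ (i : ℤ) (x : S), x ∈ 𝒮 i → EndDegree 𝒲 i (ρ x)

theorem EndDegree.mul {a b : ℤ} {Φ Ψ : Module.End K W} (h : EndDegree 𝒲 a Φ)
    (h' : EndDegree 𝒲 b Ψ) : EndDegree 𝒲 (a + b) (Φ * Ψ) := fun d w hw => by
  rw [add_assoc]; exact h _ _ (h' _ _ hw)

theorem EndDegree.sub {a : ℤ} {Φ Ψ : Module.End K W} (h : EndDegree 𝒲 a Φ)
    (h' : EndDegree 𝒲 a Ψ) : EndDegree 𝒲 a (Φ - Ψ) := fun _ _ hw =>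
  Submodule.sub_mem _ (h _ _ hw) (h' _ _ hw)

theorem EndDegree.sgn {a : ℤ} {Φ : Module.End K W} (h : EndDegree 𝒲 a Φ) (s : ℤˣ) :
    EndDegree 𝒲 a (s • Φ) := fun d w hw => by
  rw [LinearMap.smul_apply]
  exact sgn_mem s (h _ _ hw)

theorem EndDegree.zero (a : ℤ) : EndDegree 𝒲 a (0 : Module.End K W) :=
  fun _ _ _ => Submodule.zero_mem _

theorem EndDegree.sum {ι : Type*} {a : ℤ} {s : Finset ι} {Φ : ι → Module.End K W}
    (h : ∀ i ∈ s, EndDegree 𝒲 a (Φ i)) : EndDegree 𝒲 a (∑ i ∈ s, Φ i) := fun d w hw => by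
  rw [LinearMap.sum_apply]
  exact Submodule.sum_mem _ fun i hi => h i hi d w hw

variable (𝒲 ρ) in
/-- The iterated commutators with the operators `ρ(u)`, `u` in a list. -/
def comm : Module.End K W → List (Hgs 𝒮) → Module.End K W
  | Φ, [] => Φ
  | Φ, u :: l => comm (gradedCommutator 𝒲 Φ (ρ u.val)) l

@[simp] theorem comm_nil (Φ : Module.End K W) : comm (𝒮 := 𝒮) 𝒲 ρ Φ [] = Φ := rfl

theorem comm_cons (Φ : Module.End K W) (u : Hgs 𝒮) (l : List (Hgs 𝒮)) :
    comm 𝒲 ρ Φ (u :: l) = comm 𝒲 ρ (gradedCommutator 𝒲 Φ (ρ u.val)) l := rfl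

theorem comm_append (Φ : Module.End K W) (l m : List (Hgs 𝒮)) :
    comm 𝒲 ρ Φ (l ++ m) = comm 𝒲 ρ (comm 𝒲 ρ Φ l) m := by
  induction l generalizing Φ with
  | nil => rfl
  | cons u l ih => exact ih _

theorem comm_snoc (Φ : Module.End K W) (l : List (Hgs 𝒮)) (u : Hgs 𝒮) :
    comm 𝒲 ρ Φ (l ++ [u]) = gradedCommutator 𝒲 (comm 𝒲 ρ Φ l) (ρ u.val) := comm_append Φ l [u]

theorem comm_add (Φ Ψ : Module.End K W) (l : List (Hgs 𝒮)) :
    comm 𝒲 ρ (Φ + Ψ) l = comm 𝒲 ρ Φ l + comm 𝒲 ρ Ψ l := by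
  induction l generalizing Φ Ψ with
  | nil => rfl
  | cons u l ih => rw [comm_cons, map_add, LinearMap.add_apply]; exact ih _ _

variable (𝒲 ρ) in
/-- `comm` as a homomorphism in the operator. -/
def commHom (l : List (Hgs 𝒮)) : Module.End K W →+ Module.End K W where
  toFun Φ := comm 𝒲 ρ Φ l
  map_zero' := by
    have h := comm_add (𝒲 := 𝒲) (ρ := ρ) 0 0 l
    simpa using h
  map_add' Φ Ψ := comm_add Φ Ψ l

theorem comm_zero (l : List (Hgs 𝒮)) : comm 𝒲 ρ 0 l = 0 := map_zero (commHom 𝒲 ρ l)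

theorem comm_sgn (s : ℤˣ) (Φ : Module.End K W) (l : List (Hgs 𝒮)) :
    comm 𝒲 ρ (s • Φ) l = s • comm 𝒲 ρ Φ l := map_sgn (commHom 𝒲 ρ l) s Φ

theorem comm_sum {ι : Type*} (s : Finset ι) (Φ : ι → Module.End K W) (l : List (Hgs 𝒮)) :
    comm 𝒲 ρ (∑ i ∈ s, Φ i) l = ∑ i ∈ s, comm 𝒲 ρ (Φ i) l := map_sum (commHom 𝒲 ρ l) _ _

theorem iteratedCommutator_eq_comm (Φ : Module.End K W) {n : ℕ} (h : Fin n → Hgs 𝒮) :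
    iteratedCommutator 𝒲 ρ.toLinearMap n Φ (fun i => (h i).val) =
      comm 𝒲 ρ Φ (List.ofFn h) := by
  induction n generalizing Φ with
  | zero => rfl
  | succ n ih =>
    rw [iteratedCommutator_succ, List.ofFn_succ, comm_cons, ← ih]
    rfl

theorem comm_eq_ev (Φ : Module.End K W) (l : List (Hgs 𝒮)) : comm 𝒲 ρ Φ l =
    ev (fun n => iteratedCommutator 𝒲 ρ.toLinearMap n Φ) l := by
  have h := iteratedCommutator_eq_comm (𝒲 := 𝒲) (ρ := ρ) Φ l.get
  rw [List.ofFn_get] at h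
  exact h.symm

theorem comm_llin (Φ : Module.End K W) : LLin (comm (𝒮 := 𝒮) 𝒲 ρ Φ) := by
  have h := ev_llin (ℳ := 𝒮) (fun n => iteratedCommutator 𝒲 ρ.toLinearMap n Φ)
  intro p q i c x y hx hy hh
  simp only [comm_eq_ev]
  exact h p q i c x y hx hy hh

variable (hρ : IsGradedAction 𝒲 𝒮 ρ)
include hρ

theorem EndDegree.gradedCommutator {a : ℤ} {Φ : Module.End K W} (h : EndDegree 𝒲 a Φ)
    (u : Hgs 𝒮) : EndDegree 𝒲 (a + deg u) (gradedCommutator 𝒲 Φ (ρ u.val)) := by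
  rw [gradedCommutator_apply 𝒲 h (hρ _ _ u.mem)]
  refine (h.mul (hρ _ _ u.mem)).sub (EndDegree.sgn ?_ _)
  rw [add_comm]
  exact (hρ _ _ u.mem).mul h

theorem EndDegree.comm {a : ℤ} {Φ : Module.End K W} (h : EndDegree 𝒲 a Φ)
    (l : List (Hgs 𝒮)) : EndDegree 𝒲 (a + ldeg l) (comm 𝒲 ρ Φ l) := by
  induction l generalizing Φ a with
  | nil => simpa using h
  | cons u l ih =>
    rw [ldeg_cons, ← add_assoc]
    exact ih (h.gradedCommutator hρ u)

theorem gradedCommutator_action [IsGradedComm 𝒮] (u v : Hgs 𝒮) :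
    gradedCommutator 𝒲 (ρ u.val) (ρ v.val) = 0 := by
  rw [gradedCommutator_apply 𝒲 (hρ _ _ u.mem) (hρ _ _ v.mem), ← map_mul, ← map_mul,
    IsGradedComm.comm _ _ _ _ u.mem v.mem, map_sgn, sub_self]

/-- The operators ρ(u) commute with each other in the graded sense. Once an iterated commutator has
become such an operator, every further commutator kills it. -/
theorem comm_action [IsGradedComm 𝒮] (u : Hgs 𝒮) {l : List (Hgs 𝒮)} (hl : l ≠ []) :
    comm 𝒲 ρ (ρ u.val) l = 0 := by
  cases l with
  | nil => exact absurd rfl hl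
  | cons v l => rw [comm_cons, gradedCommutator_action hρ, comm_zero]

/-- This is the Jacobi identity for graded commutators, with the term [ρ(u), ρ(v)] equal to zero. It
is checked by expanding both sides in products. -/
theorem gradedCommutator_swap [IsGradedComm 𝒮] {a : ℤ} {Φ : Module.End K W}
    (h : EndDegree 𝒲 a Φ) (u v : Hgs 𝒮) :
    gradedCommutator 𝒲 (gradedCommutator 𝒲 Φ (ρ u.val)) (ρ v.val) =
      (deg u * deg v).negOnePow •
        gradedCommutator 𝒲 (gradedCommutator 𝒲 Φ (ρ v.val)) (ρ u.val) := by
  have e1 : ρ u.val * ρ v.val = (deg u * deg v).negOnePow • (ρ v.val * ρ u.val) := by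
    rw [← map_mul, ← map_mul, IsGradedComm.comm _ _ _ _ u.mem v.mem, map_sgn]; rfl
  rw [gradedCommutator_apply 𝒲 (h.gradedCommutator hρ u) (hρ _ _ v.mem),
    gradedCommutator_apply 𝒲 (h.gradedCommutator hρ v) (hρ _ _ u.mem),
    gradedCommutator_apply 𝒲 h (hρ _ _ u.mem), gradedCommutator_apply 𝒲 h (hρ _ _ v.mem)]
  change _ = _ • (_ - ((a + deg v) * deg u).negOnePow • _)
  change _ - ((a + deg u) * deg v).negOnePow • _ = _
  change (Φ * ρ u.val - (a * deg u).negOnePow • (ρ u.val * Φ)) * ρ v.val - _ • (ρ v.val *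
    (Φ * ρ u.val - (a * deg u).negOnePow • (ρ u.val * Φ))) = _ • ((Φ * ρ v.val -
    (a * deg v).negOnePow • (ρ v.val * Φ)) * ρ u.val - _ • (ρ u.val *
    (Φ * ρ v.val - (a * deg v).negOnePow • (ρ v.val * Φ))))
  simp only [sub_mul, mul_sub, sgn_mul, mul_sgn, smul_sub, sgn_smul_sgn, mul_assoc, e1]
  have e2 : ρ u.val * (ρ v.val * Φ) = (deg u * deg v).negOnePow • (ρ v.val * (ρ u.val * Φ)) := by
    rw [← mul_assoc, e1, sgn_mul, mul_assoc]
  rw [e2, sgn_smul_sgn]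
  have c1 : ∀ x : Module.End K W, ((a + deg u) * deg v).negOnePow • x =
    (deg u * deg v + a * deg v).negOnePow • x := fun x => sgn_congr (by grind) rfl
  have c2 : ∀ x : Module.End K W, (a * deg u).negOnePow • x =
    (deg u * deg v + (a + deg v) * deg u).negOnePow • x := fun x => sgn_congr (by grind) rfl
  have c3 : ∀ x : Module.End K W, ((a + deg u) * deg v + a * deg u).negOnePow • x =
    (deg u * deg v + ((a + deg v) * deg u + a * deg v) + deg u * deg v).negOnePow • x :=
    fun x => sgn_congr (by grind) rfl
  rw [c1, c2, c3]
  abel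

theorem comm_lsym [IsGradedComm 𝒮] {a : ℤ} {Φ : Module.End K W} (h : EndDegree 𝒲 a Φ) :
    LSym (comm (𝒮 := 𝒮) 𝒲 ρ Φ) := by
  intro p u v q
  rw [comm_append, comm_append, comm_cons, comm_cons, comm_cons, comm_cons,
    gradedCommutator_swap hρ (h.comm hρ p) u v, comm_sgn]

/-- Leibniz rule for the commutator with a product. -/
theorem gradedCommutator_action_mul {a : ℤ} {Φ : Module.End K W} (h : EndDegree 𝒲 a Φ)
    (u v : Hgs 𝒮) : gradedCommutator 𝒲 Φ (ρ (u.val * v.val)) =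
      gradedCommutator 𝒲 Φ (ρ u.val) * ρ v.val +
        (a * deg u).negOnePow • (ρ u.val * gradedCommutator 𝒲 Φ (ρ v.val)) := by
  rw [gradedCommutator_apply 𝒲 h (hρ _ _ (SetLike.GradedMul.mul_mem u.mem v.mem)),
    gradedCommutator_apply 𝒲 h (hρ _ _ u.mem), gradedCommutator_apply 𝒲 h (hρ _ _ v.mem), map_mul]
  change _ - (a * (deg u + deg v)).negOnePow • _ =
    (_ - (a * deg u).negOnePow • _) * _ + _ • (_ * (_ - (a * deg v).negOnePow • _))
  simp only [sub_mul, mul_sub, sgn_mul, mul_sgn, smul_sub, sgn_smul_sgn, mul_assoc, mul_add]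
  abel

/-- Leibniz rule for the commutator of a product. -/
theorem gradedCommutator_mul {a b : ℤ} {Φ Ψ : Module.End K W} (h : EndDegree 𝒲 a Φ)
    (h' : EndDegree 𝒲 b Ψ) (u : Hgs 𝒮) : gradedCommutator 𝒲 (Φ * Ψ) (ρ u.val) =
      Φ * gradedCommutator 𝒲 Ψ (ρ u.val) +
        (b * deg u).negOnePow • (gradedCommutator 𝒲 Φ (ρ u.val) * Ψ) := by
  rw [gradedCommutator_apply 𝒲 (h.mul h') (hρ _ _ u.mem),
    gradedCommutator_apply 𝒲 h (hρ _ _ u.mem), gradedCommutator_apply 𝒲 h' (hρ _ _ u.mem)]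
  change _ - ((a + b) * deg u).negOnePow • _ =
    _ * (_ - (b * deg u).negOnePow • _) + _ • ((_ - (a * deg u).negOnePow • _) * _)
  simp only [sub_mul, mul_sub, sgn_mul, mul_sgn, smul_sub, sgn_smul_sgn, mul_assoc, add_mul]
  rw [add_comm (b * deg u)]
  abel

/-- In the Leibniz rule each operator of the list acts on the left or on the right factor. The
choices are the splittings of the list, and the sign is the one for passing `Ψ` on the way to `Φ`.
This is how unshuffle sums arise from compositions of operators. -/
theorem comm_mul {a b : ℤ} {Φ Ψ : Module.End K W} (h : EndDegree 𝒲 a Φ)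
    (h' : EndDegree 𝒲 b Ψ) (l : List (Hgs 𝒮)) : comm 𝒲 ρ (Φ * Ψ) l =
      spl (fun I J => (b * ldeg I).negOnePow • (comm 𝒲 ρ Φ I * comm 𝒲 ρ Ψ J)) l := by
  induction l generalizing Φ Ψ a b with
  | nil => simp
  | cons u l ih =>
    rw [comm_cons, gradedCommutator_mul hρ h h', comm_add, comm_sgn, spl_cons,
      ih h (h'.gradedCommutator hρ u), ih (h.gradedCommutator hρ u) h', add_comm, ← spl_smul]
    refine congrArg₂ (· + ·) (spl_congr fun I J _ => ?_) (spl_congr fun I J _ => ?_)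
    · simp only [sgn_smul_sgn, comm_cons, ldeg_cons, mul_add]
    · simp only [sgn_smul_sgn, comm_cons, add_mul]
      exact sgn_congr (by grind) rfl

end Comm

end SHLR

namespace SHLR

open scoped DirectSum TensorProduct
open HasDeg (deg)

/-! ### Higher derived brackets -/

section Derived

theorem sum_univ_deg {K M : Type*} [Field K] [AddCommGroup M] [Module K M] {ℳ : ℤ → Submodule K M}
    (l : List (Hgs ℳ)) : ∑ i : Fin l.length, (l.get i).d = ldeg l := by
  rw [← List.sum_ofFn, ldeg]
  congr 1
  conv_rhs => rw [← List.ofFn_get l, List.map_ofFn]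
  rfl

theorem ev_mem {K M N : Type*} [Field K] [AddCommGroup M] [Module K M] [AddCommGroup N] [Module K N]
    {ℳ : ℤ → Submodule K M} {𝒩 : ℤ → Submodule K N}
    {f : ∀ k : ℕ, MultilinearMap K (fun _ : Fin k => M) N} {d : ℤ}
    (h : ∀ k, HasDegree ℳ 𝒩 d (f k)) (l : List (Hgs ℳ)) : ev f l ∈ 𝒩 (d + ldeg l) := by
  rw [← sum_univ_deg]
  exact h _ _ _ fun i => (l.get i).mem

variable {K : Type*} [Field K] [CharZero K]
  {W : Type*} [AddCommGroup W] [Module K W] {𝒲 : ℤ → Submodule K W} [DirectSum.Decomposition 𝒲]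
  {S : Type*} [Ring S] [Algebra K S] {𝒮 : ℤ → Submodule K S} [GradedAlgebra 𝒮] [IsGradedComm 𝒮]
  {ρ : S →ₐ[K] Module.End K W}
  {lam : ∀ k : ℕ, MultilinearMap K (fun _ : Fin k => S) S}

/-- The bracket of a list of homogeneous elements, as a homogeneous element. -/
def br {V : Type*} [AddCommGroup V] [Module K V] {𝒱 : ℤ → Submodule K V}
    {lam : ∀ k : ℕ, MultilinearMap K (fun _ : Fin k => V) V}
    (hlam : ∀ k, HasDegree 𝒱 𝒱 1 (lam k)) (l : List (Hgs 𝒱)) : Hgs 𝒱 :=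
  ⟨1 + ldeg l, ev lam l, ev_mem hlam l⟩

/-- The component `∑_{p + q = n} D_p D_q` of the square of `∑ D_p`. -/
def sqComp (D : ℕ → Module.End K W) (n : ℕ) : Module.End K W :=
  ∑ p ∈ Finset.range (n + 1), D p * D (n - p)

theorem sqComp_degree {D : ℕ → Module.End K W} (hD : ∀ n, EndDegree 𝒲 1 (D n)) (n : ℕ) :
    EndDegree 𝒲 2 (sqComp D n) :=
  EndDegree.sum fun _ _ => (hD _).mul (hD _)

theorem comm_sqComp (hρ : IsGradedAction 𝒲 𝒮 ρ) {D : ℕ → Module.End K W}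
    (hD : ∀ n, EndDegree 𝒲 1 (D n)) (n : ℕ) (l : List (Hgs 𝒮)) :
    comm 𝒲 ρ (sqComp D n) l = spl (fun I J => ∑ p ∈ Finset.range (n + 1),
      (ldeg I).negOnePow • (comm 𝒲 ρ (D p) I * comm 𝒲 ρ (D (n - p)) J)) l := by
  rw [sqComp, comm_sum, spl_sum]
  refine Finset.sum_congr rfl fun p _ => ?_
  rw [comm_mul hρ (hD _) (hD _)]
  simp only [one_mul]

variable (hρ : IsGradedAction 𝒲 𝒮 ρ) {D : ℕ → Module.End K W} (hD : ∀ n, EndDegree 𝒲 1 (D n))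
  (hlam : ∀ k, HasDegree 𝒮 𝒮 1 (lam k)) (hlam0 : lam 0 = 0) {s : ℤˣ}
  (hs : ∀ (n : ℕ) (l : List (Hgs 𝒮)), l.length = n + 1 →
    comm 𝒲 ρ (D n) l = s ^ n • ρ (ev lam l))
include hρ hs hlam

/-- The hypothesis `hs` says that D n behaves as a differential operator of order n + 1 whose symbol
is the bracket: n + 1 commutators leave an operator of the action, and any further one is zero by
`comm_action`. -/
theorem comm_eq_zero_of_length {n : ℕ} {l : List (Hgs 𝒮)} (hl : n + 1 < l.length) :
    comm 𝒲 ρ (D n) l = 0 := by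
  have h := hs n (l.take (n + 1)) (by simp; omega)
  rw [← List.take_append_drop (n + 1) l, comm_append, h, comm_sgn]
  have h1 : l.drop (n + 1) ≠ [] := by
    intro h0
    have := congrArg List.length h0
    simp at this
    omega
  rw [show ev lam (l.take (n + 1)) = (br hlam (l.take (n + 1))).val from rfl,
    comm_action hρ _ h1, smul_zero]

include hD in
/-- Insertion of a bracket into an iterated commutator. -/
theorem comm_br_cons (m : ℕ) (I J : List (Hgs 𝒮)) :
    comm 𝒲 ρ (D m) (br hlam I :: J) =
      (ldeg J + ldeg I * ldeg J).negOnePow • (comm 𝒲 ρ (D m) J * ρ (ev lam I)) +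
        (ldeg I).negOnePow • (ρ (ev lam I) * comm 𝒲 ρ (D m) J) := by
  rw [(comm_lsym hρ (hD m)).back, comm_snoc,
    gradedCommutator_apply 𝒲 ((hD m).comm hρ J) (hρ _ _ (br hlam I).mem)]
  change ((1 + ldeg I) * ldeg J).negOnePow •
    (_ - ((1 + ldeg J) * (1 + ldeg I)).negOnePow • _) = _
  rw [smul_sub, sgn_smul_sgn, sub_eq_add_neg, neg_sgn]
  exact congrArg₂ (· + ·) (sgn_congr (by grind) rfl) (sgn_congr (by grind) rfl)

include hlam0

/-- The exponent is the length plus one instead of minus one; both give the same sign since s is its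
own inverse, and no truncated subtraction occurs. -/
theorem comm_mul_pred {m : ℕ} {I : List (Hgs 𝒮)} (hm : m + 1 = I.length) :
    comm 𝒲 ρ (D m) I = s ^ (I.length + 1) • ρ (ev lam I) := by
  rw [hs m I hm.symm, ← hm, pow_succ, pow_succ, mul_assoc, Int.units_mul_self, mul_one]

include hD

/-- For a splitting with |I| + |J| = n only p = |I| - 1, |I|, |I| + 1 can contribute, since
otherwise one factor carries too many commutators. The middle value gives the composition of two
operations. The outer ones turn one factor into the operator of a bracket; the two together are the
two halves of the commutator with that operator, hence the operation with the bracket inserted. -/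
theorem comm_sqComp_eq (n : ℕ) (l : List (Hgs 𝒮)) (hl : l.length = n) :
    comm 𝒲 ρ (sqComp D n) l =
      spl (fun I J => (ldeg I).negOnePow •
        (comm 𝒲 ρ (D I.length) I * comm 𝒲 ρ (D J.length) J)) l +
      spl (fun I J => s ^ (I.length + 1) • comm 𝒲 ρ (D (J.length + 1)) (br hlam I :: J)) l := by
  have hnil : ev lam ([] : List (Hgs 𝒮)) = 0 := by rw [ev]; simp [hlam0]
  rw [comm_sqComp hρ hD]
  have key : ∀ I J : List (Hgs 𝒮), (I ++ J).Perm l → ∑ p ∈ Finset.range (n + 1),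
      (ldeg I).negOnePow • (comm 𝒲 ρ (D p) I * comm 𝒲 ρ (D (n - p)) J) =
      (ldeg I).negOnePow • (comm 𝒲 ρ (D I.length) I * comm 𝒲 ρ (D J.length) J) +
      ((ldeg I).negOnePow • s ^ (I.length + 1) •
        (ρ (ev lam I) * comm 𝒲 ρ (D (J.length + 1)) J) +
      (ldeg I).negOnePow • s ^ (J.length + 1) •
        (comm 𝒲 ρ (D (I.length + 1)) I * ρ (ev lam J))) := by
    intro I J hp
    have hij : I.length + J.length = n := by rw [← hl, ← hp.length_eq, List.length_append]
    have hj : n - I.length = J.length := by omega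
    rw [← Finset.sum_erase_add _ _ (Finset.mem_range.2 (show I.length < n + 1 by omega)), hj,
      add_comm]
    congr 1
    -- The contribution of p = |I| - 1 is written as a sum with a test on p. If I is empty there is
    -- no such p, and the left side vanishes because the bracket without entries is zero.
    have e1 : (ldeg I).negOnePow • s ^ (I.length + 1) •
        (ρ (ev lam I) * comm 𝒲 ρ (D (J.length + 1)) J) =
        ∑ p ∈ Finset.range (n + 1), if p + 1 = I.length then (ldeg I).negOnePow •
          (comm 𝒲 ρ (D p) I * comm 𝒲 ρ (D (n - p)) J) else 0 := by
      rcases Nat.eq_zero_or_pos I.length with h | h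
      · rw [List.length_eq_zero_iff.1 h, hnil]
        simp
      · rw [Finset.sum_eq_single (I.length - 1)]
        · rw [if_pos (by omega), comm_mul_pred hρ hlam hlam0 hs (by omega : I.length - 1 + 1 = _),
            sgn_mul]
          congr 6; omega
        · intro p _ hp; rw [if_neg (by omega)]
        · intro hp; exact absurd (Finset.mem_range.2 (by omega)) hp
    have e2 : (ldeg I).negOnePow • s ^ (J.length + 1) •
        (comm 𝒲 ρ (D (I.length + 1)) I * ρ (ev lam J)) =
        ∑ p ∈ Finset.range (n + 1), if p = I.length + 1 then (ldeg I).negOnePow •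
          (comm 𝒲 ρ (D p) I * comm 𝒲 ρ (D (n - p)) J) else 0 := by
      rcases Nat.eq_zero_or_pos J.length with h | h
      · rw [List.length_eq_zero_iff.1 h, hnil, Finset.sum_eq_zero]
        · simp
        · intro p hp; rw [if_neg]; have := Finset.mem_range.1 hp; omega
      · rw [Finset.sum_eq_single (I.length + 1)]
        · rw [if_pos rfl, comm_mul_pred hρ hlam hlam0 hs (by omega : n - (I.length + 1) + 1 = _),
            mul_sgn]
        · intro p _ hp; rw [if_neg hp]
        · intro hp; exact absurd (Finset.mem_range.2 (by omega)) hp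
    rw [e1, e2, ← Finset.sum_add_distrib]
    rw [← Finset.sum_subset (Finset.erase_subset I.length (Finset.range (n + 1)))]
    · refine Finset.sum_congr rfl fun p hp => ?_
      have h1 := Finset.mem_erase.1 hp
      have h2 := Finset.mem_range.1 h1.2
      rcases lt_trichotomy (p + 1) I.length with h | h | h
      · rw [comm_eq_zero_of_length hρ hlam hs h]; simp
      · rw [if_pos h, if_neg (by omega), add_zero]
      · rcases eq_or_ne p (I.length + 1) with h' | h'
        · rw [if_neg (by omega), if_pos h', zero_add]
        · rw [comm_eq_zero_of_length hρ hlam hs (n := n - p) (l := J) (by have := h1.1; omega)]; simp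
    · intro p hp hp'
      have : p = I.length := by by_contra h; exact hp' (Finset.mem_erase.2 ⟨h, hp⟩)
      rw [if_neg (by omega), if_neg (by omega), add_zero]
  rw [spl_congr key, spl_add, spl_add]
  congr 1
  -- Renaming the parts in the sum with the bracket of J lets it join the sum with the bracket of I.
  rw [spl_swap (fun I J => (ldeg I).negOnePow • s ^ (J.length + 1) •
        (comm 𝒲 ρ (D (I.length + 1)) I * ρ (ev lam J))), ← spl_add]
  refine spl_congr fun I J _ => ?_
  rw [comm_br_cons hρ hD hlam hs, smul_add, add_comm, smul_comm (s ^ _), smul_comm (s ^ _)]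
  congr 1
  rw [sgn_smul_sgn, add_comm]

/-- With one more operator, |I| + |J| = n + 1, only p = |I| - 1 and p = |I| survive, and in both
cases one factor is the operator of a bracket. Together they are an iterated commutator of D |J|
with |J| + 1 operators, which is itself the operator of a bracket by `hs`; the sum is the operator
of the Jacobiator. -/
theorem comm_sqComp_eq_action (n : ℕ) (l : List (Hgs 𝒮)) (hl : l.length = n + 1) :
    comm 𝒲 ρ (sqComp D n) l = s ^ n • ρ (spl (fun I J => ev lam (br hlam I :: J)) l) := by
  have hnil : ev lam ([] : List (Hgs 𝒮)) = 0 := by rw [ev]; simp [hlam0]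
  rw [comm_sqComp hρ hD]
  have key : ∀ I J : List (Hgs 𝒮), (I ++ J).Perm l → ∑ p ∈ Finset.range (n + 1),
      (ldeg I).negOnePow • (comm 𝒲 ρ (D p) I * comm 𝒲 ρ (D (n - p)) J) =
      (ldeg I).negOnePow • s ^ (I.length + 1) •
        (ρ (ev lam I) * comm 𝒲 ρ (D J.length) J) +
      (ldeg I).negOnePow • s ^ (J.length + 1) •
        (comm 𝒲 ρ (D I.length) I * ρ (ev lam J)) := by
    intro I J hp
    have hij : I.length + J.length = n + 1 := by rw [← hl, ← hp.length_eq, List.length_append]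
    have e1 : (ldeg I).negOnePow • s ^ (I.length + 1) •
        (ρ (ev lam I) * comm 𝒲 ρ (D J.length) J) =
        ∑ p ∈ Finset.range (n + 1), if p + 1 = I.length then (ldeg I).negOnePow •
          (comm 𝒲 ρ (D p) I * comm 𝒲 ρ (D (n - p)) J) else 0 := by
      rcases Nat.eq_zero_or_pos I.length with h | h
      · rw [List.length_eq_zero_iff.1 h, hnil]
        simp
      · rw [Finset.sum_eq_single (I.length - 1)]
        · rw [if_pos (by omega), comm_mul_pred hρ hlam hlam0 hs (by omega : I.length - 1 + 1 = _),
            sgn_mul]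
          congr 6; omega
        · intro p _ hp; rw [if_neg (by omega)]
        · intro hp; exact absurd (Finset.mem_range.2 (by omega)) hp
    have e2 : (ldeg I).negOnePow • s ^ (J.length + 1) •
        (comm 𝒲 ρ (D I.length) I * ρ (ev lam J)) =
        ∑ p ∈ Finset.range (n + 1), if p = I.length then (ldeg I).negOnePow •
          (comm 𝒲 ρ (D p) I * comm 𝒲 ρ (D (n - p)) J) else 0 := by
      rcases Nat.eq_zero_or_pos J.length with h | h
      · rw [List.length_eq_zero_iff.1 h, hnil, Finset.sum_eq_zero]
        · simp
        · intro p hp; rw [if_neg]; have := Finset.mem_range.1 hp; omega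
      · rw [Finset.sum_eq_single I.length]
        · rw [if_pos rfl, comm_mul_pred hρ hlam hlam0 hs (by omega : n - I.length + 1 = _),
            mul_sgn]
        · intro p _ hp; rw [if_neg hp]
        · intro hp; exact absurd (Finset.mem_range.2 (by omega)) hp
    rw [e1, e2, ← Finset.sum_add_distrib]
    refine Finset.sum_congr rfl fun p hp => ?_
    have h2 := Finset.mem_range.1 hp
    rcases lt_trichotomy (p + 1) I.length with h | h | h
    · rw [comm_eq_zero_of_length hρ hlam hs h]; simp
    · rw [if_pos h, if_neg (by omega), add_zero]
    · rcases eq_or_ne p I.length with h' | h'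
      · rw [if_neg (by omega), if_pos h', zero_add]
      · rw [comm_eq_zero_of_length hρ hlam hs (n := n - p) (l := J) (by omega)]; simp
  rw [spl_congr key, spl_add, spl_map, ← spl_smul]
  rw [spl_swap (fun I J => (ldeg I).negOnePow • s ^ (J.length + 1) •
        (comm 𝒲 ρ (D I.length) I * ρ (ev lam J))), ← spl_add]
  refine spl_congr fun I J hp => ?_
  have hij : I.length + J.length = n + 1 := by rw [← hl, ← hp.length_eq, List.length_append]
  have h1 := hs J.length (br hlam I :: J) rfl
  have h2 : ρ (ev lam (br hlam I :: J)) = s ^ J.length • comm 𝒲 ρ (D J.length) (br hlam I :: J) := by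
    rw [h1, smul_smul, ← pow_add, ← two_mul, pow_mul, sq, Int.units_mul_self, one_pow, one_smul]
  -- As n = |I| + |J| - 1, the two exponents have the same parity; adding squares of s avoids
  -- subtraction.
  have h3 : s ^ n * s ^ J.length = s ^ (I.length + 1) := by
    have : s ^ (I.length + 1) = s ^ (I.length + 1) * s ^ (2 * J.length) := by
      rw [pow_mul, sq, Int.units_mul_self, one_pow, mul_one]
    rw [this, ← pow_add, ← pow_add]
    have : I.length + 1 + 2 * J.length = n + J.length + 2 := by omega
    rw [this, pow_succ, pow_succ, mul_assoc, Int.units_mul_self, mul_one]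
  rw [h2, ← mul_smul (s ^ n), h3, comm_br_cons hρ hD hlam hs, smul_add, add_comm, smul_comm (s ^ _),
    smul_comm (s ^ _)]
  congr 1
  rw [sgn_smul_sgn, add_comm]

/-- If `lam` satisfies the Jacobi identities, the iterated commutators of the square of `∑ D_p`
with too many operators vanish. -/
theorem comm_sqComp_eq_zero
    (hjac : ∀ l : List (Hgs 𝒮), spl (fun I J => ev lam (br hlam I :: J)) l = 0)
    (n : ℕ) (l : List (Hgs 𝒮)) (hl : n < l.length) : comm 𝒲 ρ (sqComp D n) l = 0 := by
  rw [← List.take_append_drop (n + 1) l, comm_append,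
    comm_sqComp_eq_action hρ hD hlam hlam0 hs n _ (by simp; omega), hjac, map_zero, smul_zero,
    comm_zero]

end Derived

end SHLR

namespace SHLR

open scoped DirectSum TensorProduct
open HasDeg (deg)

/-! ### Generators of the graded symmetric algebra and induction -/

section Generators

/-- Permutations are generated by exchanges of neighbours. This brings lists of generators into a
normal form. -/
theorem perm_of_swap {α : Type*} {P : List α → Prop}
    (swap : ∀ p x y q, P (p ++ x :: y :: q) → P (p ++ y :: x :: q)) {l m : List α}
    (h : l.Perm m) : P l → P m := by
  suffices ∀ p, P (p ++ l) → P (p ++ m) from this []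
  induction h with
  | nil => exact fun _ => id
  | cons x _ ih => exact fun p hp => by simpa using ih (p ++ [x]) (by simpa using hp)
  | swap x y l => exact fun p => swap p y x l
  | trans _ _ h1 h2 => exact fun p hp => h2 p (h1 p hp)

variable {K : Type*} [Field K]
  {A : Type*} [Ring A] [Algebra K A] (𝒜 : ℤ → Submodule K A) [GradedAlgebra 𝒜]
  {L : Type*} [AddCommGroup L] [Module K L] [Module A L] [IsScalarTower K A L]
  (ℒ : ℤ → Submodule K L) [DirectSum.Decomposition ℒ] [SetLike.GradedSMul 𝒜 ℒ]

/-- Homogeneous generators of `S_A^• L`. -/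
abbrev Gen := Hgs 𝒜 ⊕ Hgs ℒ

instance : HasDeg (Gen 𝒜 ℒ) := ⟨Sum.elim Hgs.d Hgs.d⟩

variable {𝒜 ℒ}

@[simp] theorem deg_inl (a : Hgs 𝒜) : deg (Sum.inl a : Gen 𝒜 ℒ) = deg a := rfl
@[simp] theorem deg_inr (ξ : Hgs ℒ) : deg (Sum.inr ξ : Gen 𝒜 ℒ) = deg ξ := rfl

/-- A generator as an element of `S_A^• L`. -/
def emb : Gen 𝒜 ℒ → Hgs (SymAlg.grade 𝒜 ℒ)
  | Sum.inl a => ⟨a.d, SymAlg.ιA 𝒜 ℒ a.val, SymAlg.ιA_mem a.mem⟩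
  | Sum.inr ξ => ⟨ξ.d, SymAlg.ιL 𝒜 ℒ ξ.val, SymAlg.ιL_mem ξ.mem⟩

@[simp] theorem deg_emb (y : Gen 𝒜 ℒ) : deg (emb y) = deg y := by cases y <;> rfl

@[simp] theorem ldeg_map_emb (g : List (Gen 𝒜 ℒ)) : ldeg (g.map emb) = ldeg g := by
  rw [ldeg, ldeg, List.map_map]
  exact congrArg _ (List.map_congr_left fun x _ => deg_emb x)

@[simp] theorem ldeg_map_inr (g : List (Hgs ℒ)) :
    ldeg (g.map (Sum.inr : Hgs ℒ → Gen 𝒜 ℒ)) = ldeg g := by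
  rw [ldeg, ldeg, List.map_map]; rfl

/-- The product of homogeneous elements. -/
def Hgs.mul {S : Type*} [Ring S] [Algebra K S] {𝒮 : ℤ → Submodule K S} [GradedAlgebra 𝒮]
    (x y : Hgs 𝒮) : Hgs 𝒮 := ⟨x.d + y.d, x.val * y.val, SetLike.GradedMul.mul_mem x.mem y.mem⟩

@[simp] theorem deg_hmul {S : Type*} [Ring S] [Algebra K S] {𝒮 : ℤ → Submodule K S}
    [GradedAlgebra 𝒮] (x y : Hgs 𝒮) : deg (x.mul y) = deg x + deg y := rfl

/-- The product of a homogeneous scalar and a homogeneous vector. -/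
def Hgs.smul {M : Type*} [AddCommGroup M] [Module K M] [Module A M] {ℳ : ℤ → Submodule K M}
    [SetLike.GradedSMul 𝒜 ℳ] (a : Hgs 𝒜) (ξ : Hgs ℳ) : Hgs ℳ :=
  ⟨a.d + ξ.d, a.val • ξ.val, SetLike.GradedSMul.smul_mem a.mem ξ.mem⟩

@[simp] theorem deg_hsmul {M : Type*} [AddCommGroup M] [Module K M] [Module A M]
    {ℳ : ℤ → Submodule K M} [SetLike.GradedSMul 𝒜 ℳ] (a : Hgs 𝒜) (ξ : Hgs ℳ) :
    deg (a.smul ξ) = deg a + deg ξ := rfl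

/-- Induction over homogeneous elements of `S_A^• L` of a fixed degree. -/
theorem hgs_mem_induction {P : Hgs (SymAlg.grade 𝒜 ℒ) → Prop}
    (zero : ∀ i, P ⟨i, 0, Submodule.zero_mem _⟩)
    (lin : ∀ i (c : K) x y (hx : x ∈ SymAlg.grade 𝒜 ℒ i) (hy : y ∈ SymAlg.grade 𝒜 ℒ i) h,
      P ⟨i, x, hx⟩ → P ⟨i, y, hy⟩ → P ⟨i, c • x + y, h⟩)
    (mul : ∀ x y, P x → P y → P (x.mul y)) (gen : ∀ y, P (emb y)) (x) : P x := by
  obtain ⟨i, x, hx⟩ := x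
  have hm : ∀ i x (h : SymAlg.IsMonomial 𝒜 ℒ i x), P ⟨i, x, Submodule.subset_span h⟩ := by
    intro i x h
    induction h with
    | one =>
      convert gen (Sum.inl ⟨0, 1, SetLike.GradedOne.one_mem⟩) using 1
      simp only [emb, SymAlg.ιA_one]
    | mulA ha _ ih => exact mul _ _ (gen (Sum.inl ⟨_, _, ha⟩)) ih
    | mulL ha _ ih => exact mul _ _ (gen (Sum.inr ⟨_, _, ha⟩)) ih
  have key : ∀ hx' : x ∈ SymAlg.grade 𝒜 ℒ i, P ⟨i, x, hx'⟩ := by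
    induction hx using Submodule.span_induction with
    | mem x h => exact fun _ => hm i x h
    | zero => exact fun _ => zero i
    | add x y hx hy h1 h2 =>
      intro h
      have := lin i 1 x y hx hy (by rw [one_smul]; exact h) (h1 hx) (h2 hy)
      simpa only [one_smul] using this
    | smul c x hx h1 =>
      intro h
      have := lin i c x 0 hx (Submodule.zero_mem _) (by rw [add_zero]; exact h) (h1 hx) (zero i)
      simpa only [add_zero] using this
  exact key hx

/-- Induction over lists of homogeneous elements of `S_A^• L`: reduction to generators. -/
theorem hgs_induction {P : List (Hgs (SymAlg.grade 𝒜 ℒ)) → Prop}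
    (swap : ∀ p x y q, P (p ++ x :: y :: q) → P (p ++ y :: x :: q))
    (zero : ∀ i l, P (⟨i, 0, Submodule.zero_mem _⟩ :: l))
    (lin : ∀ i (c : K) x y (hx : x ∈ SymAlg.grade 𝒜 ℒ i) (hy : y ∈ SymAlg.grade 𝒜 ℒ i) h l,
      P (⟨i, x, hx⟩ :: l) → P (⟨i, y, hy⟩ :: l) → P (⟨i, c • x + y, h⟩ :: l))
    (mul : ∀ x y l, P (x :: l) → P (y :: l) → P (x.mul y :: l))
    (gen : ∀ g : List (Gen 𝒜 ℒ), P (g.map emb)) (l) : P l := by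
  -- The induction is strengthened by collecting, in front of the list, the entries that have
  -- already been reduced to generators.
  suffices ∀ g : List (Gen 𝒜 ℒ), P (g.map emb ++ l) from this []
  induction l with
  | nil => simpa using gen
  | cons x l ih =>
    intro g
    refine perm_of_swap swap List.perm_middle.symm ?_
    exact hgs_mem_induction (P := fun x => P (x :: (g.map emb ++ l))) (fun i => zero i _)
      (fun i c x y hx hy h => lin i c x y hx hy h _) (fun x y => mul x y _)
      (fun y => by simpa using ih (y :: g)) x

/-- Up to order, a list of generators has no entry, one entry, or at least two entries in `A`. -/
theorem gen_induction {P : List (Gen 𝒜 ℒ) → Prop}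
    (swap : ∀ p x y q, P (p ++ x :: y :: q) → P (p ++ y :: x :: q))
    (hL : ∀ l : List (Hgs ℒ), P (l.map Sum.inr))
    (hA : ∀ a (l : List (Hgs ℒ)), P (Sum.inl a :: l.map Sum.inr))
    (hAA : ∀ a b g, P (Sum.inl a :: Sum.inl b :: g)) (g) : P g := by
  have key : (∃ l : List (Hgs ℒ), (l.map Sum.inr).Perm g) ∨
      (∃ (a : Hgs 𝒜) (l : List (Hgs ℒ)), (Sum.inl a :: l.map Sum.inr).Perm g) ∨
      ∃ (a b : Hgs 𝒜) (g' : List (Gen 𝒜 ℒ)), (Sum.inl a :: Sum.inl b :: g').Perm g := by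
    induction g with
    | nil => exact Or.inl ⟨[], by simp⟩
    | cons y g ih =>
      rcases y with a | ξ
      · rcases ih with ⟨l, h⟩ | ⟨b, l, h⟩ | ⟨b, c, g', h⟩
        · exact Or.inr (Or.inl ⟨a, l, h.cons _⟩)
        · exact Or.inr (Or.inr ⟨a, b, _, h.cons _⟩)
        · exact Or.inr (Or.inr ⟨a, b, _, h.cons _⟩)
      · rcases ih with ⟨l, h⟩ | ⟨b, l, h⟩ | ⟨b, c, g', h⟩
        · exact Or.inl ⟨ξ :: l, h.cons _⟩
        · exact Or.inr (Or.inl ⟨b, ξ :: l, (List.Perm.swap _ _ _).trans (h.cons _)⟩)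
        · exact Or.inr (Or.inr ⟨b, c, Sum.inr ξ :: g',
            (List.perm_middle (l₁ := [Sum.inl b, Sum.inl c])).trans (h.cons _)⟩)
  rcases key with ⟨l, h⟩ | ⟨b, l, h⟩ | ⟨b, c, g', h⟩
  · exact perm_of_swap swap h (hL l)
  · exact perm_of_swap swap h (hA b l)
  · exact perm_of_swap swap h (hAA b c g')

/-- The relations impose graded commutativity only on generators. For a fixed second factor the
identity is linear and stable under products in the first one, and vice versa, so a double induction
spreads it. -/
instance [IsGradedComm 𝒜] : IsGradedComm (SymAlg.grade 𝒜 ℒ) where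
  comm := by
    have h : ∀ x y : Hgs (SymAlg.grade 𝒜 ℒ),
        x.val * y.val = (deg x * deg y).negOnePow • (y.val * x.val) := by
      intro x y
      refine hgs_mem_induction (P := fun x => x.val * y.val =
        (deg x * deg y).negOnePow • (y.val * x.val)) (fun i => by simp) ?_ ?_ ?_ x
      · intro i c x z hx hz h h1 h2
        simp only [deg_mk] at h1 h2 ⊢
        rw [add_mul, mul_add, smul_mul_assoc, h1, h2, mul_smul_comm, smul_add, smul_sgn]
      · intro x z h1 h2
        simp only [Hgs.mul, deg_mk]
        rw [mul_assoc, h2, mul_sgn, ← mul_assoc, h1, sgn_mul, mul_assoc, sgn_smul_sgn]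
        exact sgn_congr (by change Even (_ * _ + _ * _ - (deg x + deg z) * _); grind) rfl
      · intro g
        refine hgs_mem_induction (P := fun y => (emb g).val * y.val =
          (deg (emb g) * deg y).negOnePow • (y.val * (emb g).val)) (fun i => by simp) ?_ ?_ ?_ y
        · intro i c x z hx hz h h1 h2
          simp only [deg_mk] at h1 h2 ⊢
          rw [mul_add, add_mul, mul_smul_comm, h1, h2, smul_mul_assoc, smul_add, smul_sgn]
        · intro x z h1 h2
          simp only [Hgs.mul, deg_mk]
          rw [← mul_assoc, h1, sgn_mul, mul_assoc, h2, mul_sgn, mul_assoc, sgn_smul_sgn]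
          exact sgn_congr (by change Even (_ * _ + _ * _ - _ * (deg x + deg z)); grind) rfl
        · intro k
          rcases g with a | ξ <;> rcases k with b | ζ
          · simp only [emb, deg_mk]
            rw [SymAlg.ιA_mul a.mem b.mem, SymAlg.ιA_mul b.mem a.mem,
              IsGradedComm.comm _ _ _ _ a.mem b.mem, map_sgn]
          · exact SymAlg.ιA_comm_ιL a.mem ζ.mem
          · simp only [emb, deg_mk]
            rw [SymAlg.ιA_comm_ιL b.mem ξ.mem, sgn_smul_sgn, sgn_eq_self]
            exact ⟨ξ.d * b.d, by ring⟩
          · exact SymAlg.ιL_comm ξ.mem ζ.mem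
    exact fun i j a b ha hb => h ⟨i, a, ha⟩ ⟨j, b, hb⟩

end Generators

end SHLR

namespace SHLR

open scoped DirectSum TensorProduct
open HasDeg (deg)

/-! ### Derivations of the graded symmetric algebra from their values on generators -/

section HLin

variable {K : Type*} [Field K] {M : Type*} [AddCommGroup M] [Module K M] {ℳ : ℤ → Submodule K M}
  {N : Type*} [AddCommGroup N] [Module K N]

/-- Linearity of a map on homogeneous elements. -/
def HLin (F : Hgs ℳ → N) : Prop :=
  ∀ (i : ℤ) (c : K) (x y : M) (hx : x ∈ ℳ i) (hy : y ∈ ℳ i) (h : c • x + y ∈ ℳ i),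
    F ⟨i, c • x + y, h⟩ = c • F ⟨i, x, hx⟩ + F ⟨i, y, hy⟩

theorem HLin.zero {F : Hgs ℳ → N} (hF : HLin F) (i : ℤ) : F ⟨i, 0, (ℳ i).zero_mem⟩ = 0 := by
  have h := hF i 1 0 0 (ℳ i).zero_mem (ℳ i).zero_mem (by simp)
  simpa using h

theorem HLin.sgn {F : Hgs ℳ → N} (hF : HLin F) (s : ℤ → ℤˣ) : HLin fun x => s (deg x) • F x :=
  fun i c x y hx hy h => by simp only [hF i c x y hx hy h, deg_mk, smul_add, smul_sgn]

theorem LLin.hlin {F : List (Hgs ℳ) → N} (hF : LLin F) (l : List (Hgs ℳ)) :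
    HLin fun x => F (x :: l) := hF [] l

/-- A graded symmetric operation that is linear in its first slot is linear in every slot. -/
theorem LSym.llin {F : List (Hgs ℳ) → N} (h : LSym F) (h' : ∀ l, HLin fun x => F (x :: l)) :
    LLin F := fun p q i c x y hx hy hh => by
  have h1 := h' (p ++ q) i c x y hx hy hh
  simp only at h1
  rw [h.front, h.front p ⟨i, x, hx⟩, h.front p ⟨i, y, hy⟩, h1, smul_add, smul_sgn]
  rfl

variable [DirectSum.Decomposition ℳ]

/-- The linear map with given values on homogeneous elements. -/
def HLin.lift {F : Hgs ℳ → N} (hF : HLin F) : M →ₗ[K] N :=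
  homogLift ℳ fun i =>
    { toFun := fun x => F ⟨i, x, x.2⟩
      map_add' := fun x y => by
        have h := hF i 1 x y x.2 y.2 (by rw [one_smul]; exact (x + y).2)
        simp only [one_smul] at h
        exact h
      map_smul' := fun c x => by
        have h := hF i c x 0 x.2 (ℳ i).zero_mem (by rw [add_zero]; exact (c • x).2)
        simp only [add_zero, hF.zero] at h
        exact h }

theorem HLin.lift_apply {F : Hgs ℳ → N} (hF : HLin F) (x : Hgs ℳ) : hF.lift x.val = F x :=
  homogLift_apply ℳ _ x.mem

end HLin

section Derivations

variable {K : Type*} [Field K]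
  {A : Type*} [Ring A] [Algebra K A] {𝒜 : ℤ → Submodule K A} [GradedAlgebra 𝒜]
  {L : Type*} [AddCommGroup L] [Module K L] [Module A L] [IsScalarTower K A L]
  {ℒ : ℤ → Submodule K L} [DirectSum.Decomposition ℒ] [SetLike.GradedSMul 𝒜 ℒ]

theorem hcomm {S : Type*} [Ring S] [Algebra K S] {𝒮 : ℤ → Submodule K S} [IsGradedComm 𝒮]
    (x y : Hgs 𝒮) : x.val * y.val = (deg x * deg y).negOnePow • (y.val * x.val) :=
  IsGradedComm.comm _ _ _ _ x.mem y.mem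

theorem hcomm_assoc {S : Type*} [Ring S] [Algebra K S] {𝒮 : ℤ → Submodule K S} [IsGradedComm 𝒮]
    (x y : Hgs 𝒮) (z : S) :
    z * x.val * y.val = (deg x * deg y).negOnePow • (z * y.val * x.val) := by
  rw [mul_assoc, hcomm, mul_sgn, mul_assoc]

/-- Derivations of `S_A^• L`, without reference to a degree. -/
def IsDer (d : SymAlg 𝒜 ℒ →ₗ[K] SymAlg 𝒜 ℒ) : Prop :=
  ∀ x y : Hgs (SymAlg.grade 𝒜 ℒ), d (x.val * y.val) =
    d x.val * y.val + (deg x * deg y).negOnePow • (d y.val * x.val)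

theorem IsDer.unique {d d' : SymAlg 𝒜 ℒ →ₗ[K] SymAlg 𝒜 ℒ} (h : IsDer d) (h' : IsDer d')
    (hg : ∀ y : Gen 𝒜 ℒ, d (emb y).val = d' (emb y).val) : d = d' := by
  refine linear_ext_homog (SymAlg.grade 𝒜 ℒ) fun i x hx => ?_
  refine hgs_mem_induction (P := fun x => d x.val = d' x.val) (fun i => by simp) ?_ ?_ hg ⟨i, x, hx⟩
  · intro i c x y hx hy h h1 h2
    simp only at h1 h2 ⊢
    rw [map_add, map_add, map_smul, map_smul, h1, h2]
  · intro x y h1 h2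
    exact (h x y).trans (by rw [h1, h2]; exact (h' x y).symm)

/-- Values on generators that extend to a derivation. -/
structure GoodDer (f : Gen 𝒜 ℒ → SymAlg 𝒜 ℒ) : Prop where
  linA : HLin fun a => f (Sum.inl a)
  linL : HLin fun ξ => f (Sum.inr ξ)
  mulA : ∀ a b : Hgs 𝒜, f (Sum.inl (a.mul b)) = f (Sum.inl a) * SymAlg.ιA 𝒜 ℒ b.val +
    (deg a * deg b).negOnePow • (f (Sum.inl b) * SymAlg.ιA 𝒜 ℒ a.val)
  smulL : ∀ (a : Hgs 𝒜) (ξ : Hgs ℒ), f (Sum.inr (a.smul ξ)) =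
    f (Sum.inl a) * SymAlg.ιL 𝒜 ℒ ξ.val +
      (deg a * deg ξ).negOnePow • (f (Sum.inr ξ) * SymAlg.ιA 𝒜 ℒ a.val)

/-- The operator `x ↦ (-1)^{jx} x`. -/
def twist {S : Type*} [AddCommGroup S] [Module K S] (𝒮 : ℤ → Submodule K S)
    [DirectSum.Decomposition 𝒮] (j : ℤ) : S →ₗ[K] S :=
  HLin.lift (ℳ := 𝒮) (F := fun x => (deg x * j).negOnePow • x.val)
    (fun i c x y hx hy h => by simp only [deg_mk, smul_add, smul_sgn])

theorem twist_apply {S : Type*} [AddCommGroup S] [Module K S] {𝒮 : ℤ → Submodule K S}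
    [DirectSum.Decomposition 𝒮] (j : ℤ) (x : Hgs 𝒮) :
    twist 𝒮 j x.val = (deg x * j).negOnePow • x.val := HLin.lift_apply _ x

/-- Right multiplication by `y` on pairs `(x, d x)`, where `d y = z` and `y` has degree `j`. -/
def derMul (j : ℤ) (y z : SymAlg 𝒜 ℒ) : Module.End K (SymAlg 𝒜 ℒ × SymAlg 𝒜 ℒ) :=
  LinearMap.prod (LinearMap.mulRight K y ∘ₗ LinearMap.fst K _ _)
    (LinearMap.mulRight K y ∘ₗ LinearMap.snd K _ _ +
      LinearMap.mulLeft K z ∘ₗ twist (SymAlg.grade 𝒜 ℒ) j ∘ₗ LinearMap.fst K _ _)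

theorem derMul_apply (j : ℤ) (y z : SymAlg 𝒜 ℒ) (x : Hgs (SymAlg.grade 𝒜 ℒ)) (w : SymAlg 𝒜 ℒ) :
    derMul j y z (x.val, w) = (x.val * y, w * y + (deg x * j).negOnePow • (z * x.val)) := by
  refine Prod.ext rfl ?_
  change w * y + z * twist _ j x.val = _
  rw [twist_apply, mul_sgn]

theorem derMul_lin (j : ℤ) (c : K) (y z y' z' : SymAlg 𝒜 ℒ) :
    derMul (𝒜 := 𝒜) (ℒ := ℒ) j (c • y + y') (c • z + z') = c • derMul j y z + derMul j y' z' := by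
  refine LinearMap.ext fun ⟨x, w⟩ => Prod.ext ?_ ?_
  · change x * (c • y + y') = c • (x * y) + x * y'
    rw [mul_add, mul_smul_comm]
  · change w * (c • y + y') + (c • z + z') * twist _ j x =
      c • (w * y + z * twist _ j x) + (w * y' + z' * twist _ j x)
    simp only [mul_add, add_mul, smul_mul_assoc, mul_smul_comm, smul_add]
    abel

theorem end_prod_ext {f g : Module.End K (SymAlg 𝒜 ℒ × SymAlg 𝒜 ℒ)}
    (h : ∀ (x : Hgs (SymAlg.grade 𝒜 ℒ)) w, f (x.val, w) = g (x.val, w)) : f = g := by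
  refine LinearMap.prod_ext (linear_ext_homog (SymAlg.grade 𝒜 ℒ) fun i x hx => h ⟨i, x, hx⟩ 0)
    (LinearMap.ext fun w => h ⟨0, 0, Submodule.zero_mem _⟩ w)

variable [IsGradedComm 𝒜]

/-- Right multiplications on pairs (x, dx) compose to the right multiplication by the product
exactly when the derivative of the product is formed by the Leibniz rule. The order is reversed,
which is why the opposite algebra appears later. -/
theorem derMul_mul (x y : Hgs (SymAlg.grade 𝒜 ℒ)) (z w v : SymAlg 𝒜 ℒ)
    (hv : v = z * y.val + (deg x * deg y).negOnePow • (w * x.val)) :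
    derMul (deg y) y.val w * derMul (deg x) x.val z =
      derMul (deg x + deg y) (x.val * y.val) v := by
  refine end_prod_ext fun u t => ?_
  rw [Module.End.mul_apply, derMul_apply, derMul_apply, hv]
  refine (derMul_apply (deg y) y.val w (u.mul x) _).trans ?_
  simp only [Hgs.mul, add_mul, sgn_mul, smul_add, sgn_smul_sgn, mul_assoc]
  refine Prod.ext rfl ?_
  change _ + ((deg u + deg x) * deg y).negOnePow • _ = _
  rw [add_assoc]
  simp only [hcomm u y, hcomm u x, mul_sgn, sgn_smul_sgn]
  refine congrArg₂ (· + ·) rfl (congrArg₂ (· + ·) ?_ ?_)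
  · exact sgn_congr (by grind) rfl
  · exact sgn_congr (by grind) rfl

end Derivations

end SHLR

namespace SHLR

open scoped DirectSum TensorProduct
open HasDeg (deg)

/-! ### Existence of derivations with given values on generators -/

section Derivations

variable {K : Type*} [Field K]
  {A : Type*} [Ring A] [Algebra K A] {𝒜 : ℤ → Submodule K A} [GradedAlgebra 𝒜]
  {L : Type*} [AddCommGroup L] [Module K L] [Module A L] [IsScalarTower K A L]
  {ℒ : ℤ → Submodule K L} [DirectSum.Decomposition ℒ] [SetLike.GradedSMul 𝒜 ℒ]

/-- The unit as a homogeneous element. -/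
def Hgs.one {S : Type*} [Ring S] [Algebra K S] (𝒮 : ℤ → Submodule K S) [GradedAlgebra 𝒮] :
    Hgs 𝒮 := ⟨0, 1, SetLike.GradedOne.one_mem⟩

theorem GoodDer.one {f : Gen 𝒜 ℒ → SymAlg 𝒜 ℒ} (hf : GoodDer f) :
    f (Sum.inl (Hgs.one 𝒜)) = 0 := by
  have h := hf.mulA (Hgs.one 𝒜) (Hgs.one 𝒜)
  have h1 : (Hgs.one 𝒜).mul (Hgs.one 𝒜) = Hgs.one 𝒜 := by simp [Hgs.mul, Hgs.one]
  have h2 : (Hgs.one 𝒜).val = 1 := rfl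
  have h3 : deg (Hgs.one 𝒜) = 0 := rfl
  rw [h1, h2, h3, SymAlg.ιA_one, mul_one, mul_zero, Int.negOnePow_zero, one_smul] at h
  exact left_eq_add.1 h

theorem derMul_one (j : ℤ) : derMul (𝒜 := 𝒜) (ℒ := ℒ) j 1 0 = 1 :=
  end_prod_ext fun x w => by rw [derMul_apply]; simp

theorem derMul_smul (s : ℤˣ) (j : ℤ) (y z : SymAlg 𝒜 ℒ) :
    derMul j (s • y) (s • z) = s • derMul j y z :=
  end_prod_ext fun x w => by
    rw [LinearMap.smul_apply, derMul_apply, derMul_apply, Prod.smul_mk, mul_sgn, mul_sgn, sgn_mul,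
      smul_add, smul_comm s]

variable [IsGradedComm 𝒜]

theorem derMul_comm (x y : Hgs (SymAlg.grade 𝒜 ℒ)) (z w : SymAlg 𝒜 ℒ) :
    derMul (deg y) y.val w * derMul (deg x) x.val z =
      (deg x * deg y).negOnePow • (derMul (deg x) x.val z * derMul (deg y) y.val w) := by
  rw [derMul_mul x y z w _ rfl, derMul_mul y x w z _ rfl, ← derMul_smul, add_comm (deg y),
    ← hcomm x y, smul_add, sgn_smul_sgn, add_comm (z * y.val),
    sgn_eq_self (x := z * y.val) (by grind)]

/-- Right multiplication by a generator on pairs `(x, d x)`, where `d` is given by `f`. -/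
def genMul (f : Gen 𝒜 ℒ → SymAlg 𝒜 ℒ) (y : Gen 𝒜 ℒ) :
    Module.End K (SymAlg 𝒜 ℒ × SymAlg 𝒜 ℒ) := derMul (deg y) (emb y).val (f y)

theorem genMul_mulA {f : Gen 𝒜 ℒ → SymAlg 𝒜 ℒ} (hf : GoodDer f) (a b : Hgs 𝒜) :
    genMul (K := K) f (Sum.inl b) * genMul f (Sum.inl a) = genMul f (Sum.inl (a.mul b)) := by
  have h : (emb (Sum.inl (a.mul b) : Gen 𝒜 ℒ)).val =
      (emb (Sum.inl a : Gen 𝒜 ℒ)).val * (emb (Sum.inl b : Gen 𝒜 ℒ)).val :=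
    (SymAlg.ιA_mul a.mem b.mem).symm
  rw [genMul, genMul, genMul, h, deg_inl, deg_inl, deg_inl, deg_hmul]
  exact derMul_mul (emb (Sum.inl a)) (emb (Sum.inl b)) _ _ _ (hf.mulA a b)

theorem genMul_smulL {f : Gen 𝒜 ℒ → SymAlg 𝒜 ℒ} (hf : GoodDer f) (a : Hgs 𝒜) (ξ : Hgs ℒ) :
    genMul (K := K) f (Sum.inr ξ) * genMul f (Sum.inl a) = genMul f (Sum.inr (a.smul ξ)) := by
  have h : (emb (Sum.inr (a.smul ξ) : Gen 𝒜 ℒ)).val =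
      (emb (Sum.inl a : Gen 𝒜 ℒ)).val * (emb (Sum.inr ξ : Gen 𝒜 ℒ)).val :=
    (SymAlg.ιA_mul_ιL a.mem ξ.mem).symm
  rw [genMul, genMul, genMul, h, deg_inl, deg_inr, deg_inr, deg_hsmul]
  exact derMul_mul (emb (Sum.inl a)) (emb (Sum.inr ξ)) _ _ _ (hf.smulL a ξ)

theorem genMul_comm (f : Gen 𝒜 ℒ → SymAlg 𝒜 ℒ) (x y : Gen 𝒜 ℒ) :
    genMul (K := K) f y * genMul f x = (deg x * deg y).negOnePow • (genMul f x * genMul f y) := by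
  have h := derMul_comm (emb x) (emb y) (f x) (f y)
  rw [deg_emb, deg_emb] at h
  exact h

theorem genMul_one {f : Gen 𝒜 ℒ → SymAlg 𝒜 ℒ} (hf : GoodDer f) :
    genMul (K := K) f (Sum.inl (Hgs.one 𝒜)) = 1 := by
  have h : (emb (Sum.inl (Hgs.one 𝒜) : Gen 𝒜 ℒ)).val = 1 := SymAlg.ιA_one
  rw [genMul, hf.one, h, derMul_one]

theorem genMul_linA {f : Gen 𝒜 ℒ → SymAlg 𝒜 ℒ} (hf : GoodDer f) :
    HLin fun a : Hgs 𝒜 => MulOpposite.op (genMul (K := K) f (Sum.inl a)) := fun i c x y hx hy h => by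
  rw [← MulOpposite.op_smul, ← MulOpposite.op_add]
  refine congrArg MulOpposite.op ?_
  simp only [genMul, hf.linA i c x y hx hy h, emb, map_add, map_smul]
  exact derMul_lin i c _ _ _ _

theorem genMul_linL {f : Gen 𝒜 ℒ → SymAlg 𝒜 ℒ} (hf : GoodDer f) :
    HLin fun a : Hgs ℒ => MulOpposite.op (genMul (K := K) f (Sum.inr a)) := fun i c x y hx hy h => by
  rw [← MulOpposite.op_smul, ← MulOpposite.op_add]
  refine congrArg MulOpposite.op ?_
  simp only [genMul, hf.linL i c x y hx hy h, emb, map_add, map_smul]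
  exact derMul_lin i c _ _ _ _

/-- The algebra map to the opposite algebra of the endomorphisms of pairs. -/
noncomputable def genMulData {f : Gen 𝒜 ℒ → SymAlg 𝒜 ℒ} (hf : GoodDer f) :
    SymAlg.LiftData (Module.End K (SymAlg 𝒜 ℒ × SymAlg 𝒜 ℒ))ᵐᵒᵖ 𝒜 ℒ where
  f := (genMul_linA hf).lift
  g := (genMul_linL hf).lift
  one := ((genMul_linA hf).lift_apply (Hgs.one 𝒜)).trans (congrArg MulOpposite.op (genMul_one hf))
  mul := fun {i j a b} ha hb => by
    have h1 := (genMul_linA hf).lift_apply ⟨i, a, ha⟩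
    have h2 := (genMul_linA hf).lift_apply ⟨j, b, hb⟩
    have h3 := (genMul_linA hf).lift_apply ((⟨i, a, ha⟩ : Hgs 𝒜).mul ⟨j, b, hb⟩)
    refine (congrArg₂ (· * ·) h1 h2).trans (Eq.trans ?_ h3.symm)
    exact congrArg MulOpposite.op (genMul_mulA hf ⟨i, a, ha⟩ ⟨j, b, hb⟩)
  smul := fun {i j a ξ} ha hξ => by
    have h1 := (genMul_linA hf).lift_apply ⟨i, a, ha⟩
    have h2 := (genMul_linL hf).lift_apply ⟨j, ξ, hξ⟩
    have h3 := (genMul_linL hf).lift_apply ((⟨i, a, ha⟩ : Hgs 𝒜).smul ⟨j, ξ, hξ⟩)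
    refine (congrArg₂ (· * ·) h1 h2).trans (Eq.trans ?_ h3.symm)
    exact congrArg MulOpposite.op (genMul_smulL hf ⟨i, a, ha⟩ ⟨j, ξ, hξ⟩)
  comm_smul := fun {i j a ξ} ha hξ => by
    have h1 := (genMul_linA hf).lift_apply ⟨i, a, ha⟩
    have h2 := (genMul_linL hf).lift_apply ⟨j, ξ, hξ⟩
    simp only at h1 h2
    rw [h1, h2]
    exact congrArg MulOpposite.op (genMul_comm f (Sum.inl ⟨i, a, ha⟩) (Sum.inr ⟨j, ξ, hξ⟩))
  comm := fun {i j ξ ζ} hξ hζ => by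
    have h1 := (genMul_linL hf).lift_apply ⟨i, ξ, hξ⟩
    have h2 := (genMul_linL hf).lift_apply ⟨j, ζ, hζ⟩
    simp only at h1 h2
    rw [h1, h2]
    exact congrArg MulOpposite.op (genMul_comm f (Sum.inr ⟨i, ξ, hξ⟩) (Sum.inr ⟨j, ζ, hζ⟩))

theorem genMulData_emb {f : Gen 𝒜 ℒ → SymAlg 𝒜 ℒ} (hf : GoodDer f) (y : Gen 𝒜 ℒ) :
    (SymAlg.lift (genMulData (K := K) hf) (emb y).val).unop =
      derMul (deg (emb y)) (emb y).val (f y) := by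
  rw [deg_emb]
  rcases y with a | ξ
  · exact congrArg MulOpposite.unop
      ((SymAlg.lift_ιA _ a.val).trans ((genMul_linA hf).lift_apply a))
  · exact congrArg MulOpposite.unop
      ((SymAlg.lift_ιL _ ξ.val).trans ((genMul_linL hf).lift_apply ξ))

/-- The universal property yields an algebra map into the opposite endomorphisms of pairs. By
induction every homogeneous y acts as right multiplication by (y, z) for some z, and
multiplicativity of the map is the Leibniz rule for y ↦ z. -/
theorem exists_der {f : Gen 𝒜 ℒ → SymAlg 𝒜 ℒ} (hf : GoodDer f) :
    ∃ d : SymAlg 𝒜 ℒ →ₗ[K] SymAlg 𝒜 ℒ, IsDer d ∧ ∀ y, d (emb y).val = f y := by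
  -- The derivative is read off by letting y act on the pair (1, 0), whose second entry stands for d
  -- 1 = 0.
  let d : SymAlg 𝒜 ℒ →ₗ[K] SymAlg 𝒜 ℒ :=
    { toFun := fun x => ((SymAlg.lift (genMulData hf) x).unop (1, 0)).2
      map_add' := fun x y => by simp
      map_smul' := fun c x => by simp }
  have happ : ∀ (j : ℤ) (y z : SymAlg 𝒜 ℒ), (derMul j y z (1, 0)).2 = z := fun j y z => by
    refine (congrArg Prod.snd (derMul_apply j y z (Hgs.one _) 0)).trans ?_
    change 0 * y + (0 * j).negOnePow • (z * 1) = z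
    simp
  have key : ∀ y : Hgs (SymAlg.grade 𝒜 ℒ), ∃ z,
      (SymAlg.lift (genMulData hf) y.val).unop = derMul (deg y) y.val z := by
    intro y
    refine hgs_mem_induction (P := fun y => ∃ z, (SymAlg.lift (genMulData hf) y.val).unop =
      derMul (deg y) y.val z) ?_ ?_ ?_ (fun y => ⟨_, genMulData_emb hf y⟩) y
    · intro i
      refine ⟨0, ?_⟩
      simp only [map_zero, MulOpposite.unop_zero]
      exact (end_prod_ext fun x w => by rw [derMul_apply]; simp).symm
    · rintro i c x y hx hy h ⟨z, hz⟩ ⟨w, hw⟩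
      refine ⟨c • z + w, ?_⟩
      simp only at hz hw ⊢
      rw [map_add, map_smul, MulOpposite.unop_add, MulOpposite.unop_smul, hz, hw]
      exact (derMul_lin i c _ _ _ _).symm
    · rintro x y ⟨z, hz⟩ ⟨w, hw⟩
      refine ⟨z * y.val + (deg x * deg y).negOnePow • (w * x.val), ?_⟩
      simp only [Hgs.mul, map_mul, MulOpposite.unop_mul, hz, hw]
      exact derMul_mul x y z w _ rfl
  have key' : ∀ y : Hgs (SymAlg.grade 𝒜 ℒ),
      (SymAlg.lift (genMulData hf) y.val).unop = derMul (deg y) y.val (d y.val) := by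
    intro y
    obtain ⟨z, hz⟩ := key y
    have : d y.val = z := (congrArg (fun g => (g (1, 0)).2) hz).trans (happ _ _ _)
    rw [hz, this]
  refine ⟨d, fun x y => ?_, fun y => (congrArg (fun g => (g (1, 0)).2) (genMulData_emb hf y)).trans (happ _ _ _)⟩
  have h := derMul_mul x y (d x.val) (d y.val) _ rfl
  rw [← key', ← key', ← MulOpposite.unop_mul, ← map_mul] at h
  exact (congrArg (fun g => (g (1, 0)).2) h).trans (happ _ _ _)

open Classical in
/-- The derivation with given values on generators, if there is one. -/
noncomputable def extDer (f : Gen 𝒜 ℒ → SymAlg 𝒜 ℒ) : SymAlg 𝒜 ℒ →ₗ[K] SymAlg 𝒜 ℒ :=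
  if h : ∃ d : SymAlg 𝒜 ℒ →ₗ[K] SymAlg 𝒜 ℒ, IsDer d ∧ ∀ y, d (emb y).val = f y
  then h.choose else 0

theorem extDer_isDer {f : Gen 𝒜 ℒ → SymAlg 𝒜 ℒ} (hf : GoodDer f) : IsDer (extDer (K := K) f) := by
  rw [extDer, dif_pos (exists_der hf)]
  exact (exists_der hf).choose_spec.1

theorem extDer_emb {f : Gen 𝒜 ℒ → SymAlg 𝒜 ℒ} (hf : GoodDer f) (y : Gen 𝒜 ℒ) :
    extDer (K := K) f (emb y).val = f y := by
  rw [extDer, dif_pos (exists_der hf)]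
  exact (exists_der hf).choose_spec.2 y

end Derivations

end SHLR

namespace SHLR

open scoped DirectSum TensorProduct
open HasDeg (deg)

/-! ### Multiderivations of the graded symmetric algebra -/

section Multiderivations

variable {K : Type*} [Field K]
  {A : Type*} [Ring A] [Algebra K A] {𝒜 : ℤ → Submodule K A} [GradedAlgebra 𝒜]
  {L : Type*} [AddCommGroup L] [Module K L] [Module A L] [IsScalarTower K A L]
  {ℒ : ℤ → Submodule K L} [DirectSum.Decomposition ℒ] [SetLike.GradedSMul 𝒜 ℒ]

/-- `R` is a derivation of `S_A^• L` on homogeneous elements, up to the signs that come from `m`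
further arguments behind its argument. -/
structure HDer (m : ℤ) (R : Hgs (SymAlg.grade 𝒜 ℒ) → SymAlg 𝒜 ℒ) : Prop where
  lin : HLin R
  mul : ∀ x y, R (x.mul y) = (deg y * m).negOnePow • (R x * y.val) +
    (deg x * deg y + deg x * m).negOnePow • (R y * x.val)

/-! ### Derivations in one slot and their sign shifts -/

section HDer

variable {m k : ℤ} {R T : Hgs (SymAlg.grade 𝒜 ℒ) → SymAlg 𝒜 ℒ}

theorem HLin.lincomb {M N : Type*} [AddCommGroup M] [Module K M] {ℳ : ℤ → Submodule K M}
    [AddCommGroup N] [Module K N] {F G : Hgs ℳ → N} (hF : HLin F) (hG : HLin G) (c : K) :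
    HLin fun x => c • F x + G x := fun i b x y hx hy h => by
  simp only [hF i b x y hx hy h, hG i b x y hx hy h, smul_add, smul_comm c b]
  abel

theorem HDer.unique (hR : HDer m R) (hT : HDer m T) (h : ∀ y, R (emb y) = T (emb y)) : R = T := by
  refine funext fun x => hgs_mem_induction (P := fun x => R x = T x)
    (fun i => by rw [hR.lin.zero, hT.lin.zero]) ?_ ?_ h x
  · intro i c x y hx hy h h1 h2
    rw [hR.lin i c x y hx hy h, hT.lin i c x y hx hy h, h1, h2]
  · intro x y h1 h2
    rw [hR.mul, hT.mul, h1, h2]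

theorem HDer.congr (hR : HDer m R) (h : Even (m - k)) : HDer k R where
  lin := hR.lin
  mul := fun x y => by
    have h1 := h.mul_left (deg y)
    have h2 := h.mul_left (deg x)
    rw [mul_sub] at h1 h2
    rw [hR.mul]
    exact congrArg₂ (· + ·) (sgn_congr h1 rfl) (sgn_congr (by grind) rfl)

theorem HDer.lincomb (hR : HDer m R) (hT : HDer m T) (c : K) : HDer m fun x => c • R x + T x where
  lin := hR.lin.lincomb hT.lin c
  mul := fun x y => by
    simp only [hR.mul, hT.mul, smul_add, add_mul, smul_mul_assoc, smul_sgn]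
    abel

theorem HDer.add (hR : HDer m R) (hT : HDer m T) : HDer m fun x => R x + T x := by
  simpa only [one_smul] using hR.lincomb hT 1

theorem HDer.zero (m : ℤ) : HDer m fun _ : Hgs (SymAlg.grade 𝒜 ℒ) => (0 : SymAlg 𝒜 ℒ) where
  lin := fun i c x y hx hy h => by simp
  mul := fun x y => by simp

theorem HDer.sgn (hR : HDer m R) (s : ℤˣ) : HDer m fun x => s • R x where
  lin := hR.lin.sgn fun _ => s
  mul := fun x y => by
    rw [hR.mul, smul_add, sgn_mul, sgn_mul, smul_comm s, smul_comm s]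

/-- The sign for moving the argument past something of degree k shifts the degree of what stands
behind it by k. Only the parity of this shift matters, by `HDer.congr`. -/
theorem HDer.twist (hR : HDer m R) (k : ℤ) : HDer (m + k) fun x => (deg x * k).negOnePow • R x where
  lin := hR.lin.sgn fun i => (i * k).negOnePow
  mul := fun x y => by
    rw [hR.mul, smul_add, sgn_mul, sgn_mul, deg_hmul]
    simp only [sgn_smul_sgn]
    exact congrArg₂ (· + ·) (sgn_congr (by grind) rfl) (sgn_congr (by grind) rfl)

variable [IsGradedComm 𝒜]

theorem HDer.mulRight (hR : HDer m R) (z : Hgs (SymAlg.grade 𝒜 ℒ)) :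
    HDer (m + deg z) fun x => R x * z.val where
  lin := fun i c x y hx hy h => by
    simp only [hR.lin i c x y hx hy h, add_mul, smul_mul_assoc]
  mul := fun x y => by
    rw [hR.mul, add_mul, sgn_mul, sgn_mul, hcomm_assoc y z, hcomm_assoc x z, sgn_smul_sgn,
      sgn_smul_sgn]
    exact congrArg₂ (· + ·) (sgn_congr (by grind) rfl) (sgn_congr (by grind) rfl)

theorem IsDer.hDer {d : SymAlg 𝒜 ℒ →ₗ[K] SymAlg 𝒜 ℒ} (h : IsDer d) : HDer 0 fun x => d x.val where
  lin := fun i c x y _ _ _ => by simp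
  mul := fun x y => by
    simp only [mul_zero, Int.negOnePow_zero, one_smul, add_zero]
    exact h x y

end HDer

/-- Graded symmetric operations that are derivations in every argument. -/
structure MDer (F : List (Hgs (SymAlg.grade 𝒜 ℒ)) → SymAlg 𝒜 ℒ) : Prop where
  sym : LSym F
  der : ∀ l, HDer (ldeg l) fun x => F (x :: l)

/-! ### Multiderivations: uniqueness and closure properties -/

section MDer

variable {F G : List (Hgs (SymAlg.grade 𝒜 ℒ)) → SymAlg 𝒜 ℒ}

/-- Symmetry moves any argument to the front, and there linearity and the product rule reduce it to
generators. Uniqueness of the brackets, consistency of their construction and the Jacobi identity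
all rest on this. -/
theorem MDer.unique (hF : MDer F) (hG : MDer G)
    (h : ∀ g : List (Gen 𝒜 ℒ), F (g.map emb) = G (g.map emb)) : F = G := by
  refine funext fun l => hgs_induction (P := fun l => F l = G l) ?_ ?_ ?_ ?_ h l
  · intro p x y q h
    rw [hF.sym, h, ← hG.sym]
  · intro i l
    exact ((hF.der l).lin.zero i).trans ((hG.der l).lin.zero i).symm
  · intro i c x y hx hy h l h1 h2
    have e1 := (hF.der l).lin i c x y hx hy h
    have e2 := (hG.der l).lin i c x y hx hy h
    rw [e1, e2, h1, h2]
  · intro x y l h1 h2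
    have e1 := (hF.der l).mul x y
    have e2 := (hG.der l).mul x y
    rw [e1, e2, h1, h2]

theorem MDer.cons (hF : MDer F) (z : Hgs (SymAlg.grade 𝒜 ℒ)) : MDer fun l => F (z :: l) where
  sym := hF.sym.cons z
  der := fun l => by
    have h := ((hF.der (z :: l)).twist (deg z)).congr (k := ldeg l) (by rw [ldeg_cons]; grind)
    convert h using 2 with x
    rw [mul_comm]
    exact hF.sym [] z x l

theorem LSym.lincomb {α : Type*} [HasDeg α] {N : Type*} [AddCommGroup N] [Module K N]
    {F G : List α → N} (hF : LSym F) (hG : LSym G) (c : K) : LSym fun l => c • F l + G l :=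
  fun p x y q => by
    beta_reduce
    rw [hF, hG, smul_sgn, smul_add]

theorem MDer.lincomb (hF : MDer F) (hG : MDer G) (c : K) : MDer fun l => c • F l + G l where
  sym := hF.sym.lincomb hG.sym c
  der := fun l => (hF.der l).lincomb (hG.der l) c

theorem MDer.add (hF : MDer F) (hG : MDer G) : MDer fun l => F l + G l := by
  simpa only [one_smul] using hF.lincomb hG 1

theorem MDer.sgn (hF : MDer F) (s : ℤˣ) : MDer fun l => s • F l where
  sym := hF.sym.smul s
  der := fun l => (hF.der l).sgn s

theorem MDer.zero : MDer fun _ : List (Hgs (SymAlg.grade 𝒜 ℒ)) => (0 : SymAlg 𝒜 ℒ) where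
  sym := fun p x y q => by simp
  der := fun l => .zero _

theorem MDer.llin (hF : MDer F) : LLin F := hF.sym.llin fun l => (hF.der l).lin

variable [IsGradedComm 𝒜]

/-- This lets the product rule in a slot held by a product of generators be read as an identity
between multiderivations in the remaining arguments, to which `MDer.unique` applies. -/
theorem MDer.mulRight (hF : MDer F) (z : Hgs (SymAlg.grade 𝒜 ℒ)) :
    MDer fun l => (deg z * ldeg l).negOnePow • (F l * z.val) where
  sym := fun p x y q => by
    beta_reduce
    rw [hF.sym, sgn_mul, smul_comm]
    congr 3
    simp only [ldeg_append, ldeg_cons]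
    ring
  der := fun l => by
    have h := ((((hF.der l).mulRight z).twist (deg z)).sgn (deg z * ldeg l).negOnePow).congr
      (k := ldeg l) (by grind)
    convert h using 2
    rw [sgn_smul_sgn]
    exact sgn_congr (by rw [ldeg_cons]; grind) rfl

end MDer

/-- Values on generators that extend to a multiderivation. -/
structure Good (f : List (Gen 𝒜 ℒ) → SymAlg 𝒜 ℒ) : Prop where
  sym : LSym f
  linA : ∀ g, HLin fun a => f (Sum.inl a :: g)
  linL : ∀ g, HLin fun ξ => f (Sum.inr ξ :: g)
  mulA : ∀ (a b : Hgs 𝒜) g, f (Sum.inl (a.mul b) :: g) =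
    (deg b * ldeg g).negOnePow • (f (Sum.inl a :: g) * SymAlg.ιA 𝒜 ℒ b.val) +
      (deg a * deg b + deg a * ldeg g).negOnePow • (f (Sum.inl b :: g) * SymAlg.ιA 𝒜 ℒ a.val)
  smulL : ∀ (a : Hgs 𝒜) (ξ : Hgs ℒ) g, f (Sum.inr (a.smul ξ) :: g) =
    (deg ξ * ldeg g).negOnePow • (f (Sum.inl a :: g) * SymAlg.ιL 𝒜 ℒ ξ.val) +
      (deg a * deg ξ + deg a * ldeg g).negOnePow • (f (Sum.inr ξ :: g) * SymAlg.ιA 𝒜 ℒ a.val)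

theorem Good.cons {f : List (Gen 𝒜 ℒ) → SymAlg 𝒜 ℒ} (hf : Good f) (y : Gen 𝒜 ℒ) :
    Good fun g => f (y :: g) where
  sym := hf.sym.cons y
  linA := fun g i c a b ha hb h => by
    have e := fun z => hf.sym [] y z g
    simp only [List.nil_append] at e
    have h1 := hf.linA (y :: g) i c a b ha hb h
    simp only at h1
    simp only [e, h1, smul_add, smul_sgn, deg_inl, deg_mk]
  linL := fun g i c a b ha hb h => by
    have e := fun z => hf.sym [] y z g
    simp only [List.nil_append] at e
    have h1 := hf.linL (y :: g) i c a b ha hb h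
    simp only at h1
    simp only [e, h1, smul_add, smul_sgn, deg_inr, deg_mk]
  mulA := fun a b g => by
    have e := fun z => hf.sym [] y z g
    simp only [List.nil_append] at e
    simp only [e, hf.mulA, smul_add, sgn_mul, sgn_smul_sgn, deg_inl, deg_hmul, ldeg_cons]
    exact congrArg₂ (· + ·) (sgn_congr (by grind) rfl) (sgn_congr (by grind) rfl)
  smulL := fun a b g => by
    have e := fun z => hf.sym [] y z g
    simp only [List.nil_append] at e
    simp only [e, hf.smulL, smul_add, sgn_mul, sgn_smul_sgn, deg_inl, deg_inr, deg_hsmul, ldeg_cons]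
    exact congrArg₂ (· + ·) (sgn_congr (by grind) rfl) (sgn_congr (by grind) rfl)

/-- The multiderivation with given values on generators. -/
noncomputable def multExt : (List (Gen 𝒜 ℒ) → SymAlg 𝒜 ℒ) → List (Hgs (SymAlg.grade 𝒜 ℒ)) →
    SymAlg 𝒜 ℒ
  | f, [] => f []
  | f, x :: u => (deg x * ldeg u).negOnePow • extDer (K := K)
      (fun y => (deg y * ldeg u).negOnePow • multExt (fun g => f (y :: g)) u) x.val

variable [IsGradedComm 𝒜]

theorem GoodDer.zero : GoodDer fun _ : Gen 𝒜 ℒ => (0 : SymAlg 𝒜 ℒ) where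
  linA := fun i c x y hx hy h => by simp
  linL := fun i c x y hx hy h => by simp
  mulA := fun a b => by simp
  smulL := fun a ξ => by simp

theorem extDer_zero : extDer (K := K) (fun _ : Gen 𝒜 ℒ => (0 : SymAlg 𝒜 ℒ)) = 0 :=
  (extDer_isDer GoodDer.zero).unique (fun x y => by simp) fun y => by
    rw [extDer_emb GoodDer.zero, LinearMap.zero_apply]

/-- An extension to n arguments sees only the values on lists of n generators. Hence different
numbers of arguments may be treated separately. -/
theorem multExt_eq_zero {f : List (Gen 𝒜 ℒ) → SymAlg 𝒜 ℒ} {u : List (Hgs (SymAlg.grade 𝒜 ℒ))}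
    (h : ∀ g, g.length = u.length → f g = 0) : multExt f u = 0 := by
  induction u generalizing f with
  | nil => exact h [] rfl
  | cons x u ih =>
    rw [multExt]
    have h1 : ∀ y, multExt (fun g => f (y :: g)) u = 0 := fun y => ih fun g hg => h _ (by simp [hg])
    simp only [h1, smul_zero, extDer_zero, LinearMap.zero_apply]

theorem multExt_congr {f f' : List (Gen 𝒜 ℒ) → SymAlg 𝒜 ℒ} {u : List (Hgs (SymAlg.grade 𝒜 ℒ))}
    (h : ∀ g, g.length = u.length → f g = f' g) : multExt f u = multExt f' u := by
  induction u generalizing f f' with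
  | nil => exact h [] rfl
  | cons x u ih =>
    rw [multExt, multExt]
    have h1 : ∀ y, multExt (fun g => f (y :: g)) u = multExt (fun g => f' (y :: g)) u :=
      fun y => ih fun g hg => h _ (by simp [hg])
    simp only [h1]

/-- What is to be proved about `multExt f` on lists of a fixed length. -/
structure ExtSpec (f : List (Gen 𝒜 ℒ) → SymAlg 𝒜 ℒ) : Prop where
  der : MDer (multExt f)
  emb : ∀ g : List (Gen 𝒜 ℒ), multExt f (g.map emb) = f g

/-! ### The induction step: extension in one more slot -/

section Step

variable {f : List (Gen 𝒜 ℒ) → SymAlg 𝒜 ℒ} (hf : Good f)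
  (ih : ∀ y, ExtSpec fun g => f (y :: g))

include hf ih

/-- Each relation to be verified for the first generator is an identity between multiderivations in
the remaining arguments u. It holds on generators by `Good`, hence for all u by uniqueness. The sign
depending on u makes the rule independent of what stands behind the argument. -/
theorem goodDer_of_spec (u : List (Hgs (SymAlg.grade 𝒜 ℒ))) :
    GoodDer fun y => (deg y * ldeg u).negOnePow • multExt (fun g => f (y :: g)) u where
  linA := HLin.sgn (F := fun a : Hgs 𝒜 => multExt (fun g => f (Sum.inl a :: g)) u)
    (s := fun i => (i * ldeg u).negOnePow) fun i c a b ha hb h => congrFun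
      ((ih _).der.unique ((ih (Sum.inl ⟨i, a, ha⟩)).der.lincomb (ih (Sum.inl ⟨i, b, hb⟩)).der c)
        fun g => by rw [(ih _).emb, (ih _).emb, (ih _).emb]; exact hf.linA g i c a b ha hb h) u
  linL := HLin.sgn (F := fun a : Hgs ℒ => multExt (fun g => f (Sum.inr a :: g)) u)
    (s := fun i => (i * ldeg u).negOnePow) fun i c a b ha hb h => congrFun
      ((ih _).der.unique ((ih (Sum.inr ⟨i, a, ha⟩)).der.lincomb (ih (Sum.inr ⟨i, b, hb⟩)).der c)
        fun g => by rw [(ih _).emb, (ih _).emb, (ih _).emb]; exact hf.linL g i c a b ha hb h) u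
  mulA := fun a b => by
    have h := congrFun ((ih (Sum.inl (a.mul b))).der.unique
      (((ih (Sum.inl a)).der.mulRight (SHLR.emb (Sum.inl b))).add
        (((ih (Sum.inl b)).der.mulRight (SHLR.emb (Sum.inl a))).sgn
          (deg a * deg b).negOnePow)) fun g => by
        rw [(ih (Sum.inl (a.mul b))).emb]
        simp only [(ih (Sum.inl a)).emb, (ih (Sum.inl b)).emb, hf.mulA, deg_emb, ldeg_map_emb, deg_inl,
          sgn_smul_sgn]
        rfl) u
    simp only [h, smul_add, sgn_smul_sgn, deg_inl, deg_emb, deg_hmul, sgn_mul]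
    exact congrArg₂ (· + ·) (sgn_congr (by grind) rfl) (sgn_congr (by grind) rfl)
  smulL := fun a b => by
    have h := congrFun ((ih (Sum.inr (a.smul b))).der.unique
      (((ih (Sum.inl a)).der.mulRight (SHLR.emb (Sum.inr b))).add
        (((ih (Sum.inr b)).der.mulRight (SHLR.emb (Sum.inl a))).sgn
          (deg a * deg b).negOnePow)) fun g => by
        rw [(ih (Sum.inr (a.smul b))).emb]
        simp only [(ih (Sum.inl a)).emb, (ih (Sum.inr b)).emb, hf.smulL, deg_emb, ldeg_map_emb, deg_inl,
          deg_inr, sgn_smul_sgn]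
        rfl) u
    simp only [h, smul_add, sgn_smul_sgn, deg_inl, deg_inr, deg_emb, deg_hsmul, sgn_mul]
    exact congrArg₂ (· + ·) (sgn_congr (by grind) rfl) (sgn_congr (by grind) rfl)

theorem multExt_head (u : List (Hgs (SymAlg.grade 𝒜 ℒ))) :
    HDer (ldeg u) fun x => multExt f (x :: u) := by
  have h := (extDer_isDer (goodDer_of_spec hf ih u)).hDer.twist (ldeg u)
  rw [zero_add] at h
  exact h

theorem multExt_emb_cons (y : Gen 𝒜 ℒ) (u : List (Hgs (SymAlg.grade 𝒜 ℒ))) :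
    multExt f (SHLR.emb y :: u) = multExt (fun g => f (y :: g)) u := by
  rw [multExt, extDer_emb (goodDer_of_spec hf ih u), deg_emb, sgn_smul_sgn,
    sgn_eq_self ⟨_, rfl⟩]

theorem multExt_emb_map (g : List (Gen 𝒜 ℒ)) : multExt f (g.map SHLR.emb) = f g := by
  cases g with
  | nil => rfl
  | cons y g => rw [List.map_cons, multExt_emb_cons hf ih, (ih y).emb]

/-- The derivation property in the second slot. -/
theorem multExt_second (z : Hgs (SymAlg.grade 𝒜 ℒ)) (q : List (Hgs (SymAlg.grade 𝒜 ℒ))) :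
    HDer (ldeg q) fun x => multExt f (z :: x :: q) where
  lin := fun i c x y hx hy h => by
    -- For fixed x and y both sides are derivations in z, so z may be taken to be a generator; then
    -- the claim is the derivation property in the first slot of the extension with one slot less.
    refine congrFun (HDer.unique (m := i + ldeg q)
      ((multExt_head hf ih (⟨i, c • x + y, h⟩ :: q)).congr (by simp))
      (((multExt_head hf ih (⟨i, x, hx⟩ :: q)).congr (k := i + ldeg q) (by simp)).lincomb
        ((multExt_head hf ih (⟨i, y, hy⟩ :: q)).congr (k := i + ldeg q) (by simp)) c) fun k => ?_) z
    rw [multExt_emb_cons hf ih, multExt_emb_cons hf ih, multExt_emb_cons hf ih]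
    exact ((ih k).der.der q).lin i c x y hx hy h
  mul := fun x y => by
    refine congrFun (HDer.unique (m := deg x + deg y + ldeg q)
      (((multExt_head hf ih (x.mul y :: q))).congr (by simp))
      ((((multExt_head hf ih (x :: q)).mulRight y).sgn (deg y * ldeg q).negOnePow).congr
        (by simp only [ldeg_cons]; grind) |>.add
        ((((multExt_head hf ih (y :: q)).mulRight x).sgn
          (deg x * deg y + deg x * ldeg q).negOnePow).congr
        (by simp only [ldeg_cons]; grind))) fun k => ?_) z
    rw [multExt_emb_cons hf ih, multExt_emb_cons hf ih, multExt_emb_cons hf ih]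
    exact ((ih k).der.der q).mul x y

/-- Both sides are derivations in x, so x may be a generator j. They are then multiderivations in q
that agree on generators by the symmetry of f. -/
theorem multExt_swap_emb (x : Hgs (SymAlg.grade 𝒜 ℒ)) (k : Gen 𝒜 ℒ)
    (q : List (Hgs (SymAlg.grade 𝒜 ℒ))) : multExt f (x :: SHLR.emb k :: q) =
      (deg x * deg k).negOnePow • multExt f (SHLR.emb k :: x :: q) := by
  refine congrFun (HDer.unique (m := deg k + ldeg q)
    ((multExt_head hf ih _).congr (by simp))
    (((multExt_second hf ih (SHLR.emb k) q).twist (deg k)).congr (by grind)) fun j => ?_) x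
  rw [multExt_emb_cons hf ih, multExt_emb_cons hf ih, deg_emb]
  refine congrFun (((ih j).der.cons (SHLR.emb k)).unique
    (((ih k).der.cons (SHLR.emb j)).sgn (deg j * deg k).negOnePow) fun g => ?_) q
  have h1 := (ih j).emb (k :: g)
  have h2 := (ih k).emb (j :: g)
  rw [List.map_cons] at h1 h2
  rw [h1, h2]
  exact hf.sym [] j k g

/-- For the first two slots the second argument is reduced to a generator, which is the case just
treated. For a later exchange the first argument is reduced to a generator, leaving an exchange in
an operation that is symmetric by induction. -/
theorem multExt_lsym : LSym (multExt f) := by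
  intro p x y q
  cases p with
  | nil =>
    refine congrFun (HDer.unique (m := ldeg q) (multExt_second hf ih x q)
      ((((multExt_head hf ih (x :: q)).twist (deg x))).congr (k := ldeg q)
        (by rw [ldeg_cons]; grind)) fun j => ?_) y |>.trans ?_
    · rw [multExt_swap_emb hf ih, deg_emb, mul_comm]
    · rw [mul_comm]; rfl
  | cons z p =>
    refine congrFun (HDer.unique (multExt_head hf ih (p ++ x :: y :: q))
      (((multExt_head hf ih (p ++ y :: x :: q)).sgn (deg x * deg y).negOnePow).congr
        (by simp only [ldeg_append, ldeg_cons]; grind)) fun j => ?_) z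
    rw [multExt_emb_cons hf ih, multExt_emb_cons hf ih]
    exact (ih j).der.sym p x y q

theorem extSpec_step : ExtSpec f := ⟨⟨multExt_lsym hf ih, multExt_head hf ih⟩, multExt_emb_map hf ih⟩

end Step

/-- The symmetry and the relations compare values on lists of one and the same length, so they
survive cutting f down to a single length. -/
theorem Good.trunc {f : List (Gen 𝒜 ℒ) → SymAlg 𝒜 ℒ} (hf : Good f) (n : ℕ) :
    Good fun g => if g.length = n then f g else 0 where
  sym := fun p x y q => by
    have h : (p ++ x :: y :: q).length = (p ++ y :: x :: q).length := by simp
    beta_reduce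
    rw [hf.sym, h]
    split_ifs <;> simp
  linA := fun g i c a b ha hb h => by
    have h1 := hf.linA g i c a b ha hb h
    simp only [List.length_cons] at h1 ⊢
    split_ifs
    · exact h1
    · simp
  linL := fun g i c a b ha hb h => by
    have h1 := hf.linL g i c a b ha hb h
    simp only [List.length_cons] at h1 ⊢
    split_ifs
    · exact h1
    · simp
  mulA := fun a b g => by
    simp only [List.length_cons]
    split_ifs
    · exact hf.mulA a b g
    · simp
  smulL := fun a b g => by
    simp only [List.length_cons]
    split_ifs
    · exact hf.smulL a b g
    · simp

/-- Fixing the length makes the induction possible: after the first generator is fixed, what remains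
is concentrated on lists shorter by one. -/
theorem extSpec_of_length (n : ℕ) {f : List (Gen 𝒜 ℒ) → SymAlg 𝒜 ℒ} (hf : Good f)
    (hn : ∀ g, g.length ≠ n → f g = 0) : ExtSpec f := by
  induction n generalizing f with
  | zero =>
    have h : ∀ l, l ≠ [] → multExt f l = 0 := fun l hl =>
      multExt_eq_zero fun g hg => hn g (by rw [hg]; simpa using hl)
    refine ⟨⟨fun p x y q => ?_, fun l => ?_⟩, fun g => ?_⟩
    · rw [h _ (by simp), h _ (by simp), smul_zero]
    · simp only [h _ (List.cons_ne_nil _ _)]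
      exact .zero _
    · cases g with
      | nil => rfl
      | cons y g => rw [h _ (by simp), hn _ (by simp)]
  | succ n ih => exact extSpec_step hf fun y => ih (hf.cons y) fun g hg => hn _ (by simpa using hg)

theorem Good.extSpec {f : List (Gen 𝒜 ℒ) → SymAlg 𝒜 ℒ} (hf : Good f) : ExtSpec f := by
  have key : ∀ n l, l.length = n →
      multExt f l = multExt (fun g => if g.length = n then f g else 0) l := fun n l h =>
    multExt_congr fun g hg => by rw [if_pos (hg.trans h)]
  have spec : ∀ n, ExtSpec fun g => if g.length = n then f g else 0 := fun n =>
    extSpec_of_length n (hf.trunc n) fun g hg => if_neg hg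
  refine ⟨⟨fun p x y q => ?_, fun l => ?_⟩, fun g => ?_⟩
  · rw [key _ (p ++ x :: y :: q) rfl, key _ (p ++ y :: x :: q) rfl, (spec _).der.sym]
    simp
  · simp only [fun x => key (l.length + 1) (x :: l) rfl]
    exact (spec _).der.der l
  · rw [key g.length (g.map emb) (by simp), (spec _).emb, if_pos rfl]

end Multiderivations

end SHLR

namespace SHLR

open scoped DirectSum TensorProduct
open HasDeg (deg)

/-! ### Unshuffle sums as sums over splittings -/

section Conversion

variable {K : Type*} [Field K] {V : Type*} [AddCommGroup V] [Module K V] {𝒱 : ℤ → Submodule K V}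
  {lam : ∀ k : ℕ, MultilinearMap K (fun _ : Fin k => V) V} (hlam : ∀ k, HasDegree 𝒱 𝒱 1 (lam k))

theorem forall_homog_iff (Φ : ∀ n : ℕ, (Fin n → ℤ) → (Fin n → V) → Prop) :
    (∀ (n : ℕ) (e : Fin n → ℤ) (v : Fin n → V), Homog 𝒱 e v → Φ n e v) ↔
      ∀ (n : ℕ) (h : Fin n → Hgs 𝒱), Φ n (fun i => deg (h i)) (fun i => (h i).val) :=
  ⟨fun H n h => H n _ _ fun i => (h i).mem, fun H n e v hv => H n fun i => ⟨e i, v i, hv i⟩⟩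

theorem forall_list_iff {α : Type*} (Φ : List α → Prop) :
    (∀ l, Φ l) ↔ ∀ (n : ℕ) (h : Fin n → α), Φ (List.ofFn h) :=
  ⟨fun H _ _ => H _, fun H l => by simpa using H l.length l.get⟩

theorem ev_ofFn_pick {N : Type*} [AddCommGroup N] [Module K N]
    (mu : ∀ n : ℕ, MultilinearMap K (fun _ : Fin n => V) N) {n : ℕ} (h : Fin n → Hgs 𝒱)
    (I : Finset (Fin n)) :
    ev mu (List.ofFn (pick h I)) = mu I.card (pick (fun i => (h i).val) I) := ev_ofFn mu _

theorem sum_koszul_bracket {N : Type*} [AddCommGroup N] [Module K N]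
    (mu : ∀ n : ℕ, MultilinearMap K (fun _ : Fin n => V) N) {n : ℕ} (h : Fin n → Hgs 𝒱) :
    ∑ I : Finset (Fin n), koszulSign I (fun i => deg (h i)) • mu (Iᶜ.card + 1)
        (Fin.cons (lam I.card (pick (fun i => (h i).val) I)) (pick (fun i => (h i).val) Iᶜ)) =
      spl (fun I J => ev mu (br hlam I :: J)) (List.ofFn h) := by
  rw [← sum_pick_eq_spl]
  refine Finset.sum_congr rfl fun I _ => ?_
  rw [ev_cons_ofFn]
  simp only [br, ev_ofFn_pick]
  rfl

theorem sum_koszul_comp {W : Type*} [AddCommGroup W] [Module K W]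
    (mu : ∀ n : ℕ, MultilinearMap K (fun _ : Fin n => V) (Module.End K W)) {n : ℕ}
    (h : Fin n → Hgs 𝒱) (w : W) :
    ∑ I : Finset (Fin n), (∑ i ∈ I, deg (h i)).negOnePow • koszulSign I (fun i => deg (h i)) •
        mu I.card (pick (fun i => (h i).val) I) (mu Iᶜ.card (pick (fun i => (h i).val) Iᶜ) w) =
      spl (fun I J => (ldeg I).negOnePow • ev mu I (ev mu J w)) (List.ofFn h) := by
  rw [← sum_pick_eq_spl]
  refine Finset.sum_congr rfl fun I _ => ?_
  rw [ldeg_ofFn_pick, ev_ofFn_pick, ev_ofFn_pick, smul_comm]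

theorem jacobi_iff {N : Type*} [AddCommGroup N] [Module K N]
    (mu : ∀ n : ℕ, MultilinearMap K (fun _ : Fin n => V) N) :
    (∀ (n : ℕ) (e : Fin n → ℤ) (v : Fin n → V), Homog 𝒱 e v →
      ∑ I : Finset (Fin n), koszulSign I e •
        mu (Iᶜ.card + 1) (Fin.cons (lam I.card (pick v I)) (pick v Iᶜ)) = 0) ↔
      ∀ l, spl (fun I J => ev mu (br hlam I :: J)) l = 0 := by
  rw [forall_homog_iff (𝒱 := 𝒱) fun n e v => ∑ I : Finset (Fin n), koszulSign I e •
    mu (Iᶜ.card + 1) (Fin.cons (lam I.card (pick v I)) (pick v Iᶜ)) = 0, forall_list_iff]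
  simp only [sum_koszul_bracket hlam]

theorem module_jacobi_iff {W : Type*} [AddCommGroup W] [Module K W]
    (mu : ∀ n : ℕ, MultilinearMap K (fun _ : Fin n => V) (Module.End K W)) :
    (∀ (n : ℕ) (e : Fin n → ℤ) (v : Fin n → V), Homog 𝒱 e v → ∀ w : W,
      (∑ I : Finset (Fin n), koszulSign I e •
        mu (Iᶜ.card + 1) (Fin.cons (lam I.card (pick v I)) (pick v Iᶜ)) w)
      + ∑ I : Finset (Fin n), (∑ i ∈ I, e i).negOnePow • koszulSign I e •
        mu I.card (pick v I) (mu Iᶜ.card (pick v Iᶜ) w) = 0) ↔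
      ∀ l w, spl (fun I J => ev mu (br hlam I :: J) w) l +
        spl (fun I J => (ldeg I).negOnePow • ev mu I (ev mu J w)) l = 0 := by
  rw [forall_homog_iff (𝒱 := 𝒱) fun n e v => ∀ w : W, (∑ I : Finset (Fin n), koszulSign I e •
        mu (Iᶜ.card + 1) (Fin.cons (lam I.card (pick v I)) (pick v Iᶜ)) w)
      + ∑ I : Finset (Fin n), (∑ i ∈ I, e i).negOnePow • koszulSign I e •
        mu I.card (pick v I) (mu Iᶜ.card (pick v Iᶜ) w) = 0, forall_list_iff]
  simp only [sum_koszul_comp]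
  refine forall_congr' fun n => forall_congr' fun h => forall_congr' fun w => ?_
  -- The bracket sum is used for the operations evaluated at w, which are multilinear with values in
  -- `W` instead of `Module.End K W`.
  exact Iff.of_eq (congrArg (· = 0) (congrArg₂ (· + ·) (sum_koszul_bracket hlam
    (fun n => (LinearMap.applyₗ w).compMultilinearMap (mu n)) h) rfl))

theorem right_module_jacobi_iff {W : Type*} [AddCommGroup W] [Module K W]
    (mu : ∀ n : ℕ, MultilinearMap K (fun _ : Fin n => V) (Module.End K W)) :
    (∀ (n : ℕ) (e : Fin n → ℤ) (v : Fin n → V), Homog 𝒱 e v → ∀ w : W,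
      (∑ I : Finset (Fin n), koszulSign I e •
        mu (Iᶜ.card + 1) (Fin.cons (lam I.card (pick v I)) (pick v Iᶜ)) w)
      - ∑ I : Finset (Fin n), (∑ i ∈ I, e i).negOnePow • koszulSign I e •
        mu I.card (pick v I) (mu Iᶜ.card (pick v Iᶜ) w) = 0) ↔
      ∀ l w, spl (fun I J => ev mu (br hlam I :: J) w) l -
        spl (fun I J => (ldeg I).negOnePow • ev mu I (ev mu J w)) l = 0 := by
  rw [forall_homog_iff (𝒱 := 𝒱) fun n e v => ∀ w : W, (∑ I : Finset (Fin n), koszulSign I e •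
        mu (Iᶜ.card + 1) (Fin.cons (lam I.card (pick v I)) (pick v Iᶜ)) w)
      - ∑ I : Finset (Fin n), (∑ i ∈ I, e i).negOnePow • koszulSign I e •
        mu I.card (pick v I) (mu Iᶜ.card (pick v Iᶜ) w) = 0, forall_list_iff]
  simp only [sum_koszul_comp]
  refine forall_congr' fun n => forall_congr' fun h => forall_congr' fun w => ?_
  exact Iff.of_eq (congrArg (· = 0) (congrArg₂ (· - ·) (sum_koszul_bracket hlam
    (fun n => (LinearMap.applyₗ w).compMultilinearMap (mu n)) h) rfl))

end Conversion

/-! ### `LR_∞[1]` algebras in terms of lists -/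

section LieRinehart

theorem ev_smul_head {K : Type*} [Field K] {A M N : Type*} [Ring A] [Algebra K A] [AddCommGroup M]
    [Module K M] [Module A M] [AddCommGroup N] [Module K N] [Module A N]
    {𝒜 : ℤ → Submodule K A} [GradedAlgebra 𝒜] {ℳ : ℤ → Submodule K M} [SetLike.GradedSMul 𝒜 ℳ]
    {f : ∀ k : ℕ, MultilinearMap K (fun _ : Fin k => M) N} {d : ℤ}
    (hf : ∀ k, GradedMultilin 𝒜 ℳ d (f k)) (a : Hgs 𝒜) (ξ : Hgs ℳ) (l : List (Hgs ℳ)) :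
    ev f (a.smul ξ :: l) = (deg a * d).negOnePow • a.val • ev f (ξ :: l) := by
  have h := hf (l.length + 1) a.d a.val a.mem (Fin.cons ξ.d fun i => (l.get i).d)
    (Fin.cons ξ.val fun i => (l.get i).val) (by
      intro i
      induction i using Fin.cases with
      | zero => exact ξ.mem
      | succ i => exact (l.get i).mem) 0
  rw [Fin.update_cons_zero] at h
  have h0 : Finset.Iio (0 : Fin (l.length + 1)) = ∅ := by ext x; simp
  rw [h0, Finset.sum_empty, add_zero] at h
  rw [ev_cons, ev_cons]
  exact h

variable {K : Type*} [Field K]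
  {A : Type*} [Ring A] [Algebra K A] {𝒜 : ℤ → Submodule K A} [GradedAlgebra 𝒜]
  {L : Type*} [AddCommGroup L] [Module K L] [Module A L] [IsScalarTower K A L]
  {ℒ : ℤ → Submodule K L} [DirectSum.Decomposition ℒ] [SetLike.GradedSMul 𝒜 ℒ]
  (𝕏 : LRInfinity 𝒜 ℒ)

namespace LRInfinity

theorem X_lsym : LSym (α := Hgs ℒ) (ev 𝕏.X) := (gradedSymm_iff_lsym _).1 𝕏.X_symm

theorem σ_lsym : LSym (α := Hgs ℒ) (ev 𝕏.σ) := (gradedSymm_iff_lsym _).1 𝕏.σ_symm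

theorem X_nil : ev 𝕏.X ([] : List (Hgs ℒ)) = 0 := by
  change 𝕏.X 0 _ = 0
  rw [𝕏.X_zero]; rfl

/-- The bracket of homogeneous elements of `L`. -/
def bracket (l : List (Hgs ℒ)) : Hgs ℒ := br 𝕏.X_degree l

@[simp] theorem deg_bracket (l : List (Hgs ℒ)) : deg (𝕏.bracket l) = 1 + ldeg l := rfl

/-- The anchor on homogeneous elements. -/
def anchor (l : List (Hgs ℒ)) (a : Hgs 𝒜) : Hgs 𝒜 :=
  ⟨1 + ldeg l + deg a, ev 𝕏.σ l a.val, by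
    rw [← sum_univ_deg]; exact 𝕏.σ_degree _ _ _ (fun i => (l.get i).mem) _ _ a.mem⟩

@[simp] theorem deg_anchor (l : List (Hgs ℒ)) (a : Hgs 𝒜) :
    deg (𝕏.anchor l a) = 1 + ldeg l + deg a := rfl

theorem σ_smul_head (a : Hgs 𝒜) (ξ : Hgs ℒ) (l : List (Hgs ℒ)) (b : A) :
    ev 𝕏.σ (a.smul ξ :: l) b = (deg a).negOnePow • (a.val * ev 𝕏.σ (ξ :: l) b) := by
  have h := ev_smul_head (f := fun n => (LinearMap.applyₗ b).compMultilinearMap (𝕏.σ n))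
    (fun k => 𝕏.σ_linear k b) a ξ l
  rw [mul_one] at h
  exact h

theorem σ_mul (l : List (Hgs ℒ)) (a : Hgs 𝒜) (b : A) :
    ev 𝕏.σ l (a.val * b) = ev 𝕏.σ l a.val * b +
      ((1 + ldeg l) * deg a).negOnePow • (a.val * ev 𝕏.σ l b) := by
  rw [← sum_univ_deg]
  exact 𝕏.σ_leibniz _ _ _ (fun i => (l.get i).mem) _ _ a.mem b

/-- The Leibniz axiom concerns the last slot. Graded symmetry carries the argument there and back,
and the accumulated signs simplify. -/
theorem X_smul_head (a : Hgs 𝒜) (ξ : Hgs ℒ) (l : List (Hgs ℒ)) :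
    ev 𝕏.X (a.smul ξ :: l) = ((deg a + deg ξ) * ldeg l).negOnePow • ev 𝕏.σ l a.val • ξ.val +
      (deg a).negOnePow • a.val • ev 𝕏.X (ξ :: l) := by
  have h := 𝕏.X_leibniz _ _ (fun i => (l.get i).val) (fun i => (l.get i).mem) _ _ a.mem ξ.val
  rw [sum_univ_deg] at h
  rw [𝕏.X_lsym.back, ev_snoc, 𝕏.X_lsym.back ξ, ev_snoc, smul_sgn, sgn_smul_sgn]
  refine (congrArg _ h).trans ?_
  rw [smul_add, sgn_smul_sgn]
  refine congrArg₂ (· + ·) rfl (sgn_congr ?_ rfl)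
  change Even ((deg a + deg ξ) * ldeg l + (1 + ldeg l) * deg a - (deg a + deg ξ * ldeg l))
  grind

theorem jacobi_list (l : List (Hgs ℒ)) : spl (fun I J => ev 𝕏.X (𝕏.bracket I :: J)) l = 0 :=
  (jacobi_iff 𝕏.X_degree 𝕏.X).1 𝕏.jacobi l

theorem jacobi_symbol_list (l : List (Hgs ℒ)) (a : A) :
    spl (fun I J => ev 𝕏.σ (𝕏.bracket I :: J) a) l +
      spl (fun I J => (ldeg I).negOnePow • ev 𝕏.σ I (ev 𝕏.σ J a)) l = 0 :=
  (module_jacobi_iff 𝕏.X_degree 𝕏.σ).1 (fun n e v h w => by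
    rw [add_comm]; exact 𝕏.jacobi_symbol n e v h w) l a

end LRInfinity

/-- The component in `L` of a generator. -/
def lPart : Gen 𝒜 ℒ → Hgs ℒ
  | Sum.inl a => ⟨a.d, 0, Submodule.zero_mem _⟩
  | Sum.inr ξ => ξ

/-- The component in `A` of a generator. -/
def aPart : Gen 𝒜 ℒ → Hgs 𝒜
  | Sum.inl a => a
  | Sum.inr ξ => ⟨ξ.d, 0, Submodule.zero_mem _⟩

@[simp] theorem deg_lPart (y : Gen 𝒜 ℒ) : deg (lPart y) = deg y := by cases y <;> rfl
@[simp] theorem deg_aPart (y : Gen 𝒜 ℒ) : deg (aPart y) = deg y := by cases y <;> rfl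

@[simp] theorem ldeg_map_lPart (g : List (Gen 𝒜 ℒ)) : ldeg (g.map lPart) = ldeg g := by
  rw [ldeg, ldeg, List.map_map]
  exact congrArg _ (List.map_congr_left fun x _ => deg_lPart x)

/-- The summands of the brackets of generators. -/
noncomputable def genTerm (I : List (Gen 𝒜 ℒ)) : List (Gen 𝒜 ℒ) → SymAlg 𝒜 ℒ
  | [] => SymAlg.ιL 𝒜 ℒ (ev 𝕏.X (I.map lPart))
  | [y] => SymAlg.ιA 𝒜 ℒ (ev 𝕏.σ (I.map lPart) (aPart y).val)
  | _ => 0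

/-- The bracket of generators. -/
noncomputable def genBracket (g : List (Gen 𝒜 ℒ)) : SymAlg 𝒜 ℒ := spl (genTerm 𝕏) g

theorem LSym.comp_map {α β N : Type*} [HasDeg α] [HasDeg β] [AddCommGroup N] {F : List β → N}
    (hF : LSym F) (φ : α → β) (hφ : ∀ x, deg (φ x) = deg x) : LSym fun l => F (l.map φ) :=
  fun p x y q => by simp only [List.map_append, List.map_cons, hF _ (φ x) (φ y), hφ]

/-- The first part of a splitting enters through the symmetric operations X and σ. In the second
part there is nothing to exchange, since it contributes only with at most one entry. -/
theorem genBracket_lsym : LSym (genBracket 𝕏) := by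
  refine LSym.spl (fun J => ?_) (fun I => ?_)
  · match J with
    | [] => exact (𝕏.X_lsym.comp_map lPart deg_lPart).map (SymAlg.ιL 𝒜 ℒ)
    | [y] =>
      exact (𝕏.σ_lsym.comp_map lPart deg_lPart).map
        ((SymAlg.ιA 𝒜 ℒ) ∘ₗ LinearMap.applyₗ (aPart y).val)
    | _ :: _ :: _ => exact fun p x y q => by simp [genTerm]
  · intro p x y q
    match p with
    | [] => simp [genTerm]
    | [_] => simp [genTerm]
    | _ :: _ :: _ => simp [genTerm]

/-- The component in L of an element of A is zero, so a multilinear operation with this entry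
vanishes. The list part meant for L thus discards letters from A by itself. -/
theorem genTerm_inl_cons (a : Hgs 𝒜) (I J : List (Gen 𝒜 ℒ)) :
    genTerm 𝕏 (Sum.inl a :: I) J = 0 := by
  have hX := (ev_llin (ℳ := ℒ) 𝕏.X).zero_head a.d [] (I.map lPart)
  have hσ := (ev_llin (ℳ := ℒ) 𝕏.σ).zero_head a.d [] (I.map lPart)
  match J with
  | [] => exact (congrArg _ hX).trans (map_zero _)
  | [y] =>
    exact (congrArg (fun f : Module.End K A => SymAlg.ιA 𝒜 ℒ (f (aPart y).val)) hσ).trans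
      (map_zero _)
  | _ :: _ :: _ => rfl

/-- The letter a must be the single entry of the second part, so all other letters precede it; the
sign is the one for moving a behind them. -/
theorem genBracket_inl (a : Hgs 𝒜) (g : List (Gen 𝒜 ℒ)) : genBracket 𝕏 (Sum.inl a :: g) =
    (deg a * ldeg g).negOnePow • SymAlg.ιA 𝒜 ℒ (ev 𝕏.σ (g.map lPart) a.val) := by
  rw [genBracket, spl_cons, spl_eq_zero fun I J _ => genTerm_inl_cons 𝕏 a I J, zero_add, spl_right]
  · rfl
  · rintro I (_ | ⟨y, J⟩) _ h
    · exact absurd rfl h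
    · exact smul_zero _

theorem genBracket_inr (ξ : Hgs ℒ) (g : List (Gen 𝒜 ℒ)) : genBracket 𝕏 (Sum.inr ξ :: g) =
    spl (fun I J => genTerm 𝕏 (Sum.inr ξ :: I) J) g := by
  rw [genBracket, spl_cons, add_eq_left]
  refine spl_eq_zero fun I J _ => ?_
  match J with
  | [] => simp [genTerm, aPart]
  | _ :: _ => exact smul_zero _

variable [IsGradedComm 𝒜]

/-- With empty second part this is the Leibniz rule of X, whose anchor term is the first summand.
With one entry in the second part it is the A-linearity of the anchor, and no extra term arises. -/
theorem genTerm_smul (a : Hgs 𝒜) (ξ : Hgs ℒ) (I J : List (Gen 𝒜 ℒ)) :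
    genTerm 𝕏 (Sum.inr (a.smul ξ) :: I) J =
      (match J with
        | [] => (deg a * ldeg I + deg ξ * ldeg I).negOnePow •
            (SymAlg.ιA 𝒜 ℒ (ev 𝕏.σ (I.map lPart) a.val) * SymAlg.ιL 𝒜 ℒ ξ.val)
        | _ => 0) + (deg a * deg ξ + deg a * (ldeg I + ldeg J)).negOnePow •
          (genTerm 𝕏 (Sum.inr ξ :: I) J * SymAlg.ιA 𝒜 ℒ a.val) := by
  match J with
  | [] =>
    have h1 := SymAlg.ιA_mul_ιL (𝒜 := 𝒜) (𝕏.anchor (I.map lPart) a).mem ξ.mem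
    have h2 := SymAlg.ιA_mul_ιL (𝒜 := 𝒜) a.mem (𝕏.bracket (ξ :: I.map lPart)).mem
    have h3 := SymAlg.ιA_comm_ιL (𝒜 := 𝒜) a.mem (𝕏.bracket (ξ :: I.map lPart)).mem
    rw [h3] at h2
    have h4 := congrArg (SymAlg.ιL 𝒜 ℒ) (𝕏.X_smul_head a ξ (I.map lPart))
    rw [map_add, map_sgn, map_sgn] at h4
    refine h4.trans (congrArg₂ (· + ·) ?_ ?_)
    · refine sgn_congr ?_ h1.symm
      rw [ldeg_map_lPart]
      grind
    · refine (congrArg _ h2.symm).trans ?_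
      rw [sgn_smul_sgn]
      refine sgn_congr ?_ rfl
      change Even (deg a + deg a * (1 + ldeg (ξ :: I.map lPart)) - _)
      rw [ldeg_cons, ldeg_map_lPart, ldeg_nil]
      grind
  | [y] =>
    have h1 := 𝕏.σ_smul_head a ξ (I.map lPart) (aPart y).val
    have h2 := SymAlg.ιA_mul (ℒ := ℒ) (𝕏.anchor (ξ :: I.map lPart) (aPart y)).mem a.mem
    have h3 := hcomm a (𝕏.anchor (ξ :: I.map lPart) (aPart y))
    change a.val * ev 𝕏.σ (ξ :: I.map lPart) (aPart y).val = _ at h3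
    rw [h3, sgn_smul_sgn] at h1
    refine ((congrArg (SymAlg.ιA 𝒜 ℒ) h1).trans (map_sgn _ _ _)).trans ?_
    rw [zero_add]
    refine sgn_congr ?_ h2.symm
    rw [𝕏.deg_anchor]
    simp only [ldeg_cons, ldeg_map_lPart, ldeg_nil, deg_aPart]
    grind
  | _ :: _ :: _ => simp [genTerm]

theorem spl_lincomb {α N : Type*} [HasDeg α] [AddCommGroup N] [Module K N]
    (F G : List α → List α → N) (c : K) (l : List α) :
    spl (fun I J => c • F I J + G I J) l = c • spl F l + spl G l := by
  rw [spl_add]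
  exact congrArg (· + spl G l) (spl_map (LinearMap.lsmul K N c) F l).symm

theorem genTerm_lin (i : ℤ) (c : K) {x y : L} (hx : x ∈ ℒ i) (hy : y ∈ ℒ i) (h : c • x + y ∈ ℒ i)
    (I J : List (Gen 𝒜 ℒ)) : genTerm 𝕏 (Sum.inr ⟨i, c • x + y, h⟩ :: I) J =
      c • genTerm 𝕏 (Sum.inr ⟨i, x, hx⟩ :: I) J + genTerm 𝕏 (Sum.inr ⟨i, y, hy⟩ :: I) J := by
  match J with
  | [] =>
    refine (congrArg (SymAlg.ιL 𝒜 ℒ)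
      (ev_llin (ℳ := ℒ) 𝕏.X [] (I.map lPart) i c x y hx hy h)).trans ?_
    rw [map_add, map_smul]
    rfl
  | [z] =>
    refine (congrArg (fun f : Module.End K A => SymAlg.ιA 𝒜 ℒ (f (aPart z).val))
      (ev_llin (ℳ := ℒ) 𝕏.σ [] (I.map lPart) i c x y hx hy h)).trans ?_
    rw [LinearMap.add_apply, LinearMap.smul_apply, map_add, map_smul]
    rfl
  | _ :: _ :: _ => simp [genTerm]

/-- The axioms of the structure match the relations of the symmetric algebra: the anchor is a
derivation of A, which gives `mulA`, and the symbol of the bracket is the A-linear anchor, which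
gives `smulL`. -/
theorem genBracket_good : Good (genBracket 𝕏) where
  sym := genBracket_lsym 𝕏
  linA := fun g i c a b ha hb h => by
    simp only [genBracket_inl, map_add, map_smul, smul_add, smul_sgn, deg_mk]
  linL := fun g i c a b ha hb h => by
    simp only [genBracket_inr]
    rw [← spl_lincomb]
    exact spl_congr fun I J _ => genTerm_lin 𝕏 i c ha hb h I J
  mulA := fun a b g => by
    have h1 := 𝕏.σ_mul (g.map lPart) a b.val
    have h2 := hcomm a (𝕏.anchor (g.map lPart) b)
    change a.val * ev 𝕏.σ (g.map lPart) b.val = _ at h2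
    rw [h2, sgn_smul_sgn] at h1
    have h3 := SymAlg.ιA_mul (ℒ := ℒ) (𝕏.anchor (g.map lPart) a).mem b.mem
    have h4 := SymAlg.ιA_mul (ℒ := ℒ) (𝕏.anchor (g.map lPart) b).mem a.mem
    simp only [genBracket_inl]
    refine (congrArg _ ((congrArg (SymAlg.ιA 𝒜 ℒ) h1).trans (map_add _ _ _))).trans ?_
    rw [map_sgn, smul_add, sgn_smul_sgn, sgn_mul, sgn_smul_sgn, sgn_mul, sgn_smul_sgn]
    refine congrArg₂ (· + ·) (sgn_congr ?_ h3.symm) (sgn_congr ?_ h4.symm)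
    · rw [deg_hmul]; grind
    · rw [deg_hmul, 𝕏.deg_anchor, ldeg_map_lPart]; grind
  smulL := fun a ξ g => by
    rw [genBracket_inr, genBracket_inr, genBracket_inl]
    simp only [genTerm_smul]
    rw [spl_add]
    refine congrArg₂ (· + ·) ?_ ?_
    · rw [spl_right]
      · rw [sgn_mul, sgn_smul_sgn]
        exact sgn_congr (by grind) rfl
      · rintro I (_ | ⟨y, J⟩) _ h
        · exact absurd rfl h
        · rfl
    · refine Eq.trans ?_ (congrArg _ (spl_map (LinearMap.mulRight K (SymAlg.ιA 𝒜 ℒ a.val))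
        (fun I J => genTerm 𝕏 (Sum.inr ξ :: I) J) g).symm)
      rw [← spl_smul]
      refine spl_congr fun I J h => ?_
      rw [← ldeg_append, ldeg_perm h]
      rfl

end LieRinehart

end SHLR

namespace SHLR

open scoped DirectSum TensorProduct
open HasDeg (deg)

/-! ### The `L_∞[1]` algebra structure on the graded symmetric algebra -/

section Extension

variable {K : Type*} [Field K]
  {A : Type*} [Ring A] [Algebra K A] {𝒜 : ℤ → Submodule K A} [GradedAlgebra 𝒜]
  {L : Type*} [AddCommGroup L] [Module K L] [Module A L] [IsScalarTower K A L]
  {ℒ : ℤ → Submodule K L} [DirectSum.Decomposition ℒ] [SetLike.GradedSMul 𝒜 ℒ]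

theorem spl_mem {α N : Type*} [HasDeg α] [AddCommGroup N] [Module K N] {p : Submodule K N}
    {F : List α → List α → N} {l : List α} (h : ∀ I J, (I ++ J).Perm l → F I J ∈ p) :
    spl F l ∈ p := by
  induction l generalizing F with
  | nil => exact h [] [] (by simp)
  | cons x l ih =>
    rw [spl_cons]
    refine Submodule.add_mem _ (ih fun I J hp => h (x :: I) J (by simpa using hp)) (ih fun I J hp =>
      sgn_mem _ (h I (x :: J) (List.perm_middle.trans (hp.cons x))))

/-! ### Degrees and normal forms of brackets of generators -/

section GenBracket

variable (𝕏 : LRInfinity 𝒜 ℒ)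

theorem genTerm_mem (I J : List (Gen 𝒜 ℒ)) :
    genTerm 𝕏 I J ∈ SymAlg.grade 𝒜 ℒ (1 + (ldeg I + ldeg J)) := by
  match J with
  | [] =>
    have h := SymAlg.ιL_mem (𝒜 := 𝒜) (𝕏.bracket (I.map lPart)).mem
    change _ ∈ SymAlg.grade 𝒜 ℒ (1 + ldeg (I.map lPart)) at h
    rw [ldeg_map_lPart] at h
    rw [ldeg_nil, add_zero]
    exact h
  | [y] =>
    have h := SymAlg.ιA_mem (ℒ := ℒ) (𝕏.anchor (I.map lPart) (aPart y)).mem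
    change _ ∈ SymAlg.grade 𝒜 ℒ (1 + ldeg (I.map lPart) + deg (aPart y)) at h
    rw [ldeg_map_lPart, deg_aPart] at h
    rw [ldeg_cons, ldeg_nil, add_zero, ← add_assoc]
    exact h
  | _ :: _ :: _ => exact Submodule.zero_mem _

theorem genBracket_mem (g : List (Gen 𝒜 ℒ)) :
    genBracket 𝕏 g ∈ SymAlg.grade 𝒜 ℒ (1 + ldeg g) :=
  spl_mem fun I J h => by
    rw [← ldeg_perm h, ldeg_append]
    exact genTerm_mem 𝕏 I J

theorem map_lPart_inr (l : List (Hgs ℒ)) :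
    (l.map (Sum.inr : Hgs ℒ → Gen 𝒜 ℒ)).map lPart = l := by
  rw [List.map_map]
  exact List.map_id l

theorem genBracket_map_inr (l : List (Hgs ℒ)) :
    genBracket 𝕏 (l.map Sum.inr) = SymAlg.ιL 𝒜 ℒ (ev 𝕏.X l) := by
  rw [genBracket, spl_right, genTerm, map_lPart_inr]
  intro I J h hJ
  match J with
  | [] => exact absurd rfl hJ
  | [y] =>
    have hy : y ∈ l.map Sum.inr := h.subset (by simp)
    obtain ⟨ξ, -, rfl⟩ := List.mem_map.1 hy
    simp [genTerm, aPart]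
  | _ :: _ :: _ => rfl

theorem genBracket_inl_map_inr (a : Hgs 𝒜) (l : List (Hgs ℒ)) :
    genBracket 𝕏 (Sum.inl a :: l.map Sum.inr) =
      (deg a * ldeg l).negOnePow • SymAlg.ιA 𝒜 ℒ (ev 𝕏.σ l a.val) := by
  rw [genBracket_inl, map_lPart_inr, ldeg_map_inr]

/-- The first letter from A is the argument on which the anchor acts, so the second one would have
to enter the anchor as an element of L, where its component is zero. -/
theorem genBracket_inl_inl (a b : Hgs 𝒜) (g : List (Gen 𝒜 ℒ)) :
    genBracket 𝕏 (Sum.inl a :: Sum.inl b :: g) = 0 := by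
  have hσ := (ev_llin (ℳ := ℒ) 𝕏.σ).zero_head b.d [] (g.map lPart)
  rw [genBracket_inl]
  refine (congrArg (fun f : Module.End K A =>
    (deg a * ldeg (Sum.inl b :: g)).negOnePow • SymAlg.ιA 𝒜 ℒ (f a.val)) hσ).trans ?_
  simp

end GenBracket

theorem MDer.mem {F : List (Hgs (SymAlg.grade 𝒜 ℒ)) → SymAlg 𝒜 ℒ} (hF : MDer F)
    (h : ∀ g : List (Gen 𝒜 ℒ), F (g.map emb) ∈ SymAlg.grade 𝒜 ℒ (1 + ldeg g)) (l) :
    F l ∈ SymAlg.grade 𝒜 ℒ (1 + ldeg l) := by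
  refine hgs_induction (P := fun l => F l ∈ SymAlg.grade 𝒜 ℒ (1 + ldeg l)) ?_ ?_ ?_ ?_ ?_ l
  · intro p x y q h
    rw [hF.sym, ldeg_perm ((List.Perm.swap x y q).append_left p)]
    exact sgn_mem _ h
  · intro i l
    rw [(hF.der l).lin.zero i]
    exact Submodule.zero_mem _
  · intro i c x y hx hy h l h1 h2
    have e := (hF.der l).lin i c x y hx hy h
    rw [e]
    exact Submodule.add_mem _ (Submodule.smul_mem _ c h1) h2
  · intro x y l h1 h2
    have e := (hF.der l).mul x y
    rw [e]
    have e1 := SetLike.GradedMul.mul_mem h1 y.mem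
    have e2 := SetLike.GradedMul.mul_mem h2 x.mem
    refine Submodule.add_mem _ (sgn_mem _ ?_) (sgn_mem _ ?_)
    · convert e1 using 2
      change _ = _ + deg y
      simp only [ldeg_cons, deg_hmul]; ring
    · convert e2 using 2
      change _ = _ + deg x
      simp only [ldeg_cons, deg_hmul]; ring
  · intro g
    rw [ldeg_map_emb]
    exact h g

variable {𝕏 : LRInfinity 𝒜 ℒ} [IsGradedComm 𝒜]

/-- The product rule of the definition is in the last slot, with one factor pulled out on the left.
Graded symmetry moves the slot to the front, and graded commutativity puts the factors on the right.
-/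
theorem IsMultiderivationExtension.mder
    {lam : ∀ k : ℕ, MultilinearMap K (fun _ : Fin k => SymAlg 𝒜 ℒ) (SymAlg 𝒜 ℒ)}
    (h : IsMultiderivationExtension 𝕏 lam) :
    MDer (ev (ℳ := SymAlg.grade 𝒜 ℒ) lam) where
  sym := (gradedSymm_iff_lsym _).1 h.symm
  der := fun l =>
    { lin := fun i c x y hx hy hh => ev_llin lam [] l i c x y hx hy hh
      mul := fun x y => by
        have hs := (gradedSymm_iff_lsym (ℳ := SymAlg.grade 𝒜 ℒ) _).1 h.symm
        have h1 := h.leibniz _ _ (fun i => (l.get i).val) (fun i => (l.get i).mem) _ _ x.mem y.val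
        rw [sum_univ_deg] at h1
        have hx : ev lam (x :: l) ∈ SymAlg.grade 𝒜 ℒ (1 + ldeg (x :: l)) := ev_mem h.degree _
        have hy : ev lam (y :: l) ∈ SymAlg.grade 𝒜 ℒ (1 + ldeg (y :: l)) := ev_mem h.degree _
        have hc := IsGradedComm.comm _ _ _ _ x.mem hy
        have e : ∀ z : Hgs (SymAlg.grade 𝒜 ℒ), lam (l.length + 1) (Fin.snoc (α := fun _ => SymAlg 𝒜 ℒ)
            (fun i => (l.get i).val) z.val) = (deg z * ldeg l).negOnePow • ev lam (z :: l) :=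
          fun z => by rw [hs.back, ev_snoc, sgn_smul_sgn, sgn_eq_self ⟨_, rfl⟩]
        rw [e, e, mul_sgn, hc] at h1
        rw [hs.back, ev_snoc]
        refine (congrArg _ h1).trans ?_
        rw [sgn_mul, smul_add, sgn_smul_sgn, sgn_smul_sgn, sgn_smul_sgn, sgn_smul_sgn, add_comm]
        refine congrArg₂ (· + ·) (sgn_congr (by rw [deg_hmul]; grind) rfl) (sgn_congr ?_ rfl)
        change Even ((deg x + deg y) * ldeg l + (1 + ldeg l) * deg x + deg y * ldeg l +
          deg x * (1 + ldeg (y :: l)) - _)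
        rw [ldeg_cons]
        grind }

theorem ev_ofFn_snoc_snoc {K M N : Type*} [Field K] [AddCommGroup M] [Module K M] [AddCommGroup N]
    [Module K N] {ℳ : ℤ → Submodule K M} (f : ∀ k : ℕ, MultilinearMap K (fun _ : Fin k => M) N)
    (x y : Hgs ℳ) {k : ℕ} (h : Fin k → Hgs ℳ) : ev f (List.ofFn h ++ [x] ++ [y]) =
      f (k + 2) (Fin.snoc (α := fun _ => M)
        (Fin.snoc (α := fun _ => M) (fun i => (h i).val) x.val) y.val) := by
  rw [← ofFn_snoc, ev_ofFn_snoc]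
  congr 2
  funext i
  induction i using Fin.lastCases <;> simp

theorem exists_ofFn {α : Type*} (l : List α) : ∃ (n : ℕ) (h : Fin n → α), l = List.ofFn h :=
  ⟨_, l.get, by simp⟩

/-- Up to order, a list of generators has no, one or several entries from A. The conditions
`bracket`, `anchor` and `vanish` prescribe the value in these three cases. -/
theorem IsMultiderivationExtension.emb
    {lam : ∀ k : ℕ, MultilinearMap K (fun _ : Fin k => SymAlg 𝒜 ℒ) (SymAlg 𝒜 ℒ)}
    (h : IsMultiderivationExtension 𝕏 lam) (g : List (Gen 𝒜 ℒ)) :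
    ev (ℳ := SymAlg.grade 𝒜 ℒ) lam (g.map emb) = genBracket 𝕏 g := by
  have hs := h.mder.sym
  refine gen_induction (P := fun g => ev (ℳ := SymAlg.grade 𝒜 ℒ) lam (g.map SHLR.emb) =
    genBracket 𝕏 g) ?_ ?_ ?_ ?_ g
  · intro p x y q e
    simp only [List.map_append, List.map_cons] at e ⊢
    rw [hs, e, (genBracket_lsym 𝕏) p x y, deg_emb, deg_emb, sgn_smul_sgn, sgn_eq_self (by grind)]
  · intro l
    obtain ⟨n, k, rfl⟩ := exists_ofFn l
    rw [genBracket_map_inr, ev_ofFn, ← h.bracket, List.map_ofFn, List.map_ofFn, ev_ofFn]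
    rfl
  · intro a l
    obtain ⟨n, k, rfl⟩ := exists_ofFn l
    rw [genBracket_inl_map_inr, List.map_cons, hs.back, deg_emb, ldeg_map_emb, ldeg_map_inr, ev_ofFn,
      ← h.anchor, List.map_ofFn, List.map_ofFn, ev_ofFn_snoc]
    rfl
  · intro a b g
    obtain ⟨n, k, hk⟩ := exists_ofFn (g.map SHLR.emb)
    rw [genBracket_inl_inl, List.map_cons, List.map_cons, hk, hs.back, List.cons_append, hs.back,
      ev_ofFn_snoc_snoc]
    refine (congrArg _ (congrArg _ (h.vanish n (fun i => (k i).val) a.val b.val))).trans ?_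
    rw [smul_zero, smul_zero]

theorem IsMultiderivationExtension.unique
    {lam lam' : ∀ k : ℕ, MultilinearMap K (fun _ : Fin k => SymAlg 𝒜 ℒ) (SymAlg 𝒜 ℒ)}
    (h : IsMultiderivationExtension 𝕏 lam) (h' : IsMultiderivationExtension 𝕏 lam') :
    lam' = lam := by
  have key := h'.mder.unique h.mder fun g => by rw [h'.emb, h.emb]
  funext k
  refine SymForms.ext_homog (SymAlg.grade 𝒜 ℒ) fun e v hv => ?_
  have := congrFun key (List.ofFn fun i => ⟨e i, v i, hv i⟩)
  rwa [ev_ofFn, ev_ofFn] at this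

variable (𝕏)

theorem genBracket_extSpec : ExtSpec (genBracket 𝕏) := (genBracket_good 𝕏).extSpec

/-- The brackets on `S_A^• L`. -/
noncomputable def symBracket (k : ℕ) : MultilinearMap K (fun _ : Fin k => SymAlg 𝒜 ℒ) (SymAlg 𝒜 ℒ) :=
  multOf (genBracket_extSpec 𝕏).der.llin k

theorem ev_symBracket (l : List (Hgs (SymAlg.grade 𝒜 ℒ))) :
    ev (symBracket 𝕏) l = multExt (genBracket 𝕏) l := ev_multOf (genBracket_extSpec 𝕏).der.llin l

theorem symBracket_mder : MDer (ev (ℳ := SymAlg.grade 𝒜 ℒ) (symBracket 𝕏)) := by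
  have h : ev (ℳ := SymAlg.grade 𝒜 ℒ) (symBracket 𝕏) = multExt (genBracket 𝕏) :=
    funext (ev_symBracket 𝕏)
  rw [h]
  exact (genBracket_extSpec 𝕏).der

theorem symBracket_emb (g : List (Gen 𝒜 ℒ)) :
    ev (symBracket 𝕏) (g.map emb) = genBracket 𝕏 g := by
  rw [ev_symBracket, (genBracket_extSpec 𝕏).emb]

theorem symBracket_degree (k : ℕ) :
    HasDegree (SymAlg.grade 𝒜 ℒ) (SymAlg.grade 𝒜 ℒ) 1 (symBracket 𝕏 k) := fun e v hv => by
  have h := (symBracket_mder 𝕏).mem (fun g => by rw [symBracket_emb]; exact genBracket_mem 𝕏 g)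
    (List.ofFn fun i => ⟨e i, v i, hv i⟩)
  rw [ev_ofFn] at h
  convert h using 2
  rw [ldeg, List.map_ofFn, List.sum_ofFn]
  rfl

/-- With two arguments from A frozen, the bracket is a multiderivation in the others. It vanishes on
generators, hence equals the zero multiderivation. -/
theorem symBracket_inl_inl (a b : Hgs 𝒜) (l : List (Hgs (SymAlg.grade 𝒜 ℒ))) :
    ev (symBracket 𝕏) (emb (Sum.inl a) :: emb (Sum.inl b) :: l) = 0 :=
  congrFun ((((symBracket_mder 𝕏).cons (emb (Sum.inl a))).cons (emb (Sum.inl b))).unique .zero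
    fun g => by
      have := symBracket_emb 𝕏 (Sum.inl a :: Sum.inl b :: g)
      rwa [genBracket_inl_inl] at this) l

/-- The list statements concern homogeneous arguments. Each condition to be proved is linear in the
entries that are not assumed homogeneous, so it follows by decomposing them. -/
theorem symBracket_extension : IsMultiderivationExtension 𝕏 (symBracket 𝕏) where
  zero := MultilinearMap.ext fun v => by
    have h := symBracket_emb 𝕏 []
    have h0 : genBracket 𝕏 [] = 0 := by
      change SymAlg.ιL 𝒜 ℒ (ev 𝕏.X []) = 0
      rw [𝕏.X_nil, map_zero]
    rw [h0] at h
    rw [Subsingleton.elim v fun i => (([] : List (Hgs (SymAlg.grade 𝒜 ℒ))).get i).val]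
    exact h
  degree := symBracket_degree 𝕏
  symm := (gradedSymm_iff_lsym _).2 (symBracket_mder 𝕏).sym
  leibniz := fun n e u hu r x hx y => by
    have hs := (symBracket_mder 𝕏).sym
    induction y using DirectSum.Decomposition.inductionOn (SymAlg.grade 𝒜 ℒ) with
    | zero => 
      have h0 : symBracket 𝕏 (n + 1) (Fin.snoc (α := fun _ => SymAlg 𝒜 ℒ) u 0) = 0 :=
        map_zero ((symBracket 𝕏 (n + 1)).curryRight u)
      rw [mul_zero, h0, mul_zero, mul_zero, smul_zero, add_zero]
    | add y z h1 h2 =>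
      have ha : ∀ y z, symBracket 𝕏 (n + 1) (Fin.snoc (α := fun _ => SymAlg 𝒜 ℒ) u (y + z)) =
          symBracket 𝕏 (n + 1) (Fin.snoc (α := fun _ => SymAlg 𝒜 ℒ) u y) +
          symBracket 𝕏 (n + 1) (Fin.snoc (α := fun _ => SymAlg 𝒜 ℒ) u z) :=
        map_add ((symBracket 𝕏 (n + 1)).curryRight u)
      rw [mul_add, ha, h1, h2, ha, mul_add, mul_add, smul_add]
      abel
    | @homogeneous j y =>
      let l : List (Hgs (SymAlg.grade 𝒜 ℒ)) := List.ofFn fun i => ⟨e i, u i, hu i⟩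
      have hl : ldeg l = ∑ i, e i := by
        rw [ldeg, List.map_ofFn, List.sum_ofFn]
        rfl
      have e1 : ∀ z : Hgs (SymAlg.grade 𝒜 ℒ), symBracket 𝕏 (n + 1)
          (Fin.snoc (α := fun _ => SymAlg 𝒜 ℒ) u z.val) =
          (deg z * ldeg l).negOnePow • ev (symBracket 𝕏) (z :: l) :=
        fun z => by
          rw [hs.back, ev_ofFn_snoc, sgn_smul_sgn, sgn_eq_self ⟨_, rfl⟩]
      have ex := e1 ⟨r, x, hx⟩
      have ey := e1 ⟨j, y, y.2⟩
      have exy := e1 ((⟨r, x, hx⟩ : Hgs _).mul ⟨j, y, y.2⟩)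
      have hm := ((symBracket_mder 𝕏).der l).mul ⟨r, x, hx⟩ ⟨j, y, y.2⟩
      have hy : ev (symBracket 𝕏) (⟨j, y, y.2⟩ :: l) ∈ SymAlg.grade 𝒜 ℒ _ :=
        ev_mem (symBracket_degree 𝕏) _
      have hc := IsGradedComm.comm _ _ _ _ hy hx
      simp only at ex ey hm hc
      rw [hm] at exy
      refine exy.trans ?_
      rw [ex, ey, hc, ← hl, smul_add, mul_sgn, sgn_mul]
      simp only [sgn_smul_sgn]
      rw [add_comm]
      refine congrArg₂ (· + ·) (sgn_congr ?_ rfl) (sgn_congr ?_ rfl)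
      · simp only [deg_hmul, deg_mk, ldeg_cons]
        grind
      · simp only [deg_hmul, deg_mk]
        grind
  bracket := fun k ξ => by
    refine congrFun (congrArg DFunLike.coe (SymForms.ext_homog (f := (symBracket 𝕏
      k).compLinearMap fun _ => SymAlg.ιL 𝒜 ℒ) (g := (SymAlg.ιL 𝒜 ℒ).compMultilinearMap (𝕏.X k)) ℒ
      fun e v hv => ?_)) ξ
    have h := symBracket_emb 𝕏 ((List.ofFn fun i => (⟨e i, v i, hv i⟩ : Hgs ℒ)).map Sum.inr)
    rw [genBracket_map_inr, ev_ofFn, List.map_ofFn, List.map_ofFn, ev_ofFn] at h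
    exact h
  anchor := fun n ξ a => by
    induction a using DirectSum.Decomposition.inductionOn 𝒜 with
    | zero =>
      rw [map_zero, map_zero, map_zero]
      exact map_zero ((symBracket 𝕏 (n + 1)).curryRight _)
    | add a b h1 h2 =>
      rw [map_add, map_add, map_add, ← h1, ← h2]
      exact map_add ((symBracket 𝕏 (n + 1)).curryRight _) _ _
    | @homogeneous j a =>
      refine congrFun (congrArg DFunLike.coe (SymForms.ext_homog
        (f := (LinearMap.applyₗ (SymAlg.ιA 𝒜 ℒ a)).compMultilinearMap
          ((symBracket 𝕏 (n + 1)).curryRight.compLinearMap fun _ => SymAlg.ιL 𝒜 ℒ))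
        (g := (SymAlg.ιA 𝒜 ℒ ∘ₗ LinearMap.applyₗ (a : A)).compMultilinearMap (𝕏.σ n)) ℒ
        fun e v hv => ?_)) ξ
      have h := symBracket_emb 𝕏 (Sum.inl ⟨j, a, a.2⟩ ::
        (List.ofFn fun i => (⟨e i, v i, hv i⟩ : Hgs ℒ)).map Sum.inr)
      rw [genBracket_inl_map_inr, List.map_cons, (symBracket_mder 𝕏).sym.back, deg_emb, ldeg_map_emb,
        ldeg_map_inr, List.map_ofFn, List.map_ofFn, ev_ofFn_snoc, ev_ofFn] at h
      exact smul_left_cancel _ h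
  vanish := fun n u a b => by
    induction b using DirectSum.Decomposition.inductionOn 𝒜 with
    | zero =>
      rw [map_zero]
      exact map_zero ((symBracket 𝕏 (n + 2)).curryRight _)
    | add b c h1 h2 =>
      rw [map_add]
      refine (map_add ((symBracket 𝕏 (n + 2)).curryRight _) _ _).trans ?_
      exact (congrArg₂ (· + ·) h1 h2).trans (add_zero 0)
    | @homogeneous j b =>
      induction a using DirectSum.Decomposition.inductionOn 𝒜 with
      | zero =>
        rw [map_zero]
        exact map_zero (((LinearMap.applyₗ (SymAlg.ιA 𝒜 ℒ b)).compMultilinearMap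
          (symBracket 𝕏 (n + 2)).curryRight).curryRight u)
      | add a c h1 h2 =>
        rw [map_add]
        refine (map_add (((LinearMap.applyₗ (SymAlg.ιA 𝒜 ℒ b)).compMultilinearMap
          (symBracket 𝕏 (n + 2)).curryRight).curryRight u) _ _).trans ?_
        exact (congrArg₂ (· + ·) h1 h2).trans (add_zero 0)
      | @homogeneous i a =>
        refine congrFun (congrArg DFunLike.coe (SymForms.ext_homog
          (f := (LinearMap.applyₗ (SymAlg.ιA 𝒜 ℒ a)).compMultilinearMap
            ((LinearMap.applyₗ (SymAlg.ιA 𝒜 ℒ b)).compMultilinearMap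
              (symBracket 𝕏 (n + 2)).curryRight).curryRight)
          (g := 0) (SymAlg.grade 𝒜 ℒ) fun e v hv => ?_)) u
        have hs := (symBracket_mder 𝕏).sym
        have h := symBracket_inl_inl 𝕏 ⟨i, a, a.2⟩ ⟨j, b, b.2⟩ (List.ofFn fun i => ⟨e i, v i, hv i⟩)
        rw [hs.back, List.cons_append, hs.back, sgn_smul_sgn, ev_ofFn_snoc_snoc] at h
        exact smul_left_cancel _ (h.trans (smul_zero _).symm)

end Extension

end SHLR

namespace SHLR

open scoped DirectSum TensorProduct
open HasDeg (deg)

/-! ### The Jacobi identity on the graded symmetric algebra -/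

section Jacobi

variable {K : Type*} [Field K]

/-- Two unshuffle sums cancel when their summands match up to sign after an exchange of the parts.
This disposes of the cross terms in the Jacobiator. -/
theorem spl_swap_neg {α N : Type*} [HasDeg α] [AddCommGroup N] {F G : List α → List α → N}
    {l : List α} (h : ∀ I J, (ldeg I * ldeg J).negOnePow • G J I = - F I J) :
    spl F l + spl G l = 0 := by
  rw [spl_swap G, spl_congr fun I J _ => h I J, spl_neg, add_neg_cancel]

theorem HLin.neg {M N : Type*} [AddCommGroup M] [Module K M] {ℳ : ℤ → Submodule K M}
    [AddCommGroup N] [Module K N] {F : Hgs ℳ → N} (hF : HLin F) {i : ℤ} {x : M} (hx : x ∈ ℳ i)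
    (h : -x ∈ ℳ i) : F ⟨i, -x, h⟩ = -F ⟨i, x, hx⟩ := by
  have h1 := hF i (-1) x 0 hx (ℳ i).zero_mem (by simpa using h)
  simpa [hF.zero] using h1

theorem HLin.map_sgn {M N : Type*} [AddCommGroup M] [Module K M] {ℳ : ℤ → Submodule K M}
    [AddCommGroup N] [Module K N] {F : Hgs ℳ → N} (hF : HLin F) (s : ℤˣ) {i : ℤ} {x : M}
    (hx : x ∈ ℳ i) (h : s • x ∈ ℳ i) : F ⟨i, s • x, h⟩ = s • F ⟨i, x, hx⟩ := by
  rcases Int.units_eq_one_or s with rfl | rfl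
  · simp
  · simp only [Units.neg_smul, one_smul] at h ⊢
    exact hF.neg hx h

theorem HLin.map_add {M N : Type*} [AddCommGroup M] [Module K M] {ℳ : ℤ → Submodule K M}
    [AddCommGroup N] [Module K N] {F : Hgs ℳ → N} (hF : HLin F) {i : ℤ} {x y : M}
    (hx : x ∈ ℳ i) (hy : y ∈ ℳ i) (h : x + y ∈ ℳ i) :
    F ⟨i, x + y, h⟩ = F ⟨i, x, hx⟩ + F ⟨i, y, hy⟩ := by
  have h1 := hF i 1 x y hx hy (by simpa using h)
  simpa using h1

theorem hgs_ext {M : Type*} [AddCommGroup M] [Module K M] {ℳ : ℤ → Submodule K M} {x y : Hgs ℳ}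
    (h : deg x = deg y) (h' : x.val = y.val) : x = y := by
  obtain ⟨i, x, hx⟩ := x
  obtain ⟨j, y, hy⟩ := y
  obtain rfl : i = j := h
  obtain rfl : x = y := h'
  rfl

theorem br_lsym {V : Type*} [AddCommGroup V] [Module K V] {𝒱 : ℤ → Submodule K V}
    {lam : ∀ k : ℕ, MultilinearMap K (fun _ : Fin k => V) V}
    (hlam : ∀ k, HasDegree 𝒱 𝒱 1 (lam k)) (hs : LSym (α := Hgs 𝒱) (ev lam))
    {N : Type*} [AddCommGroup N] [Module K N] {F : Hgs 𝒱 → N} (hF : HLin F) :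
    LSym fun I => F (br hlam I) := fun p x y q => by
  have h : br hlam (p ++ x :: y :: q) = ⟨1 + ldeg (p ++ y :: x :: q),
      (deg x * deg y).negOnePow • ev lam (p ++ y :: x :: q), sgn_mem _ (ev_mem hlam _)⟩ :=
    hgs_ext (congrArg (1 + ·) (ldeg_perm ((List.Perm.swap y x q).append_left p))) (hs p x y q)
  beta_reduce
  rw [h]
  exact hF.map_sgn _ (ev_mem hlam _) _

variable {A : Type*} [Ring A] [Algebra K A] {𝒜 : ℤ → Submodule K A} [GradedAlgebra 𝒜]
  {L : Type*} [AddCommGroup L] [Module K L] [Module A L] [IsScalarTower K A L]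
  {ℒ : ℤ → Submodule K L} [DirectSum.Decomposition ℒ] [SetLike.GradedSMul 𝒜 ℒ]

theorem HDer.spl {α : Type*} [HasDeg α] {m : ℤ} {u : List α}
    {F : Hgs (SymAlg.grade 𝒜 ℒ) → List α → List α → SymAlg 𝒜 ℒ}
    (h : ∀ I J, (I ++ J).Perm u → HDer m fun x => F x I J) : HDer m fun x => spl (F x) u := by
  induction u generalizing F with
  | nil => exact h [] [] (by simp)
  | cons z u ih =>
    exact (ih (F := fun x I J => F x (z :: I) J) fun I J hp => h (z :: I) J (by simpa using hp)).add
      (ih (F := fun x I J => (deg z * ldeg I).negOnePow • F x I (z :: J)) fun I J hp =>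
        (h I (z :: J) (List.perm_middle.trans (hp.cons z))).sgn _)

variable [IsGradedComm 𝒜] {lam : ∀ k : ℕ, MultilinearMap K (fun _ : Fin k => SymAlg 𝒜 ℒ) (SymAlg 𝒜 ℒ)}
  (hdeg : ∀ k, HasDegree (SymAlg.grade 𝒜 ℒ) (SymAlg.grade 𝒜 ℒ) 1 (lam k))
  (hF : MDer (ev (ℳ := SymAlg.grade 𝒜 ℒ) lam))
include hF

/-- The product rule is applied to the inner bracket, then to the outer one. The first two terms are
what a derivation should give; in the last two the outer bracket acts on the factor left alone by
the inner one. -/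
theorem ev_br_mul (x y : Hgs (SymAlg.grade 𝒜 ℒ)) (I J : List (Hgs (SymAlg.grade 𝒜 ℒ))) :
    ev lam (br hdeg (x.mul y :: I) :: J) =
      ((deg y * (ldeg I + ldeg J)).negOnePow • (ev lam (br hdeg (x :: I) :: J) * y.val) +
      (deg x * deg y + deg x * (ldeg I + ldeg J)).negOnePow •
        (ev lam (br hdeg (y :: I) :: J) * x.val)) +
      ((deg y * ldeg I + (1 + deg x + ldeg I) * (deg y + ldeg J)).negOnePow •
        (ev lam (y :: J) * ev lam (x :: I)) +
      (deg x * deg y + deg x * ldeg I + (1 + deg y + ldeg I) * (deg x + ldeg J)).negOnePow •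
        (ev lam (x :: J) * ev lam (y :: I))) := by
  have hR := hF.der J
  have m1 := (hF.der I).mul x y
  have hx := ((br hdeg (x :: I)).mul y).mem
  have hy := ((br hdeg (y :: I)).mul x).mem
  have d1 : ((br hdeg (x :: I)).mul y).d = 1 + (deg x + deg y + ldeg I) := by
    change 1 + ldeg (x :: I) + deg y = _
    rw [ldeg_cons]; ring
  have d2 : ((br hdeg (y :: I)).mul x).d = 1 + (deg x + deg y + ldeg I) := by
    change 1 + ldeg (y :: I) + deg x = _
    rw [ldeg_cons]; ring
  rw [d1] at hx
  rw [d2] at hy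
  have e : br hdeg (x.mul y :: I) = ⟨1 + (deg x + deg y + ldeg I), _,
      Submodule.add_mem _ (sgn_mem (deg y * ldeg I).negOnePow hx)
        (sgn_mem (deg x * deg y + deg x * ldeg I).negOnePow hy)⟩ :=
    hgs_ext (by change 1 + ldeg _ = _; rw [ldeg_cons, deg_hmul]; rfl) m1
  have e1 : (⟨_, _, hx⟩ : Hgs (SymAlg.grade 𝒜 ℒ)) = (br hdeg (x :: I)).mul y := hgs_ext d1.symm rfl
  have e2 : (⟨_, _, hy⟩ : Hgs (SymAlg.grade 𝒜 ℒ)) = (br hdeg (y :: I)).mul x := hgs_ext d2.symm rfl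
  rw [e]
  refine (hR.lin.map_add (sgn_mem _ hx) (sgn_mem _ hy) _).trans ?_
  rw [hR.lin.map_sgn _ hx, hR.lin.map_sgn _ hy, e1, e2, hR.mul, hR.mul, smul_add, smul_add]
  have b : ∀ z, deg (br hdeg (z :: I)) = 1 + (deg z + ldeg I) := fun z => by
    change 1 + ldeg (z :: I) = _
    rw [ldeg_cons]
  simp only [sgn_smul_sgn, b]
  rw [add_add_add_comm]
  refine congrArg₂ (· + ·) (congrArg₂ (· + ·) ?_ ?_) (congrArg₂ (· + ·) ?_ ?_)
  all_goals exact sgn_congr (by grind) rfl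

/-- When a product stands in the inner bracket, two cross terms appear besides the Leibniz terms;
they cancel after exchanging I and J because the brackets are odd. When it stands in the outer
bracket, the derivation property is immediate. -/
theorem jacobiator_mder : MDer fun l => spl (fun I J => ev lam (br hdeg I :: J)) l where
  sym := LSym.spl (fun J => br_lsym hdeg hF.sym (hF.der J).lin) fun I => hF.sym.cons _
  der := fun u => by
    have h1 : HDer (ldeg u) fun x => spl (fun I J => ev lam (br hdeg (x :: I) :: J)) u :=
      { lin := fun i c x y hx hy h => by
          rw [← spl_lincomb]
          refine spl_congr fun I J _ => ?_
          refine Eq.trans ?_ ((hF.der J).lin _ c _ _ (br hdeg (⟨i, x, hx⟩ :: I)).mem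
            (br hdeg (⟨i, y, hy⟩ :: I)).mem (Submodule.add_mem _ (Submodule.smul_mem _ _
            (br hdeg (⟨i, x, hx⟩ :: I)).mem) (br hdeg (⟨i, y, hy⟩ :: I)).mem))
          exact congrArg (fun z => ev lam (z :: J)) (hgs_ext rfl ((hF.der I).lin i c x y hx hy h))
        mul := fun x y => by
          simp only [ev_br_mul hdeg hF]
          rw [spl_add, spl_add, spl_add]
          refine (congrArg₂ (· + ·) rfl (spl_swap_neg fun I J => ?_)).trans
            ((add_zero _).trans (congrArg₂ (· + ·) ?_ ?_))
          · have hc := hcomm (br hdeg (x :: I)) (br hdeg (y :: J))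
            change ev lam (x :: I) * ev lam (y :: J) = ((1 + ldeg (x :: I)) * (1 + ldeg (y :: J))).negOnePow • _ at hc
            rw [hc, sgn_smul_sgn, sgn_smul_sgn, neg_sgn]
            refine sgn_congr ?_ rfl
            rw [ldeg_cons, ldeg_cons]
            grind
          · refine Eq.trans ?_ (congrArg _ (spl_map (LinearMap.mulRight K y.val)
              (fun I J => ev lam (br hdeg (x :: I) :: J)) u).symm)
            rw [← spl_smul]
            refine spl_congr fun I J h => ?_
            rw [← ldeg_append, ldeg_perm h]
            rfl
          · refine Eq.trans ?_ (congrArg _ (spl_map (LinearMap.mulRight K x.val)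
              (fun I J => ev lam (br hdeg (y :: I) :: J)) u).symm)
            rw [← spl_smul]
            refine spl_congr fun I J h => ?_
            rw [← ldeg_append, ldeg_perm h]
            rfl }
    -- Here x stands in the outer bracket. Moving it past the inner bracket costs the degree of I
    -- plus one, since the bracket itself is odd; hence the twist by 1.
    have h2 : HDer (ldeg u) fun x =>
        spl (fun I J => (deg x * ldeg I).negOnePow • ev lam (br hdeg I :: x :: J)) u := by
      refine HDer.spl fun I J h => ?_
      have h3 := ((hF.der (br hdeg I :: J)).twist 1).congr (k := ldeg u) (by
        rw [← ldeg_perm h, ldeg_append, ldeg_cons]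
        change Even (1 + ldeg I + ldeg J + 1 - _)
        grind)
      convert h3 using 2 with x
      have := hF.sym [] (br hdeg I) x J
      rw [List.nil_append, List.nil_append] at this
      rw [this, sgn_smul_sgn]
      refine sgn_congr ?_ rfl
      change Even (deg x * ldeg I + (1 + ldeg I) * deg x - _)
      grind
    exact h1.add h2

omit hF

theorem spl_comp_map {α β N : Type*} [HasDeg α] [HasDeg β] [AddCommGroup N] (φ : α → β)
    (hφ : ∀ x, deg (φ x) = deg x) (F : List β → List β → N) (l : List α) :
    spl F (l.map φ) = spl (fun I J => F (I.map φ) (J.map φ)) l := by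
  induction l generalizing F with
  | nil => rfl
  | cons x l ih =>
    have h : ∀ I : List α, ldeg (I.map φ) = ldeg I := fun I => by
      rw [ldeg, ldeg, List.map_map]
      exact congrArg _ (List.map_congr_left fun x _ => hφ x)
    rw [List.map_cons, spl_cons, spl_cons, ih, ih]
    simp only [hφ, h, List.map_cons]

variable (𝕏 : LRInfinity 𝒜 ℒ)

theorem symBracket_cons_inl (a : Hgs 𝒜) (g : List (Gen 𝒜 ℒ)) :
    br (symBracket_degree 𝕏) (emb (Sum.inl a) :: g.map emb) = ⟨_, _,
      sgn_mem (deg a * ldeg g).negOnePow (emb (Sum.inl (𝕏.anchor (g.map lPart) a))).mem⟩ := by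
  refine hgs_ext ?_ ?_
  · change 1 + ldeg _ = deg (emb _)
    rw [ldeg_cons, deg_emb, deg_emb, ldeg_map_emb, deg_inl, deg_inl, 𝕏.deg_anchor, ldeg_map_lPart]
    ring
  · exact (symBracket_emb 𝕏 (Sum.inl a :: g)).trans (genBracket_inl 𝕏 a g)

theorem br_map_inr (l : List (Hgs ℒ)) :
    br (symBracket_degree 𝕏) ((l.map Sum.inr).map emb) = emb (Sum.inr (𝕏.bracket l)) := by
  refine hgs_ext ?_ ((symBracket_emb 𝕏 _).trans (genBracket_map_inr 𝕏 l))
  change 1 + ldeg _ = deg (emb _)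
  rw [deg_emb, ldeg_map_emb, ldeg_map_inr, deg_inr, 𝕏.deg_bracket]

theorem jacobiator_inr (l : List (Hgs ℒ)) :
    spl (fun I J => ev (symBracket 𝕏) (br (symBracket_degree 𝕏) I :: J))
      ((l.map Sum.inr).map emb) = 0 := by
  rw [spl_comp_map emb deg_emb, spl_comp_map Sum.inr deg_inr]
  have h : ∀ I J : List (Hgs ℒ), ev (symBracket 𝕏)
      (br (symBracket_degree 𝕏) ((I.map Sum.inr).map emb) :: (J.map Sum.inr).map emb) =
      SymAlg.ιL 𝒜 ℒ (ev 𝕏.X (𝕏.bracket I :: J)) := fun I J => by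
    rw [br_map_inr, ← List.map_cons, ← List.map_cons, symBracket_emb, genBracket_map_inr]
  simp only [h]
  rw [← spl_map, 𝕏.jacobi_list, map_zero]

theorem ev_anchor_cons (a : Hgs 𝒜) (I J : List (Hgs ℒ)) :
    ev (symBracket 𝕏) (br (symBracket_degree 𝕏)
      (emb (Sum.inl a) :: (I.map Sum.inr).map emb) :: (J.map Sum.inr).map emb) =
      (deg a * ldeg I + (1 + ldeg I + deg a) * ldeg J).negOnePow •
        SymAlg.ιA 𝒜 ℒ (ev 𝕏.σ J (ev 𝕏.σ I a.val)) := by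
  rw [symBracket_cons_inl]
  refine (((symBracket_mder 𝕏).der _).lin.map_sgn _ (emb (Sum.inl _)).mem _).trans ?_
  refine (congrArg _ ((symBracket_emb 𝕏
    (Sum.inl (𝕏.anchor ((I.map Sum.inr).map lPart) a) :: J.map Sum.inr)).trans
    (genBracket_inl_map_inr 𝕏 _ _))).trans ?_
  rw [sgn_smul_sgn, map_lPart_inr, ldeg_map_inr, 𝕏.deg_anchor]
  rfl

theorem ev_bracket_cons (a : Hgs 𝒜) (I J : List (Hgs ℒ)) :
    ev (symBracket 𝕏) (br (symBracket_degree 𝕏)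
      ((I.map Sum.inr).map emb) :: emb (Sum.inl a) :: (J.map Sum.inr).map emb) =
      (deg a * ldeg J).negOnePow • SymAlg.ιA 𝒜 ℒ (ev 𝕏.σ (𝕏.bracket I :: J) a.val) := by
  rw [br_map_inr]
  have h := (symBracket_mder 𝕏).sym [] (emb (Sum.inr (𝕏.bracket I))) (emb (Sum.inl a))
    ((J.map Sum.inr).map emb)
  rw [List.nil_append, List.nil_append] at h
  have h1 := symBracket_emb 𝕏 (Sum.inl a :: (𝕏.bracket I :: J).map Sum.inr)
  rw [genBracket_inl_map_inr, List.map_cons, List.map_cons, List.map_cons] at h1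
  rw [h, h1, sgn_smul_sgn, deg_emb, deg_emb, deg_inl, deg_inr, ldeg_cons, 𝕏.deg_bracket]
  exact sgn_congr (by grind) rfl

/-- With a in the inner bracket the terms are compositions of two anchors, and with a in the outer
bracket they are anchors with a bracket inserted. Their sum is the anchor identity; the swap is
needed because the inner bracket supplies the anchor that acts first. -/
theorem jacobiator_inl (a : Hgs 𝒜) (l : List (Hgs ℒ)) :
    spl (fun I J => ev (symBracket 𝕏) (br (symBracket_degree 𝕏) I :: J))
      ((Sum.inl a :: l.map Sum.inr).map emb) = 0 := by
  rw [spl_comp_map emb deg_emb, spl_cons, spl_comp_map Sum.inr deg_inr,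
    spl_comp_map Sum.inr deg_inr]
  simp only [List.map_cons, ev_anchor_cons, ev_bracket_cons, ldeg_map_inr, sgn_smul_sgn]
  rw [spl_swap]
  simp only [sgn_smul_sgn]
  have h := congrArg (fun x => (deg a * ldeg l).negOnePow • SymAlg.ιA 𝒜 ℒ x)
    (𝕏.jacobi_symbol_list l a.val)
  simp only [map_add, map_zero, smul_zero, smul_add] at h
  rw [spl_map, spl_map, ← spl_smul, ← spl_smul, add_comm] at h
  simp only [map_sgn, sgn_smul_sgn] at h
  refine Eq.trans (congrArg₂ (· + ·) (spl_congr fun I J hp => ?_) (spl_congr fun I J hp => ?_)) h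
  · refine sgn_congr ?_ rfl
    rw [← ldeg_perm hp, ldeg_append]
    grind
  · refine sgn_congr ?_ rfl
    rw [← ldeg_perm hp, ldeg_append, deg_inl]
    grind

theorem ev_inl_cons (a b : Hgs 𝒜) (I J : List (Gen 𝒜 ℒ)) :
    ev (symBracket 𝕏) (br (symBracket_degree 𝕏)
      (emb (Sum.inl a) :: I.map emb) :: emb (Sum.inl b) :: J.map emb) = 0 := by
  rw [symBracket_cons_inl]
  refine (((symBracket_mder 𝕏).der _).lin.map_sgn _ (emb (Sum.inl _)).mem _).trans ?_
  exact (congrArg _ (symBracket_inl_inl 𝕏 _ b _)).trans (smul_zero _)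

/-- The entries a and b lie both inside, both outside, or one on each side. In the last case the
inner bracket is an element of A, so the outer bracket again has two entries from A. All four sums
vanish termwise. -/
theorem jacobiator_inl_inl (a b : Hgs 𝒜) (g : List (Gen 𝒜 ℒ)) :
    spl (fun I J => ev (symBracket 𝕏) (br (symBracket_degree 𝕏) I :: J))
      ((Sum.inl a :: Sum.inl b :: g).map emb) = 0 := by
  have hs := (symBracket_mder 𝕏).sym
  rw [spl_comp_map emb deg_emb, spl_cons, spl_cons, spl_cons]
  rw [spl_eq_zero, spl_eq_zero, spl_eq_zero, spl_eq_zero]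
  · simp
  · intro I J _
    have h1 := hs [] (br (symBracket_degree 𝕏) (I.map emb)) (emb (Sum.inl a))
      (emb (Sum.inl b) :: J.map emb)
    have h2 := hs [emb (Sum.inl a)] (br (symBracket_degree 𝕏) (I.map emb)) (emb (Sum.inl b))
      (J.map emb)
    simp only [List.nil_append, List.cons_append] at h1 h2
    simp only [List.map_cons]
    rw [h1, h2, symBracket_inl_inl, smul_zero, smul_zero, smul_zero, smul_zero]
  · intro I J _
    simp only [List.map_cons]
    rw [ev_inl_cons, smul_zero]
  · intro I J _
    simp only [List.map_cons]
    rw [ev_inl_cons, smul_zero]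
  · intro I J _
    simp only [List.map_cons]
    have h : br (symBracket_degree 𝕏) (emb (Sum.inl a) :: emb (Sum.inl b) :: I.map emb) =
      ⟨_, 0, Submodule.zero_mem _⟩ := hgs_ext rfl (symBracket_inl_inl 𝕏 a b _)
    rw [h]
    exact ((symBracket_mder 𝕏).der _).lin.zero _

/-- The Jacobiator and zero are multiderivations that agree on generators. -/
theorem symBracket_jacobi (l : List (Hgs (SymAlg.grade 𝒜 ℒ))) :
    spl (fun I J => ev (symBracket 𝕏) (br (symBracket_degree 𝕏) I :: J)) l = 0 := by
  have hJ := jacobiator_mder (symBracket_degree 𝕏) (symBracket_mder 𝕏)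
  refine congrFun (hJ.unique .zero fun g => ?_) l
  refine gen_induction (P := fun g => spl (fun I J => ev (symBracket 𝕏)
    (br (symBracket_degree 𝕏) I :: J)) (g.map emb) = 0) ?_ (jacobiator_inr 𝕏) (jacobiator_inl 𝕏)
    (jacobiator_inl_inl 𝕏) g
  intro p x y q h
  have := hJ.sym (p.map emb) (emb y) (emb x) (q.map emb)
  simp only [List.map_append, List.map_cons] at h ⊢
  rw [this, h, smul_zero]

theorem symBracket_isLInfinity : IsLInfinityAlgebra (SymAlg.grade 𝒜 ℒ) (symBracket 𝕏) where
  zero := (symBracket_extension 𝕏).zero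
  degree := symBracket_degree 𝕏
  symm := (symBracket_extension 𝕏).symm
  jacobi := (jacobi_iff (symBracket_degree 𝕏) (symBracket 𝕏)).2 (symBracket_jacobi 𝕏)

end Jacobi

end SHLR

namespace SHLR

open scoped DirectSum TensorProduct
open HasDeg (deg)

/-! ### Modules from derived brackets -/

section

variable {α : Type*} [HasDeg α] {K M N : Type*} [Field K] [AddCommGroup M] [Module K M]
  [AddCommGroup N] [Module K N]

theorem spl_apply (F : List α → List α → M →ₗ[K] N) (l : List α) (w : M) :
    (spl F l) w = spl (fun I J => F I J w) l :=
  spl_map (LinearMap.applyₗ w) F l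

end

section DerivedModules

variable {K : Type*} [Field K] [CharZero K]
  {A : Type*} [Ring A] [Algebra K A] {𝒜 : ℤ → Submodule K A} [GradedAlgebra 𝒜]
  {L : Type*} [AddCommGroup L] [Module K L] [Module A L] [IsScalarTower K A L]
  {ℒ : ℤ → Submodule K L} [DirectSum.Decomposition ℒ] [SetLike.GradedSMul 𝒜 ℒ]
  [IsGradedComm 𝒜] {𝕏 : LRInfinity 𝒜 ℒ}
  {W : Type*} [AddCommGroup W] [Module K W] {𝒲 : ℤ → Submodule K W} [DirectSum.Decomposition 𝒲]
  {ρ : SymAlg 𝒜 ℒ →ₐ[K] Module.End K W} (hρ : IsGradedAction 𝒲 (SymAlg.grade 𝒜 ℒ) ρ)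
  {D : ℕ → Module.End K W} (hD : ∀ n, EndDegree 𝒲 1 (D n)) {s : ℤˣ}

include hρ

/-- The product is moved to the end of the list, where the commutator with ρ(x)ρ(y) obeys the
Leibniz rule. This is the operator version of the product rule for brackets. -/
theorem comm_mul_cons {a : ℤ} {Φ : Module.End K W} (h : EndDegree 𝒲 a Φ)
    (x y : Hgs (SymAlg.grade 𝒜 ℒ)) (u : List (Hgs (SymAlg.grade 𝒜 ℒ))) :
    comm 𝒲 ρ Φ (x.mul y :: u) = (deg y * ldeg u).negOnePow • (comm 𝒲 ρ Φ (x :: u) * ρ y.val) +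
      (a * deg x).negOnePow • (ρ x.val * comm 𝒲 ρ Φ (y :: u)) := by
  have hs := comm_lsym hρ h
  rw [hs.back, hs.back x, hs.back y, comm_snoc, comm_snoc, comm_snoc]
  refine (congrArg _ (gradedCommutator_action_mul hρ (h.comm hρ u) x y)).trans ?_
  rw [smul_add, sgn_mul, mul_sgn, sgn_smul_sgn, sgn_smul_sgn, sgn_smul_sgn, deg_hmul]
  exact congrArg₂ (· + ·) (sgn_congr (by grind) rfl) (sgn_congr (by grind) rfl)

include hD

/-- Both sides are graded symmetric and linear and satisfy the same product rule in the first slot,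
which keeps the length n + 1. So the condition that D n has the bracket as its symbol reduces to the
three kinds of lists of generators. -/
theorem comm_eq_of_generators
    (hL : ∀ l : List (Hgs ℒ), ∀ n, l.length = n + 1 → comm 𝒲 ρ (D n) ((l.map Sum.inr).map emb) =
      s ^ n • ρ (SymAlg.ιL 𝒜 ℒ (ev 𝕏.X l)))
    (hA : ∀ (a : Hgs 𝒜) (l : List (Hgs ℒ)), comm 𝒲 ρ (D l.length)
      (emb (Sum.inl a) :: (l.map Sum.inr).map emb) =
      s ^ l.length • (deg a * ldeg l).negOnePow • ρ (SymAlg.ιA 𝒜 ℒ (ev 𝕏.σ l a.val)))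
    (hAA : ∀ (a b : Hgs 𝒜) (g : List (Gen 𝒜 ℒ)) (n : ℕ), g.length + 1 = n → comm 𝒲 ρ (D n)
      (emb (Sum.inl a) :: emb (Sum.inl b) :: g.map emb) = 0)
    (n : ℕ) (l : List (Hgs (SymAlg.grade 𝒜 ℒ))) (hl : l.length = n + 1) :
    comm 𝒲 ρ (D n) l = s ^ n • ρ (ev (symBracket 𝕏) l) := by
  have hM := symBracket_mder 𝕏
  have hs := comm_lsym hρ (hD n)
  revert hl
  refine hgs_induction (P := fun l => l.length = n + 1 →
    comm 𝒲 ρ (D n) l = s ^ n • ρ (ev (symBracket 𝕏) l)) ?_ ?_ ?_ ?_ ?_ l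
  · intro p x y q h hl
    rw [hs, h (by simpa using hl), hM.sym p y x q, map_sgn, smul_comm]
  · intro i l _
    have h1 := (comm_llin (𝒲 := 𝒲) (ρ := ρ) (𝒮 := SymAlg.grade 𝒜 ℒ) (D n)).zero_head i [] l
    have h2 := (hM.der l).lin.zero i
    rw [List.nil_append] at h1
    rw [h1, h2, map_zero, smul_zero]
  · intro i c x y hx hy h l h1 h2 hl
    have e1 := comm_llin (𝒲 := 𝒲) (ρ := ρ) (𝒮 := SymAlg.grade 𝒜 ℒ) (D n) [] l i c x y hx hy h
    have e2 := (hM.der l).lin i c x y hx hy h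
    simp only [List.nil_append] at e1
    rw [e1, e2, h1 hl, h2 hl, map_add, map_smul, smul_add, smul_sgn]
  · intro x y u h1 h2 hl
    have e1 := (hM.der u).mul x y
    have hc := IsGradedComm.comm _ _ _ _ x.mem (br (symBracket_degree 𝕏) (y :: u)).mem
    have hc' : ρ x.val * ρ (ev (symBracket 𝕏) (y :: u)) =
      (deg x * (1 + ldeg (y :: u))).negOnePow • (ρ (ev (symBracket 𝕏) (y :: u)) * ρ x.val) := by
      rw [← map_mul, ← map_mul, ← map_sgn ρ]
      exact congrArg ρ hc
    rw [comm_mul_cons hρ (hD n), h1 hl, h2 hl, e1, map_add, map_sgn, map_sgn, map_mul, map_mul, sgn_mul,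
      mul_sgn, hc', smul_add, smul_comm _ (s ^ n), smul_comm _ (s ^ n), sgn_smul_sgn]
    refine congrArg₂ (· + ·) rfl (congrArg _ (sgn_congr ?_ rfl))
    rw [ldeg_cons]
    grind
  · intro g hg
    rw [symBracket_emb]
    have hg' : g.length = n + 1 := by simpa using hg
    clear hg
    revert hg'
    refine gen_induction (P := fun g => g.length = n + 1 →
      comm 𝒲 ρ (D n) (g.map emb) = s ^ n • ρ (genBracket 𝕏 g)) ?_ ?_ ?_ ?_ g
    · intro p x y q h hl
      have := hs (p.map emb) (emb y) (emb x) (q.map emb)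
      have h' := h (by simpa using hl)
      simp only [List.map_append, List.map_cons] at h' ⊢
      rw [this, h', genBracket_lsym 𝕏 p y x q, map_sgn, smul_comm, deg_emb, deg_emb]
    · intro l hl
      rw [genBracket_map_inr]
      exact hL l n (by simpa using hl)
    · intro a l hl
      have hl' : l.length = n := by simpa using hl
      subst hl'
      rw [genBracket_inl_map_inr, map_sgn]
      exact hA a l
    · intro a b g hl
      rw [genBracket_inl_inl, map_zero, smul_zero]
      exact hAA a b g n (by simpa using hl)

variable (hs : ∀ (n : ℕ) (l : List (Hgs (SymAlg.grade 𝒜 ℒ))), l.length = n + 1 →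
    comm 𝒲 ρ (D n) l = s ^ n • ρ (ev (symBracket 𝕏) l))

theorem isModuleOps_comm (t : ℕ → ℤˣ)
    {mu : ∀ n : ℕ, MultilinearMap K (fun _ : Fin n => SymAlg 𝒜 ℒ) (Module.End K W)}
    (hmu : ∀ l : List (Hgs (SymAlg.grade 𝒜 ℒ)), ev mu l = t l.length • comm 𝒲 ρ (D l.length) l) :
    IsModuleOps (SymAlg.grade 𝒜 ℒ) 𝒲 mu where
  degree := fun n e v hv f w hw => by
    have h := hmu (List.ofFn fun i => ⟨e i, v i, hv i⟩)
    rw [ev_ofFn, List.length_ofFn] at h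
    simp only at h
    have hl : ldeg (List.ofFn fun i => (⟨e i, v i, hv i⟩ : Hgs (SymAlg.grade 𝒜 ℒ))) = ∑ i, e i := by
      rw [ldeg, List.map_ofFn, List.sum_ofFn]
      rfl
    have h1 := ((hD n).comm hρ (List.ofFn fun i => ⟨e i, v i, hv i⟩)).sgn (t n) f w hw
    rw [h, ← hl]
    exact h1
  symm := by
    refine (gradedSymm_iff_lsym _).2 fun p x y q => ?_
    rw [hmu, hmu, comm_lsym hρ (hD _) p x y q, smul_comm]
    simp

include hs

/-- Multiplying the formula for the commutators of the square by s to the power |l| gives the module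
identity: in the compositions this sign splits over I and J, and in the insertions it combines with
s ^ (|I| + 1) to s ^ (|J| + 1), because s squares to 1. -/
theorem isLeftModule_iff
    {mu : ∀ n : ℕ, MultilinearMap K (fun _ : Fin n => SymAlg 𝒜 ℒ) (Module.End K W)}
    (hmu : ∀ l : List (Hgs (SymAlg.grade 𝒜 ℒ)), ev mu l = s ^ l.length • comm 𝒲 ρ (D l.length) l) :
    IsLeftLInfinityModule (SymAlg.grade 𝒜 ℒ) 𝒲 (symBracket 𝕏) mu ↔
      ∀ l, comm (𝒮 := SymAlg.grade 𝒜 ℒ) 𝒲 ρ (sqComp D l.length) l = 0 := by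
  have key : ∀ (l : List (Hgs (SymAlg.grade 𝒜 ℒ))) w,
      spl (fun I J => ev mu (br (symBracket_degree 𝕏) I :: J) w) l +
        spl (fun I J => (ldeg I).negOnePow • ev mu I (ev mu J w)) l =
      s ^ l.length • comm (𝒮 := SymAlg.grade 𝒜 ℒ) 𝒲 ρ (sqComp D l.length) l w := by
    intro l w
    rw [comm_sqComp_eq hρ hD (symBracket_degree 𝕏) (symBracket_extension 𝕏).zero hs _ l rfl,
      LinearMap.add_apply, smul_add, add_comm, spl_apply, spl_apply, ← spl_smul, ← spl_smul]
    refine congrArg₂ (· + ·) (spl_congr fun I J h => ?_) (spl_congr fun I J h => ?_)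
    · have hl : l.length = I.length + J.length := by rw [← h.length_eq, List.length_append]
      rw [hmu, hmu, hl, pow_add]
      simp only [LinearMap.smul_apply, Module.End.mul_apply, map_sgn,
        smul_smul]
      congr 1
      ac_rfl
    · have hl : l.length = I.length + J.length := by rw [← h.length_eq, List.length_append]
      rw [hmu, hl, pow_add, List.length_cons]
      simp only [LinearMap.smul_apply, smul_smul]
      congr 1
      rw [pow_succ, pow_succ]
      have := Int.units_mul_self (s ^ I.length)
      calc s ^ J.length * s = (s ^ I.length * s ^ I.length) * (s ^ J.length * s) := by
            rw [this, one_mul]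
        _ = _ := by ac_rfl
  constructor
  · intro h l
    refine LinearMap.ext fun w => ?_
    have := (module_jacobi_iff (symBracket_degree 𝕏) mu).1 h.jacobi l w
    rw [key] at this
    exact smul_left_cancel _ (this.trans (smul_zero _).symm)
  · intro h
    exact ⟨isModuleOps_comm hρ hD (fun n => s ^ n) hmu,
      (module_jacobi_iff (symBracket_degree 𝕏) mu).2 fun l w => by
        rw [key, h, LinearMap.zero_apply, smul_zero]⟩

/-- The operations are minus the commutators. A composition contains two of these signs and an
insertion only one, which produces the relative minus sign of right modules. -/
theorem isRightModule_iff (hs1 : s = 1)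
    {mu : ∀ n : ℕ, MultilinearMap K (fun _ : Fin n => SymAlg 𝒜 ℒ) (Module.End K W)}
    (hmu : ∀ l : List (Hgs (SymAlg.grade 𝒜 ℒ)), ev mu l = (-1 : ℤˣ) • comm 𝒲 ρ (D l.length) l) :
    IsRightLInfinityModule (SymAlg.grade 𝒜 ℒ) 𝒲 (symBracket 𝕏) mu ↔
      ∀ l, comm (𝒮 := SymAlg.grade 𝒜 ℒ) 𝒲 ρ (sqComp D l.length) l = 0 := by
  have key : ∀ (l : List (Hgs (SymAlg.grade 𝒜 ℒ))) w,
      spl (fun I J => ev mu (br (symBracket_degree 𝕏) I :: J) w) l -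
        spl (fun I J => (ldeg I).negOnePow • ev mu I (ev mu J w)) l =
      - comm (𝒮 := SymAlg.grade 𝒜 ℒ) 𝒲 ρ (sqComp D l.length) l w := by
    intro l w
    rw [comm_sqComp_eq hρ hD (symBracket_degree 𝕏) (symBracket_extension 𝕏).zero hs _ l rfl,
      LinearMap.add_apply, neg_add, add_comm, spl_apply, spl_apply, ← spl_neg, ← spl_neg,
      sub_eq_add_neg, ← spl_neg]
    refine congrArg₂ (· + ·) (spl_congr fun I J h => ?_) (spl_congr fun I J h => ?_)
    · rw [hmu, hs1, one_pow, one_smul]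
      simp only [Units.neg_smul, one_smul, LinearMap.neg_apply]
      rfl
    · rw [hmu, hmu]
      simp only [LinearMap.smul_apply, Module.End.mul_apply,
        Units.neg_smul, one_smul, LinearMap.neg_apply, map_neg, neg_neg]
  constructor
  · intro h l
    refine LinearMap.ext fun w => ?_
    have := (right_module_jacobi_iff (symBracket_degree 𝕏) mu).1 h.jacobi l w
    rw [key] at this
    exact neg_eq_zero.1 this
  · intro h
    exact ⟨isModuleOps_comm hρ hD (fun _ => -1) hmu,
      (right_module_jacobi_iff (symBracket_degree 𝕏) mu).2 fun l w => by
        rw [key, h, LinearMap.zero_apply, neg_zero]⟩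

end DerivedModules

end SHLR

namespace SHLR

open scoped DirectSum TensorProduct
open HasDeg (deg)

/-! ### Linear maps out of `S_A^• L ⊗_A Q` -/

section BalancedFamilies

variable {K : Type*} [Field K]
  {A : Type*} [Ring A] [Algebra K A] {𝒜 : ℤ → Submodule K A} [GradedAlgebra 𝒜]
  {L : Type*} [AddCommGroup L] [Module K L] [Module A L] [IsScalarTower K A L]
  {ℒ : ℤ → Submodule K L} [DirectSum.Decomposition ℒ] [SetLike.GradedSMul 𝒜 ℒ]
  {Q : Type*} [AddCommGroup Q] [Module K Q] [Module A Q] [IsScalarTower K A Q]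
  {N : Type*} [AddCommGroup N] [Module K N]

variable (𝒜 ℒ Q N) in
/-- The families `F(ξ_1, …, ξ_n | q)` that define linear maps `ξ_1 ⋯ ξ_n ⊗ q ↦ F(ξ_1, …, ξ_n | q)`
on `S_A^• L ⊗_A Q`. -/
def balancedFamilies : Submodule K (List (Hgs ℒ) → Q →ₗ[K] N) where
  carrier := {F | LSym F ∧ LLin F ∧ ∀ (a : Hgs 𝒜) ξ l q,
    F (a.smul ξ :: l) q = (deg a * (deg ξ + ldeg l)).negOnePow • F (ξ :: l) (a.val • q)}
  zero_mem' := by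
    refine ⟨fun p x y q => ?_, fun p q i c x y hx hy h => ?_, fun a ξ l q => ?_⟩ <;> simp
  add_mem' := by
    rintro F G ⟨h1, h2, h3⟩ ⟨k1, k2, k3⟩
    refine ⟨fun p x y q => ?_, fun p q i c x y hx hy h => ?_, fun a ξ l q => ?_⟩
    · rw [Pi.add_apply, Pi.add_apply, h1, k1, smul_add]
    · rw [Pi.add_apply, Pi.add_apply, Pi.add_apply, h2 _ _ _ _ _ _ hx hy, k2 _ _ _ _ _ _ hx hy,
        smul_add]
      abel
    · rw [Pi.add_apply, Pi.add_apply, LinearMap.add_apply, LinearMap.add_apply, h3, k3, smul_add]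
  smul_mem' := by
    rintro c F ⟨h1, h2, h3⟩
    refine ⟨fun p x y q => ?_, fun p q i b x y hx hy h => ?_, fun a ξ l q => ?_⟩
    · rw [Pi.smul_apply, Pi.smul_apply, h1, smul_sgn]
    · rw [Pi.smul_apply, Pi.smul_apply, Pi.smul_apply, h2 _ _ _ _ _ _ hx hy, smul_add, smul_comm c]
    · rw [Pi.smul_apply, Pi.smul_apply, LinearMap.smul_apply, LinearMap.smul_apply, h3, smul_sgn]

namespace balancedFamilies

theorem smul_smul_comm [IsGradedComm 𝒜] (a b : Hgs 𝒜) (q : Q) :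
    b.val • a.val • q = (deg a * deg b).negOnePow • a.val • b.val • q := by
  have h := IsGradedComm.comm (𝒜 := 𝒜) _ _ _ _ b.mem a.mem
  rw [smul_smul, smul_smul, h, sgn_smul]
  exact sgn_congr ⟨0, by change b.d * a.d - a.d * b.d = _; ring⟩ rfl

/-- The family `F(ξ, ξ_1, …, ξ_n | q)`. -/
def consL (ξ : Hgs ℒ) :
    balancedFamilies 𝒜 ℒ Q N →ₗ[K] balancedFamilies 𝒜 ℒ Q N where
  toFun F := ⟨fun l => F.1 (ξ :: l), F.2.1.cons ξ, F.2.2.1.cons ξ, fun a ζ l q => by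
    have h := F.2.1 [] ξ (a.smul ζ) l
    have h' := F.2.1 [] ζ ξ l
    simp only [List.nil_append] at h h'
    beta_reduce
    rw [h, LinearMap.smul_apply, F.2.2.2, h', LinearMap.smul_apply, sgn_smul_sgn, sgn_smul_sgn]
    refine sgn_congr ?_ rfl
    rw [ldeg_cons, deg_hsmul]
    grind⟩
  map_add' F G := rfl
  map_smul' c F := rfl

/-- The family `± F(ξ_1, …, ξ_n | a q)`. -/
def smulA [IsGradedComm 𝒜] (a : Hgs 𝒜) :
    balancedFamilies 𝒜 ℒ Q N →ₗ[K] balancedFamilies 𝒜 ℒ Q N where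
  toFun F := ⟨fun l => (deg a * ldeg l).negOnePow • (F.1 l ∘ₗ Algebra.lsmul K K Q a.val),
    (F.2.1.map (LinearMap.lcomp K N (Algebra.lsmul K K Q a.val))).smul_ldeg
      fun d => (deg a * d).negOnePow,
    (F.2.2.1.map (LinearMap.lcomp K N (Algebra.lsmul K K Q a.val))).smul_ldeg
      fun d => (deg a * d).negOnePow, fun b ζ l q => by
    simp only [LinearMap.smul_apply, LinearMap.comp_apply, Algebra.lsmul_coe]
    rw [F.2.2.2, smul_smul_comm, map_sgn, sgn_smul_sgn, sgn_smul_sgn, sgn_smul_sgn]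
    refine sgn_congr ?_ rfl
    rw [ldeg_cons, ldeg_cons, deg_hsmul]
    grind⟩
  map_add' F G := Subtype.ext (funext fun l => LinearMap.ext fun q => by
    simp only [Submodule.coe_add, Pi.add_apply, LinearMap.smul_apply, LinearMap.comp_apply,
      LinearMap.add_apply, smul_add])
  map_smul' c F := Subtype.ext (funext fun l => LinearMap.ext fun q => by
    simp only [Submodule.coe_smul, Pi.smul_apply, LinearMap.smul_apply, LinearMap.comp_apply,
      RingHom.id_apply, smul_sgn])

theorem ext_apply {Φ Ψ : Module.End K (balancedFamilies 𝒜 ℒ Q N)}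
    (h : ∀ F l q, (Φ F).1 l q = (Ψ F).1 l q) : Φ = Ψ :=
  LinearMap.ext fun F => Subtype.ext (funext fun l => LinearMap.ext fun q => h F l q)

theorem smulA_apply [IsGradedComm 𝒜] (a : Hgs 𝒜) (F : balancedFamilies 𝒜 ℒ Q N)
    (l : List (Hgs ℒ)) (q : Q) :
    (smulA a F).1 l q = (deg a * ldeg l).negOnePow • F.1 l (a.val • q) := rfl

variable (𝒜 ℒ Q N) in
/-- `consL`, linearly extended to all of `L`. -/
def opL : L →ₗ[K] Module.End K (balancedFamilies 𝒜 ℒ Q N) :=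
  homogLift ℒ fun i =>
    { toFun := fun ξ => consL ⟨i, ξ, ξ.2⟩
      map_add' := fun ξ ζ => ext_apply fun F l q => by
        have h := F.2.2.1 [] l i 1 ξ ζ ξ.2 ζ.2 (by rw [one_smul]; exact (ξ + ζ).2)
        simp only [one_smul] at h
        exact congrArg (fun f => f q) h
      map_smul' := fun c ξ => ext_apply fun F l q => by
        have h := F.2.2.1 [] l i c ξ 0 ξ.2 (ℒ i).zero_mem (by rw [add_zero]; exact (c • ξ).2)
        simp only [add_zero, F.2.2.1.zero_head i [] l] at h
        exact congrArg (fun f => f q) h }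

theorem opL_apply (ξ : Hgs ℒ) : opL 𝒜 ℒ Q N ξ.val = consL ξ := homogLift_apply ℒ _ ξ.mem

variable (𝒜 ℒ Q N) in
/-- `smulA`, linearly extended to all of `A`. -/
def opA [IsGradedComm 𝒜] : A →ₗ[K] Module.End K (balancedFamilies 𝒜 ℒ Q N) :=
  homogLift 𝒜 fun i =>
    { toFun := fun a => smulA ⟨i, a, a.2⟩
      map_add' := fun a b => ext_apply fun F l q => by
        have h : F.1 l (((a + b : 𝒜 i) : A) • q) = F.1 l ((a : A) • q) + F.1 l ((b : A) • q) := by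
          rw [Submodule.coe_add, add_smul, map_add]
        exact (congrArg ((i * ldeg l).negOnePow • ·) h).trans (smul_add _ _ _)
      map_smul' := fun c a => ext_apply fun F l q => by
        have h : F.1 l (((c • a : 𝒜 i) : A) • q) = c • F.1 l ((a : A) • q) := by
          rw [Submodule.coe_smul, smul_assoc, map_smul]
        exact (congrArg ((i * ldeg l).negOnePow • ·) h).trans (smul_sgn _ _ _).symm }

theorem opA_apply [IsGradedComm 𝒜] (a : Hgs 𝒜) : opA 𝒜 ℒ Q N a.val = smulA a :=
  homogLift_apply 𝒜 _ a.mem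

variable (𝒜 ℒ Q N) in
/-- The right action of `S_A^• L` on families. -/
def liftData [IsGradedComm 𝒜] :
    SymAlg.LiftData (Module.End K (balancedFamilies 𝒜 ℒ Q N))ᵐᵒᵖ 𝒜 ℒ where
  f := (MulOpposite.opLinearEquiv K).toLinearMap ∘ₗ opA 𝒜 ℒ Q N
  g := (MulOpposite.opLinearEquiv K).toLinearMap ∘ₗ opL 𝒜 ℒ Q N
  one := congrArg MulOpposite.op (show opA 𝒜 ℒ Q N 1 = 1 from ext_apply fun F l q => by
    rw [opA_apply ⟨0, 1, SetLike.GradedOne.one_mem⟩, smulA_apply, one_smul]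
    exact sgn_eq_self ⟨0, zero_mul _⟩)
  mul := fun {i j a b} ha hb => congrArg MulOpposite.op
    (show opA 𝒜 ℒ Q N b * opA 𝒜 ℒ Q N a = opA 𝒜 ℒ Q N (a * b) from ext_apply fun F l q => by
      rw [opA_apply ⟨i, a, ha⟩, opA_apply ⟨j, b, hb⟩,
        opA_apply ⟨i + j, a * b, SetLike.GradedMul.mul_mem ha hb⟩, Module.End.mul_apply,
        smulA_apply, smulA_apply, smulA_apply, sgn_smul_sgn, mul_smul]
      refine sgn_congr ?_ rfl
      change Even (j * _ + i * _ - (i + j) * _)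
      grind)
  smul := fun {i j a ξ} ha hξ => congrArg MulOpposite.op
    (show opL 𝒜 ℒ Q N ξ * opA 𝒜 ℒ Q N a = opL 𝒜 ℒ Q N (a • ξ) from ext_apply fun F l q => by
      have h := opL_apply (𝒜 := 𝒜) (Q := Q) (N := N) (Hgs.smul ⟨i, a, ha⟩ (⟨j, ξ, hξ⟩ : Hgs ℒ))
      change opL 𝒜 ℒ Q N (a • ξ) = _ at h
      rw [opA_apply ⟨i, a, ha⟩, opL_apply ⟨j, ξ, hξ⟩, h]
      exact (F.2.2.2 ⟨i, a, ha⟩ ⟨j, ξ, hξ⟩ l q).symm)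
  comm_smul := fun {i j a ξ} ha hξ => congrArg MulOpposite.op
    (show opL 𝒜 ℒ Q N ξ * opA 𝒜 ℒ Q N a =
      (i * j).negOnePow • (opA 𝒜 ℒ Q N a * opL 𝒜 ℒ Q N ξ) from ext_apply fun F l q => by
      rw [opA_apply ⟨i, a, ha⟩, opL_apply ⟨j, ξ, hξ⟩]
      change (_ : ℤ).negOnePow • F.1 (⟨j, ξ, hξ⟩ :: l) (a • q) =
        (_ : ℤ).negOnePow • (_ : ℤ).negOnePow • F.1 (⟨j, ξ, hξ⟩ :: l) (a • q)
      rw [sgn_smul_sgn]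
      refine sgn_congr ?_ rfl
      change Even (i * (j + ldeg l) - (i * j + i * ldeg l))
      grind)
  comm := fun {i j ξ ζ} hξ hζ => congrArg MulOpposite.op
    (show opL 𝒜 ℒ Q N ζ * opL 𝒜 ℒ Q N ξ =
      (i * j).negOnePow • (opL 𝒜 ℒ Q N ξ * opL 𝒜 ℒ Q N ζ) from ext_apply fun F l q => by
      rw [opL_apply ⟨i, ξ, hξ⟩, opL_apply ⟨j, ζ, hζ⟩]
      exact congrArg (fun f => f q) (F.2.1 [] ⟨i, ξ, hξ⟩ ⟨j, ζ, hζ⟩ l))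

/-- The right action of `S_A^• L` on families. -/
def act [IsGradedComm 𝒜] (u : SymAlg 𝒜 ℒ) : Module.End K (balancedFamilies 𝒜 ℒ Q N) :=
  (SymAlg.lift (liftData 𝒜 ℒ Q N) u).unop

end balancedFamilies

open balancedFamilies

/-- The product of a list of elements of `L`. -/
def prodList (𝒜 : ℤ → Submodule K A) {ℒ : ℤ → Submodule K L} (l : List (Hgs ℒ)) : SymAlg 𝒜 ℒ :=
  (l.map fun ξ => SymAlg.ιL 𝒜 ℒ ξ.val).prod

@[simp] theorem prodList_nil : prodList 𝒜 ([] : List (Hgs ℒ)) = 1 := rfl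

@[simp] theorem prodList_cons (ξ : Hgs ℒ) (l : List (Hgs ℒ)) :
    prodList 𝒜 (ξ :: l) = SymAlg.ιL 𝒜 ℒ ξ.val * prodList 𝒜 l := List.prod_cons

variable [IsGradedComm 𝒜]

theorem act_mul (u v : SymAlg 𝒜 ℒ) (F : balancedFamilies 𝒜 ℒ Q N) :
    act (u * v) F = act v (act u F) := by
  rw [act, map_mul]
  rfl

theorem act_ιA (a : Hgs 𝒜) : act (Q := Q) (N := N) (SymAlg.ιA 𝒜 ℒ a.val) = smulA a := by
  rw [act, SymAlg.lift_ιA]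
  exact opA_apply a

theorem act_ιL (ξ : Hgs ℒ) : act (Q := Q) (N := N) (SymAlg.ιL 𝒜 ℒ ξ.val) = consL ξ := by
  rw [act, SymAlg.lift_ιL]
  exact opL_apply ξ

/-- Acting by a letter fixes it as the next entry of the family, so after the whole word only the
empty list remains to be filled. Thus the value of a family on a word depends only on the product of
the word in the symmetric algebra. -/
theorem act_prodList (l : List (Hgs ℒ)) (F : balancedFamilies 𝒜 ℒ Q N) :
    (act (prodList 𝒜 l) F).1 [] = F.1 l := by
  induction l generalizing F with
  | nil => rw [prodList_nil, act, map_one]; rfl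
  | cons ξ l ih => rw [prodList_cons, act_mul, ih, act_ιL]; rfl

/-- `u ↦ (q ↦ (F · u)( | q))`. -/
def evalFamily (F : balancedFamilies 𝒜 ℒ Q N) : SymAlg 𝒜 ℒ →ₗ[K] Q →ₗ[K] N where
  toFun u := (act u F).1 []
  map_add' u v := by rw [act, map_add]; rfl
  map_smul' c u := by rw [act, map_smul]; rfl

theorem evalFamily_balanced (F : balancedFamilies 𝒜 ℒ Q N) (u : SymAlg 𝒜 ℒ) (a : A) (q : Q) :
    evalFamily F (u * SymAlg.ιA 𝒜 ℒ a) q = evalFamily F u (a • q) := by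
  have h : ((evalFamily F).flip q ∘ₗ LinearMap.mulLeft K u) ∘ₗ SymAlg.ιA 𝒜 ℒ =
      (evalFamily F u) ∘ₗ (Algebra.lsmul K K Q).toLinearMap.flip q :=
    linear_ext_homog 𝒜 fun i a ha => by
      change (act (u * SymAlg.ιA 𝒜 ℒ a) F).1 [] q = (act u F).1 [] (a • q)
      rw [act_mul, act_ιA ⟨i, a, ha⟩]
      -- On the empty list the scalar passes nothing, so it reaches q without a sign.
      exact sgn_eq_self ⟨0, mul_zero _⟩
  exact congrArg (fun f => f a) h

/-- The linear map on `S_A^• L ⊗_A Q` given by a family. -/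
def liftFamily (F : balancedFamilies 𝒜 ℒ Q N) : SymTensor 𝒜 ℒ Q →ₗ[K] N :=
  ((balanced 𝒜 ℒ Q).restrictScalars K).liftQ (TensorProduct.lift (evalFamily F)) fun x hx => by
    rw [Submodule.restrictScalars_mem] at hx
    rw [LinearMap.mem_ker]
    suffices h : ∀ s : SymAlg 𝒜 ℒ, TensorProduct.lift (evalFamily F) (s • x) = 0 by
      simpa using h 1
    induction hx using Submodule.span_induction with
    | zero => simp
    | add x y _ _ h1 h2 => intro s; rw [smul_add, map_add, h1, h2, add_zero]
    | smul c x _ h => intro s; rw [smul_smul]; exact h _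
    | mem x hx =>
      obtain ⟨u, a, q, rfl⟩ := hx
      intro s
      rw [smul_sub, TensorProduct.smul_tmul', TensorProduct.smul_tmul', map_sub,
        TensorProduct.lift.tmul, TensorProduct.lift.tmul, smul_eq_mul, smul_eq_mul, ← mul_assoc,
        evalFamily_balanced, sub_self]

theorem liftFamily_tmul (F : balancedFamilies 𝒜 ℒ Q N) (l : List (Hgs ℒ)) (q : Q) :
    liftFamily F (SymTensor.tmul 𝒜 ℒ (prodList 𝒜 l) q) = F.1 l q := by
  rw [← act_prodList]
  rfl

end BalancedFamilies

end SHLR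

namespace SHLR

open scoped DirectSum TensorProduct
open HasDeg (deg)

/-! ### Differences and truncations of operations on lists -/

section ListOperations

variable {α : Type*} [HasDeg α] {N : Type*} [AddCommGroup N]

theorem LSym.ite {F : List α → N} (h : LSym F) (n : ℕ) :
    LSym fun l => if l.length = n then F l else 0 := fun p x y q => by
  have e : (p ++ x :: y :: q).length = (p ++ y :: x :: q).length := by simp
  beta_reduce
  rw [e, h]
  split_ifs
  · rfl
  · rw [smul_zero]

theorem LSym.sub {F G : List α → N} (h : LSym F) (h' : LSym G) : LSym fun l => F l - G l :=
  fun p x y q => by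
    beta_reduce
    rw [h, h', smul_sub]

theorem LSym.const_ite {F : List α → N} (h : LSym F) (P : Prop) [Decidable P] :
    LSym fun l => if P then F l else 0 := by
  by_cases hP : P
  · simpa only [hP, if_true] using h
  · simp only [hP, if_false]
    exact fun p x y q => (smul_zero _).symm

end ListOperations

section

variable {K : Type*} [Field K] {M : Type*} [AddCommGroup M] [Module K M] {ℳ : ℤ → Submodule K M}
  {N : Type*} [AddCommGroup N] [Module K N]

theorem LLin.sub {F G : List (Hgs ℳ) → N} (h : LLin F) (h' : LLin G) : LLin fun l => F l - G l :=
  fun p q i c x y hx hy hh => by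
    beta_reduce
    rw [h p q i c x y hx hy, h' p q i c x y hx hy, smul_sub]
    abel

theorem LLin.const_ite {F : List (Hgs ℳ) → N} (h : LLin F) (P : Prop) [Decidable P] :
    LLin fun l => if P then F l else 0 := by
  by_cases hP : P
  · simpa only [hP, if_true] using h
  · simp only [hP, if_false]
    exact fun p q i c x y hx hy hh => by rw [smul_zero, zero_add]

end

/-! ### The operators `D_k^Δ` -/

section Rinehart

variable {K : Type*} [Field K]
  {A : Type*} [Ring A] [Algebra K A] {𝒜 : ℤ → Submodule K A} [GradedAlgebra 𝒜]
  {L : Type*} [AddCommGroup L] [Module K L] [Module A L] [IsScalarTower K A L]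
  {ℒ : ℤ → Submodule K L} [DirectSum.Decomposition ℒ] [SetLike.GradedSMul 𝒜 ℒ]
  {Q : Type*} [AddCommGroup Q] [Module K Q] [Module A Q] [IsScalarTower K A Q]
  {𝒬 : ℤ → Submodule K Q} [DirectSum.Decomposition 𝒬] [SetLike.GradedSMul 𝒜 𝒬]

theorem prodList_append (l m : List (Hgs ℒ)) :
    prodList 𝒜 (l ++ m) = prodList 𝒜 l * prodList 𝒜 m := by
  rw [prodList, List.map_append, List.prod_append]
  rfl

theorem prodList_mem (l : List (Hgs ℒ)) : prodList 𝒜 l ∈ SymAlg.grade 𝒜 ℒ (ldeg l) := by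
  induction l with
  | nil => exact SetLike.GradedOne.one_mem
  | cons ξ l ih =>
    rw [prodList_cons, ldeg_cons]
    exact SetLike.GradedMul.mul_mem (SymAlg.ιL_mem ξ.mem) ih

theorem prodList_lsym : LSym (prodList 𝒜 (ℒ := ℒ)) := fun p x y q => by
  rw [prodList_append, prodList_append, prodList_cons, prodList_cons, prodList_cons, prodList_cons,
    ← mul_assoc (SymAlg.ιL 𝒜 ℒ x.val), SymAlg.ιL_comm x.mem y.mem, sgn_mul, mul_sgn, mul_assoc]
  rfl

theorem prodList_llin : LLin (prodList 𝒜 (ℒ := ℒ)) := fun p q i c x y hx hy h => by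
  rw [prodList_append, prodList_append, prodList_append, prodList_cons, prodList_cons,
    prodList_cons, map_add, map_smul, add_mul, mul_add, smul_mul_assoc, mul_smul_comm]

theorem prodL_eq {m : ℕ} (h : Fin m → Hgs ℒ) :
    SymAlg.prodL 𝒜 ℒ (fun i => (h i).val) = prodList 𝒜 (List.ofFn h) := by
  rw [SymAlg.prodL, prodList, List.map_ofFn]
  rfl

section

variable [IsGradedComm 𝒜]

theorem ιA_mul_prodList (a : Hgs 𝒜) (l : List (Hgs ℒ)) : SymAlg.ιA 𝒜 ℒ a.val * prodList 𝒜 l =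
    (deg a * ldeg l).negOnePow • (prodList 𝒜 l * SymAlg.ιA 𝒜 ℒ a.val) :=
  IsGradedComm.comm _ _ _ _ (SymAlg.ιA_mem a.mem) (prodList_mem l)

/-- The scalar is carried to the right end of the word, from where the tensor product over A hands
it on to q. -/
theorem prodList_smul_head (a : Hgs 𝒜) (ξ : Hgs ℒ) (l : List (Hgs ℒ)) :
    prodList 𝒜 (a.smul ξ :: l) =
      (deg a * (deg ξ + ldeg l)).negOnePow • (prodList 𝒜 (ξ :: l) * SymAlg.ιA 𝒜 ℒ a.val) := by
  have h : SymAlg.ιL 𝒜 ℒ (a.smul ξ).val = SymAlg.ιA 𝒜 ℒ a.val * SymAlg.ιL 𝒜 ℒ ξ.val :=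
    (SymAlg.ιA_mul_ιL a.mem ξ.mem).symm
  rw [prodList_cons, h, mul_assoc, ← prodList_cons, ιA_mul_prodList, ldeg_cons]

theorem ιL_X_smul_head (𝕏 : LRInfinity 𝒜 ℒ) (a : Hgs 𝒜) (ξ : Hgs ℒ) (I : List (Hgs ℒ)) :
    SymAlg.ιL 𝒜 ℒ (ev 𝕏.X (a.smul ξ :: I)) = ((deg a + deg ξ) * ldeg I).negOnePow •
      (SymAlg.ιA 𝒜 ℒ (ev 𝕏.σ I a.val) * SymAlg.ιL 𝒜 ℒ ξ.val) +
      (deg a).negOnePow • (SymAlg.ιA 𝒜 ℒ a.val * SymAlg.ιL 𝒜 ℒ (ev 𝕏.X (ξ :: I))) := by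
  rw [𝕏.X_smul_head, map_add, map_sgn, map_sgn]
  have h1 := SymAlg.ιA_mul_ιL (𝒜 := 𝒜) (𝕏.anchor I a).mem ξ.mem
  have h2 := SymAlg.ιA_mul_ιL (𝒜 := 𝒜) a.mem (𝕏.bracket (ξ :: I)).mem
  exact congrArg₂ (· + ·) (congrArg _ h1.symm) (congrArg _ h2.symm)

end

variable (𝒜 ℒ Q) in
/-- The bilinear map `(u, q) ↦ u ⊗ q`. -/
def tens : SymAlg 𝒜 ℒ →ₗ[K] Q →ₗ[K] SymTensor 𝒜 ℒ Q :=
  LinearMap.mk₂ K (SymTensor.tmul 𝒜 ℒ) SymTensor.tmul_add_left SymTensor.tmul_smul_left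
    SymTensor.tmul_add_right SymTensor.tmul_smul_right

theorem tens_apply (u : SymAlg 𝒜 ℒ) (q : Q) : tens 𝒜 ℒ Q u q = SymTensor.tmul 𝒜 ℒ u q := rfl

theorem smul_tens (u v : SymAlg 𝒜 ℒ) (q : Q) : u • tens 𝒜 ℒ Q v q = tens 𝒜 ℒ Q (u * v) q := rfl

theorem tens_mul_ιA (u : SymAlg 𝒜 ℒ) (a : A) (q : Q) :
    tens 𝒜 ℒ Q (u * SymAlg.ιA 𝒜 ℒ a) q = tens 𝒜 ℒ Q u (a • q) := SymTensor.tmul_balanced u a q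

theorem tens_sgn (s : ℤˣ) (u : SymAlg 𝒜 ℒ) (q : Q) :
    tens 𝒜 ℒ Q (s • u) q = s • tens 𝒜 ℒ Q u q := by
  rw [map_sgn, LinearMap.smul_apply]

variable {𝕏 : LRInfinity 𝒜 ℒ} (C : RightConnection 𝕏 𝒬)

namespace RightConnection

theorem delta_lsym : LSym (α := Hgs ℒ) (ev C.delta) := (gradedSymm_iff_lsym _).1 C.symm

theorem delta_smul (l : List (Hgs ℒ)) (a : Hgs 𝒜) (q : Q) : ev C.delta l (a.val • q) =
    ((1 + ldeg l) * deg a).negOnePow • a.val • ev C.delta l q - ev 𝕏.σ l a.val • q := by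
  rw [← sum_univ_deg]
  exact C.leibniz _ _ _ (fun i => (l.get i).mem) _ _ a.mem q

theorem delta_smul_head (a : Hgs 𝒜) (ξ : Hgs ℒ) (l : List (Hgs ℒ)) (q : Q) :
    ev C.delta (a.smul ξ :: l) q =
      (deg a * (deg ξ + ldeg l)).negOnePow • ev C.delta (ξ :: l) (a.val • q) := by
  have h := C.linear (l.length + 1) a.d a.val a.mem (Fin.cons ξ.d fun i => (l.get i).d)
    (Fin.cons ξ.val fun i => (l.get i).val) (by
      intro i
      induction i using Fin.cases with
      | zero => exact ξ.mem
      | succ i => exact (l.get i).mem) 0 q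
  rw [Fin.update_cons_zero] at h
  have h0 : Finset.Iio (0 : Fin (l.length + 1)) = ∅ := by ext x; simp
  rw [h0, Finset.sum_empty, add_zero, Fin.sum_univ_succ, Fin.cons_zero] at h
  simp only [Fin.cons_succ] at h
  rw [sum_univ_deg, sgn_smul_sgn] at h
  rw [ev_cons, ev_cons]
  refine h.trans (sgn_congr ?_ rfl)
  change Even (deg a * 1 + deg a * (1 + (deg ξ + ldeg l)) - _)
  grind

theorem delta_mem (l : List (Hgs ℒ)) {j : ℤ} {q : Q} (hq : q ∈ 𝒬 j) :
    ev C.delta l q ∈ 𝒬 (1 + ldeg l + j) := by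
  rw [← sum_univ_deg]
  exact C.degree _ _ _ (fun i => (l.get i).mem) _ _ hq

/-- The summands of `D_{n+1}^Δ`. -/
def rinehartTerm (n : ℕ) (I J : List (Hgs ℒ)) : Q →ₗ[K] SymTensor 𝒜 ℒ Q :=
  (if I.length = n + 1 then tens 𝒜 ℒ Q (SymAlg.ιL 𝒜 ℒ (ev 𝕏.X I) * prodList 𝒜 J) else 0) -
    if I.length = n then
      ((1 + ldeg I) * ldeg J).negOnePow • (tens 𝒜 ℒ Q (prodList 𝒜 J) ∘ₗ ev C.delta I) else 0

theorem rinehartTerm_apply (n : ℕ) (I J : List (Hgs ℒ)) (q : Q) : C.rinehartTerm n I J q =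
    (if I.length = n + 1 then tens 𝒜 ℒ Q (SymAlg.ιL 𝒜 ℒ (ev 𝕏.X I) * prodList 𝒜 J) q else 0) -
    if I.length = n then
      ((1 + ldeg I) * ldeg J).negOnePow • tens 𝒜 ℒ Q (prodList 𝒜 J) (ev C.delta I q) else 0 := by
  rw [rinehartTerm, LinearMap.sub_apply]
  split_ifs <;> rfl

/-- A letter that enters neither the bracket nor the connection only multiplies the result. These
terms cancel in the commutator with multiplication by that letter. -/
theorem rinehartTerm_cons (n : ℕ) (ξ : Hgs ℒ) (I J : List (Hgs ℒ)) (q : Q) :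
    C.rinehartTerm n I (ξ :: J) q =
      ((1 + ldeg I) * deg ξ).negOnePow • (SymAlg.ιL 𝒜 ℒ ξ.val • C.rinehartTerm n I J q) := by
  rw [rinehartTerm_apply, rinehartTerm_apply, smul_sub, smul_sub]
  refine congrArg₂ (· - ·) ?_ ?_
  · split_ifs
    · have h := SymAlg.ιL_comm (𝒜 := 𝒜) (𝕏.bracket I).mem ξ.mem
      rw [smul_tens, prodList_cons, ← mul_assoc, ← mul_assoc]
      refine (congrArg (fun u => tens 𝒜 ℒ Q (u * prodList 𝒜 J) q) h).trans ?_
      rw [sgn_mul, tens_sgn]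
      rfl
    · rw [smul_zero, smul_zero]
  · split_ifs
    · rw [smul_sgn, sgn_smul_sgn, smul_tens, prodList_cons]
      refine sgn_congr ?_ rfl
      rw [ldeg_cons]
      grind
    · rw [smul_zero, smul_zero]

variable [IsGradedComm 𝒜]

/-- The two terms that place the letter aξ in the first or in the second part are compared jointly.
Neither is balanced alone: the bracket produces an anchor term by its Leibniz rule, the connection
produces another one when a is moved into q, and the two cancel. -/
theorem rinehartTerm_smul (n : ℕ) (a : Hgs 𝒜) (ξ : Hgs ℒ) (I J : List (Hgs ℒ)) (q : Q) :
    C.rinehartTerm n (a.smul ξ :: I) J q +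
        ((deg a + deg ξ) * ldeg I).negOnePow • C.rinehartTerm n I (a.smul ξ :: J) q =
      (deg a * (deg ξ + (ldeg I + ldeg J))).negOnePow •
        (C.rinehartTerm n (ξ :: I) J (a.val • q) +
          (deg ξ * ldeg I).negOnePow • C.rinehartTerm n I (ξ :: J) (a.val • q)) := by
  have hX : tens 𝒜 ℒ Q (SymAlg.ιL 𝒜 ℒ (ev 𝕏.X (a.smul ξ :: I)) * prodList 𝒜 J) q =
      ((deg a + deg ξ) * ldeg I + (1 + ldeg I + deg a) * (deg ξ + ldeg J)).negOnePow •
        tens 𝒜 ℒ Q (prodList 𝒜 (ξ :: J)) (ev 𝕏.σ I a.val • q) +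
      (deg a * (deg ξ + (ldeg I + ldeg J))).negOnePow •
        tens 𝒜 ℒ Q (SymAlg.ιL 𝒜 ℒ (ev 𝕏.X (ξ :: I)) * prodList 𝒜 J) (a.val • q) := by
    rw [ιL_X_smul_head, add_mul, map_add, LinearMap.add_apply, sgn_mul, sgn_mul, tens_sgn, tens_sgn,
      mul_assoc, ← prodList_cons]
    refine congrArg₂ (· + ·) ?_ ?_
    · have h := ιA_mul_prodList (𝕏.anchor I a) (ξ :: J)
      refine (congrArg (fun u => ((deg a + deg ξ) * ldeg I).negOnePow • tens 𝒜 ℒ Q u q) h).trans ?_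
      rw [tens_sgn, tens_mul_ιA, sgn_smul_sgn]
      exact sgn_congr (by rw [ldeg_cons, 𝕏.deg_anchor]; grind) rfl
    · have h := ιA_mul_prodList a (𝕏.bracket (ξ :: I) :: J)
      rw [prodList_cons, ← mul_assoc] at h
      refine (congrArg (fun u => (deg a).negOnePow • tens 𝒜 ℒ Q u q) h).trans ?_
      rw [tens_sgn, tens_mul_ιA, sgn_smul_sgn]
      exact sgn_congr (by rw [ldeg_cons, 𝕏.deg_bracket, ldeg_cons]; grind) rfl
  have hX' : tens 𝒜 ℒ Q (SymAlg.ιL 𝒜 ℒ (ev 𝕏.X I) * prodList 𝒜 (a.smul ξ :: J)) q =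
      (deg a * (deg ξ + ldeg J)).negOnePow •
        tens 𝒜 ℒ Q (SymAlg.ιL 𝒜 ℒ (ev 𝕏.X I) * prodList 𝒜 (ξ :: J)) (a.val • q) := by
    rw [prodList_smul_head, mul_sgn, tens_sgn, ← mul_assoc, tens_mul_ιA]
  have hD : tens 𝒜 ℒ Q (prodList 𝒜 (a.smul ξ :: J)) (ev C.delta I q) =
      (deg a * (deg ξ + ldeg J + 1 + ldeg I)).negOnePow •
        (tens 𝒜 ℒ Q (prodList 𝒜 (ξ :: J)) (ev C.delta I (a.val • q)) +
          tens 𝒜 ℒ Q (prodList 𝒜 (ξ :: J)) (ev 𝕏.σ I a.val • q)) := by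
    have h := C.delta_smul I a q
    rw [← map_add, h, sub_add_cancel, prodList_smul_head, tens_sgn, tens_mul_ιA, map_sgn,
      sgn_smul_sgn]
    exact sgn_congr (by grind) rfl
  simp only [rinehartTerm_apply, List.length_cons, add_left_inj]
  by_cases h1 : I.length = n + 1
  · rw [if_neg (by omega), if_neg (by omega), if_pos h1, if_neg (by omega), if_neg (by omega),
      if_neg (by omega), if_pos h1, if_neg (by omega)]
    simp only [sub_zero, zero_add, hX', sgn_smul_sgn]
    exact sgn_congr (by grind) rfl
  -- The case with anchor terms: ξ and I together fill the bracket, while I alone fills the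
  -- connection. In the cases of length n + 1 and of length n - 1 only one kind of term occurs and
  -- it is linear by itself.
  · by_cases h2 : I.length = n
    · rw [if_pos h2, if_neg (by omega), if_neg h1, if_pos h2, if_pos h2, if_neg (by omega),
        if_neg h1, if_pos h2, hX, hD]
      simp only [sub_zero, zero_sub, smul_add, smul_neg, sgn_smul_sgn, neg_add]
      have key : ∀ x₁ x₂ y z₁ z₂ : SymTensor 𝒜 ℒ Q, x₁ = x₂ → z₁ = z₂ →
          x₁ + y + (-z₁ + -x₂) = y + -z₂ := by
        rintro x _ y z _ rfl rfl
        abel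
      rw [ldeg_cons, ldeg_cons, deg_hsmul]
      exact key _ _ _ _ _ (sgn_congr (by grind) rfl) (sgn_congr (by grind) rfl)
    · by_cases h3 : I.length + 1 = n
      · rw [if_neg h2, if_pos h3, if_neg h1, if_neg h2, if_neg h2, if_pos h3, if_neg h1, if_neg h2,
          delta_smul_head]
        simp only [sub_zero, zero_sub, smul_zero, add_zero, smul_neg, map_sgn, sgn_smul_sgn]
        refine congrArg _ (sgn_congr ?_ rfl)
        rw [ldeg_cons, ldeg_cons, deg_hsmul]
        grind
      · simp [h1, h2, h3]

theorem rinehartTerm_lsym_left (n : ℕ) (J : List (Hgs ℒ)) :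
    LSym fun I => C.rinehartTerm n I J := by
  refine LSym.sub (LSym.ite (F := fun I => tens 𝒜 ℒ Q (SymAlg.ιL 𝒜 ℒ (ev 𝕏.X I) * prodList 𝒜 J))
    (𝕏.X_lsym.map (tens 𝒜 ℒ Q ∘ₗ LinearMap.mulRight K (prodList 𝒜 J) ∘ₗ SymAlg.ιL 𝒜 ℒ)) (n + 1))
    (LSym.ite (F := fun I => ((1 + ldeg I) * ldeg J).negOnePow •
      (tens 𝒜 ℒ Q (prodList 𝒜 J) ∘ₗ ev C.delta I)) ?_ n)
  exact (C.delta_lsym.map (LinearMap.compRight K (tens 𝒜 ℒ Q (prodList 𝒜 J)))).smul_ldeg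
    fun d => ((1 + d) * ldeg J).negOnePow

theorem rinehartTerm_lsym_right (n : ℕ) (I : List (Hgs ℒ)) : LSym (C.rinehartTerm n I) := by
  refine LSym.sub (LSym.const_ite (prodList_lsym.map
    (tens 𝒜 ℒ Q ∘ₗ LinearMap.mulLeft K (SymAlg.ιL 𝒜 ℒ (ev 𝕏.X I)))) _) (LSym.const_ite ?_ _)
  exact (prodList_lsym.map (LinearMap.lcomp K _ (ev C.delta I) ∘ₗ tens 𝒜 ℒ Q)).smul_ldeg
    fun d => ((1 + ldeg I) * d).negOnePow

theorem rinehartTerm_llin_left (n : ℕ) (J : List (Hgs ℒ)) :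
    LLin fun I => C.rinehartTerm n I J := by
  refine LLin.sub (LLin.ite (F := fun I => tens 𝒜 ℒ Q (SymAlg.ιL 𝒜 ℒ (ev 𝕏.X I) * prodList 𝒜 J))
    ((ev_llin 𝕏.X).map
      (tens 𝒜 ℒ Q ∘ₗ LinearMap.mulRight K (prodList 𝒜 J) ∘ₗ SymAlg.ιL 𝒜 ℒ)) (n + 1))
    (LLin.ite (F := fun I => ((1 + ldeg I) * ldeg J).negOnePow •
      (tens 𝒜 ℒ Q (prodList 𝒜 J) ∘ₗ ev C.delta I)) ?_ n)
  exact ((ev_llin C.delta).map (LinearMap.compRight K (tens 𝒜 ℒ Q (prodList 𝒜 J)))).smul_ldeg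
    fun d => ((1 + d) * ldeg J).negOnePow

theorem rinehartTerm_llin_right (n : ℕ) (I : List (Hgs ℒ)) : LLin (C.rinehartTerm n I) := by
  refine LLin.sub (LLin.const_ite (prodList_llin.map
    (tens 𝒜 ℒ Q ∘ₗ LinearMap.mulLeft K (SymAlg.ιL 𝒜 ℒ (ev 𝕏.X I)))) _) (LLin.const_ite ?_ _)
  exact (prodList_llin.map (LinearMap.lcomp K _ (ev C.delta I) ∘ₗ tens 𝒜 ℒ Q)).smul_ldeg
    fun d => ((1 + ldeg I) * d).negOnePow

/-- The family that defines `D_{n+1}^Δ`. -/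
def rinehartFamily (n : ℕ) : balancedFamilies 𝒜 ℒ Q (SymTensor 𝒜 ℒ Q) :=
  ⟨spl (C.rinehartTerm n), LSym.spl (C.rinehartTerm_lsym_left n) (C.rinehartTerm_lsym_right n),
    LLin.spl (C.rinehartTerm_llin_left n) (C.rinehartTerm_llin_right n), fun a ξ l q => by
      rw [spl_cons, spl_cons, LinearMap.add_apply, LinearMap.add_apply, spl_apply, spl_apply,
        spl_apply, spl_apply, ← spl_add, ← spl_add, ← spl_smul]
      refine spl_congr fun I J h => ?_
      rw [LinearMap.smul_apply, LinearMap.smul_apply, ← ldeg_perm h, ldeg_append]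
      exact C.rinehartTerm_smul n a ξ I J q⟩

/-- The operator `D_{n+1}^Δ`. -/
def rinehart (n : ℕ) : Module.End K (SymTensor 𝒜 ℒ Q) := liftFamily (C.rinehartFamily n)

theorem rinehart_tens (n : ℕ) (l : List (Hgs ℒ)) (q : Q) :
    C.rinehart n (tens 𝒜 ℒ Q (prodList 𝒜 l) q) = spl (fun I J => C.rinehartTerm n I J q) l :=
  (liftFamily_tmul _ l q).trans (spl_apply _ l q)

theorem sum_rinehart (n : ℕ) {m : ℕ} (h : Fin m → Hgs ℒ) (q : Q) :
    (∑ I : Finset (Fin m) with I.card = n + 1, koszulSign I (fun i => deg (h i)) •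
        SymTensor.tmul 𝒜 ℒ (SymAlg.ιL 𝒜 ℒ (𝕏.X I.card (pick (fun i => (h i).val) I)) *
          SymAlg.prodL 𝒜 ℒ (pick (fun i => (h i).val) Iᶜ)) q)
      - ∑ J : Finset (Fin m) with Jᶜ.card = n, (∑ j ∈ J, deg (h j)).negOnePow •
        koszulSign J (fun i => deg (h i)) • SymTensor.tmul 𝒜 ℒ
          (SymAlg.prodL 𝒜 ℒ (pick (fun i => (h i).val) J))
          (C.delta Jᶜ.card (pick (fun i => (h i).val) Jᶜ) q) =
      spl (fun I J => C.rinehartTerm n I J q) (List.ofFn h) := by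
  have hp : ∀ I : Finset (Fin m), SymAlg.prodL 𝒜 ℒ (pick (fun i => (h i).val) I) =
      prodList 𝒜 (List.ofFn (pick h I)) := fun I => prodL_eq (pick h I)
  simp only [rinehartTerm_apply]
  rw [spl_sub, Finset.sum_filter, Finset.sum_filter]
  refine congrArg₂ (· - ·) ?_ ?_
  · rw [← sum_pick_eq_spl]
    refine Finset.sum_congr rfl fun I _ => ?_
    rw [List.length_ofFn, hp, ev_ofFn_pick, smul_ite, smul_zero]
    rfl
  -- In the second sum the subset labels the letters that stay in front, and its complement enters
  -- the connection; in `rinehartTerm` the roles are reversed.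
  · rw [spl_swap, ← sum_pick_eq_spl]
    refine Finset.sum_congr rfl fun I _ => ?_
    rw [List.length_ofFn, hp, ev_ofFn_pick, smul_ite, smul_zero, smul_ite, smul_zero]
    refine congrArg₂ (ite _) ?_ rfl
    rw [smul_comm, sgn_smul_sgn]
    refine congrArg _ (sgn_congr ?_ rfl)
    rw [← ldeg_ofFn_pick]
    grind

theorem rinehart_isRinehart : IsRinehart C C.rinehart := fun n m e ξ hξ q => by
  have h := C.sum_rinehart n (fun i => (⟨e i, ξ i, hξ i⟩ : Hgs ℒ)) q
  rw [← rinehart_tens, ← prodL_eq] at h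
  exact h.symm

end RightConnection

end Rinehart

end SHLR

namespace SHLR

open scoped DirectSum TensorProduct
open HasDeg (deg)

/-! ### The right module `S_A^• L ⊗_A Q` -/

section RightModule

variable {K : Type*} [Field K]
  {A : Type*} [Ring A] [Algebra K A] {𝒜 : ℤ → Submodule K A} [GradedAlgebra 𝒜] [IsGradedComm 𝒜]
  {L : Type*} [AddCommGroup L] [Module K L] [Module A L] [IsScalarTower K A L]
  {ℒ : ℤ → Submodule K L} [DirectSum.Decomposition ℒ] [SetLike.GradedSMul 𝒜 ℒ]
  {Q : Type*} [AddCommGroup Q] [Module K Q] [Module A Q] [IsScalarTower K A Q]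
  {𝒬 : ℤ → Submodule K Q} [DirectSum.Decomposition 𝒬] [SetLike.GradedSMul 𝒜 𝒬]

variable (𝒜 ℒ 𝒬) in
/-- The span of the elements `ξ_1 ⋯ ξ_n ⊗ q` of degree `d`. -/
def tensSpan (d : ℤ) : Submodule K (SymTensor 𝒜 ℒ Q) :=
  Submodule.span K {w | ∃ (l : List (Hgs ℒ)) (j : ℤ) (q : Q), q ∈ 𝒬 j ∧ ldeg l + j = d ∧
    w = tens 𝒜 ℒ Q (prodList 𝒜 l) q}

/-- The span of the words tensored with homogeneous q is stable under the algebra and contains all 1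
⊗ q. It therefore exhausts each graded component, which permits induction on words. -/
theorem smul_mem_tensSpan (x : Hgs (SymAlg.grade 𝒜 ℒ)) :
    ∀ (d : ℤ), ∀ w ∈ tensSpan 𝒜 ℒ 𝒬 d, x.val • w ∈ tensSpan 𝒜 ℒ 𝒬 (deg x + d) := by
  refine hgs_mem_induction (P := fun x => ∀ (d : ℤ), ∀ w ∈ tensSpan 𝒜 ℒ 𝒬 d,
    x.val • w ∈ tensSpan 𝒜 ℒ 𝒬 (deg x + d)) ?_ ?_ ?_ ?_ x
  · intro i d w hw
    rw [zero_smul]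
    exact Submodule.zero_mem _
  · intro i c x y hx hy h h1 h2 d w hw
    rw [add_smul, smul_assoc]
    exact Submodule.add_mem _ (Submodule.smul_mem _ c (h1 d w hw)) (h2 d w hw)
  · intro x y h1 h2 d w hw
    have := h1 _ _ (h2 d w hw)
    rw [deg_hmul, add_assoc]
    rwa [smul_smul] at this
  · intro y d w hw
    induction hw using Submodule.span_induction with
    | zero => rw [smul_zero]; exact Submodule.zero_mem _
    | add u v _ _ h1 h2 => rw [smul_add]; exact Submodule.add_mem _ h1 h2
    | smul c u _ h => rw [smul_comm]; exact Submodule.smul_mem _ c h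
    | mem u hu =>
      obtain ⟨l, j, q, hq, rfl, rfl⟩ := hu
      rw [smul_tens, deg_emb]
      cases y with
      | inl a =>
        have h := ιA_mul_prodList a l
        change SymAlg.ιA 𝒜 ℒ a.val * _ = _ at h
        change tens 𝒜 ℒ Q (SymAlg.ιA 𝒜 ℒ a.val * _) q ∈ _
        rw [h, tens_sgn, tens_mul_ιA]
        refine sgn_mem _ (Submodule.subset_span
          ⟨l, _, _, SetLike.GradedSMul.smul_mem a.mem hq, ?_, rfl⟩)
        change _ + (deg a + j) = deg a + _
        ring
      | inr ξ =>
        refine Submodule.subset_span ⟨ξ :: l, j, q, hq, ?_, rfl⟩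
        rw [ldeg_cons, deg_inr, add_assoc]

theorem grade_le_tensSpan (d : ℤ) : SymTensor.grade 𝒜 ℒ 𝒬 d ≤ tensSpan 𝒜 ℒ 𝒬 d := by
  refine Submodule.span_le.2 ?_
  rintro _ ⟨i, j, u, q, hu, hq, rfl, rfl⟩
  have h := smul_mem_tensSpan (𝒬 := 𝒬) ⟨i, u, hu⟩ j (tens 𝒜 ℒ Q (prodList 𝒜 []) q)
    (Submodule.subset_span ⟨[], j, q, hq, by rw [ldeg_nil, zero_add], rfl⟩)
  rw [smul_tens, prodList_nil, mul_one] at h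
  exact h

variable (𝒬) in
theorem tens_hom_ext {N : Type*} [AddCommGroup N] [Module K N] {f g : SymTensor 𝒜 ℒ Q →ₗ[K] N}
    (h : ∀ (l : List (Hgs ℒ)), ∀ j, ∀ q ∈ 𝒬 j,
      f (tens 𝒜 ℒ Q (prodList 𝒜 l) q) = g (tens 𝒜 ℒ Q (prodList 𝒜 l) q)) : f = g := by
  refine linear_ext_homog (SymTensor.grade 𝒜 ℒ 𝒬) fun d w hw => ?_
  replace hw := grade_le_tensSpan d hw
  induction hw using Submodule.span_induction with
  | zero => rw [map_zero, map_zero]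
  | add u v _ _ h1 h2 => rw [map_add, map_add, h1, h2]
  | smul c u _ h => rw [map_smul, map_smul, h]
  | mem u hu =>
    obtain ⟨l, j, q, hq, rfl, rfl⟩ := hu
    exact h l j q hq

theorem tens_endDegree {a : ℤ} {Φ : Module.End K (SymTensor 𝒜 ℒ Q)}
    (h : ∀ (l : List (Hgs ℒ)), ∀ j, ∀ q ∈ 𝒬 j,
      Φ (tens 𝒜 ℒ Q (prodList 𝒜 l) q) ∈ SymTensor.grade 𝒜 ℒ 𝒬 (a + (ldeg l + j))) :
    EndDegree (SymTensor.grade 𝒜 ℒ 𝒬) a Φ := fun d w hw => by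
  replace hw := grade_le_tensSpan d hw
  induction hw using Submodule.span_induction with
  | zero => rw [map_zero]; exact Submodule.zero_mem _
  | add u v _ _ h1 h2 => rw [map_add]; exact Submodule.add_mem _ h1 h2
  | smul c u _ h => rw [map_smul]; exact Submodule.smul_mem _ c h
  | mem u hu =>
    obtain ⟨l, j, q, hq, rfl, rfl⟩ := hu
    exact h l j q hq

variable (𝒜 ℒ Q) in
/-- The action of `S_A^• L` by multiplication. -/
def mulAct : SymAlg 𝒜 ℒ →ₐ[K] Module.End K (SymTensor 𝒜 ℒ Q) :=
  Algebra.lsmul K K (SymTensor 𝒜 ℒ Q)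

theorem mulAct_apply (u : SymAlg 𝒜 ℒ) (w : SymTensor 𝒜 ℒ Q) : mulAct 𝒜 ℒ Q u w = u • w := rfl

theorem mulAct_graded : IsGradedAction (SymTensor.grade 𝒜 ℒ 𝒬) (SymAlg.grade 𝒜 ℒ)
    (mulAct 𝒜 ℒ Q) := fun i x hx => tens_endDegree fun l j q hq => by
  rw [mulAct_apply, smul_tens, ← add_assoc]
  exact SymTensor.tmul_mem (SetLike.GradedMul.mul_mem hx (prodList_mem l)) hq

/-- A list of elements of `L` as a list of elements of `S_A^• L`. -/
abbrev embL (𝒜 : ℤ → Submodule K A) [GradedAlgebra 𝒜] {ℒ : ℤ → Submodule K L}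
    [DirectSum.Decomposition ℒ] [SetLike.GradedSMul 𝒜 ℒ] (l : List (Hgs ℒ)) :
    List (Hgs (SymAlg.grade 𝒜 ℒ)) := (l.map Sum.inr).map emb

theorem embL_append (l m : List (Hgs ℒ)) : embL 𝒜 (l ++ m) = embL 𝒜 l ++ embL 𝒜 m := by
  rw [embL, List.map_append, List.map_append]

theorem ldeg_embL (l : List (Hgs ℒ)) : ldeg (embL 𝒜 l) = ldeg l := by
  rw [ldeg_map_emb, ldeg_map_inr]

theorem length_embL (l : List (Hgs ℒ)) : (embL 𝒜 l).length = l.length := by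
  rw [List.length_map, List.length_map]

variable [CharZero K]

section General

variable {W : Type*} [AddCommGroup W] [Module K W] {𝒲 : ℤ → Submodule K W}
  [DirectSum.Decomposition 𝒲] {S : Type*} [Ring S] [Algebra K S] {𝒮 : ℤ → Submodule K S}
  [GradedAlgebra 𝒮] {ρ : S →ₐ[K] Module.End K W} (hρ : IsGradedAction 𝒲 𝒮 ρ)
include hρ

/-- The graded commutator read backwards: moving an operator of the action past an iterated
commutator costs one commutator more. Repeated use trades letters of the argument for letters of the
commutator. -/
theorem comm_apply_action {a : ℤ} {Φ : Module.End K W} (h : EndDegree 𝒲 a Φ) (l : List (Hgs 𝒮))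
    (u : Hgs 𝒮) (w : W) : comm 𝒲 ρ Φ l (ρ u.val w) = comm 𝒲 ρ Φ (l ++ [u]) w +
      ((a + ldeg l) * deg u).negOnePow • ρ u.val (comm 𝒲 ρ Φ l w) := by
  rw [comm_snoc, gradedCommutator_apply 𝒲 (h.comm hρ l) (hρ _ _ u.mem)]
  simp only [LinearMap.sub_apply, LinearMap.smul_apply, Module.End.mul_apply]
  exact (sub_add_cancel _ _).symm

end General

/-- The elements 1 ⊗ q generate the module. The letters of a word are pushed out of the argument one
at a time by `comm_apply_action`, and every term left over is a commutator evaluated at 1 ⊗ q. -/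
theorem comm_eq_of_one {a : ℤ} {Φ Ψ : Module.End K (SymTensor 𝒜 ℒ Q)}
    (hΦ : EndDegree (SymTensor.grade 𝒜 ℒ 𝒬) a Φ) (hΨ : EndDegree (SymTensor.grade 𝒜 ℒ 𝒬) a Ψ)
    (h : ∀ (l : List (Hgs ℒ)) (q : Q), comm (SymTensor.grade 𝒜 ℒ 𝒬) (mulAct 𝒜 ℒ Q) Φ (embL 𝒜 l)
      (tens 𝒜 ℒ Q 1 q) = comm (SymTensor.grade 𝒜 ℒ 𝒬) (mulAct 𝒜 ℒ Q) Ψ (embL 𝒜 l)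
      (tens 𝒜 ℒ Q 1 q)) : Φ = Ψ := by
  suffices key : ∀ m l q, comm (SymTensor.grade 𝒜 ℒ 𝒬) (mulAct 𝒜 ℒ Q) Φ (embL 𝒜 l)
      (tens 𝒜 ℒ Q (prodList 𝒜 m) q) = comm (SymTensor.grade 𝒜 ℒ 𝒬) (mulAct 𝒜 ℒ Q) Ψ (embL 𝒜 l)
      (tens 𝒜 ℒ Q (prodList 𝒜 m) q) from tens_hom_ext 𝒬 fun m _ q _ => key m [] q
  intro m
  induction m with
  | nil => exact h
  | cons ξ m ih =>
    intro l q
    have e : tens 𝒜 ℒ Q (prodList 𝒜 (ξ :: m)) q =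
      mulAct 𝒜 ℒ Q (emb (Sum.inr ξ)).val (tens 𝒜 ℒ Q (prodList 𝒜 m) q) := rfl
    have e' : embL 𝒜 l ++ [emb (Sum.inr ξ)] = embL 𝒜 (l ++ [ξ]) := (embL_append l [ξ]).symm
    rw [e, comm_apply_action mulAct_graded hΦ, comm_apply_action mulAct_graded hΨ, e', ih, ih]

variable {𝕏 : LRInfinity 𝒜 ℒ} (C : RightConnection 𝕏 𝒬)

/-! ### Commutators of the right operators with multiplications, and the curvature -/

namespace RightConnection

theorem rinehart_unique {D : ℕ → Module.End K (SymTensor 𝒜 ℒ Q)} (h : IsRinehart C D) :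
    D = C.rinehart := funext fun n => tens_hom_ext 𝒬 fun l _ q _ => by
  obtain ⟨m, f, rfl⟩ := exists_ofFn l
  have e := h n m (fun i => deg (f i)) (fun i => (f i).val) (fun i => (f i).mem) q
  rw [sum_rinehart, ← rinehart_tens, prodL_eq] at e
  exact e

theorem rinehart_degree (n : ℕ) : EndDegree (SymTensor.grade 𝒜 ℒ 𝒬) 1 (C.rinehart n) :=
  tens_endDegree fun l j q hq => by
    rw [rinehart_tens]
    refine spl_mem fun I J h => ?_
    rw [← ldeg_perm h, ldeg_append, rinehartTerm_apply]
    refine Submodule.sub_mem _ ?_ ?_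
    · split_ifs
      · have h1 := SymTensor.tmul_mem (SetLike.GradedMul.mul_mem
          (SymAlg.ιL_mem (𝒜 := 𝒜) (𝕏.bracket I).mem) (prodList_mem J)) hq
        have e : (𝕏.bracket I).d + ldeg J + j = 1 + (ldeg I + ldeg J + j) := by
          change 1 + ldeg I + _ + _ = _
          ring
        rw [← e]
        exact h1
      · exact Submodule.zero_mem _
    · split_ifs
      · have h1 := SymTensor.tmul_mem (prodList_mem (𝒜 := 𝒜) J) (C.delta_mem I hq)
        have e : ldeg J + (1 + ldeg I + j) = 1 + (ldeg I + ldeg J + j) := by ring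
        rw [← e]
        exact sgn_mem _ h1
      · exact Submodule.zero_mem _

/-- Commuting with a letter removes the terms in which that letter merely multiplies, by
`rinehartTerm_cons`. What remains are the splittings in which all letters of l enter the bracket or
the connection. -/
theorem comm_rinehart (n : ℕ) (l m : List (Hgs ℒ)) (q : Q) :
    comm (SymTensor.grade 𝒜 ℒ 𝒬) (mulAct 𝒜 ℒ Q) (C.rinehart n) (embL 𝒜 l)
      (tens 𝒜 ℒ Q (prodList 𝒜 m) q) = spl (fun I J => C.rinehartTerm n (l ++ I) J q) m := by
  induction l using List.reverseRecOn generalizing m with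
  | nil => exact C.rinehart_tens n m q
  | append_singleton l ξ ih =>
    have h := comm_apply_action mulAct_graded (C.rinehart_degree n) (embL 𝒜 l) (emb (Sum.inr ξ))
      (tens 𝒜 ℒ Q (prodList 𝒜 m) q)
    have e : mulAct 𝒜 ℒ Q (emb (Sum.inr ξ)).val (tens 𝒜 ℒ Q (prodList 𝒜 m) q) =
      tens 𝒜 ℒ Q (prodList 𝒜 (ξ :: m)) q := rfl
    have e' : embL 𝒜 l ++ [emb (Sum.inr ξ)] = embL 𝒜 (l ++ [ξ]) := (embL_append l [ξ]).symm
    rw [e, e', ih, ih, ldeg_embL, spl_cons, spl_map, ← spl_smul] at h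
    have h' : spl (fun I J => (deg ξ * ldeg I).negOnePow • C.rinehartTerm n (l ++ I) (ξ :: J) q) m =
        spl (fun I J => ((1 + ldeg l) * deg (emb (𝒜 := 𝒜) (Sum.inr ξ))).negOnePow •
          mulAct 𝒜 ℒ Q (emb (Sum.inr ξ)).val (C.rinehartTerm n (l ++ I) J q)) m :=
      spl_congr fun I J _ => by
        rw [rinehartTerm_cons, sgn_smul_sgn]
        refine sgn_congr ?_ rfl
        rw [ldeg_append, deg_emb, deg_inr]
        grind
    rw [h'] at h
    rw [← add_right_cancel h]
    exact spl_congr fun I J _ => by rw [List.append_assoc]; rfl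

theorem comm_rinehart_one (n : ℕ) (l : List (Hgs ℒ)) (q : Q) :
    comm (SymTensor.grade 𝒜 ℒ 𝒬) (mulAct 𝒜 ℒ Q) (C.rinehart n) (embL 𝒜 l) (tens 𝒜 ℒ Q 1 q) =
      (if l.length = n + 1 then tens 𝒜 ℒ Q (SymAlg.ιL 𝒜 ℒ (ev 𝕏.X l)) q else 0) -
        if l.length = n then tens 𝒜 ℒ Q 1 (ev C.delta l q) else 0 := by
  have h := C.comm_rinehart n l [] q
  rw [prodList_nil, spl_nil, List.append_nil, rinehartTerm_apply, ldeg_nil, mul_zero,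
    prodList_nil, mul_one, Int.negOnePow_zero, one_smul] at h
  exact h

/-- Both operators are compared through further commutators at 1 ⊗ q. Without further letters both
give the bracket; with further letters the left side has more entries than any term of D allows, and
the right side vanishes by `comm_action`. -/
theorem comm_rinehart_L (n : ℕ) (l : List (Hgs ℒ)) (hl : l.length = n + 1) :
    comm (SymTensor.grade 𝒜 ℒ 𝒬) (mulAct 𝒜 ℒ Q) (C.rinehart n) (embL 𝒜 l) =
      mulAct 𝒜 ℒ Q (SymAlg.ιL 𝒜 ℒ (ev 𝕏.X l)) := by
  have hb := mulAct_graded (𝒬 := 𝒬) _ _ (emb (𝒜 := 𝒜) (Sum.inr (𝕏.bracket l))).mem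
  have hd := (C.rinehart_degree n).comm mulAct_graded (embL 𝒜 l)
  rw [ldeg_embL] at hd
  refine comm_eq_of_one hd hb fun m q => ?_
  rw [← comm_append, ← embL_append, comm_rinehart_one]
  cases m with
  | nil =>
    rw [List.append_nil, if_pos hl, if_neg (by omega), sub_zero]
    exact congrArg (fun u => tens 𝒜 ℒ Q u q) (mul_one _).symm
  | cons ξ m =>
    have h := comm_action (𝒲 := SymTensor.grade 𝒜 ℒ 𝒬) mulAct_graded
      (emb (𝒜 := 𝒜) (Sum.inr (𝕏.bracket l))) (l := embL 𝒜 (ξ :: m)) (List.cons_ne_nil _ _)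
    have e : (l ++ ξ :: m).length = n + 2 + m.length := by
      rw [List.length_append, List.length_cons, hl]
      omega
    rw [e, if_neg (by omega), if_neg (by omega), sub_zero]
    exact (congrArg (fun Φ => Φ (tens 𝒜 ℒ Q 1 q)) h).symm

/-- For n letters, commuting with a measures the failure of the connection to be A-linear, which is
the anchor; the minus sign of the Leibniz rule meets the minus sign in D. For n + 1 letters the
result is a bracket, with which a commutes. -/
theorem comm_rinehart_A_one (n : ℕ) (l : List (Hgs ℒ)) (a : Hgs 𝒜) (q : Q) :
    comm (SymTensor.grade 𝒜 ℒ 𝒬) (mulAct 𝒜 ℒ Q) (C.rinehart n) (embL 𝒜 l ++ [emb (Sum.inl a)])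
      (tens 𝒜 ℒ Q 1 q) =
      if l.length = n then tens 𝒜 ℒ Q 1 (ev 𝕏.σ l a.val • q) else 0 := by
  have h := comm_apply_action mulAct_graded (C.rinehart_degree n) (embL 𝒜 l) (emb (Sum.inl a))
      (tens 𝒜 ℒ Q 1 q)
  have e : ∀ p, mulAct 𝒜 ℒ Q (emb (ℒ := ℒ) (Sum.inl a)).val (tens 𝒜 ℒ Q 1 p) =
      tens 𝒜 ℒ Q 1 (a.val • p) := fun p => by
    rw [← tens_mul_ιA, one_mul]
    exact congrArg (fun u => tens 𝒜 ℒ Q u p) (mul_one _)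
  rw [e, comm_rinehart_one, comm_rinehart_one, ldeg_embL] at h
  rw [eq_sub_of_add_eq h.symm]
  by_cases h1 : l.length = n
  · rw [if_neg (by omega), if_pos h1, if_pos h1, if_pos h1, if_neg (by omega), zero_sub, zero_sub,
      map_neg, e, C.delta_smul, map_sub, map_sgn, smul_neg, deg_emb, deg_inl]
    abel
  · rw [if_neg h1, if_neg h1, if_neg h1, sub_zero, sub_zero]
    split_ifs
    · have h2 := IsGradedComm.comm _ _ _ _ (SymAlg.ιL_mem (𝒜 := 𝒜) (𝕏.bracket l).mem)
        (emb (ℒ := ℒ) (Sum.inl a)).mem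
      rw [sub_eq_zero, ← tens_mul_ιA]
      refine (congrArg (fun u => tens 𝒜 ℒ Q u q) h2).trans ?_
      rw [tens_sgn]
      rfl
    · rw [map_zero, smul_zero, sub_zero]

theorem comm_rinehart_A (a : Hgs 𝒜) (l : List (Hgs ℒ)) :
    comm (SymTensor.grade 𝒜 ℒ 𝒬) (mulAct 𝒜 ℒ Q) (C.rinehart l.length)
      (emb (Sum.inl a) :: embL 𝒜 l) =
      (deg a * ldeg l).negOnePow • mulAct 𝒜 ℒ Q (SymAlg.ιA 𝒜 ℒ (ev 𝕏.σ l a.val)) := by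
  have hs := comm_lsym (mulAct_graded (𝒬 := 𝒬)) (C.rinehart_degree l.length)
  rw [hs.back, ldeg_embL, deg_emb, deg_inl]
  refine congrArg _ ?_
  have hb := mulAct_graded (𝒬 := 𝒬) _ _ (emb (ℒ := ℒ) (Sum.inl (𝕏.anchor l a))).mem
  have hd := (C.rinehart_degree l.length).comm mulAct_graded (embL 𝒜 l ++ [emb (Sum.inl a)])
  have e : 1 + ldeg (embL 𝒜 l ++ [emb (Sum.inl a)]) = 1 + ldeg l + deg a := by
    rw [ldeg_append, ldeg_cons, ldeg_nil, ldeg_embL, deg_emb, deg_inl, add_zero, add_assoc]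
  rw [e] at hd
  refine comm_eq_of_one hd hb fun m q => ?_
  rw [← comm_append, List.append_assoc, List.singleton_append, (hs.append (embL 𝒜 l)).back,
    ← List.append_assoc, ← embL_append, LinearMap.smul_apply, comm_rinehart_A_one]
  cases m with
  | nil =>
    rw [List.append_nil, if_pos rfl, ldeg_embL, ldeg_nil, mul_zero, Int.negOnePow_zero, one_smul, ← tens_mul_ιA,
      one_mul]
    exact congrArg (fun u => tens 𝒜 ℒ Q u q) (mul_one _).symm
  | cons ξ m =>
    have h := comm_action (𝒲 := SymTensor.grade 𝒜 ℒ 𝒬) mulAct_graded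
      (emb (ℒ := ℒ) (Sum.inl (𝕏.anchor l a))) (l := embL 𝒜 (ξ :: m)) (List.cons_ne_nil _ _)
    rw [if_neg (by simp), smul_zero]
    exact (congrArg (fun Φ => Φ (tens 𝒜 ℒ Q 1 q)) h).symm

/-- After one commutator with an element of A the value on 1 ⊗ q is multiplication of q by an anchor
value in A. This commutes with a second element of A. -/
theorem comm_rinehart_AA (a b : Hgs 𝒜) (g : List (Hgs (SymAlg.grade 𝒜 ℒ))) (n : ℕ) :
    comm (SymTensor.grade 𝒜 ℒ 𝒬) (mulAct 𝒜 ℒ Q) (C.rinehart n)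
      (emb (Sum.inl a) :: emb (Sum.inl b) :: g) = 0 := by
  have hs := comm_lsym (mulAct_graded (𝒬 := 𝒬)) (C.rinehart_degree n)
  suffices h : comm (SymTensor.grade 𝒜 ℒ 𝒬) (mulAct 𝒜 ℒ Q) (C.rinehart n)
      [emb (Sum.inl a), emb (ℒ := ℒ) (Sum.inl b)] = 0 by
    have e := comm_append (𝒲 := SymTensor.grade 𝒜 ℒ 𝒬) (ρ := mulAct 𝒜 ℒ Q) (C.rinehart n)
      [emb (Sum.inl a), emb (ℒ := ℒ) (Sum.inl b)] g
    rw [h, comm_zero] at e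
    exact e
  refine comm_eq_of_one ((C.rinehart_degree n).comm mulAct_graded _) (EndDegree.zero _)
    fun m q => ?_
  rw [comm_zero, LinearMap.zero_apply, ← comm_append]
  have e : comm (SymTensor.grade 𝒜 ℒ 𝒬) (mulAct 𝒜 ℒ Q) (C.rinehart n)
      (embL 𝒜 m ++ [emb (Sum.inl b)] ++ [emb (Sum.inl a)]) (tens 𝒜 ℒ Q 1 q) = 0 := by
    have h := comm_apply_action mulAct_graded (C.rinehart_degree n)
      (embL 𝒜 m ++ [emb (Sum.inl b)]) (emb (Sum.inl a)) (tens 𝒜 ℒ Q 1 q)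
    have e : ∀ p, mulAct 𝒜 ℒ Q (emb (ℒ := ℒ) (Sum.inl a)).val (tens 𝒜 ℒ Q 1 p) =
        tens 𝒜 ℒ Q 1 (a.val • p) := fun p => by
      rw [← tens_mul_ιA, one_mul]
      exact congrArg (fun u => tens 𝒜 ℒ Q u p) (mul_one _)
    rw [e, comm_rinehart_A_one, comm_rinehart_A_one] at h
    rw [eq_sub_of_add_eq h.symm, sub_eq_zero]
    split_ifs
    · rw [e]
      have h2 := balancedFamilies.smul_smul_comm a (𝕏.anchor m b) q
      refine (congrArg (tens 𝒜 ℒ Q 1) h2).trans ?_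
      rw [map_sgn]
      refine sgn_congr ?_ rfl
      rw [𝕏.deg_anchor, ldeg_append, ldeg_embL, ldeg_cons, ldeg_nil, deg_emb, deg_emb]
      simp only [deg_inl]
      grind
    · rw [map_zero, smul_zero]
  -- The vanishing has been shown with both elements of A at the end of the list; three
  -- rearrangements by symmetry bring them to the front.
  have e1 := hs.back (emb (Sum.inl a)) (emb (Sum.inl b) :: embL 𝒜 m)
  have e2 := ((hs.back (emb (Sum.inl b)) (embL 𝒜 m ++ [emb (Sum.inl a)])))
  have e3 := hs (embL 𝒜 m) (emb (Sum.inl a)) (emb (Sum.inl b)) []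
  rw [List.append_assoc] at e
  rw [List.append_assoc, List.singleton_append] at e2
  simp only [List.cons_append, List.nil_append] at e e1 e2 e3 ⊢
  rw [e1, e2, e3, LinearMap.smul_apply, LinearMap.smul_apply, LinearMap.smul_apply, e, smul_zero,
    smul_zero, smul_zero]

theorem comm_rinehart_bracket (n : ℕ) (l : List (Hgs (SymAlg.grade 𝒜 ℒ))) (hl : l.length = n + 1) :
    comm (SymTensor.grade 𝒜 ℒ 𝒬) (mulAct 𝒜 ℒ Q) (C.rinehart n) l =
      (1 : ℤˣ) ^ n • mulAct 𝒜 ℒ Q (ev (symBracket 𝕏) l) :=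
  comm_eq_of_generators mulAct_graded C.rinehart_degree
    (fun l n hl => by rw [one_pow, one_smul]; exact C.comm_rinehart_L n l hl)
    (fun a l => by rw [one_pow, one_smul]; exact C.comm_rinehart_A a l)
    (fun a b g n _ => C.comm_rinehart_AA a b _ n) n l hl

/-- The curvature on a list of homogeneous elements. -/
def curv (l : List (Hgs ℒ)) (q : Q) : Q :=
  spl (fun I J => ev C.delta (𝕏.bracket I :: J) q) l -
    spl (fun I J => (ldeg I).negOnePow • ev C.delta I (ev C.delta J q)) l

theorem flat_iff : C.Flat ↔ ∀ l q, C.curv l q = 0 :=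
  right_module_jacobi_iff 𝕏.X_degree C.delta

/-- At 1 ⊗ q with exactly n letters only the connection terms survive. They enter D with a minus
sign, which occurs twice in a composition and once in an insertion, so the result is minus the
curvature. -/
theorem comm_sqComp_one (l : List (Hgs ℒ)) (q : Q) :
    comm (SymTensor.grade 𝒜 ℒ 𝒬) (mulAct 𝒜 ℒ Q) (sqComp C.rinehart l.length) (embL 𝒜 l)
      (tens 𝒜 ℒ Q 1 q) = -tens 𝒜 ℒ Q 1 (C.curv l q) := by
  rw [comm_sqComp_eq mulAct_graded C.rinehart_degree (symBracket_degree 𝕏)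
    (symBracket_extension 𝕏).zero C.comm_rinehart_bracket _ _ (length_embL l), LinearMap.add_apply,
    spl_apply, spl_apply, spl_comp_map emb deg_emb, spl_comp_map emb deg_emb,
    spl_comp_map Sum.inr deg_inr, spl_comp_map Sum.inr deg_inr, curv, map_sub, neg_sub,
    sub_eq_add_neg, spl_map, spl_map, ← spl_neg]
  refine congrArg₂ (· + ·) (spl_congr fun I J _ => ?_) (spl_congr fun I J _ => ?_)
  · rw [LinearMap.smul_apply, Module.End.mul_apply, length_embL, length_embL, ldeg_embL,
      comm_rinehart_one, if_neg (by omega), if_pos rfl, zero_sub, map_neg, comm_rinehart_one,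
      if_neg (by omega), if_pos rfl, zero_sub, neg_neg, map_sgn]
  · have h := C.comm_rinehart_one (J.length + 1) (𝕏.bracket I :: J) q
    rw [if_neg (by simp), if_pos List.length_cons, zero_sub] at h
    rw [br_map_inr, length_embL J, one_pow, one_smul]
    exact h

/-- With J the inner factor is nonzero only if |J| is k or k + 1. In the first case I has fewer than
p letters. In the second the inner value is a bracket, which counts as one further letter when
pushed through the outer factor, and the total still stays below p. -/
theorem comm_comp_eq_zero (p k : ℕ) (I J : List (Hgs ℒ)) (h : I.length + J.length < p + k) (q : Q) :
    comm (SymTensor.grade 𝒜 ℒ 𝒬) (mulAct 𝒜 ℒ Q) (C.rinehart p) (embL 𝒜 I)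
      (comm (SymTensor.grade 𝒜 ℒ 𝒬) (mulAct 𝒜 ℒ Q) (C.rinehart k) (embL 𝒜 J)
        (tens 𝒜 ℒ Q 1 q)) = 0 := by
  rw [comm_rinehart_one]
  by_cases h1 : J.length = k + 1
  · rw [if_pos h1, if_neg (by omega), sub_zero]
    have e := comm_apply_action mulAct_graded (C.rinehart_degree p) (embL 𝒜 I)
      (emb (Sum.inr (𝕏.bracket J))) (tens 𝒜 ℒ Q 1 q)
    have e' : embL 𝒜 I ++ [emb (Sum.inr (𝕏.bracket J))] = embL 𝒜 (I ++ [𝕏.bracket J]) :=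
      (embL_append I [_]).symm
    have e2 : tens 𝒜 ℒ Q (SymAlg.ιL 𝒜 ℒ (ev 𝕏.X J)) q =
        mulAct 𝒜 ℒ Q (emb (Sum.inr (𝕏.bracket J))).val (tens 𝒜 ℒ Q 1 q) :=
      congrArg (fun u => tens 𝒜 ℒ Q u q) (mul_one _).symm
    have e3 : (I ++ [𝕏.bracket J]).length = I.length + 1 := by simp
    rw [e2, e, e', comm_rinehart_one, comm_rinehart_one, e3, if_neg (by omega), if_neg (by omega),
      if_neg (by omega), if_neg (by omega), sub_zero, map_zero, smul_zero, add_zero]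
  · rw [if_neg h1, zero_sub]
    by_cases h2 : J.length = k
    · rw [if_pos h2, map_neg, comm_rinehart_one, if_neg (by omega), if_neg (by omega), sub_zero,
        neg_zero]
    · rw [if_neg h2, neg_zero, map_zero]

/-- By `comm_eq_of_one` only commutators at 1 ⊗ q matter. For fewer than n letters they vanish by
counting, for n letters by flatness, and for more than n letters by the Jacobi identity of the
symmetric algebra. -/
theorem sqComp_eq_zero (h : C.Flat) (n : ℕ) : sqComp C.rinehart n = 0 := by
  refine comm_eq_of_one (sqComp_degree C.rinehart_degree n) (EndDegree.zero _) fun l q => ?_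
  rw [comm_zero, LinearMap.zero_apply]
  rcases lt_trichotomy l.length n with h1 | h1 | h1
  · rw [comm_sqComp mulAct_graded C.rinehart_degree, spl_apply, spl_comp_map emb deg_emb,
      spl_comp_map Sum.inr deg_inr]
    refine spl_eq_zero fun I J hIJ => ?_
    have hl := hIJ.length_eq
    rw [List.length_append] at hl
    rw [LinearMap.sum_apply]
    refine Finset.sum_eq_zero fun p hp => ?_
    have hp' := Finset.mem_range.1 hp
    rw [LinearMap.smul_apply, Module.End.mul_apply, C.comm_comp_eq_zero _ _ I J (by omega),
      smul_zero]
  · rw [← h1, comm_sqComp_one, C.flat_iff.1 h, map_zero, neg_zero]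
  · rw [comm_sqComp_eq_zero mulAct_graded C.rinehart_degree (symBracket_degree 𝕏)
      (symBracket_extension 𝕏).zero C.comm_rinehart_bracket (symBracket_jacobi 𝕏) n _
      (by rwa [length_embL]), LinearMap.zero_apply]

end RightConnection

/-- The family that is the identity on the empty list and zero elsewhere is balanced, and so defines
a linear left inverse of q ↦ 1 ⊗ q. -/
theorem tens_one_injective {q : Q} (h : tens 𝒜 ℒ Q 1 q = 0) : q = 0 := by
  let F : List (Hgs ℒ) → Q →ₗ[K] Q := fun l => if l.length = 0 then LinearMap.id else 0
  have hF : F ∈ balancedFamilies 𝒜 ℒ Q Q := by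
    refine ⟨fun p x y q => ?_, fun p q i c x y hx hy hh => ?_, fun a ξ l q => ?_⟩ <;> simp [F]
  have e := liftFamily_tmul ⟨F, hF⟩ ([] : List (Hgs ℒ)) q
  rw [prodList_nil, ← tens_apply, h, map_zero] at e
  exact e.symm

theorem ev_rightLie (D : ℕ → Module.End K (SymTensor 𝒜 ℒ Q))
    (l : List (Hgs (SymAlg.grade 𝒜 ℒ))) : ev (rightLie 𝒬 D) l =
      (-1 : ℤˣ) • comm (SymTensor.grade 𝒜 ℒ 𝒬) (mulAct 𝒜 ℒ Q) (D l.length) l := by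
  rw [comm_eq_ev, Units.neg_smul, one_smul]
  rfl

theorem RightConnection.flat_iff_module : C.Flat ↔
    IsRightLInfinityModule (SymAlg.grade 𝒜 ℒ) (SymTensor.grade 𝒜 ℒ 𝒬) (symBracket 𝕏)
      (rightLie 𝒬 C.rinehart) := by
  rw [isRightModule_iff mulAct_graded C.rinehart_degree C.comm_rinehart_bracket rfl
    (ev_rightLie C.rinehart)]
  constructor
  · intro h l
    rw [C.sqComp_eq_zero h, comm_zero]
  · intro h
    refine C.flat_iff.2 fun l q => tens_one_injective (𝒜 := 𝒜) (ℒ := ℒ) ?_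
    have e := C.comm_sqComp_one l q
    have h' := h (embL 𝒜 l)
    rw [length_embL] at h'
    rw [h', LinearMap.zero_apply] at e
    exact neg_eq_zero.1 e.symm

end RightModule

end SHLR

namespace SHLR

open scoped DirectSum TensorProduct
open HasDeg (deg)

/-! ### Symmetric forms as operations on lists -/

section FormLists

theorem exists_ofFn_update {α : Type*} [HasDeg α] {m : ℕ} (h : Fin m → α) (i : Fin m) (x : α) :
    ∃ p q, List.ofFn h = p ++ h i :: q ∧ List.ofFn (Function.update h i x) = p ++ x :: q ∧
      ldeg p = ∑ j ∈ Finset.Iio i, deg (h j) := by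
  induction m with
  | zero => exact i.elim0
  | succ m ih =>
    induction i using Fin.cases with
    | zero =>
      have h0 : Finset.Iio (0 : Fin (m + 1)) = ∅ := by ext x; simp
      refine ⟨[], List.ofFn fun j => h j.succ, List.ofFn_succ, ?_, by rw [h0]; rfl⟩
      rw [List.ofFn_succ, Function.update_self]
      refine congrArg _ (congrArg _ (funext fun j => ?_))
      rw [Function.update_of_ne (Fin.succ_ne_zero j)]
    | succ i =>
      obtain ⟨p, q, h1, h2, h3⟩ := ih (fun j => h j.succ) i
      refine ⟨h 0 :: p, q, ?_, ?_, ?_⟩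
      · rw [List.ofFn_succ, h1]
        rfl
      · rw [List.ofFn_succ, Function.update_of_ne (Fin.succ_ne_zero i).symm]
        refine congrArg _ (Eq.trans (congrArg _ (funext fun j => ?_)) h2)
        by_cases hj : j = i
        · subst hj
          rw [Function.update_self, Function.update_self]
        · rw [Function.update_of_ne hj, Function.update_of_ne (by simpa using hj)]
      · have e := SymForms.sum_Iio_succ (deg (h 0)) (fun j => deg (h j.succ)) i
        rw [ldeg_cons, h3, ← e]
        refine Finset.sum_congr rfl fun j _ => ?_
        induction j using Fin.cases with
        | zero => rfl
        | succ j => rfl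

variable {K : Type*} [Field K]
  {A : Type*} [Ring A] [Algebra K A] {𝒜 : ℤ → Submodule K A} [GradedAlgebra 𝒜]
  {L : Type*} [AddCommGroup L] [Module K L] [Module A L] [IsScalarTower K A L]
  {ℒ : ℤ → Submodule K L} [DirectSum.Decomposition ℒ] [SetLike.GradedSMul 𝒜 ℒ]
  {P : Type*} [AddCommGroup P] [Module K P] [Module A P] [IsScalarTower K A P]
  {𝓟 : ℤ → Submodule K P} [DirectSum.Decomposition 𝓟] [SetLike.GradedSMul 𝒜 𝓟]

variable (𝒜 𝓟) in
/-- Operations on lists that behave like forms of degree `d`. -/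
structure IsFormList (d : ℤ) (F : List (Hgs ℒ) → P) : Prop where
  sym : LSym F
  lin : LLin F
  mem : ∀ l, F l ∈ 𝓟 (d + ldeg l)
  smul : ∀ (a : Hgs 𝒜) ξ l, F (a.smul ξ :: l) = (deg a * d).negOnePow • a.val • F (ξ :: l)

theorem IsFormList.zero (d : ℤ) : IsFormList 𝒜 𝓟 d fun _ : List (Hgs ℒ) => (0 : P) where
  sym _ _ _ _ := (smul_zero _).symm
  lin _ _ _ _ _ _ _ _ _ := by rw [smul_zero, zero_add]
  mem _ := Submodule.zero_mem _
  smul _ _ _ := by rw [smul_zero, smul_zero]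

theorem IsFormList.add {d : ℤ} {F G : List (Hgs ℒ) → P} (hF : IsFormList 𝒜 𝓟 d F)
    (hG : IsFormList 𝒜 𝓟 d G) : IsFormList 𝒜 𝓟 d fun l => F l + G l where
  sym p x y q := by
    beta_reduce
    rw [hF.sym, hG.sym, smul_add]
  lin p q i c x y hx hy h := by
    beta_reduce
    rw [hF.lin p q i c x y hx hy, hG.lin p q i c x y hx hy, smul_add]
    abel
  mem l := Submodule.add_mem _ (hF.mem l) (hG.mem l)
  smul a ξ l := by rw [hF.smul, hG.smul, smul_add, smul_add]

/-- The form with given values on lists. -/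
noncomputable def IsFormList.form {d : ℤ} {F : List (Hgs ℒ) → P} (hF : IsFormList 𝒜 𝓟 d F) (m : ℕ) :
    symForm 𝒜 ℒ 𝓟 m d :=
  ⟨multOf hF.lin m, by
    refine ⟨fun e v hv => ?_, ?_, fun r a ha e v hv i => ?_⟩
    · have h := multOf_apply hF.lin fun i => (⟨e i, v i, hv i⟩ : Hgs ℒ)
      have h' := hF.mem (List.ofFn fun i => (⟨e i, v i, hv i⟩ : Hgs ℒ))
      rw [ldeg, List.map_ofFn, List.sum_ofFn, ← h] at h'
      exact h'
    · refine (gradedSymm_iff_lsym (ℳ := ℒ) (multOf hF.lin)).2 ?_ m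
      intro p x y q
      rw [ev_multOf, ev_multOf, hF.sym]
    · obtain ⟨p, q, h1, h2, h3⟩ := exists_ofFn_update (fun i => (⟨e i, v i, hv i⟩ : Hgs ℒ)) i
        (Hgs.smul ⟨r, a, ha⟩ ⟨e i, v i, hv i⟩)
      have k1 := multOf_apply hF.lin fun i => (⟨e i, v i, hv i⟩ : Hgs ℒ)
      have k2 := multOf_apply hF.lin (Function.update (fun i => (⟨e i, v i, hv i⟩ : Hgs ℒ)) i
        (Hgs.smul ⟨r, a, ha⟩ ⟨e i, v i, hv i⟩))
      have e1 : (fun j => (Function.update (fun i => (⟨e i, v i, hv i⟩ : Hgs ℒ)) i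
          (Hgs.smul ⟨r, a, ha⟩ ⟨e i, v i, hv i⟩) j).val) = Function.update v i (a • v i) := by
        funext j
        by_cases hj : j = i
        · subst hj
          rw [Function.update_self, Function.update_self]
          rfl
        · rw [Function.update_of_ne hj, Function.update_of_ne hj]
      -- The slot carrying the scalar is moved to the front, where linearity is known. The letters
      -- passed on the way account for the sum over the earlier slots in the sign.
      rw [e1, h2, hF.sym.front, hF.smul] at k2
      rw [h1, hF.sym.front] at k1
      simp only at k1
      rw [k1, k2, smul_sgn, sgn_smul_sgn, sgn_smul_sgn, deg_hsmul]
      refine sgn_congr ?_ rfl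
      have h3' : ldeg p = ∑ j ∈ Finset.Iio i, e j := h3
      change Even ((r + e i) * ldeg p + r * d - (r * (d + _) + e i * ldeg p))
      rw [← h3']
      grind⟩

theorem IsFormList.form_apply {d : ℤ} {F : List (Hgs ℒ) → P} (hF : IsFormList 𝒜 𝓟 d F) {m : ℕ}
    (h : Fin m → Hgs ℒ) : (hF.form m).1 (fun i => (h i).val) = F (List.ofFn h) :=
  multOf_apply hF.lin h

/-! ### Forms through their values on lists of homogeneous elements -/

namespace SymForms

/-- The `k`-linear component of a form. -/
def component {m : ℕ} {d : ℤ} (Ω : symForm 𝒜 ℒ 𝓟 m d) (k : ℕ) :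
    MultilinearMap K (fun _ : Fin k => L) P :=
  if h : k = m then Ω.1.domDomCongr (finCongr h.symm) else 0

theorem component_self {m : ℕ} {d : ℤ} (Ω : symForm 𝒜 ℒ 𝓟 m d) : component Ω m = Ω.1 := by
  rw [component, dif_pos rfl]
  rfl

theorem component_of_ne {m k : ℕ} {d : ℤ} (Ω : symForm 𝒜 ℒ 𝓟 m d) (h : k ≠ m) :
    component Ω k = 0 := dif_neg h

theorem formEval_eq {m : ℕ} {d : ℤ} (Ω : symForm 𝒜 ℒ 𝓟 m d) {k : ℕ} (v : Fin k → L) :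
    formEval Ω v = component Ω k v := by
  by_cases h : k = m
  · subst h
    rw [formEval, dif_pos rfl, component_self]
    rfl
  · rw [formEval, dif_neg h, component_of_ne Ω h]
    rfl

variable (𝒜 𝓟) in
/-- The `k`-linear component of an element of `Sym_A(L, P)`. -/
def comps (k : ℕ) : SymForms 𝒜 ℒ 𝓟 →ₗ[K] MultilinearMap K (fun _ : Fin k => L) P :=
  lift 𝒜 ℒ 𝓟 fun m d =>
    { toFun := fun Ω => component Ω k
      map_add' := fun Ω Θ => by
        by_cases h : k = m
        · subst h
          rw [component_self, component_self, component_self]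
          rfl
        · rw [component_of_ne _ h, component_of_ne _ h, component_of_ne _ h, add_zero]
      map_smul' := fun c Ω => by
        by_cases h : k = m
        · subst h
          rw [component_self, component_self]
          rfl
        · rw [component_of_ne _ h, component_of_ne _ h, smul_zero] }

variable (𝒜 𝓟) in
/-- The value of forms on a list of homogeneous arguments. -/
def val (l : List (Hgs ℒ)) : SymForms 𝒜 ℒ 𝓟 →ₗ[K] P where
  toFun w := ev (fun k => comps 𝒜 𝓟 k w) l
  map_add' v w := by simp only [ev, map_add, add_apply]
  map_smul' c w := by simp only [ev, map_smul, smul_apply, RingHom.id_apply]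

theorem val_eq_ev (l : List (Hgs ℒ)) (w : SymForms 𝒜 ℒ 𝓟) :
    val 𝒜 𝓟 l w = ev (fun k => comps 𝒜 𝓟 k w) l := rfl

theorem val_incl (l : List (Hgs ℒ)) {m : ℕ} {d : ℤ} (Ω : symForm 𝒜 ℒ 𝓟 m d) :
    val 𝒜 𝓟 l (incl 𝒜 ℒ 𝓟 m d Ω) = ev (component Ω) l := by
  have h : ∀ k, comps 𝒜 𝓟 k (incl 𝒜 ℒ 𝓟 m d Ω) = component Ω k := fun k => lift_incl _ m d Ω
  rw [val_eq_ev]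
  simp only [h]

theorem val_incl_ofFn {m : ℕ} {d : ℤ} (Ω : symForm 𝒜 ℒ 𝓟 m d) (h : Fin m → Hgs ℒ) :
    val 𝒜 𝓟 (List.ofFn h) (incl 𝒜 ℒ 𝓟 m d Ω) = Ω.1 fun i => (h i).val := by
  rw [val_incl, ev_ofFn, component_self]

theorem val_incl_of_ne {l : List (Hgs ℒ)} {m : ℕ} {d : ℤ} (Ω : symForm 𝒜 ℒ 𝓟 m d)
    (h : l.length ≠ m) : val 𝒜 𝓟 l (incl 𝒜 ℒ 𝓟 m d Ω) = 0 := by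
  rw [val_incl, ev, component_of_ne Ω h]
  rfl

theorem grade_induction {d : ℤ} {p : SymForms 𝒜 ℒ 𝓟 → Prop} (h0 : p 0)
    (hadd : ∀ v w, p v → p w → p (v + w)) (h : ∀ m Ω, p (incl 𝒜 ℒ 𝓟 m d Ω))
    {w : SymForms 𝒜 ℒ 𝓟} (hw : w ∈ grade 𝒜 ℒ 𝓟 d) : p w := by
  obtain ⟨x, rfl⟩ := hw
  refine DirectSum.induction_on (motive := fun x => p (inclDeg 𝒜 ℒ 𝓟 d x)) x ?_ (fun m Ω => h m Ω)
    fun x y hx hy => ?_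
  · exact (map_zero (inclDeg 𝒜 ℒ 𝓟 d)).symm ▸ h0
  · exact (map_add (inclDeg 𝒜 ℒ 𝓟 d) x y).symm ▸ hadd _ _ hx hy

theorem incl_mem (m : ℕ) (d : ℤ) (Ω : symForm 𝒜 ℒ 𝓟 m d) :
    incl 𝒜 ℒ 𝓟 m d Ω ∈ grade 𝒜 ℒ 𝓟 d := LinearMap.mem_range_self _ _

theorem component_props {m : ℕ} {d : ℤ} (Ω : symForm 𝒜 ℒ 𝓟 m d) (k : ℕ) :
    HasDegree ℒ 𝓟 d (component Ω k) ∧ GradedSymm ℒ (component Ω k) ∧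
      GradedMultilin 𝒜 ℒ d (component Ω k) := by
  by_cases h : k = m
  · subst h
    rw [component_self]
    exact Ω.2
  · rw [component_of_ne Ω h]
    exact (0 : symForm 𝒜 ℒ 𝓟 k d).2

theorem val_isFormList {d : ℤ} {w : SymForms 𝒜 ℒ 𝓟} (hw : w ∈ grade 𝒜 ℒ 𝓟 d) :
    IsFormList 𝒜 𝓟 d fun l => val 𝒜 𝓟 l w := by
  refine grade_induction (p := fun w => IsFormList 𝒜 𝓟 d fun l => val 𝒜 𝓟 l w) ?_ ?_ ?_ hw
  · simp only [map_zero]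
    exact IsFormList.zero d
  · intro v w hv hw
    simp only [map_add]
    exact hv.add hw
  · intro m Ω
    simp only [val_incl]
    exact ⟨(gradedSymm_iff_lsym _).1 fun k => (component_props Ω k).2.1, ev_llin _,
      ev_mem fun k => (component_props Ω k).1, ev_smul_head fun k => (component_props Ω k).2.2⟩

/-- Homogeneous elements of `Sym_A(L, P)` are determined by their values. -/
theorem eq_zero_of_val {d : ℤ} {w : SymForms 𝒜 ℒ 𝓟} (hw : w ∈ grade 𝒜 ℒ 𝓟 d)
    (h : ∀ l, val 𝒜 𝓟 l w = 0) : w = 0 := by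
  obtain ⟨x, rfl⟩ := hw
  -- Values on lists of length m depend only on the component with m entries, so all components are
  -- recovered from values.
  have hx : ∀ m (f : Fin m → Hgs ℒ), val 𝒜 𝓟 (List.ofFn f) ∘ₗ inclDeg 𝒜 ℒ 𝓟 d =
      { toFun := fun x : FormsDeg 𝒜 ℒ 𝓟 d =>
          (DirectSum.component K ℕ (fun m => symForm 𝒜 ℒ 𝓟 m d) m x).1 fun i => (f i).val
        map_add' := fun _ _ => rfl
        map_smul' := fun _ _ => rfl } := fun m f =>
    DirectSum.linearMap_ext _ fun k => LinearMap.ext fun Ω => by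
      refine (congrArg (fun w => val 𝒜 𝓟 (List.ofFn f) w) (rfl : _ = incl 𝒜 ℒ 𝓟 k d Ω)).trans ?_
      change _ = (DirectSum.component K ℕ (fun m => symForm 𝒜 ℒ 𝓟 m d) m
        (DirectSum.lof K ℕ (fun m => symForm 𝒜 ℒ 𝓟 m d) k Ω)).1 fun i => (f i).val
      by_cases hk : m = k
      · subst hk
        rw [val_incl_ofFn, DirectSum.component.lof_self]
      · rw [val_incl_of_ne Ω (by rwa [List.length_ofFn]),
          DirectSum.component.of, dif_neg (Ne.symm hk)]
        rfl
  have h0 : x = 0 := DirectSum.ext_component K fun m =>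
    Subtype.ext (ext_homog ℒ fun e v hv =>
      (congrArg (fun g => g x) (hx m fun i => ⟨e i, v i, hv i⟩)).symm.trans (h _))
  rw [h0, map_zero]

variable [IsGradedComm 𝒜] [CharZero K]

theorem val_insertion_A (a : Hgs 𝒜) (l : List (Hgs ℒ)) (w : SymForms 𝒜 ℒ 𝓟) :
    val 𝒜 𝓟 l (insertion 𝒜 ℒ 𝓟 (SymAlg.ιA 𝒜 ℒ a.val) w) = a.val • val 𝒜 𝓟 l w := by
  have h : val 𝒜 𝓟 l ∘ₗ insertion 𝒜 ℒ 𝓟 (SymAlg.ιA 𝒜 ℒ a.val) =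
      Algebra.lsmul K K P a.val ∘ₗ val 𝒜 𝓟 l := hom_ext fun m d Ω => by
    rw [LinearMap.comp_apply, LinearMap.comp_apply, insertion, SymAlg.lift_ιA]
    refine (congrArg (val 𝒜 𝓟 l) (opA_incl a.mem m d Ω)).trans ?_
    rw [val_incl, val_incl, Algebra.lsmul_coe, ev, ev]
    by_cases hm : l.length = m
    · subst hm
      rw [component_self, component_self]
      rfl
    · rw [component_of_ne _ hm, component_of_ne _ hm]
      exact (smul_zero _).symm
  exact congrArg (fun f => f w) h

theorem val_insertion_L {d : ℤ} {w : SymForms 𝒜 ℒ 𝓟} (hw : w ∈ grade 𝒜 ℒ 𝓟 d) (ξ : Hgs ℒ)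
    (l : List (Hgs ℒ)) : val 𝒜 𝓟 l (insertion 𝒜 ℒ 𝓟 (SymAlg.ιL 𝒜 ℒ ξ.val) w) =
      (deg ξ * d).negOnePow • val 𝒜 𝓟 (ξ :: l) w := by
  refine grade_induction (p := fun w => val 𝒜 𝓟 l (insertion 𝒜 ℒ 𝓟 (SymAlg.ιL 𝒜 ℒ ξ.val) w) =
      (deg ξ * d).negOnePow • val 𝒜 𝓟 (ξ :: l) w) ?_ ?_ ?_ hw
  · rw [map_zero, map_zero, map_zero, smul_zero]
  · intro v w hv hw
    rw [map_add, map_add, map_add, hv, hw, smul_add]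
  · intro m Ω
    rw [insertion, SymAlg.lift_ιL]
    cases m with
    | zero =>
      refine (congrArg (val 𝒜 𝓟 l) (opL_incl_zero ξ.mem d Ω)).trans ?_
      rw [map_zero, val_incl_of_ne Ω (by simp), smul_zero]
    | succ m =>
      refine (congrArg (val 𝒜 𝓟 l) (opL_incl ξ.mem m d Ω)).trans ?_
      by_cases hm : l.length = m
      · subst hm
        rw [val_incl, val_incl, ev_cons, ev, component_self, component_self]
        rfl
      · rw [val_incl_of_ne _ hm, val_incl_of_ne _ (by simpa using hm), smul_zero]

theorem insertion_graded : IsGradedAction (grade 𝒜 ℒ 𝓟) (SymAlg.grade 𝒜 ℒ)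
    (insertion 𝒜 ℒ 𝓟) := fun i x hx => by
  refine hgs_mem_induction (P := fun x => EndDegree (grade 𝒜 ℒ 𝓟) (deg x)
    (insertion 𝒜 ℒ 𝓟 x.val)) ?_ ?_ ?_ ?_ ⟨i, x, hx⟩
  · intro i
    rw [map_zero]
    exact EndDegree.zero _
  · intro i c x y hx hy h h1 h2 d w hw
    rw [map_add, map_smul]
    exact Submodule.add_mem _ (Submodule.smul_mem _ c (h1 d w hw)) (h2 d w hw)
  · intro x y h1 h2
    have h := h1.mul h2
    rwa [← map_mul] at h
  · intro y d w hw
    refine grade_induction (p := fun w => insertion 𝒜 ℒ 𝓟 (emb y).val w ∈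
      grade 𝒜 ℒ 𝓟 (deg (emb y) + d)) ?_ ?_ ?_ hw
    · rw [map_zero]
      exact Submodule.zero_mem _
    · intro v w hv hw
      rw [map_add]
      exact Submodule.add_mem _ hv hw
    · intro m Ω
      rw [add_comm, insertion]
      cases y with
      | inl a =>
        change SymAlg.lift (insertData 𝒜 ℒ 𝓟) (SymAlg.ιA 𝒜 ℒ a.val) _ ∈ _
        rw [SymAlg.lift_ιA]
        exact (opA_incl a.mem m d Ω).symm ▸ incl_mem m _ _
      | inr ξ =>
        change SymAlg.lift (insertData 𝒜 ℒ 𝓟) (SymAlg.ιL 𝒜 ℒ ξ.val) _ ∈ _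
        rw [SymAlg.lift_ιL]
        cases m with
        | zero => exact (opL_incl_zero ξ.mem d Ω).symm ▸ Submodule.zero_mem _
        | succ m => exact (opL_incl ξ.mem m d Ω).symm ▸ incl_mem m _ _

end SymForms

end FormLists

end SHLR

namespace SHLR

open scoped DirectSum TensorProduct
open HasDeg (deg)

/-! ### The operators `D_k^∇` -/

section ChevalleyEilenberg

variable {K : Type*} [Field K]
  {A : Type*} [Ring A] [Algebra K A] {𝒜 : ℤ → Submodule K A} [GradedAlgebra 𝒜]
  {L : Type*} [AddCommGroup L] [Module K L] [Module A L] [IsScalarTower K A L]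
  {ℒ : ℤ → Submodule K L} [DirectSum.Decomposition ℒ] [SetLike.GradedSMul 𝒜 ℒ]
  {P : Type*} [AddCommGroup P] [Module K P] [Module A P] [IsScalarTower K A P]
  {𝓟 : ℤ → Submodule K P} [DirectSum.Decomposition 𝓟] [SetLike.GradedSMul 𝒜 𝓟]
  {𝕏 : LRInfinity 𝒜 ℒ}

theorem LRInfinity.bracket_lsym (𝕏 : LRInfinity 𝒜 ℒ) {N : Type*} [AddCommGroup N] [Module K N]
    {F : Hgs ℒ → N} (hF : HLin F) : LSym fun I => F (𝕏.bracket I) :=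
  br_lsym 𝕏.X_degree 𝕏.X_lsym hF

theorem LRInfinity.bracket_llin (𝕏 : LRInfinity 𝒜 ℒ) {N : Type*} [AddCommGroup N] [Module K N]
    {F : Hgs ℒ → N} (hF : HLin F) : LLin fun I => F (𝕏.bracket I) := by
  have e : (fun I => F (𝕏.bracket I)) = fun I => hF.lift (ev 𝕏.X I) :=
    funext fun I => (hF.lift_apply (𝕏.bracket I)).symm
  rw [e]
  exact (ev_llin 𝕏.X).map hF.lift

theorem LRInfinity.bracket_smul_head (𝕏 : LRInfinity 𝒜 ℒ) {N : Type*} [AddCommGroup N] [Module K N]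
    {F : Hgs ℒ → N} (hF : HLin F) (a : Hgs 𝒜) (ξ : Hgs ℒ) (l : List (Hgs ℒ)) :
    F (𝕏.bracket (a.smul ξ :: l)) =
      ((deg a + deg ξ) * ldeg l).negOnePow • F ((𝕏.anchor l a).smul ξ) +
        (deg a).negOnePow • F (a.smul (𝕏.bracket (ξ :: l))) := by
  have e : hF.lift (ev 𝕏.X (a.smul ξ :: l)) = F (𝕏.bracket (a.smul ξ :: l)) :=
    hF.lift_apply (𝕏.bracket (a.smul ξ :: l))
  rw [← e, 𝕏.X_smul_head, map_add, map_sgn, map_sgn]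
  exact congrArg₂ (· + ·) (congrArg _ (hF.lift_apply ((𝕏.anchor l a).smul ξ)))
    (congrArg _ (hF.lift_apply (a.smul (𝕏.bracket (ξ :: l)))))

variable (C : LeftConnection 𝕏 𝓟)

namespace LeftConnection

theorem nabla_lsym : LSym (α := Hgs ℒ) (ev C.nabla) := (gradedSymm_iff_lsym _).1 C.symm

theorem nabla_smul (l : List (Hgs ℒ)) (a : Hgs 𝒜) (p : P) : ev C.nabla l (a.val • p) =
    ((1 + ldeg l) * deg a).negOnePow • a.val • ev C.nabla l p + ev 𝕏.σ l a.val • p := by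
  rw [← sum_univ_deg]
  exact C.leibniz _ _ _ (fun i => (l.get i).mem) _ _ a.mem p

theorem nabla_smul_head (a : Hgs 𝒜) (ξ : Hgs ℒ) (l : List (Hgs ℒ)) (p : P) :
    ev C.nabla (a.smul ξ :: l) p = (deg a).negOnePow • a.val • ev C.nabla (ξ :: l) p := by
  have h := ev_smul_head (f := fun n => (LinearMap.applyₗ p).compMultilinearMap (C.nabla n))
    (fun k => C.linear k p) a ξ l
  rw [mul_one] at h
  exact h

theorem nabla_mem (l : List (Hgs ℒ)) {j : ℤ} {p : P} (hp : p ∈ 𝓟 j) :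
    ev C.nabla l p ∈ 𝓟 (1 + ldeg l + j) := by
  rw [← sum_univ_deg]
  exact C.degree _ _ _ (fun i => (l.get i).mem) _ _ hp

/-- The summands of `D_{n+1}^∇ Ω`, where `G` is the value of `Ω` on lists and `d` is its degree. -/
def ceTerm (n : ℕ) (d : ℤ) (G : List (Hgs ℒ) → P) (I J : List (Hgs ℒ)) : P :=
  (if I.length = n then (d * ldeg I).negOnePow • ev C.nabla I (G J) else 0) -
    if I.length = n + 1 then d.negOnePow • G (𝕏.bracket I :: J) else 0

variable {d : ℤ} {G : List (Hgs ℒ) → P}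

/-- As for right connections, the letter aξ is followed into both parts at once. For |I| = n the
bracket yields an anchor term inserted into the form, and ∇ applied to a multiple of the form yields
the same term with the opposite sign; the other cases are linear by themselves. -/
theorem ceTerm_smul (hG : IsFormList 𝒜 𝓟 d G) (n : ℕ) (a : Hgs 𝒜) (ξ : Hgs ℒ)
    (I J : List (Hgs ℒ)) :
    C.ceTerm n d G (a.smul ξ :: I) J +
        ((deg a + deg ξ) * ldeg I).negOnePow • C.ceTerm n d G I (a.smul ξ :: J) =
      (deg a * (d + 1)).negOnePow • a.val • (C.ceTerm n d G (ξ :: I) J +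
        (deg ξ * ldeg I).negOnePow • C.ceTerm n d G I (ξ :: J)) := by
  simp only [ceTerm, List.length_cons, add_left_inj]
  by_cases h1 : I.length = n + 1
  · have e1 := hG.sym.front [𝕏.bracket I] (a.smul ξ) J
    have e2 := hG.sym.front [𝕏.bracket I] ξ J
    simp only [List.cons_append, List.nil_append] at e1 e2
    rw [if_neg (by omega), if_neg (by omega), if_neg (by omega), if_pos h1, if_neg (by omega),
      if_neg (by omega), if_neg (by omega), if_pos h1, e1, e2, hG.smul]
    simp only [sub_zero, zero_sub, zero_add, smul_neg, smul_sgn, sgn_smul_sgn]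
    refine congrArg _ (sgn_congr ?_ rfl)
    rw [ldeg_cons, ldeg_nil, 𝕏.deg_bracket, deg_hsmul]
    grind
  · by_cases h2 : I.length = n
    · have e1 := 𝕏.bracket_smul_head (hG.lin.hlin J) a ξ I
      beta_reduce at e1
      rw [if_neg (by omega), if_pos h2, if_pos h2, if_neg (by omega), if_neg (by omega), if_pos h2,
        if_pos h2, if_neg (by omega), e1, hG.smul, hG.smul, hG.smul, map_sgn, C.nabla_smul]
      simp only [sub_zero, zero_sub, smul_add, smul_neg, smul_sgn, sgn_smul_sgn, neg_add]
      have key : ∀ x₁ x₂ y₁ y₂ z₁ z₂ : P, x₁ = x₂ → y₁ = y₂ → z₁ = z₂ →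
          -x₁ + -y₁ + (z₁ + x₂) = -y₂ + z₂ := by
        rintro x _ y _ z _ rfl rfl rfl
        abel
      refine key _ _ _ _ _ _ (sgn_congr ?_ rfl) (sgn_congr ?_ rfl) (sgn_congr ?_ rfl)
      · rw [𝕏.deg_anchor]
        grind
      · grind
      · grind
    · by_cases h3 : I.length + 1 = n
      · rw [if_pos h3, if_neg h2, if_neg h2, if_neg h1, if_pos h3, if_neg h2, if_neg h2, if_neg h1,
          C.nabla_smul_head]
        simp only [sub_zero, smul_zero, add_zero, smul_sgn, sgn_smul_sgn]
        refine sgn_congr ?_ rfl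
        rw [ldeg_cons, ldeg_cons, deg_hsmul]
        grind
      · simp [h1, h2, h3]

theorem ceTerm_mem (hG : IsFormList 𝒜 𝓟 d G) (n : ℕ) (I J : List (Hgs ℒ)) :
    C.ceTerm n d G I J ∈ 𝓟 (d + 1 + (ldeg I + ldeg J)) := by
  refine Submodule.sub_mem _ ?_ ?_
  · split_ifs
    · have h := C.nabla_mem I (hG.mem J)
      have e : 1 + ldeg I + (d + ldeg J) = d + 1 + (ldeg I + ldeg J) := by ring
      rw [e] at h
      exact sgn_mem _ h
    · exact Submodule.zero_mem _
  · split_ifs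
    · have h := hG.mem (𝕏.bracket I :: J)
      have e : d + ldeg (𝕏.bracket I :: J) = d + 1 + (ldeg I + ldeg J) := by
        rw [ldeg_cons, 𝕏.deg_bracket]
        ring
      rw [e] at h
      exact sgn_mem _ h
    · exact Submodule.zero_mem _

theorem ceTerm_lsym_left (hG : IsFormList 𝒜 𝓟 d G) (n : ℕ) (J : List (Hgs ℒ)) :
    LSym fun I => C.ceTerm n d G I J := by
  refine LSym.sub (LSym.ite (F := fun I => (d * ldeg I).negOnePow • ev C.nabla I (G J)) ?_ n)
    (LSym.ite (F := fun I => d.negOnePow • G (𝕏.bracket I :: J)) ?_ (n + 1))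
  · exact (C.nabla_lsym.map (LinearMap.applyₗ (R := K) (G J))).smul_ldeg
      fun x => (d * x).negOnePow
  · exact (𝕏.bracket_lsym (hG.lin.hlin J)).smul_ldeg fun _ => d.negOnePow

theorem ceTerm_llin_left (hG : IsFormList 𝒜 𝓟 d G) (n : ℕ) (J : List (Hgs ℒ)) :
    LLin fun I => C.ceTerm n d G I J := by
  refine LLin.sub (LLin.ite (F := fun I => (d * ldeg I).negOnePow • ev C.nabla I (G J)) ?_ n)
    (LLin.ite (F := fun I => d.negOnePow • G (𝕏.bracket I :: J)) ?_ (n + 1))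
  · exact ((ev_llin C.nabla).map (LinearMap.applyₗ (R := K) (G J))).smul_ldeg
      fun x => (d * x).negOnePow
  · exact (𝕏.bracket_llin (hG.lin.hlin J)).smul_ldeg fun _ => d.negOnePow

theorem ceTerm_lsym_right (hG : IsFormList 𝒜 𝓟 d G) (n : ℕ) (I : List (Hgs ℒ)) :
    LSym (C.ceTerm n d G I) := by
  refine LSym.sub (LSym.const_ite ?_ _) (LSym.const_ite ?_ _)
  · exact (hG.sym.map (ev C.nabla I)).smul_ldeg fun _ => (d * ldeg I).negOnePow
  · exact (hG.sym.cons (𝕏.bracket I)).smul_ldeg fun _ => d.negOnePow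

theorem ceTerm_llin_right (hG : IsFormList 𝒜 𝓟 d G) (n : ℕ) (I : List (Hgs ℒ)) :
    LLin (C.ceTerm n d G I) := by
  refine LLin.sub (LLin.const_ite ?_ _) (LLin.const_ite ?_ _)
  · exact (hG.lin.map (ev C.nabla I)).smul_ldeg fun _ => (d * ldeg I).negOnePow
  · exact (hG.lin.cons (𝕏.bracket I)).smul_ldeg fun _ => d.negOnePow

theorem ceTerm_isFormList (hG : IsFormList 𝒜 𝓟 d G) (n : ℕ) :
    IsFormList 𝒜 𝓟 (d + 1) (spl (C.ceTerm n d G)) where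
  sym := LSym.spl (C.ceTerm_lsym_left hG n) (C.ceTerm_lsym_right hG n)
  lin := LLin.spl (C.ceTerm_llin_left hG n) (C.ceTerm_llin_right hG n)
  mem l := spl_mem fun I J h => by
    rw [← ldeg_perm h, ldeg_append]
    exact C.ceTerm_mem hG n I J
  smul a ξ l := by
    have e : ∀ x : P, a.val • x = DistribSMul.toAddMonoidHom P a.val x := fun _ => rfl
    rw [spl_cons, spl_cons, ← spl_add, ← spl_add, e, spl_map, ← spl_smul]
    refine spl_congr fun I J _ => ?_
    rw [deg_hsmul]
    exact C.ceTerm_smul hG n a ξ I J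

theorem ceTerm_lincomb (n : ℕ) (d : ℤ) (c : K) (F G : List (Hgs ℒ) → P) (I J : List (Hgs ℒ)) :
    C.ceTerm n d (fun l => c • F l + G l) I J = c • C.ceTerm n d F I J + C.ceTerm n d G I J := by
  rw [ceTerm, ceTerm, ceTerm]
  split_ifs <;>
    simp only [sub_zero, zero_sub, smul_zero, add_zero, map_add, map_smul, smul_add, smul_sub,
      smul_neg, smul_sgn] <;> abel

end LeftConnection

end ChevalleyEilenberg

end SHLR

namespace SHLR

open scoped DirectSum TensorProduct
open HasDeg (deg)

/-! ### Construction and uniqueness of the operators on forms -/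

section ChevalleyEilenberg

variable {K : Type*} [Field K]
  {A : Type*} [Ring A] [Algebra K A] {𝒜 : ℤ → Submodule K A} [GradedAlgebra 𝒜]
  {L : Type*} [AddCommGroup L] [Module K L] [Module A L] [IsScalarTower K A L]
  {ℒ : ℤ → Submodule K L} [DirectSum.Decomposition ℒ] [SetLike.GradedSMul 𝒜 ℒ]
  {P : Type*} [AddCommGroup P] [Module K P] [Module A P] [IsScalarTower K A P]
  {𝓟 : ℤ → Submodule K P} [DirectSum.Decomposition 𝓟] [SetLike.GradedSMul 𝒜 𝓟]
  {𝕏 : LRInfinity 𝒜 ℒ} (C : LeftConnection 𝕏 𝓟)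

namespace LeftConnection

open SymForms

/-- The form `D_{n+1}^∇ Ω`. -/
noncomputable def ceForm (n : ℕ) {m : ℕ} {d : ℤ} (Ω : symForm 𝒜 ℒ 𝓟 m d) :
    symForm 𝒜 ℒ 𝓟 (m + n) (d + 1) :=
  (C.ceTerm_isFormList (val_isFormList (incl_mem m d Ω)) n).form (m + n)

theorem ceForm_apply (n : ℕ) {m : ℕ} {d : ℤ} (Ω : symForm 𝒜 ℒ 𝓟 m d) (h : Fin (m + n) → Hgs ℒ) :
    (C.ceForm n Ω).1 (fun i => (h i).val) =
      spl (C.ceTerm n d fun l => val 𝒜 𝓟 l (incl 𝒜 ℒ 𝓟 m d Ω)) (List.ofFn h) :=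
  IsFormList.form_apply _ h

theorem ceForm_lincomb (n : ℕ) {m : ℕ} {d : ℤ} (c : K) (Ω Θ : symForm 𝒜 ℒ 𝓟 m d) :
    C.ceForm n (c • Ω + Θ) = c • C.ceForm n Ω + C.ceForm n Θ :=
  Subtype.ext (ext_homog ℒ fun e v hv => by
    have h : ∀ Ω : symForm 𝒜 ℒ 𝓟 m d, (C.ceForm n Ω).1 v = _ :=
      fun Ω => C.ceForm_apply n Ω fun i => (⟨e i, v i, hv i⟩ : Hgs ℒ)
    change _ = c • (C.ceForm n Ω).1 v + (C.ceForm n Θ).1 v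
    rw [h, h, h, ← spl_lincomb]
    simp only [map_add, map_smul]
    exact spl_congr fun I J _ => C.ceTerm_lincomb n d c _ _ I J)

/-- The operator `D_{n+1}^∇`. -/
noncomputable def ce (n : ℕ) : Module.End K (SymForms 𝒜 ℒ 𝓟) :=
  lift 𝒜 ℒ 𝓟 fun m d => incl 𝒜 ℒ 𝓟 (m + n) (d + 1) ∘ₗ
    { toFun := C.ceForm n
      map_add' := fun Ω Θ => by
        have h := C.ceForm_lincomb n 1 Ω Θ
        rwa [one_smul, one_smul] at h
      map_smul' := fun c Ω => by
        have h0 := C.ceForm_lincomb n 1 (0 : symForm 𝒜 ℒ 𝓟 m d) 0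
        have h := C.ceForm_lincomb n c Ω 0
        rw [one_smul, one_smul, add_zero, left_eq_add] at h0
        rwa [h0, add_zero, add_zero] at h }

theorem ce_incl (n m : ℕ) (d : ℤ) (Ω : symForm 𝒜 ℒ 𝓟 m d) :
    C.ce n (incl 𝒜 ℒ 𝓟 m d Ω) = incl 𝒜 ℒ 𝓟 (m + n) (d + 1) (C.ceForm n Ω) :=
  lift_incl _ m d Ω

theorem ce_degree (n : ℕ) : EndDegree (SymForms.grade 𝒜 ℒ 𝓟) 1 (C.ce n) := fun d w hw => by
  refine grade_induction (p := fun w => C.ce n w ∈ SymForms.grade 𝒜 ℒ 𝓟 (1 + d)) ?_ ?_ ?_ hw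
  · rw [map_zero]
    exact Submodule.zero_mem _
  · intro v w hv hw
    rw [map_add]
    exact Submodule.add_mem _ hv hw
  · intro m Ω
    rw [ce_incl, add_comm 1 d]
    exact incl_mem _ _ _

theorem val_ce (n : ℕ) {d : ℤ} {w : SymForms 𝒜 ℒ 𝓟} (hw : w ∈ SymForms.grade 𝒜 ℒ 𝓟 d)
    (l : List (Hgs ℒ)) :
    val 𝒜 𝓟 l (C.ce n w) = spl (C.ceTerm n d fun l => val 𝒜 𝓟 l w) l := by
  have hadd : ∀ v w : SymForms 𝒜 ℒ 𝓟, spl (C.ceTerm n d fun l => val 𝒜 𝓟 l (v + w)) l =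
      spl (C.ceTerm n d fun l => val 𝒜 𝓟 l v) l + spl (C.ceTerm n d fun l => val 𝒜 𝓟 l w) l := by
    intro v w
    rw [← spl_add]
    refine spl_congr fun I J _ => ?_
    have h := C.ceTerm_lincomb n d 1 (fun l => val 𝒜 𝓟 l v) (fun l => val 𝒜 𝓟 l w) I J
    simpa only [one_smul, ← map_add] using h
  refine grade_induction (p := fun w => val 𝒜 𝓟 l (C.ce n w) =
    spl (C.ceTerm n d fun l => val 𝒜 𝓟 l w) l) ?_ ?_ ?_ hw
  · have h := hadd 0 0
    rw [add_zero, left_eq_add] at h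
    rw [map_zero, map_zero, h]
  · intro v w hv hw
    rw [map_add, map_add, hv, hw, hadd]
  · intro m Ω
    rw [ce_incl]
    by_cases hl : l.length = m + n
    · obtain ⟨k, h, rfl⟩ := exists_ofFn l
      rw [List.length_ofFn] at hl
      subst hl
      rw [val_incl_ofFn, ceForm_apply]
    -- On lists of the wrong length the value is zero, and each summand evaluates the form on a
    -- wrong number of entries.
    · rw [val_incl_of_ne _ hl]
      refine (spl_eq_zero fun I J h => ?_).symm
      have hl' := h.length_eq
      rw [List.length_append] at hl'
      rw [ceTerm]
      split_ifs with h1 h2 h2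
      · omega
      · rw [val_incl_of_ne Ω (by omega), map_zero, smul_zero, sub_zero]
      · rw [val_incl_of_ne Ω (by rw [List.length_cons]; omega), smul_zero, sub_zero]
      · rw [sub_zero]

theorem ceForm_sum (n : ℕ) {m : ℕ} {d : ℤ} (Ω : symForm 𝒜 ℒ 𝓟 m d) (h : Fin (m + n) → Hgs ℒ) :
    (C.ceForm n Ω).1 (fun i => (h i).val) =
      (∑ I : Finset (Fin (m + n)) with I.card = n,
          (d * ∑ i ∈ I, deg (h i)).negOnePow • koszulSign I (fun i => deg (h i)) •
            C.nabla I.card (pick (fun i => (h i).val) I)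
              (formEval Ω (pick (fun i => (h i).val) Iᶜ)))
        - ∑ I : Finset (Fin (m + n)) with I.card = n + 1,
          d.negOnePow • koszulSign I (fun i => deg (h i)) •
            formEval Ω (Fin.cons (𝕏.X I.card (pick (fun i => (h i).val) I))
              (pick (fun i => (h i).val) Iᶜ) : Fin (Iᶜ.card + 1) → L) := by
  rw [ceForm_apply]
  unfold ceTerm
  simp only [formEval_eq]
  rw [spl_sub, Finset.sum_filter, Finset.sum_filter, ← sum_pick_eq_spl, ← sum_pick_eq_spl]
  refine congrArg₂ (· - ·) (Finset.sum_congr rfl fun I _ => ?_) (Finset.sum_congr rfl fun I _ => ?_)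
  · rw [List.length_ofFn, ldeg_ofFn_pick, val_incl, ev_ofFn_pick, ev_ofFn_pick, smul_ite, smul_zero,
      smul_comm]
  · have e : (𝕏.bracket (List.ofFn (pick h I))).val =
        𝕏.X I.card (pick (fun i => (h i).val) I) := ev_ofFn_pick 𝕏.X h I
    rw [List.length_ofFn, val_incl, ev_cons_ofFn, e, smul_ite, smul_zero, smul_comm]
    rfl

theorem ce_isChevalleyEilenberg : IsChevalleyEilenberg C C.ce := fun n m d Ω =>
  ⟨C.ceForm n Ω, C.ce_incl n m d Ω, fun e ξ hξ =>
    C.ceForm_sum n Ω fun i => (⟨e i, ξ i, hξ i⟩ : Hgs ℒ)⟩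

theorem ce_unique {D : ℕ → Module.End K (SymForms 𝒜 ℒ 𝓟)} (h : IsChevalleyEilenberg C D) :
    D = C.ce := funext fun n => hom_ext fun m d Ω => by
  obtain ⟨Ω', h1, h2⟩ := h n m d Ω
  rw [h1, ce_incl]
  refine incl_eq rfl (ext_homog ℒ fun e ξ hξ => ?_)
  exact (h2 e ξ hξ).trans (C.ceForm_sum n Ω fun i => (⟨e i, ξ i, hξ i⟩ : Hgs ℒ)).symm

end LeftConnection

end ChevalleyEilenberg

end SHLR

namespace SHLR

open scoped DirectSum TensorProduct
open HasDeg (deg)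

/-! ### The left module `Sym_A(L, P)` -/

section LeftModule

theorem negOnePow_natCast (n : ℕ) : (n : ℤ).negOnePow = (-1) ^ n := by
  rw [Int.negOnePow_def, zpow_natCast]

variable {K : Type*} [Field K]
  {A : Type*} [Ring A] [Algebra K A] {𝒜 : ℤ → Submodule K A} [GradedAlgebra 𝒜] [IsGradedComm 𝒜]
  {L : Type*} [AddCommGroup L] [Module K L] [Module A L] [IsScalarTower K A L]
  {ℒ : ℤ → Submodule K L} [DirectSum.Decomposition ℒ] [SetLike.GradedSMul 𝒜 ℒ]
  {P : Type*} [AddCommGroup P] [Module K P] [Module A P] [IsScalarTower K A P]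
  {𝓟 : ℤ → Submodule K P} [DirectSum.Decomposition 𝓟] [SetLike.GradedSMul 𝒜 𝓟]
  [CharZero K]

open SymForms

namespace SymForms

theorem insertion_emb_inl (a : Hgs 𝒜) (l : List (Hgs ℒ)) (w : SymForms 𝒜 ℒ 𝓟) :
    val 𝒜 𝓟 l (insertion 𝒜 ℒ 𝓟 (emb (Sum.inl a)).val w) = a.val • val 𝒜 𝓟 l w :=
  val_insertion_A a l w

theorem insertion_emb_inr {d : ℤ} {w : SymForms 𝒜 ℒ 𝓟} (hw : w ∈ SymForms.grade 𝒜 ℒ 𝓟 d)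
    (ξ : Hgs ℒ) (l : List (Hgs ℒ)) : val 𝒜 𝓟 l (insertion 𝒜 ℒ 𝓟 (emb (Sum.inr ξ)).val w) =
      (deg ξ * d).negOnePow • val 𝒜 𝓟 (ξ :: l) w :=
  val_insertion_L hw ξ l

theorem insertion_mem (u : Hgs (SymAlg.grade 𝒜 ℒ)) {d : ℤ} {w : SymForms 𝒜 ℒ 𝓟}
    (hw : w ∈ SymForms.grade 𝒜 ℒ 𝓟 d) :
    insertion 𝒜 ℒ 𝓟 u.val w ∈ SymForms.grade 𝒜 ℒ 𝓟 (deg u + d) :=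
  insertion_graded _ _ u.mem _ _ hw

end SymForms

/-- Dual to the argument for tensors: the first entry of a list of arguments is an insertion applied
to the result. It is moved through the operator at the cost of one commutator, until no argument
remains. -/
theorem comm_eq_of_val_nil {a : ℤ} {Φ Ψ : Module.End K (SymForms 𝒜 ℒ 𝓟)}
    (hΦ : EndDegree (SymForms.grade 𝒜 ℒ 𝓟) a Φ) (hΨ : EndDegree (SymForms.grade 𝒜 ℒ 𝓟) a Ψ)
    (h : ∀ (l : List (Hgs ℒ)) (d : ℤ) (w : SymForms 𝒜 ℒ 𝓟), w ∈ SymForms.grade 𝒜 ℒ 𝓟 d →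
      val 𝒜 𝓟 [] (comm (SymForms.grade 𝒜 ℒ 𝓟) (insertion 𝒜 ℒ 𝓟) Φ (embL 𝒜 l) w) =
      val 𝒜 𝓟 [] (comm (SymForms.grade 𝒜 ℒ 𝓟) (insertion 𝒜 ℒ 𝓟) Ψ (embL 𝒜 l) w)) : Φ = Ψ := by
  have key : ∀ (m l : List (Hgs ℒ)) (d : ℤ) (w : SymForms 𝒜 ℒ 𝓟), w ∈ SymForms.grade 𝒜 ℒ 𝓟 d →
      val 𝒜 𝓟 m (comm (SymForms.grade 𝒜 ℒ 𝓟) (insertion 𝒜 ℒ 𝓟) Φ (embL 𝒜 l) w) =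
      val 𝒜 𝓟 m (comm (SymForms.grade 𝒜 ℒ 𝓟) (insertion 𝒜 ℒ 𝓟) Ψ (embL 𝒜 l) w) := by
    intro m
    induction m with
    | nil => exact h
    | cons ξ m ih =>
      intro l d w hw
      have e' : embL 𝒜 l ++ [emb (Sum.inr ξ)] = embL 𝒜 (l ++ [ξ]) := (embL_append l [ξ]).symm
      have h1 := congrArg (val 𝒜 𝓟 m)
        (comm_apply_action insertion_graded hΦ (embL 𝒜 l) (emb (Sum.inr ξ)) w)
      have h2 := congrArg (val 𝒜 𝓟 m)
        (comm_apply_action insertion_graded hΨ (embL 𝒜 l) (emb (Sum.inr ξ)) w)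
      rw [ih l _ _ (insertion_mem (emb (Sum.inr ξ)) hw), h2, e', map_add, map_add,
        ih (l ++ [ξ]) d w hw, map_sgn, map_sgn,
        insertion_emb_inr (hΦ.comm insertion_graded (embL 𝒜 l) d w hw),
        insertion_emb_inr (hΨ.comm insertion_graded (embL 𝒜 l) d w hw)] at h1
      exact (smul_left_cancel _ (smul_left_cancel _ (add_left_cancel h1))).symm
  refine linear_ext_homog (SymForms.grade 𝒜 ℒ 𝓟) fun d w hw => sub_eq_zero.1
    (eq_zero_of_val (Submodule.sub_mem _ (hΦ d w hw) (hΨ d w hw)) fun m => ?_)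
  rw [map_sub]
  exact sub_eq_zero.2 (key m [] d w hw)

variable {𝕏 : LRInfinity 𝒜 ℒ} (C : LeftConnection 𝕏 𝓟)

namespace LeftConnection

/-- A letter already inserted into the form behaves like a letter of the second part. Such terms
cancel in the commutator with the insertion. -/
theorem ceTerm_insertion (n : ℕ) {d : ℤ} {G : List (Hgs ℒ) → P} (hG : LSym G) (ξ : Hgs ℒ)
    (I J : List (Hgs ℒ)) :
    C.ceTerm n (deg ξ + d) (fun l => (deg ξ * d).negOnePow • G (ξ :: l)) I J =
      (deg ξ * (d + ldeg I)).negOnePow • C.ceTerm n d G I (ξ :: J) := by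
  have e := hG [] ξ (𝕏.bracket I) J
  simp only [List.nil_append] at e
  rw [ceTerm, ceTerm, smul_sub, smul_ite, smul_ite, smul_zero, e, map_sgn]
  simp only [sgn_smul_sgn]
  refine congrArg₂ (· - ·) (congrArg₂ (ite _) (sgn_congr ?_ rfl) rfl)
    (congrArg₂ (ite _) (sgn_congr ?_ rfl) rfl)
  · grind
  · rw [𝕏.deg_bracket]
    grind

/-- The product with the insertion on the right gives the splittings that keep ξ in the second part,
and the one with the insertion on the left gives all splittings. Their difference is minus the
splittings with ξ in the first part, hence one factor -1 for each letter of l. -/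
theorem val_comm_ce (n : ℕ) (l m : List (Hgs ℒ)) {d : ℤ} {w : SymForms 𝒜 ℒ 𝓟}
    (hw : w ∈ SymForms.grade 𝒜 ℒ 𝓟 d) :
    val 𝒜 𝓟 m (comm (SymForms.grade 𝒜 ℒ 𝓟) (insertion 𝒜 ℒ 𝓟) (C.ce n) (embL 𝒜 l) w) =
      (l.length + d * ldeg l).negOnePow •
        spl (fun I J => C.ceTerm n d (fun k => val 𝒜 𝓟 k w) (l ++ I) J) m := by
  induction l using List.reverseRecOn generalizing m d w with
  | nil =>
    rw [ldeg_nil, List.length_nil, mul_zero, sgn_eq_self (by simp)]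
    exact C.val_ce n hw m
  | append_singleton l ξ ih =>
    have h := congrArg (val 𝒜 𝓟 m) (comm_apply_action insertion_graded (C.ce_degree n) (embL 𝒜 l)
      (emb (Sum.inr ξ)) w)
    have e' : embL 𝒜 l ++ [emb (Sum.inr ξ)] = embL 𝒜 (l ++ [ξ]) := (embL_append l [ξ]).symm
    rw [e', ih m (insertion_mem _ hw), map_add, map_sgn,
      insertion_emb_inr ((C.ce_degree n).comm insertion_graded (embL 𝒜 l) d w hw), ih _ hw,
      ldeg_embL l, deg_emb, deg_inr, spl_cons, smul_add, smul_add, smul_add] at h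
    have h' : (l.length + (deg ξ + d) * ldeg l).negOnePow •
        spl (fun I J => C.ceTerm n (deg ξ + d) (fun k => val 𝒜 𝓟 k (insertion 𝒜 ℒ 𝓟
          (emb (Sum.inr ξ)).val w)) (l ++ I) J) m =
        ((1 + ldeg l) * deg ξ).negOnePow • (deg ξ * (1 + ldeg l + d)).negOnePow •
          (l.length + d * ldeg l).negOnePow • spl (fun I J => (deg ξ * ldeg I).negOnePow •
            C.ceTerm n d (fun k => val 𝒜 𝓟 k w) (l ++ I) (ξ :: J)) m := by
      simp only [insertion_emb_inr hw, C.ceTerm_insertion n (val_isFormList hw).sym, sgn_smul_sgn]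
      rw [← spl_smul, ← spl_smul]
      refine spl_congr fun I J _ => ?_
      rw [sgn_smul_sgn, sgn_smul_sgn, ldeg_append]
      exact sgn_congr (by grind) rfl
    rw [h', ← add_assoc, right_eq_add, sgn_smul_sgn, sgn_smul_sgn] at h
    rw [eq_neg_of_add_eq_zero_left h, neg_sgn, List.length_append, ldeg_append, ldeg_cons, ldeg_nil]
    simp only [List.append_assoc, List.singleton_append]
    refine sgn_congr ?_ rfl
    rw [List.length_singleton]
    push_cast
    grind

theorem val_nil_comm_ce (n : ℕ) (l : List (Hgs ℒ)) {d : ℤ} {w : SymForms 𝒜 ℒ 𝓟}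
    (hw : w ∈ SymForms.grade 𝒜 ℒ 𝓟 d) :
    val 𝒜 𝓟 [] (comm (SymForms.grade 𝒜 ℒ 𝓟) (insertion 𝒜 ℒ 𝓟) (C.ce n) (embL 𝒜 l) w) =
      (if l.length = n then (l.length : ℤ).negOnePow • ev C.nabla l (val 𝒜 𝓟 [] w) else 0) -
        if l.length = n + 1 then
          (l.length + d * ldeg l + d).negOnePow • val 𝒜 𝓟 [𝕏.bracket l] w else 0 := by
  rw [val_comm_ce C n l [] hw, spl_nil, List.append_nil, ceTerm, smul_sub, smul_ite, smul_ite,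
    smul_zero, sgn_smul_sgn, sgn_smul_sgn]
  exact congrArg₂ (· - ·) (congrArg₂ (ite _) (sgn_congr (by grind) rfl) rfl) rfl

theorem comm_ce_L (n : ℕ) (l : List (Hgs ℒ)) (hl : l.length = n + 1) :
    comm (SymForms.grade 𝒜 ℒ 𝓟) (insertion 𝒜 ℒ 𝓟) (C.ce n) (embL 𝒜 l) =
      (-1 : ℤˣ) ^ n • insertion 𝒜 ℒ 𝓟 (SymAlg.ιL 𝒜 ℒ (ev 𝕏.X l)) := by
  have hb := (insertion_graded (𝓟 := 𝓟) _ _ (emb (𝒜 := 𝒜) (Sum.inr (𝕏.bracket l))).mem).sgn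
    ((-1) ^ n)
  have hd := (C.ce_degree n).comm insertion_graded (embL 𝒜 l)
  rw [ldeg_embL] at hd
  refine comm_eq_of_val_nil hd hb fun m d w hw => ?_
  rw [← comm_append, ← embL_append, C.val_nil_comm_ce n (l ++ m) hw, comm_sgn]
  cases m with
  | nil =>
    have e := insertion_emb_inr hw (𝕏.bracket l) []
    change _ = val 𝒜 𝓟 [] ((-1 : ℤˣ) ^ n • insertion 𝒜 ℒ 𝓟 (emb (Sum.inr (𝕏.bracket l))).val w)
    rw [map_sgn, e, List.append_nil, if_neg (by omega), if_pos hl, zero_sub, neg_sgn,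
      ← negOnePow_natCast, sgn_smul_sgn, hl, 𝕏.deg_bracket]
    push_cast
    exact sgn_congr (by grind) rfl
  | cons ξ m =>
    have h := comm_action (𝒲 := SymForms.grade 𝒜 ℒ 𝓟) insertion_graded
      (emb (𝒜 := 𝒜) (Sum.inr (𝕏.bracket l))) (l := embL 𝒜 (ξ :: m)) (List.cons_ne_nil _ _)
    have e : (l ++ ξ :: m).length = n + 2 + m.length := by
      rw [List.length_append, List.length_cons, hl]
      omega
    have h' := congrArg (fun Φ => val 𝒜 𝓟 [] (((-1 : ℤˣ) ^ n • Φ) w)) h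
    rw [e, if_neg (by omega), if_neg (by omega), sub_zero]
    refine Eq.symm (h'.trans ?_)
    rw [smul_zero, LinearMap.zero_apply, map_zero]

/-- For n letters the commutator with a isolates the anchor term in the Leibniz rule of ∇. For n + 1
letters the form is evaluated on a bracket, and this commutes with multiplication by a up to the
expected sign. -/
theorem val_nil_comm_ce_A (n : ℕ) (l : List (Hgs ℒ)) (a : Hgs 𝒜) {d : ℤ} {w : SymForms 𝒜 ℒ 𝓟}
    (hw : w ∈ SymForms.grade 𝒜 ℒ 𝓟 d) :
    val 𝒜 𝓟 [] (comm (SymForms.grade 𝒜 ℒ 𝓟) (insertion 𝒜 ℒ 𝓟) (C.ce n)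
      (embL 𝒜 l ++ [emb (Sum.inl a)]) w) =
      if l.length = n then (l.length : ℤ).negOnePow • ev 𝕏.σ l a.val • val 𝒜 𝓟 [] w else 0 := by
  have h := congrArg (val 𝒜 𝓟 []) (comm_apply_action insertion_graded (C.ce_degree n) (embL 𝒜 l)
    (emb (Sum.inl a)) w)
  rw [map_add, map_sgn, insertion_emb_inl, C.val_nil_comm_ce n l hw,
    C.val_nil_comm_ce n l (insertion_mem (emb (Sum.inl a)) hw), insertion_emb_inl,
    insertion_emb_inl, ldeg_embL l] at h
  rw [eq_sub_of_add_eq h.symm]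
  by_cases h1 : l.length = n
  · have h2 : l.length ≠ n + 1 := by omega
    rw [if_pos h1, if_pos h1, if_pos h1, if_neg h2, if_neg h2, sub_zero, sub_zero, C.nabla_smul,
      deg_emb, deg_inl, smul_add, smul_sgn,
      smul_comm (l.length : ℤ).negOnePow ((1 + ldeg l) * deg a).negOnePow, add_sub_cancel_left]
  · rw [if_neg h1, if_neg h1, if_neg h1, zero_sub, zero_sub, sub_eq_zero, smul_neg, smul_neg]
    refine congrArg _ ?_
    split_ifs
    · rw [smul_sgn, sgn_smul_sgn, deg_emb, deg_inl]
      exact sgn_congr (by grind) rfl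
    · rw [smul_zero, smul_zero]

theorem comm_ce_A (a : Hgs 𝒜) (l : List (Hgs ℒ)) :
    comm (SymForms.grade 𝒜 ℒ 𝓟) (insertion 𝒜 ℒ 𝓟) (C.ce l.length)
      (emb (Sum.inl a) :: embL 𝒜 l) =
      (-1 : ℤˣ) ^ l.length • (deg a * ldeg l).negOnePow •
        insertion 𝒜 ℒ 𝓟 (SymAlg.ιA 𝒜 ℒ (ev 𝕏.σ l a.val)) := by
  have hs := comm_lsym (insertion_graded (𝓟 := 𝓟)) (C.ce_degree l.length)
  rw [hs.back, ldeg_embL, deg_emb, deg_inl, smul_comm ((-1 : ℤˣ) ^ l.length)]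
  refine congrArg _ ?_
  have hb := (insertion_graded (𝓟 := 𝓟) _ _ (emb (ℒ := ℒ) (Sum.inl (𝕏.anchor l a))).mem).sgn
    ((-1) ^ l.length)
  have hd := (C.ce_degree l.length).comm insertion_graded (embL 𝒜 l ++ [emb (Sum.inl a)])
  have e : 1 + ldeg (embL 𝒜 l ++ [emb (Sum.inl a)]) = 1 + ldeg l + deg a := by
    rw [ldeg_append, ldeg_cons, ldeg_nil, ldeg_embL, deg_emb, deg_inl, add_zero, add_assoc]
  rw [e] at hd
  refine comm_eq_of_val_nil hd hb fun m d w hw => ?_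
  rw [← comm_append, List.append_assoc, List.singleton_append, (hs.append (embL 𝒜 l)).back,
    ← List.append_assoc, ← embL_append, LinearMap.smul_apply, map_sgn,
    C.val_nil_comm_ce_A _ (l ++ m) a hw, comm_sgn]
  cases m with
  | nil =>
    have e := insertion_emb_inl (𝕏.anchor l a) [] w
    change _ = val 𝒜 𝓟 [] ((-1 : ℤˣ) ^ l.length •
      insertion 𝒜 ℒ 𝓟 (emb (Sum.inl (𝕏.anchor l a))).val w)
    rw [List.append_nil, if_pos rfl, ldeg_embL, ldeg_nil, mul_zero, Int.negOnePow_zero, one_smul,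
      map_sgn, e, negOnePow_natCast]
    rfl
  | cons ξ m =>
    have h := comm_action (𝒲 := SymForms.grade 𝒜 ℒ 𝓟) insertion_graded
      (emb (ℒ := ℒ) (Sum.inl (𝕏.anchor l a))) (l := embL 𝒜 (ξ :: m)) (List.cons_ne_nil _ _)
    have h' := congrArg (fun Φ => val 𝒜 𝓟 [] (((-1 : ℤˣ) ^ l.length • Φ) w)) h
    rw [if_neg (by simp), smul_zero]
    refine Eq.symm (h'.trans ?_)
    rw [smul_zero, LinearMap.zero_apply, map_zero]

theorem comm_ce_AA (a b : Hgs 𝒜) (g : List (Hgs (SymAlg.grade 𝒜 ℒ))) (n : ℕ) :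
    comm (SymForms.grade 𝒜 ℒ 𝓟) (insertion 𝒜 ℒ 𝓟) (C.ce n)
      (emb (Sum.inl a) :: emb (Sum.inl b) :: g) = 0 := by
  have hs := comm_lsym (insertion_graded (𝓟 := 𝓟)) (C.ce_degree n)
  suffices h : comm (SymForms.grade 𝒜 ℒ 𝓟) (insertion 𝒜 ℒ 𝓟) (C.ce n)
      [emb (Sum.inl a), emb (ℒ := ℒ) (Sum.inl b)] = 0 by
    have e := comm_append (𝒲 := SymForms.grade 𝒜 ℒ 𝓟) (ρ := insertion 𝒜 ℒ 𝓟) (C.ce n)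
      [emb (Sum.inl a), emb (ℒ := ℒ) (Sum.inl b)] g
    rw [h, comm_zero] at e
    exact e
  refine comm_eq_of_val_nil ((C.ce_degree n).comm insertion_graded _) (EndDegree.zero _)
    fun m d w hw => ?_
  rw [comm_zero, LinearMap.zero_apply, map_zero, ← comm_append]
  have e : val 𝒜 𝓟 [] (comm (SymForms.grade 𝒜 ℒ 𝓟) (insertion 𝒜 ℒ 𝓟) (C.ce n)
      (embL 𝒜 m ++ [emb (Sum.inl b)] ++ [emb (Sum.inl a)]) w) = 0 := by
    have h := congrArg (val 𝒜 𝓟 []) (comm_apply_action insertion_graded (C.ce_degree n)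
      (embL 𝒜 m ++ [emb (Sum.inl b)]) (emb (Sum.inl a)) w)
    rw [map_add, map_sgn, insertion_emb_inl, C.val_nil_comm_ce_A n m b hw,
      C.val_nil_comm_ce_A n m b (insertion_mem (emb (Sum.inl a)) hw), insertion_emb_inl] at h
    rw [eq_sub_of_add_eq h.symm, sub_eq_zero]
    split_ifs
    · have h2 := balancedFamilies.smul_smul_comm a (𝕏.anchor m b) (val 𝒜 𝓟 [] w)
      have h3 : ev 𝕏.σ m b.val • a.val • val 𝒜 𝓟 [] w = _ := h2
      rw [h3, smul_sgn, sgn_smul_sgn, sgn_smul_sgn]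
      refine sgn_congr ?_ rfl
      rw [𝕏.deg_anchor, ldeg_append, ldeg_embL, ldeg_cons, ldeg_nil, deg_emb, deg_emb]
      simp only [deg_inl]
      grind
    · rw [smul_zero, smul_zero]
  have e1 := hs.back (emb (Sum.inl a)) (emb (Sum.inl b) :: embL 𝒜 m)
  have e2 := ((hs.back (emb (Sum.inl b)) (embL 𝒜 m ++ [emb (Sum.inl a)])))
  have e3 := hs (embL 𝒜 m) (emb (Sum.inl a)) (emb (Sum.inl b)) []
  rw [List.append_assoc] at e
  rw [List.append_assoc, List.singleton_append] at e2
  simp only [List.cons_append, List.nil_append] at e e1 e2 e3 ⊢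
  rw [e1, e2, e3, LinearMap.smul_apply, LinearMap.smul_apply, LinearMap.smul_apply, map_sgn,
    map_sgn, map_sgn, e, smul_zero, smul_zero, smul_zero]

theorem comm_ce_bracket (n : ℕ) (l : List (Hgs (SymAlg.grade 𝒜 ℒ))) (hl : l.length = n + 1) :
    comm (SymForms.grade 𝒜 ℒ 𝓟) (insertion 𝒜 ℒ 𝓟) (C.ce n) l =
      (-1 : ℤˣ) ^ n • insertion 𝒜 ℒ 𝓟 (ev (symBracket 𝕏) l) :=
  comm_eq_of_generators insertion_graded C.ce_degree
    (fun l n hl => C.comm_ce_L n l hl) (fun a l => C.comm_ce_A a l)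
    (fun a b _ n _ => C.comm_ce_AA a b _ n) n l hl

end LeftConnection

end LeftModule

end SHLR

namespace SHLR

open scoped DirectSum TensorProduct
open HasDeg (deg)

/-! ### The curvature of a left connection and the square of its operators -/

section LeftModule

variable {K : Type*} [Field K]
  {A : Type*} [Ring A] [Algebra K A] {𝒜 : ℤ → Submodule K A} [GradedAlgebra 𝒜] [IsGradedComm 𝒜]
  {L : Type*} [AddCommGroup L] [Module K L] [Module A L] [IsScalarTower K A L]
  {ℒ : ℤ → Submodule K L} [DirectSum.Decomposition ℒ] [SetLike.GradedSMul 𝒜 ℒ]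
  {P : Type*} [AddCommGroup P] [Module K P] [Module A P] [IsScalarTower K A P]
  {𝓟 : ℤ → Submodule K P} [DirectSum.Decomposition 𝓟] [SetLike.GradedSMul 𝒜 𝓟]
  [CharZero K] {𝕏 : LRInfinity 𝒜 ℒ} (C : LeftConnection 𝕏 𝓟)

open SymForms

namespace LeftConnection

/-- The curvature on a list of homogeneous elements. -/
def curv (l : List (Hgs ℒ)) : Module.End K P :=
  spl (fun I J => ev C.nabla (𝕏.bracket I :: J)) l +
    spl (fun I J => (ldeg I).negOnePow • (ev C.nabla I * ev C.nabla J)) l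

theorem curv_apply (l : List (Hgs ℒ)) (p : P) : C.curv l p =
    spl (fun I J => ev C.nabla (𝕏.bracket I :: J) p) l +
      spl (fun I J => (ldeg I).negOnePow • ev C.nabla I (ev C.nabla J p)) l := by
  rw [curv, LinearMap.add_apply, spl_apply, spl_apply]
  rfl

theorem flat_iff : C.Flat ↔ ∀ l, C.curv l = 0 := by
  refine (module_jacobi_iff 𝕏.X_degree C.nabla).trans (forall_congr' fun l => ?_)
  rw [LinearMap.ext_iff]
  exact forall_congr' fun p => (C.curv_apply l p).symm ▸ Iff.rfl

/-- The 0-form component selects the connection terms in both the compositions and the insertions.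
The signs (-1) ^ |l| of the derived operations combine to one overall sign. -/
theorem val_nil_comm_sqComp (l : List (Hgs ℒ)) {d : ℤ} {w : SymForms 𝒜 ℒ 𝓟}
    (hw : w ∈ SymForms.grade 𝒜 ℒ 𝓟 d) :
    val 𝒜 𝓟 [] (comm (SymForms.grade 𝒜 ℒ 𝓟) (insertion 𝒜 ℒ 𝓟) (sqComp C.ce l.length)
      (embL 𝒜 l) w) = (l.length : ℤ).negOnePow • C.curv l (val 𝒜 𝓟 [] w) := by
  rw [comm_sqComp_eq insertion_graded C.ce_degree (symBracket_degree 𝕏)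
    (symBracket_extension 𝕏).zero C.comm_ce_bracket _ _ (length_embL l), LinearMap.add_apply,
    spl_apply, spl_apply, spl_comp_map emb deg_emb, spl_comp_map emb deg_emb,
    spl_comp_map Sum.inr deg_inr, spl_comp_map Sum.inr deg_inr, curv_apply, map_add, smul_add,
    add_comm, spl_map, spl_map, ← spl_smul, ← spl_smul]
  refine congrArg₂ (· + ·) (spl_congr fun I J hl => ?_) (spl_congr fun I J hl => ?_)
  · have hl' := hl.length_eq
    rw [List.length_append] at hl'
    have h := C.val_nil_comm_ce (J.length + 1) (𝕏.bracket I :: J) hw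
    have hn : ¬(𝕏.bracket I :: J).length = J.length + 1 + 1 := by simp
    rw [if_pos List.length_cons, if_neg hn, sub_zero] at h
    rw [br_map_inr, LinearMap.smul_apply, map_sgn, length_embL J, length_embL I,
      ← negOnePow_natCast]
    refine (congrArg _ h).trans ?_
    rw [sgn_smul_sgn, List.length_cons, ← hl']
    push_cast
    exact sgn_congr (by grind) rfl
  · have hl' := hl.length_eq
    rw [List.length_append] at hl'
    have h1 : ¬I.length = I.length + 1 := by omega
    have h2 : ¬J.length = J.length + 1 := by omega
    rw [LinearMap.smul_apply, Module.End.mul_apply, length_embL I, length_embL J, ldeg_embL I,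
      map_sgn, C.val_nil_comm_ce I.length I
        (((C.ce_degree J.length).comm insertion_graded (embL 𝒜 J)) d w hw), if_pos rfl, if_neg h1,
      sub_zero, C.val_nil_comm_ce J.length J hw, if_pos rfl, if_neg h2, sub_zero, map_sgn,
      sgn_smul_sgn, sgn_smul_sgn, sgn_smul_sgn, ← hl']
    push_cast
    exact sgn_congr (by grind) rfl

/-- The outer factor needs p or p + 1 letters. It then evaluates the inner result on nothing or on a
single bracket; even with that additional entry the inner factor has fewer than k letters available.
-/
theorem val_nil_comm_comp_eq_zero (p k : ℕ) (I J : List (Hgs ℒ)) (h : I.length + J.length < p + k)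
    {d : ℤ} {w : SymForms 𝒜 ℒ 𝓟} (hw : w ∈ SymForms.grade 𝒜 ℒ 𝓟 d) :
    val 𝒜 𝓟 [] (comm (SymForms.grade 𝒜 ℒ 𝓟) (insertion 𝒜 ℒ 𝓟) (C.ce p) (embL 𝒜 I)
      (comm (SymForms.grade 𝒜 ℒ 𝓟) (insertion 𝒜 ℒ 𝓟) (C.ce k) (embL 𝒜 J) w)) = 0 := by
  rw [C.val_nil_comm_ce p I (((C.ce_degree k).comm insertion_graded (embL 𝒜 J)) d w hw)]
  split_ifs with h1 h2 h2
  · omega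
  · rw [C.val_nil_comm_ce k J hw, if_neg (by omega), if_neg (by omega), sub_zero, sub_zero, map_zero,
      smul_zero]
  · rw [C.val_comm_ce k J _ hw, spl_eq_zero, smul_zero, smul_zero, sub_zero]
    intro I' J' hl
    have hl' := hl.length_eq
    rw [List.length_append, List.length_singleton] at hl'
    have h3 : ¬(J ++ I').length = k := by rw [List.length_append]; omega
    have h4 : ¬(J ++ I').length = k + 1 := by rw [List.length_append]; omega
    rw [ceTerm, if_neg h3, if_neg h4, sub_zero]
  · rw [sub_zero]

theorem sqComp_eq_zero (h : C.Flat) (n : ℕ) : sqComp C.ce n = 0 := by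
  refine comm_eq_of_val_nil (sqComp_degree C.ce_degree n) (EndDegree.zero _) fun l d w hw => ?_
  rw [comm_zero, LinearMap.zero_apply, map_zero]
  rcases lt_trichotomy l.length n with h1 | h1 | h1
  · rw [comm_sqComp insertion_graded C.ce_degree, spl_apply, spl_comp_map emb deg_emb,
      spl_comp_map Sum.inr deg_inr, spl_map]
    refine spl_eq_zero fun I J hIJ => ?_
    have hl := hIJ.length_eq
    rw [List.length_append] at hl
    rw [LinearMap.sum_apply, map_sum]
    refine Finset.sum_eq_zero fun p hp => ?_
    have hp' := Finset.mem_range.1 hp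
    rw [LinearMap.smul_apply, Module.End.mul_apply, map_sgn,
      C.val_nil_comm_comp_eq_zero _ _ I J (by omega) hw, smul_zero]
  · rw [← h1, C.val_nil_comm_sqComp l hw, C.flat_iff.1 h, LinearMap.zero_apply, smul_zero]
  · rw [comm_sqComp_eq_zero insertion_graded C.ce_degree (symBracket_degree 𝕏)
      (symBracket_extension 𝕏).zero C.comm_ce_bracket (symBracket_jacobi 𝕏) n _
      (by rwa [length_embL]), LinearMap.zero_apply, map_zero]

end LeftConnection

/-- A 0-form is the same thing as an element of P. -/
theorem exists_val_nil_eq {d : ℤ} {p : P} (hp : p ∈ 𝓟 d) :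
    ∃ w ∈ SymForms.grade 𝒜 ℒ 𝓟 d, val 𝒜 𝓟 [] w = p := by
  let Ω : symForm 𝒜 ℒ 𝓟 0 d := ⟨MultilinearMap.constOfIsEmpty K (fun _ : Fin 0 => L) p,
    fun e v _ => by
      rw [Finset.univ_eq_empty, Finset.sum_empty, add_zero]
      exact hp,
    fun _ _ _ i => i.elim0, fun _ _ _ _ _ _ i => i.elim0⟩
  exact ⟨incl 𝒜 ℒ 𝓟 0 d Ω, incl_mem 0 d Ω, val_incl_ofFn Ω Fin.elim0⟩

/-- The prefactor -(-1) ^ (n + 1) equals (-1) ^ n, the power of s = -1 required by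
`isLeftModule_iff`. -/
theorem ev_leftLie (D : ℕ → Module.End K (SymForms 𝒜 ℒ 𝓟))
    (l : List (Hgs (SymAlg.grade 𝒜 ℒ))) : ev (leftLie 𝓟 D) l =
      (-1 : ℤˣ) ^ l.length • comm (SymForms.grade 𝒜 ℒ 𝓟) (insertion 𝒜 ℒ 𝓟) (D l.length) l := by
  rw [comm_eq_ev]
  change (-(-1 : K) ^ (l.length + 1)) • ev (fun n => iteratedCommutator (SymForms.grade 𝒜 ℒ 𝓟)
    (insertion 𝒜 ℒ 𝓟).toLinearMap n (D l.length)) l = _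
  rw [pow_succ, mul_neg, mul_one, neg_neg]
  rcases Nat.even_or_odd l.length with h | h
  · rw [h.neg_one_pow, h.neg_one_pow, one_smul, one_smul]
  · rw [h.neg_one_pow, h.neg_one_pow, Units.neg_smul, one_smul, neg_smul, one_smul]

/-- Flatness kills all components of the square, so all its commutators vanish. Conversely the
commutators with letters from L, read on 0-forms, return the curvature on every homogeneous p. -/
theorem LeftConnection.flat_iff_module : C.Flat ↔
    IsLeftLInfinityModule (SymAlg.grade 𝒜 ℒ) (SymForms.grade 𝒜 ℒ 𝓟) (symBracket 𝕏)
      (leftLie 𝓟 C.ce) := by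
  rw [isLeftModule_iff insertion_graded C.ce_degree C.comm_ce_bracket (ev_leftLie C.ce)]
  constructor
  · intro h l
    rw [C.sqComp_eq_zero h, comm_zero]
  · intro h
    refine C.flat_iff.2 fun l => linear_ext_homog 𝓟 fun d p hp => ?_
    obtain ⟨w, hw, rfl⟩ := exists_val_nil_eq (𝒜 := 𝒜) (ℒ := ℒ) hp
    have e := C.val_nil_comm_sqComp l hw
    have h' := h (embL 𝒜 l)
    rw [length_embL] at h'
    rw [h', LinearMap.zero_apply, map_zero] at e
    rw [LinearMap.zero_apply]
    exact (smul_eq_zero_iff_eq _).1 e.symm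

end LeftModule

end SHLR

theorem mainTheorem10 {K : Type*} [Field K] [CharZero K]
    {A : Type*} [Ring A] [Algebra K A] (𝒜 : ℤ → Submodule K A) [GradedAlgebra 𝒜]
    [SHLR.IsGradedComm 𝒜]
    {L : Type*} [AddCommGroup L] [Module K L] [Module A L] [IsScalarTower K A L]
    (ℒ : ℤ → Submodule K L) [DirectSum.Decomposition ℒ] [SetLike.GradedSMul 𝒜 ℒ]
    {P : Type*} [AddCommGroup P] [Module K P] [Module A P] [IsScalarTower K A P]
    (𝓟 : ℤ → Submodule K P) [DirectSum.Decomposition 𝓟] [SetLike.GradedSMul 𝒜 𝓟]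
    {Q : Type*} [AddCommGroup Q] [Module K Q] [Module A Q] [IsScalarTower K A Q]
    (𝒬 : ℤ → Submodule K Q) [DirectSum.Decomposition 𝒬] [SetLike.GradedSMul 𝒜 𝒬]
    (𝕏 : SHLR.LRInfinity 𝒜 ℒ) :
    ∃ lam : ∀ k : ℕ, MultilinearMap K (fun _ : Fin k => SHLR.SymAlg 𝒜 ℒ) (SHLR.SymAlg 𝒜 ℒ),
      SHLR.IsMultiderivationExtension 𝕏 lam ∧
      (∀ lam', SHLR.IsMultiderivationExtension 𝕏 lam' → lam' = lam) ∧
      SHLR.IsLInfinityAlgebra (SHLR.SymAlg.grade 𝒜 ℒ) lam ∧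
      (∀ C : SHLR.LeftConnection 𝕏 𝓟, ∃ D : ℕ → Module.End K (SHLR.SymForms 𝒜 ℒ 𝓟),
        SHLR.IsChevalleyEilenberg C D ∧
        (∀ D', SHLR.IsChevalleyEilenberg C D' → D' = D) ∧
        (C.Flat → SHLR.IsLeftLInfinityModule (SHLR.SymAlg.grade 𝒜 ℒ) (SHLR.SymForms.grade 𝒜 ℒ 𝓟)
          lam (SHLR.leftLie 𝓟 D)) ∧
        (Module.Projective A L → Module.Finite A L →
          SHLR.IsLeftLInfinityModule (SHLR.SymAlg.grade 𝒜 ℒ) (SHLR.SymForms.grade 𝒜 ℒ 𝓟)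
            lam (SHLR.leftLie 𝓟 D) → C.Flat)) ∧
      (∀ C : SHLR.RightConnection 𝕏 𝒬, ∃ D : ℕ → Module.End K (SHLR.SymTensor 𝒜 ℒ Q),
        SHLR.IsRinehart C D ∧
        (∀ D', SHLR.IsRinehart C D' → D' = D) ∧
        (C.Flat ↔ SHLR.IsRightLInfinityModule (SHLR.SymAlg.grade 𝒜 ℒ) (SHLR.SymTensor.grade 𝒜 ℒ 𝒬)
          lam (SHLR.rightLie 𝒬 D))) := by
  refine ⟨SHLR.symBracket 𝕏, SHLR.symBracket_extension 𝕏,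
    fun lam' h => (SHLR.symBracket_extension 𝕏).unique h, SHLR.symBracket_isLInfinity 𝕏,
    fun C => ?_, fun C => ?_⟩
  · exact ⟨C.ce, C.ce_isChevalleyEilenberg, fun D' h => C.ce_unique h, C.flat_iff_module.1,
      fun _ _ h => C.flat_iff_module.2 h⟩
  · exact ⟨C.rinehart, C.rinehart_isRinehart, fun D' h => C.rinehart_unique h, C.flat_iff_module⟩
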